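/- **Theorem (Soundness of Mixed Graded/Linear Logic models).** *Grades.* Let $(R,1,*,0,+,\le)$ be a preordered semiring: a semiring with a preorder for which $+$ and $*$ are monotone in each argument. *Types.* Graded types $X,Y ::= J \mid X\boxtimes Y \mid \mathsf{Lin}\,A$ and linear types $A,B ::= I\mid A\otimes B\mid A\multimap B\mid \mathsf{Grd}_r X$ ($r\in R$). A graded context $\delta\odot\Delta$ is a list of hypotheses $r_i\odot X_i$; write $r*\delta$ for $(r*r_1,\dots,r*r_n)$ and $\delta\le\delta'$ for the pointwise preorder. A linear context $\Gamma$ is a list of linear types. Below, $\Delta$ abbreviates $\delta\odot\Delta$ and $r*\Delta$ abbreviates $(r*\delta)\odot\Delta$. *Graded sequents* $\Delta\vdash X$, with the rules (premises / conclusion): id: $1\odot X\vdash X$; Sub: $\delta\odot\Delta\vdash X\,/\,\delta'\odot\Delta\vdash X$ if $\delta\le\delta'$; $J$R: $\emptyset\vdash J$; $J$L: $\Delta_1,\Delta_2\vdash Y\,/\,\Delta_1,r\odot J,\Delta_2\vdash Y$; $\boxtimes$R: $\Delta_1\vdash X$ and $\Delta_2\vdash Y\,/\,\Delta_1,\Delta_2\vdash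 X\boxtimes Y$; $\boxtimes$L: $\Delta_1,r\odot X,r\odot Y,\Delta_2\vdash Z\,/\,\Delta_1,r\odot(X\boxtimes Y),\Delta_2\vdash Z$; LinR: $\Delta;\emptyset\vdash A\,/\,\Delta\vdash\mathsf{Lin}\,A$; Weak: $\Delta_1,\Delta_2\vdash Y\,/\,\Delta_1,0\odot X,\Delta_2\vdash Y$; Cont: $\Delta_1,r\odot X,s\odot X,\Delta_2\vdash Y\,/\,\Delta_1,(r+s)\odot X,\Delta_2\vdash Y$; Ex: exchange of two adjacent hypotheses; Cut: $\Delta_2\vdash X$ and $\Delta_1,r\odot X,\Delta_3\vdash Y\,/\,\Delta_1,r*\Delta_2,\Delta_3\vdash Y$. *Mixed sequents* $\Delta;\Gamma\vdash A$, with the rules: Sub, $J$L, $\boxtimes$L, Weak, Cont, graded exchange and GCut, acting on the graded context exactly as above (the left premise of GCut is a graded sequent); and id: $\emptyset;A\vdash A$; $I$R: $\emptyset;\emptyset\vdash I$; $I$L: $\Delta;\Gamma_1,\Gamma_2\vdash B\,/\,\Delta;\Gamma_1,I,\Gamma_2\vdash B$; $\otimes$L: $\Delta;\Gamma_1,A,B,\Gamma_2\vdash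 C\,/\,\Delta;\Gamma_1,A\otimes B,\Gamma_2\vdash C$; $\otimes$R: $\Delta_1;\Gamma_1\vdash A$ and $\Delta_2;\Gamma_2\vdash B\,/\,\Delta_1,\Delta_2;\Gamma_1,\Gamma_2\vdash A\otimes B$; exchange of adjacent linear hypotheses; $\multimap$R: $\Delta;\Gamma,A\vdash B\,/\,\Delta;\Gamma\vdash A\multimap B$; $\multimap$L: $\Delta_2;\Gamma_2\vdash A$ and $\Delta_1;\Gamma_1,B,\Gamma_3\vdash C\,/\,\Delta_1,\Delta_2;\Gamma_1,A\multimap B,\Gamma_2,\Gamma_3\vdash C$; GrdR: $\Delta\vdash X\,/\,r*\Delta;\emptyset\vdash\mathsf{Grd}_rX$; GrdL: $\Delta,r\odot X;\Gamma\vdash B\,/\,\Delta;\mathsf{Grd}_rX,\Gamma\vdash B$; LinL: $\Delta;A,\Gamma\vdash B\,/\,\Delta,1\odot\mathsf{Lin}\,A;\Gamma\vdash B$; Cut: $\Delta_2;\Gamma_2\vdash A$ and $\Delta_1;\Gamma_1,A,\Gamma_3\vdash B\,/\,\Delta_1,\Delta_2;\Gamma_1,\Gamma_2,\Gamma_3\vdash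 B$. *Equational theory.* $\equiv$ is the least equivalence relation on derivations of the same sequent that is a congruence for all the rules and contains: (a) in both calculi: Weak followed by Cont (on either side) is the identity, Cont is commutative (up to Ex) and associative, two consecutive exchanges of the same hypotheses cancel, Sub along $\delta\le\delta$ is the identity, two consecutive Subs compose, Sub commutes with every rule, Sub before Cont along $r_1\le r_2,s_1\le s_2$ equals Sub after it along $r_1+s_1\le r_2+s_2$, $J$L at grade $r$ followed by Sub along $r\le s$ equals $J$L at grade $s$, $\boxtimes$L at grade $r$ followed by Sub along $r\le s$ equals Sub on both components followed by $\boxtimes$L at grade $s$, and a cut of grade $r'$ between derivations ending in Sub along $\delta_2\le\delta_2'$ and $r\le r'$ equals the cut of grade $r$ followed by Sub along $r*\delta_2\le r'*\delta_2'$; (b) all the cut-reduction steps. Here a *multicut* of $\Pi:\Delta_2\vdash X$ against consecutive hypotheses $d_1\odot X,\dots,d_n\odot X$ ($n\ge0$) is the contraction of these hypotheses to $(d_1+\dots+d_n)\odot X$ (weakening if $n=0$) followed by a cut with $\Pi$. The steps are: cuts against an identity on either side disappear; principal cuts for $\boxtimes$, $J$, $\mathsf{Lin}$, $\otimes$, $I$,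 $\mathsf{Grd}_r$, $\multimap$ are replaced by cuts of the premises (with exchanges as required); a cut of $\Pi:\Delta_2\vdash X$ against a weakened hypothesis becomes weakening by $0*\Delta_2$; against a contraction of $r\odot X,s\odot X$ it becomes two cuts of $\Pi$, of grades $r$ and $s$, followed by the hypothesis-wise contraction of $r*\Delta_2,s*\Delta_2$ (after exchanges); against an exchanged hypothesis it becomes a cut followed by exchanges; a multicut commutes with every rule of its right premise in which the cut hypotheses are not active, including other cuts, where cutting into the left premise of a graded cut or of GrdR multiplies the multicut grades by the grade of that rule; a graded cut of grade $s$ commutes with the left and structural rules of its left premise, whose grades get multiplied by $s$; a linear cut commutes with every rule in either premise in which the cut formula is not active, up to the required exchanges; (c) the $\eta$-expansions of the identities on $X\boxtimes Y$, $J$, $\mathsf{Lin}\,A$, $A\otimes B$, $I$, $\mathsf{Grd}_rX$ into the corresponding right and left rules applied to smaller identities. *Models.* Let $(\mathcal C,J,\boxtimes)$ be a symmetric monoidal category and $(\mathcal M,I,\otimes)$ a symmetric monoidal closed category. A *mixed graded/linear model* consists of a symmetric monoidal adjunction $\mathsf{Mny}\dashv\mathsf{Lin}$, $\mathsf{Mny}:\mathcal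 C\to\mathcal M$ (both functors symmetric lax monoidal, unit and counit monoidal), and a *strict exponential action*, i.e. a bifunctor $\odot:R^{op}\times\mathcal C\to\mathcal C$ with 1. equalities, natural in all arguments, $\varepsilon_X:1\odot X=X$ and $\delta_{r,s,X}:(r*s)\odot X=r\odot(s\odot X)$; 2. symmetric lax monoidal structures $m_{J,r}:J\to r\odot J$, $m_{\boxtimes,r,X,Y}:(r\odot X)\boxtimes(r\odot Y)\to r\odot(X\boxtimes Y)$ on the functors $r\odot-$, natural in $r$, all whose components are identities (so $J = r\odot J$ and $(r\odot X)\boxtimes(r\odot Y)=r\odot(X\boxtimes Y)$); 3. natural transformations $\mathsf{weak}_X:0\odot X\to J$ and $\mathsf{contr}_{r,s,X}:(r+s)\odot X\to(r\odot X)\boxtimes(s\odot X)$ (natural in $X$, $r$, $s$) such that $\mathsf{contr}$ is associative and commutative with unit $\mathsf{weak}$; they are compatible with the action: $\mathsf{weak}_{s\odot X}\circ\delta_{0,s,X}=\mathsf{weak}_X$, $(s\odot\mathsf{weak}_X)\circ\delta_{s,0,X}=m_{J,s}\circ\mathsf{weak}_X$, $(r\odot\mathsf{contr}_{s_1,s_2,X})\circ\delta_{r,s_1+s_2,X}=m_{\boxtimes,r}\circ(\delta_{r,s_1,X}\boxtimes\delta_{r,s_2,X})\circ\mathsf{contr}_{r*s_1,r*s_2,X}$,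 $\mathsf{contr}_{s_1,s_2,r\odot X}\circ\delta_{s_1+s_2,r,X}=(\delta_{s_1,r,X}\boxtimes\delta_{s_2,r,X})\circ\mathsf{contr}_{s_1*r,s_2*r,X}$ (modulo $0=0*s=s*0$ and distributivity); and they are monoidal natural transformations with respect to $m_J,m_\boxtimes$. *Interpretation.* $[\![J]\!]=J$, $[\![X\boxtimes Y]\!]=[\![X]\!]\boxtimes[\![Y]\!]$, $[\![\mathsf{Lin}\,A]\!]=\mathsf{Lin}[\![A]\!]$, $[\![I]\!]=I$, $[\![A\otimes B]\!]=[\![A]\!]\otimes[\![B]\!]$, $[\![A\multimap B]\!]=[\![A]\!]\multimap[\![B]\!]$, $[\![\mathsf{Grd}_rX]\!]=\mathsf{Mny}(r\odot[\![X]\!])$. A graded derivation of $(r_i\odot X_i)_{i\le n}\vdash X$ is interpreted as a morphism $(r_1\odot[\![X_1]\!])\boxtimes\cdots\boxtimes(r_n\odot[\![X_n]\!])\to[\![X]\!]$ of $\mathcal C$, and a mixed derivation of $(r_i\odot X_i)_{i\le n};A_1,\dots,A_m\vdash B$ as a morphism $\mathsf{Mny}(r_1\odot[\![X_1]\!])\otimes\cdots\otimes\mathsf{Mny}(r_n\odot[\![X_n]\!])\otimes[\![A_1]\!]\otimes\cdots\otimes[\![A_m]\!]\to[\![B]\!]$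 of $\mathcal M$, by recursion on the derivation: identities by $\varepsilon$ and $\mathrm{id}$; Sub by functoriality in the grade; $J$L and $\boxtimes$L by the inverses of $m_J,m_\boxtimes$; Weak and Cont by $\mathsf{weak}$ and $\mathsf{contr}$; in the mixed calculus these are taken under $\mathsf{Mny}$ and followed by the colax structure of $\mathsf{Mny}$ induced by the adjunction; exchange by the symmetry; a cut with $\Pi$ of grade $r$ by $r\odot[\![\Pi]\!]$ preceded by $\delta$ and $m$ (under $\mathsf{Mny}$, preceded by the lax structure of $\mathsf{Mny}$, for GCut and GrdR); LinR by the unit of the adjunction, the lax structure of $\mathsf{Lin}$ and $\mathsf{Lin}[\![\Pi]\!]$; LinL by $\varepsilon$ and the counit; GrdL by the identity; the remaining rules by the symmetric monoidal closed structure of $\mathcal M$ (tensor, composition, currying and evaluation). *Conclusion.* For every mixed graded/linear model, if $\Pi_1,\Pi_2$ are derivations of the same graded sequent $\delta\odot\Delta\vdash X$ and $\Pi_1\equiv\Pi_2$, then $[\![\Pi_1]\!]=[\![\Pi_2]\!]$; and if $\Pi_1,\Pi_2$ are derivations of the same mixed sequent $\delta\odot\Delta;\Gamma\vdash A$ and $\Pi_1\equiv\Pi_2$,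 then $[\![\Pi_1]\!]=[\![\Pi_2]\!]$. -/

import Mathlib

open CategoryTheory MonoidalCategory Opposite

universe u v w

namespace MGL

section Calculus

/-! ### Types, graded contexts -/

mutual
/-- Graded types `X, Y ::= J | X ⊠ Y | Lin A`. -/
inductive GTy (R : Type u) : Type u
  | J : GTy R
  | ten (X Y : GTy R) : GTy R
  | Lin (A : LTy R) : GTy R
/-- Linear types `A, B ::= I | A ⊗ B | A ⊸ B | Grd r X`. -/
inductive LTy (R : Type u) : Type u
  | I : LTy R
  | ten (A B : LTy R) : LTy R
  | imp (A B : LTy R) : LTy R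
  | Grd (r : R) (X : GTy R) : LTy R
end

/-- A graded context `δ ⊙ Δ`: a grade vector `δ` and a list of types `Δ` of the same length,
that is, a list of graded hypotheses `r ⊙ X`. -/
abbrev GCtx (R : Type u) : Type u := List (R × GTy R)

variable {R : Type u}

/-- `(r * δ) ⊙ Δ`. -/
def scale [Mul R] (r : R) (Δ : GCtx R) : GCtx R := Δ.map fun p => (r * p.1, p.2)

/-- Consecutive hypotheses `(d₁, …, dₙ) ⊙ (X, …, X)`. -/
def rep (ds : List R) (X : GTy R) : GCtx R := ds.map fun d => (d, X)

/-- `GLe (δ ⊙ Δ) (δ' ⊙ Δ)`: the pointwise inequality `δ ≤ δ'` over the same list of types. -/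
inductive GLe [LE R] : GCtx R → GCtx R → Type u
  | nil : GLe [] []
  | cons {r s : R} (X : GTy R) (h : r ≤ s) {Δ Δ' : GCtx R} (t : GLe Δ Δ') :
      GLe ((r, X) :: Δ) ((s, X) :: Δ')

namespace GLe

def refl [Preorder R] : ∀ Δ : GCtx R, GLe Δ Δ
  | [] => .nil
  | p :: Δ => .cons p.2 le_rfl (refl Δ)

def trans [Preorder R] : ∀ {Δ₁ Δ₂ Δ₃ : GCtx R}, GLe Δ₁ Δ₂ → GLe Δ₂ Δ₃ → GLe Δ₁ Δ₃
  | _, _, _, .nil, .nil => .nil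
  | _, _, _, .cons X h t, .cons _ h' t' => .cons X (h.trans h') (trans t t')

def append [LE R] : ∀ {Δ₁ Δ₁' Δ₂ Δ₂' : GCtx R}, GLe Δ₁ Δ₁' → GLe Δ₂ Δ₂' →
    GLe (Δ₁ ++ Δ₂) (Δ₁' ++ Δ₂')
  | _, _, _, _, .nil, k => k
  | _, _, _, _, .cons X h t, k => .cons X h (append t k)

/-- An inequality in the middle of a context, the rest of the context being unchanged. -/
def inside [Preorder R] (A D : GCtx R) {P Q : GCtx R} (h : GLe P Q) :
    GLe (A ++ (P ++ D)) (A ++ (Q ++ D)) :=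
  (refl A).append (h.append (refl D))

def single [LE R] {r s : R} (h : r ≤ s) (X : GTy R) : GLe [(r, X)] [(s, X)] := .cons X h .nil

def double [LE R] {r s r' s' : R} (h : r ≤ s) (h' : r' ≤ s') (X Y : GTy R) :
    GLe [(r, X), (r', Y)] [(s, X), (s', Y)] := .cons X h (.cons Y h' .nil)

def scale [Mul R] [Preorder R] [MulLeftMono R] [MulRightMono R] {r s : R} (h : r ≤ s) :
    ∀ {Δ Δ' : GCtx R}, GLe Δ Δ' → GLe (MGL.scale r Δ) (MGL.scale s Δ')
  | _, _, .nil => .nil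
  | _, _, .cons X k t => .cons X (mul_le_mul' h k) (scale h t)

end GLe

/-! ### Derivations -/

/-- The left and structural rules acting on linear contexts. A step from `P` to `Q` replaces the
consecutive linear hypotheses `P` of the premise by the hypotheses `Q` of the conclusion. -/
inductive LStep : List (LTy R) → List (LTy R) → Type u
  | unitL : LStep [] [.I]
  | tenL (A B : LTy R) : LStep [A, B] [.ten A B]
  | ex (A B : LTy R) : LStep [A, B] [B, A]

theorem sum_map_mul [Semiring R] (s : R) (ds : List R) : (ds.map (s * ·)).sum = s * ds.sum := by
  induction ds with
  | nil => simp
  | cons d ds ih => simp [ih, mul_add]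

variable [Semiring R] [Preorder R]

mutual
/-- Derivations of the graded sequents `δ ⊙ Δ ⊢ X`. -/
inductive GS : GCtx R → GTy R → Type u
  | id (X : GTy R) : GS [(1, X)] X
  | sub {Δ Δ' : GCtx R} {X : GTy R} (h : GLe Δ Δ') (π : GS Δ X) : GS Δ' X
  | unitR : GS [] .J
  | tenR {Δ₁ Δ₂ : GCtx R} {X Y : GTy R} (π₁ : GS Δ₁ X) (π₂ : GS Δ₂ Y) :
      GS (Δ₁ ++ Δ₂) (.ten X Y)
  | linR {Δ : GCtx R} {A : LTy R} (π : MS Δ [] A) : GS Δ (.Lin A)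
  | gleft (A D : GCtx R) {P Q : GCtx R} {Y : GTy R} (ρ : GStep P Q)
      (π : GS (A ++ (P ++ D)) Y) : GS (A ++ (Q ++ D)) Y
/-- The left rules, structural rules and cut acting on graded contexts; they are common to the
graded and the mixed calculus. A step from `P` to `Q` replaces the consecutive hypotheses `P` of
the (right-most) premise by the hypotheses `Q` of the conclusion. -/
inductive GStep : GCtx R → GCtx R → Type u
  | unitL (r : R) : GStep [] [(r, .J)]
  | tenL (r : R) (X Y : GTy R) : GStep [(r, X), (r, Y)] [(r, .ten X Y)]
  | weak (X : GTy R) : GStep [] [(0, X)]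
  | cont (r s : R) (X : GTy R) : GStep [(r, X), (s, X)] [(r + s, X)]
  | ex (p q : R × GTy R) : GStep [p, q] [q, p]
  | cut (r : R) {Δ : GCtx R} {X : GTy R} (Θ : GS Δ X) : GStep [(r, X)] (scale r Δ)
/-- Derivations of the mixed sequents `δ ⊙ Δ ; Γ ⊢ A`. -/
inductive MS : GCtx R → List (LTy R) → LTy R → Type u
  | id (A : LTy R) : MS [] [A] A
  | sub {Δ Δ' : GCtx R} {Γ : List (LTy R)} {A : LTy R} (h : GLe Δ Δ') (π : MS Δ Γ A) :
      MS Δ' Γ A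
  | gleft (A D : GCtx R) {P Q : GCtx R} {Γ : List (LTy R)} {B : LTy R} (ρ : GStep P Q)
      (π : MS (A ++ (P ++ D)) Γ B) : MS (A ++ (Q ++ D)) Γ B
  | lleft {Δ : GCtx R} (Γ₁ Γ₃ : List (LTy R)) {P Q : List (LTy R)} {B : LTy R} (κ : LStep P Q)
      (π : MS Δ (Γ₁ ++ (P ++ Γ₃)) B) : MS Δ (Γ₁ ++ (Q ++ Γ₃)) B
  | unitR : MS [] [] .I
  | tenR {Δ₁ Δ₂ : GCtx R} {Γ₁ Γ₂ : List (LTy R)} {A B : LTy R}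
      (π₁ : MS Δ₁ Γ₁ A) (π₂ : MS Δ₂ Γ₂ B) : MS (Δ₁ ++ Δ₂) (Γ₁ ++ Γ₂) (.ten A B)
  | impR {Δ : GCtx R} {Γ : List (LTy R)} {A B : LTy R} (π : MS Δ (Γ ++ [A]) B) :
      MS Δ Γ (.imp A B)
  | impL (Γ₁ Γ₃ : List (LTy R)) {Δ₁ Δ₂ : GCtx R} {Γ₂ : List (LTy R)} {A B C : LTy R}
      (π₂ : MS Δ₂ Γ₂ A) (π₁ : MS Δ₁ (Γ₁ ++ B :: Γ₃) C) :
      MS (Δ₁ ++ Δ₂) (Γ₁ ++ .imp A B :: (Γ₂ ++ Γ₃)) C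
  | grdR (r : R) {Δ : GCtx R} {X : GTy R} (Θ : GS Δ X) : MS (scale r Δ) [] (.Grd r X)
  | grdL {Δ : GCtx R} {Γ : List (LTy R)} {B : LTy R} {r : R} {X : GTy R}
      (π : MS (Δ ++ [(r, X)]) Γ B) : MS Δ (.Grd r X :: Γ) B
  | linL {Δ : GCtx R} {Γ : List (LTy R)} {A B : LTy R} (π : MS Δ (A :: Γ) B) :
      MS (Δ ++ [(1, .Lin A)]) Γ B
  | cut (Γ₁ Γ₃ : List (LTy R)) {Δ₁ Δ₂ : GCtx R} {Γ₂ : List (LTy R)} {A B : LTy R}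
      (π₁ : MS Δ₂ Γ₂ A) (π₂ : MS Δ₁ (Γ₁ ++ A :: Γ₃) B) : MS (Δ₁ ++ Δ₂) (Γ₁ ++ (Γ₂ ++ Γ₃)) B
end

/-! ### Sequents that are equal as lists are the same sequent -/

def GS.tr {Δ Δ' : GCtx R} {X : GTy R} (π : GS Δ X)
    (h : Δ = Δ' := by first
      | rfl
      | simp [MGL.scale, rep, mul_assoc, sum_map_mul, Function.comp_def]) : GS Δ' X :=
  h ▸ π

def GStep.tr {P P' Q Q' : GCtx R} (ρ : GStep P Q) (hP : P = P') (hQ : Q = Q') : GStep P' Q' :=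
  hP ▸ hQ ▸ ρ

def MS.tr {Δ Δ' : GCtx R} {Γ Γ' : List (LTy R)} {A : LTy R} (π : MS Δ Γ A)
    (h : Δ = Δ' := by first
      | rfl
      | simp [MGL.scale, rep, mul_assoc, sum_map_mul, Function.comp_def])
    (h' : Γ = Γ' := by first | rfl | simp) : MS Δ' Γ' A :=
  h ▸ h' ▸ π

/-- The same, for any family `F` of derivations indexed by the graded context. -/
def tr {F : GCtx R → Type u} {Δ Δ' : GCtx R} (π : F Δ)
    (h : Δ = Δ' := by first
      | rfl
      | simp [MGL.scale, rep, mul_assoc, sum_map_mul, Function.comp_def]) : F Δ' :=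
  h ▸ π

/-! ### Derived rules -/

section Exchange

variable {α : Type u} {F : List α → Type u}
  (ex : ∀ (A D : List α) (p q : α), F (A ++ (p :: q :: D)) → F (A ++ (q :: p :: D)))

/-- Repeated exchange: move `p` to the right, past the block `Q`. -/
def movePast (p : α) : ∀ (A Q D : List α), F (A ++ (p :: (Q ++ D))) → F (A ++ (Q ++ p :: D))
  | _, [], _, π => π
  | A, q :: Q, D, π =>
      (List.append_assoc A [q] (Q ++ p :: D)) ▸
        movePast p (A ++ [q]) Q D
          ((List.append_assoc A [q] (p :: (Q ++ D))).symm ▸ ex A (Q ++ D) p q π)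

/-- Repeated exchange: swap the adjacent blocks `P` and `Q`. -/
def swapBlocks : ∀ (A P Q D : List α), F (A ++ (P ++ (Q ++ D))) → F (A ++ (Q ++ (P ++ D)))
  | _, [], _, _, π => π
  | A, p :: P, Q, D, π =>
      movePast ex p A Q (P ++ D)
        ((List.append_assoc A [p] (Q ++ (P ++ D))) ▸
          swapBlocks (A ++ [p]) P Q D
            ((List.append_assoc A [p] (P ++ (Q ++ D))).symm ▸ π))

end Exchange

section Blocks

variable {F : GCtx R → Type u}
  (step : ∀ (A D : GCtx R) {P Q : GCtx R}, GStep P Q → F (A ++ (P ++ D)) → F (A ++ (Q ++ D)))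

/-- Exchange of the adjacent blocks `P` and `Q`. -/
def gswap (A P Q D : GCtx R) (π : F (A ++ (P ++ (Q ++ D)))) : F (A ++ (Q ++ (P ++ D))) :=
  swapBlocks (fun A D p q => step A D (.ex p q)) A P Q D π

/-- Weakening by all the hypotheses of `(0 * δ) ⊙ Δ`. -/
def weakBlock (A D : GCtx R) : ∀ Δ : GCtx R, F (A ++ D) → F (A ++ (scale 0 Δ ++ D))
  | [], π => π
  | p :: Δ, π =>
      tr (step A (scale 0 Δ ++ D) (.weak p.2) (weakBlock A D Δ π))

/-- Contraction of `(r * δ) ⊙ Δ, (s * δ) ⊙ Δ` to `((r + s) * δ) ⊙ Δ`, hypothesis by hypothesis. -/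
def contBlock (r s : R) (D : GCtx R) : ∀ A Δ : GCtx R,
    F (A ++ (scale r Δ ++ (scale s Δ ++ D))) → F (A ++ (scale (r + s) Δ ++ D))
  | _, [], π => π
  | A, p :: Δ, π =>
      tr (contBlock r s D (A ++ [((r + s) * p.1, p.2)]) Δ
        (tr (step A (scale r Δ ++ (scale s Δ ++ D)) (.cont (r * p.1) (s * p.1) p.2)
          (tr (gswap step (A ++ [(r * p.1, p.2)]) (scale r Δ) [(s * p.1, p.2)] (scale s Δ ++ D)
            (tr π))))
        (by simp [add_mul])))

/-- Contraction of `n ≥ 0` consecutive hypotheses `(d₁, …, dₙ) ⊙ (X, …, X)` to one hypothesis of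
grade `d₁ + ⋯ + dₙ`. -/
def contN (X : GTy R) (D : GCtx R) : ∀ (A : GCtx R) (ds : List R),
    F (A ++ (rep ds X ++ D)) → F (A ++ ([(ds.sum, X)] ++ D))
  | A, [], π => step A D (.weak X) π
  | A, d :: ds, π =>
      step A D (.cont d ds.sum X) (tr (contN X D (A ++ [(d, X)]) ds (tr π)))

/-- Multicut: the derivation `Θ` of `δ ⊙ Δ ⊢ X` is cut against the hypotheses
`(d₁, …, dₙ) ⊙ (X, …, X)`, which are replaced by `((d₁ + ⋯ + dₙ) * δ) ⊙ Δ`. -/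
def mcut (A D : GCtx R) (ds : List R) {Δ : GCtx R} {X : GTy R} (Θ : GS Δ X)
    (π : F (A ++ (rep ds X ++ D))) : F (A ++ (scale ds.sum Δ ++ D)) :=
  step A D (.cut ds.sum Θ) (contN step X D A ds π)

end Blocks

/-- Graded steps on derivations of graded sequents with conclusion `Y`. -/
def GS.step (Y : GTy R) (A D : GCtx R) {P Q : GCtx R} (ρ : GStep P Q)
    (π : GS (A ++ (P ++ D)) Y) : GS (A ++ (Q ++ D)) Y := .gleft A D ρ π

/-- Graded steps on derivations of mixed sequents with linear context `Γ` and conclusion `B`. -/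
def MS.step (Γ : List (LTy R)) (B : LTy R) (A D : GCtx R) {P Q : GCtx R} (ρ : GStep P Q)
    (π : MS (A ++ (P ++ D)) Γ B) : MS (A ++ (Q ++ D)) Γ B := .gleft A D ρ π

/-- Multicut into a graded derivation. -/
def GS.mcut (A D : GCtx R) (ds : List R) {Δ : GCtx R} {X Y : GTy R} (Θ : GS Δ X)
    (π : GS (A ++ (rep ds X ++ D)) Y) : GS (A ++ (scale ds.sum Δ ++ D)) Y :=
  MGL.mcut (F := fun Δ => GS Δ Y) (GS.step Y) A D ds Θ π

/-- Multicut into a mixed derivation. -/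
def MS.mcut (A D : GCtx R) (ds : List R) {Δ : GCtx R} {X : GTy R} {Γ : List (LTy R)} {B : LTy R}
    (Θ : GS Δ X) (π : MS (A ++ (rep ds X ++ D)) Γ B) : MS (A ++ (scale ds.sum Δ ++ D)) Γ B :=
  MGL.mcut (F := fun Δ => MS Δ Γ B) (MS.step Γ B) A D ds Θ π

/-- Exchange of adjacent blocks of the graded context of a mixed sequent. -/
def MS.gswap (A P Q D : GCtx R) {Γ : List (LTy R)} {B : LTy R}
    (π : MS (A ++ (P ++ (Q ++ D))) Γ B) : MS (A ++ (Q ++ (P ++ D))) Γ B :=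
  MGL.gswap (F := fun Δ => MS Δ Γ B) (MS.step Γ B) A P Q D π

/-- Exchange of adjacent blocks of the linear context of a mixed sequent. -/
def MS.lswap {Δ : GCtx R} (Γ₁ P Q Γ₃ : List (LTy R)) {B : LTy R}
    (π : MS Δ (Γ₁ ++ (P ++ (Q ++ Γ₃))) B) : MS Δ (Γ₁ ++ (Q ++ (P ++ Γ₃))) B :=
  swapBlocks (F := fun Γ => MS Δ Γ B) (fun Γ₁ Γ₃ A B => .lleft Γ₁ Γ₃ (.ex A B)) Γ₁ P Q Γ₃ π

/-- The same rule with all grades multiplied by `s` on the left; a cut of grade `r` becomes a cut of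
grade `s * r`. -/
def GStep.smul (s : R) : ∀ {P Q : GCtx R}, GStep P Q → GStep (scale s P) (scale s Q)
  | _, _, .unitL r => .unitL (s * r)
  | _, _, .tenL r X Y => .tenL (s * r) X Y
  | _, _, .weak X => GStep.tr (.weak X) rfl (by simp [scale])
  | _, _, .cont r t X => GStep.tr (.cont (s * r) (s * t) X) rfl (by simp [scale, mul_add])
  | _, _, .ex p q => .ex (s * p.1, p.2) (s * q.1, q.2)
  | _, _, .cut r Θ => GStep.tr (.cut (s * r) Θ) rfl (by simp [scale, mul_assoc, Function.comp_def])

/-! ### The equational theory -/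

/-- The equations between derivations that only involve the graded context; they are common to the
graded and the mixed calculus. `F` is a family of derivations indexed by the graded context, `step`
applies a graded step and `sub` is the approximation rule. -/
inductive Ax [AddLeftMono R] [MulLeftMono R] [MulRightMono R] {F : GCtx R → Type u}
    (step : ∀ (A D : GCtx R) {P Q : GCtx R}, GStep P Q → F (A ++ (P ++ D)) → F (A ++ (Q ++ D)))
    (sub : ∀ {Δ Δ' : GCtx R}, GLe Δ Δ' → F Δ → F Δ') : ∀ {Δ : GCtx R}, F Δ → F Δ → Prop
  -- contraction, weakening and exchange
  | contUnitL (A D : GCtx R) (r : R) (X : GTy R) (π : F (A ++ ([(r, X)] ++ D))) :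
      Ax step sub (step A D (.cont 0 r X) (step A ([(r, X)] ++ D) (.weak X) π)) (tr π)
  | contUnitR (A D : GCtx R) (r : R) (X : GTy R) (π : F (A ++ ([(r, X)] ++ D))) :
      Ax step sub (step A D (.cont r 0 X) (tr (step (A ++ [(r, X)]) D (.weak X) (tr π)))) (tr π)
  | contSym (A D : GCtx R) (r s : R) (X : GTy R) (π : F (A ++ ([(r, X), (s, X)] ++ D))) :
      Ax step sub (step A D (.cont r s X) π)
        (tr (step A D (.cont s r X) (step A D (.ex (r, X) (s, X)) π)) (by simp [add_comm]))
  | contAssoc (A D : GCtx R) (r₁ r₂ r₃ : R) (X : GTy R)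
      (π : F (A ++ ([(r₁, X), (r₂, X), (r₃, X)] ++ D))) :
      Ax step sub (step A D (.cont (r₁ + r₂) r₃ X) (step A ([(r₃, X)] ++ D) (.cont r₁ r₂ X) π))
        (tr (step A D (.cont r₁ (r₂ + r₃) X)
          (tr (step (A ++ [(r₁, X)]) D (.cont r₂ r₃ X) (tr π)))) (by simp [add_assoc]))
  | exEx (A D : GCtx R) (p q : R × GTy R) (π : F (A ++ ([p, q] ++ D))) :
      Ax step sub (step A D (.ex q p) (step A D (.ex p q) π)) π
  -- approximation
  | subRefl {Δ : GCtx R} (h : GLe Δ Δ) (π : F Δ) : Ax step sub (sub h π) π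
  | subTrans {Δ₁ Δ₂ Δ₃ : GCtx R} (h : GLe Δ₁ Δ₂) (h' : GLe Δ₂ Δ₃) (π : F Δ₁) :
      Ax step sub (sub h' (sub h π)) (sub (h.trans h') π)
  | subStep {A A' D D' P Q : GCtx R} (h : GLe A A') (h' : GLe D D') (ρ : GStep P Q)
      (π : F (A ++ (P ++ D))) :
      Ax step sub (step A' D' ρ (sub (h.append ((GLe.refl P).append h')) π))
        (sub (h.append ((GLe.refl Q).append h')) (step A D ρ π))
  | contMono (A D : GCtx R) {r₁ r₂ s₁ s₂ : R} (X : GTy R) (h : r₁ ≤ r₂) (h' : s₁ ≤ s₂)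
      (π : F (A ++ ([(r₁, X), (s₁, X)] ++ D))) :
      Ax step sub (step A D (.cont r₂ s₂ X) (sub (.inside A D (.double h h' X X)) π))
        (sub (.inside A D (.single (add_le_add h h') X)) (step A D (.cont r₁ s₁ X) π))
  | subUnitL (A D : GCtx R) {r s : R} (h : r ≤ s) (π : F (A ++ ([] ++ D))) :
      Ax step sub (sub (.inside A D (.single h .J)) (step A D (.unitL r) π))
        (step A D (.unitL s) π)
  | subTenL (A D : GCtx R) {r s : R} (X Y : GTy R) (h : r ≤ s)
      (π : F (A ++ ([(r, X), (r, Y)] ++ D))) :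
      Ax step sub (sub (.inside A D (.single h (.ten X Y))) (step A D (.tenL r X Y) π))
        (step A D (.tenL s X Y) (sub (.inside A D (.double h h X Y)) π))
  | multMono (A D : GCtx R) {r s : R} {Δ Δ' : GCtx R} {X : GTy R} (h : r ≤ s) (h' : GLe Δ Δ')
      (Θ : GS Δ X) (π : F (A ++ ([(r, X)] ++ D))) :
      Ax step sub (step A D (.cut s (.sub h' Θ)) (sub (.inside A D (.single h X)) π))
        (sub (.inside A D (.scale h h')) (step A D (.cut r Θ) π))
  -- cut reduction: commuting conversions and secondary hypotheses
  | mcutStepL (A B D : GCtx R) {P Q Δ : GCtx R} {X : GTy R} (ds : List R) (ρ : GStep P Q)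
      (Θ : GS Δ X) (π : F (A ++ (P ++ (B ++ (rep ds X ++ D))))) :
      Ax step sub
        (mcut step (A ++ (Q ++ B)) D ds Θ (tr (step A (B ++ (rep ds X ++ D)) ρ π)))
        (tr (step A (B ++ (scale ds.sum Δ ++ D)) ρ
          (tr (mcut step (A ++ (P ++ B)) D ds Θ (tr π)))))
  | mcutStepR (A B D : GCtx R) {P Q Δ : GCtx R} {X : GTy R} (ds : List R) (ρ : GStep P Q)
      (Θ : GS Δ X) (π : F (A ++ (rep ds X ++ (B ++ (P ++ D))))) :
      Ax step sub
        (mcut step A (B ++ (Q ++ D)) ds Θ (tr (step (A ++ (rep ds X ++ B)) D ρ (tr π))))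
        (tr (step (A ++ (scale ds.sum Δ ++ B)) D ρ
          (tr (mcut step A (B ++ (P ++ D)) ds Θ π))))
  | mcutCut (A B C D : GCtx R) (s : R) (ds : List R) {Δ : GCtx R} {X Y : GTy R} (Θ₁ : GS Δ X)
      (Θ₂ : GS (B ++ (rep ds X ++ C)) Y) (π : F (A ++ ([(s, Y)] ++ D))) :
      Ax step sub
        (mcut step (A ++ scale s B) (scale s C ++ D) (ds.map (s * ·)) Θ₁
          (tr (step A D (.cut s Θ₂) π)))
        (tr (step A D (.cut s (GS.mcut B C ds Θ₁ Θ₂)) π))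
  -- cut reduction: axiom and principal cases
  | cutId (A D : GCtx R) (r : R) (X : GTy R) (π : F (A ++ ([(r, X)] ++ D))) :
      Ax step sub (step A D (.cut r (.id X)) π) (tr π)
  | cutTen (A D : GCtx R) (r : R) {Δ₁ Δ₂ : GCtx R} {X Y : GTy R} (Θ₁ : GS Δ₁ X) (Θ₂ : GS Δ₂ Y)
      (π : F (A ++ ([(r, X), (r, Y)] ++ D))) :
      Ax step sub (step A D (.cut r (.tenR Θ₁ Θ₂)) (step A D (.tenL r X Y) π))
        (tr (step (A ++ scale r Δ₁) D (.cut r Θ₂)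
          (tr (step A ([(r, Y)] ++ D) (.cut r Θ₁) π))))
  | cutUnit (A D : GCtx R) (r : R) (π : F (A ++ ([] ++ D))) :
      Ax step sub (step A D (.cut r .unitR) (step A D (.unitL r) π)) (tr π)
  -- cut reduction: structural cases
  | cutWeak (A D : GCtx R) {Δ : GCtx R} {X : GTy R} (Θ : GS Δ X) (π : F (A ++ ([] ++ D))) :
      Ax step sub (step A D (.cut 0 Θ) (step A D (.weak X) π)) (weakBlock step A D Δ π)
  | cutCont (A D : GCtx R) (r s : R) {Δ : GCtx R} {X : GTy R} (Θ : GS Δ X)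
      (π : F (A ++ ([(r, X), (s, X)] ++ D))) :
      Ax step sub (step A D (.cut (r + s) Θ) (step A D (.cont r s X) π))
        (contBlock step r s D A Δ
          (tr (step (A ++ scale r Δ) D (.cut s Θ)
            (tr (step A ([(s, X)] ++ D) (.cut r Θ) π)))))
  | cutExL (A D : GCtx R) (r : R) (q : R × GTy R) {Δ : GCtx R} {X : GTy R} (Θ : GS Δ X)
      (π : F (A ++ ([(r, X), q] ++ D))) :
      Ax step sub (step (A ++ [q]) D (.cut r Θ) (tr (step A D (.ex (r, X) q) π)))
        (tr (gswap step A (scale r Δ) [q] D (tr (step A ([q] ++ D) (.cut r Θ) π))))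
  | cutExR (A D : GCtx R) (r : R) (q : R × GTy R) {Δ : GCtx R} {X : GTy R} (Θ : GS Δ X)
      (π : F (A ++ ([q, (r, X)] ++ D))) :
      Ax step sub (step A ([q] ++ D) (.cut r Θ) (step A D (.ex q (r, X)) π))
        (gswap step A [q] (scale r Δ) D (tr (step (A ++ [q]) D (.cut r Θ) (tr π))))
  -- cut reduction: secondary conclusions
  | cutStep (A B C D : GCtx R) (s : R) {P Q : GCtx R} {Y : GTy R} (ρ : GStep P Q)
      (Θ : GS (B ++ (P ++ C)) Y) (π : F (A ++ ([(s, Y)] ++ D))) :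
      Ax step sub (step A D (.cut s (.gleft B C ρ Θ)) π)
        (tr (step (A ++ scale s B) (scale s C ++ D) (ρ.smul s) (tr (step A D (.cut s Θ) π))))

variable [AddLeftMono R] [MulLeftMono R] [MulRightMono R]

mutual
/-- The equational theory of the graded calculus. -/
inductive GEq : ∀ {Δ : GCtx R} {X : GTy R}, GS Δ X → GS Δ X → Prop
  -- equivalence relation and congruence
  | refl {Δ : GCtx R} {X : GTy R} (π : GS Δ X) : GEq π π
  | symm {Δ : GCtx R} {X : GTy R} {π π' : GS Δ X} (e : GEq π π') : GEq π' π
  | trans {Δ : GCtx R} {X : GTy R} {π π' π'' : GS Δ X} (e : GEq π π') (e' : GEq π' π'') :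
      GEq π π''
  | sub {Δ Δ' : GCtx R} {X : GTy R} (h : GLe Δ Δ') {π π' : GS Δ X} (e : GEq π π') :
      GEq (.sub h π) (.sub h π')
  | tenR {Δ₁ Δ₂ : GCtx R} {X Y : GTy R} {π₁ π₁' : GS Δ₁ X} {π₂ π₂' : GS Δ₂ Y}
      (e₁ : GEq π₁ π₁') (e₂ : GEq π₂ π₂') : GEq (.tenR π₁ π₂) (.tenR π₁' π₂')
  | linR {Δ : GCtx R} {A : LTy R} {π π' : MS Δ [] A} (e : MEq π π') : GEq (.linR π) (.linR π')
  | gleft (A D : GCtx R) {P Q : GCtx R} {Y : GTy R} (ρ : GStep P Q)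
      {π π' : GS (A ++ (P ++ D)) Y} (e : GEq π π') : GEq (.gleft A D ρ π) (.gleft A D ρ π')
  | cut (A D : GCtx R) (r : R) {Δ : GCtx R} {X Y : GTy R} {Θ Θ' : GS Δ X} (e : GEq Θ Θ')
      (π : GS (A ++ ([(r, X)] ++ D)) Y) : GEq (.gleft A D (.cut r Θ) π) (.gleft A D (.cut r Θ') π)
  -- equations
  | ax {Δ : GCtx R} {X : GTy R} {π π' : GS Δ X}
      (e : Ax (F := fun Δ => GS Δ X) (GS.step X) GS.sub π π') : GEq π π'
  | etaTen (X Y : GTy R) :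
      GEq (.id (.ten X Y)) (.gleft [] [] (.tenL 1 X Y) (.tenR (Δ₁ := [(1, X)]) (.id X) (.id Y)))
  | etaUnit : GEq (.id .J) (.gleft [] [] (.unitL 1) .unitR)
  | etaLin (A : LTy R) : GEq (.id (.Lin A)) (.linR (.linL (.id A)))
  | cutIdR {Δ : GCtx R} {X : GTy R} (Θ : GS Δ X) :
      GEq (.gleft [] [] (.cut 1 Θ) (.id X)) Θ.tr
  | subTenR {Δ₁ Δ₁' Δ₂ Δ₂' : GCtx R} {X Y : GTy R} (h₁ : GLe Δ₁ Δ₁') (h₂ : GLe Δ₂ Δ₂')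
      (π₁ : GS Δ₁ X) (π₂ : GS Δ₂ Y) :
      GEq (.tenR (.sub h₁ π₁) (.sub h₂ π₂)) (.sub (h₁.append h₂) (.tenR π₁ π₂))
  | subLinR {Δ Δ' : GCtx R} {A : LTy R} (h : GLe Δ Δ') (π : MS Δ [] A) :
      GEq (.linR (.sub h π)) (.sub h (.linR π))
  | mcutTenR₁ (A D : GCtx R) (ds : List R) {Δ Δ₂ : GCtx R} {X Y Z : GTy R} (Θ : GS Δ X)
      (π₁ : GS (A ++ (rep ds X ++ D)) Y) (π₂ : GS Δ₂ Z) :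
      GEq (GS.mcut A (D ++ Δ₂) ds Θ (GS.tr (.tenR π₁ π₂)))
        (GS.tr (.tenR (GS.mcut A D ds Θ π₁) π₂))
  | mcutTenR₂ (A D : GCtx R) (ds : List R) {Δ Δ₁ : GCtx R} {X Y Z : GTy R} (Θ : GS Δ X)
      (π₁ : GS Δ₁ Y) (π₂ : GS (A ++ (rep ds X ++ D)) Z) :
      GEq (GS.mcut (Δ₁ ++ A) D ds Θ (GS.tr (.tenR π₁ π₂)))
        (GS.tr (.tenR π₁ (GS.mcut A D ds Θ π₂)))
  | mcutLinR (A D : GCtx R) (ds : List R) {Δ : GCtx R} {X : GTy R} {B : LTy R} (Θ : GS Δ X)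
      (π : MS (A ++ (rep ds X ++ D)) [] B) :
      GEq (GS.mcut A D ds Θ (.linR π)) (.linR (MS.mcut A D ds Θ π))
/-- The equational theory of the mixed calculus. -/
inductive MEq : ∀ {Δ : GCtx R} {Γ : List (LTy R)} {A : LTy R}, MS Δ Γ A → MS Δ Γ A → Prop
  -- equivalence relation and congruence
  | refl {Δ : GCtx R} {Γ : List (LTy R)} {A : LTy R} (π : MS Δ Γ A) : MEq π π
  | symm {Δ : GCtx R} {Γ : List (LTy R)} {A : LTy R} {π π' : MS Δ Γ A} (e : MEq π π') : MEq π' π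
  | trans {Δ : GCtx R} {Γ : List (LTy R)} {A : LTy R} {π π' π'' : MS Δ Γ A} (e : MEq π π')
      (e' : MEq π' π'') : MEq π π''
  | sub {Δ Δ' : GCtx R} {Γ : List (LTy R)} {A : LTy R} (h : GLe Δ Δ') {π π' : MS Δ Γ A}
      (e : MEq π π') : MEq (.sub h π) (.sub h π')
  | gleft (A D : GCtx R) {P Q : GCtx R} {Γ : List (LTy R)} {B : LTy R} (ρ : GStep P Q)
      {π π' : MS (A ++ (P ++ D)) Γ B} (e : MEq π π') : MEq (.gleft A D ρ π) (.gleft A D ρ π')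
  | gcut (A D : GCtx R) (r : R) {Δ : GCtx R} {X : GTy R} {Γ : List (LTy R)} {B : LTy R}
      {Θ Θ' : GS Δ X} (e : GEq Θ Θ') (π : MS (A ++ ([(r, X)] ++ D)) Γ B) :
      MEq (.gleft A D (.cut r Θ) π) (.gleft A D (.cut r Θ') π)
  | lleft (Γ₁ Γ₃ : List (LTy R)) {Δ : GCtx R} {P Q : List (LTy R)} {B : LTy R} (κ : LStep P Q)
      {π π' : MS Δ (Γ₁ ++ (P ++ Γ₃)) B} (e : MEq π π') :
      MEq (.lleft Γ₁ Γ₃ κ π) (.lleft Γ₁ Γ₃ κ π')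
  | tenR {Δ₁ Δ₂ : GCtx R} {Γ₁ Γ₂ : List (LTy R)} {A B : LTy R} {π₁ π₁' : MS Δ₁ Γ₁ A}
      {π₂ π₂' : MS Δ₂ Γ₂ B} (e₁ : MEq π₁ π₁') (e₂ : MEq π₂ π₂') :
      MEq (.tenR π₁ π₂) (.tenR π₁' π₂')
  | impR {Δ : GCtx R} {Γ : List (LTy R)} {A B : LTy R} {π π' : MS Δ (Γ ++ [A]) B}
      (e : MEq π π') : MEq (.impR π) (.impR π')
  | impL (Γ₁ Γ₃ : List (LTy R)) {Δ₁ Δ₂ : GCtx R} {Γ₂ : List (LTy R)} {A B C : LTy R}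
      {π₂ π₂' : MS Δ₂ Γ₂ A} {π₁ π₁' : MS Δ₁ (Γ₁ ++ B :: Γ₃) C} (e₂ : MEq π₂ π₂')
      (e₁ : MEq π₁ π₁') : MEq (.impL Γ₁ Γ₃ π₂ π₁) (.impL Γ₁ Γ₃ π₂' π₁')
  | grdR (r : R) {Δ : GCtx R} {X : GTy R} {Θ Θ' : GS Δ X} (e : GEq Θ Θ') :
      MEq (.grdR r Θ) (.grdR r Θ')
  | grdL {Δ : GCtx R} {Γ : List (LTy R)} {B : LTy R} {r : R} {X : GTy R}
      {π π' : MS (Δ ++ [(r, X)]) Γ B} (e : MEq π π') : MEq (.grdL π) (.grdL π')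
  | linL {Δ : GCtx R} {Γ : List (LTy R)} {A B : LTy R} {π π' : MS Δ (A :: Γ) B}
      (e : MEq π π') : MEq (.linL π) (.linL π')
  | cut (Γ₁ Γ₃ : List (LTy R)) {Δ₁ Δ₂ : GCtx R} {Γ₂ : List (LTy R)} {A B : LTy R}
      {π₁ π₁' : MS Δ₂ Γ₂ A} {π₂ π₂' : MS Δ₁ (Γ₁ ++ A :: Γ₃) B} (e₁ : MEq π₁ π₁')
      (e₂ : MEq π₂ π₂') : MEq (.cut Γ₁ Γ₃ π₁ π₂) (.cut Γ₁ Γ₃ π₁' π₂')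
  -- equations on the graded context, and exchange
  | ax {Δ : GCtx R} {Γ : List (LTy R)} {B : LTy R} {π π' : MS Δ Γ B}
      (e : Ax (F := fun Δ => MS Δ Γ B) (MS.step Γ B) MS.sub π π') : MEq π π'
  | exEx {Δ : GCtx R} (Γ₁ Γ₃ : List (LTy R)) (A B : LTy R) {C : LTy R}
      (π : MS Δ (Γ₁ ++ ([A, B] ++ Γ₃)) C) :
      MEq (.lleft Γ₁ Γ₃ (.ex B A) (.lleft Γ₁ Γ₃ (.ex A B) π)) π
  -- eta-expansions
  | etaTen (A B : LTy R) :
      MEq (.id (.ten A B)) (.lleft [] [] (.tenL A B) (.tenR (.id A) (.id B)))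
  | etaUnit : MEq (.id .I) (.lleft [] [] .unitL .unitR)
  | etaGrd (r : R) (X : GTy R) :
      MEq (.id (.Grd r X)) (.grdL (MS.tr (Δ' := [] ++ [(r, X)]) (.grdR r (.id X))))
  -- approximation commutes with the rules of the mixed calculus
  | subLleft {Δ Δ' : GCtx R} (h : GLe Δ Δ') (Γ₁ Γ₃ : List (LTy R)) {P Q : List (LTy R)}
      {B : LTy R} (κ : LStep P Q) (π : MS Δ (Γ₁ ++ (P ++ Γ₃)) B) :
      MEq (.lleft Γ₁ Γ₃ κ (.sub h π)) (.sub h (.lleft Γ₁ Γ₃ κ π))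
  | subTenR {Δ₁ Δ₁' Δ₂ Δ₂' : GCtx R} {Γ₁ Γ₂ : List (LTy R)} {A B : LTy R} (h₁ : GLe Δ₁ Δ₁')
      (h₂ : GLe Δ₂ Δ₂') (π₁ : MS Δ₁ Γ₁ A) (π₂ : MS Δ₂ Γ₂ B) :
      MEq (.tenR (.sub h₁ π₁) (.sub h₂ π₂)) (.sub (h₁.append h₂) (.tenR π₁ π₂))
  | subImpR {Δ Δ' : GCtx R} (h : GLe Δ Δ') {Γ : List (LTy R)} {A B : LTy R}
      (π : MS Δ (Γ ++ [A]) B) : MEq (.impR (.sub h π)) (.sub h (.impR π))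
  | subImpL (Γ₁ Γ₃ : List (LTy R)) {Δ₁ Δ₁' Δ₂ Δ₂' : GCtx R} {Γ₂ : List (LTy R)} {A B C : LTy R}
      (h₁ : GLe Δ₁ Δ₁') (h₂ : GLe Δ₂ Δ₂') (π₂ : MS Δ₂ Γ₂ A) (π₁ : MS Δ₁ (Γ₁ ++ B :: Γ₃) C) :
      MEq (.impL Γ₁ Γ₃ (.sub h₂ π₂) (.sub h₁ π₁)) (.sub (h₁.append h₂) (.impL Γ₁ Γ₃ π₂ π₁))
  | subGrdR (r : R) {Δ Δ' : GCtx R} {X : GTy R} (h : GLe Δ Δ') (Θ : GS Δ X) :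
      MEq (.grdR r (.sub h Θ)) (.sub (.scale le_rfl h) (.grdR r Θ))
  | subGrdL {Δ Δ' : GCtx R} {Γ : List (LTy R)} {B : LTy R} {r : R} {X : GTy R} (h : GLe Δ Δ')
      (π : MS (Δ ++ [(r, X)]) Γ B) :
      MEq (.grdL (.sub (h.append (.refl _)) π)) (.sub h (.grdL π))
  | subLinL {Δ Δ' : GCtx R} {Γ : List (LTy R)} {A B : LTy R} (h : GLe Δ Δ')
      (π : MS Δ (A :: Γ) B) : MEq (.linL (.sub h π)) (.sub (h.append (.refl _)) (.linL π))
  | subCut (Γ₁ Γ₃ : List (LTy R)) {Δ₁ Δ₁' Δ₂ Δ₂' : GCtx R} {Γ₂ : List (LTy R)} {A B : LTy R}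
      (h₁ : GLe Δ₁ Δ₁') (h₂ : GLe Δ₂ Δ₂') (π₁ : MS Δ₂ Γ₂ A) (π₂ : MS Δ₁ (Γ₁ ++ A :: Γ₃) B) :
      MEq (.cut Γ₁ Γ₃ (.sub h₂ π₁) (.sub h₁ π₂)) (.sub (h₁.append h₂) (.cut Γ₁ Γ₃ π₁ π₂))
  -- reduction of graded cuts: secondary hypotheses
  | mcutLleft (A D : GCtx R) (ds : List R) {Δ : GCtx R} {X : GTy R} (Θ : GS Δ X)
      (Γ₁ Γ₃ : List (LTy R)) {P Q : List (LTy R)} {B : LTy R} (κ : LStep P Q)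
      (π : MS (A ++ (rep ds X ++ D)) (Γ₁ ++ (P ++ Γ₃)) B) :
      MEq (MS.mcut A D ds Θ (.lleft Γ₁ Γ₃ κ π)) (.lleft Γ₁ Γ₃ κ (MS.mcut A D ds Θ π))
  | mcutTenR₁ (A D : GCtx R) (ds : List R) {Δ Δ₂ : GCtx R} {X : GTy R} (Θ : GS Δ X)
      {Γ₁ Γ₂ : List (LTy R)} {B C : LTy R} (π₁ : MS (A ++ (rep ds X ++ D)) Γ₁ B)
      (π₂ : MS Δ₂ Γ₂ C) :
      MEq (MS.mcut A (D ++ Δ₂) ds Θ (MS.tr (.tenR π₁ π₂)))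
        (MS.tr (.tenR (MS.mcut A D ds Θ π₁) π₂))
  | mcutTenR₂ (A D : GCtx R) (ds : List R) {Δ Δ₁ : GCtx R} {X : GTy R} (Θ : GS Δ X)
      {Γ₁ Γ₂ : List (LTy R)} {B C : LTy R} (π₁ : MS Δ₁ Γ₁ B)
      (π₂ : MS (A ++ (rep ds X ++ D)) Γ₂ C) :
      MEq (MS.mcut (Δ₁ ++ A) D ds Θ (MS.tr (.tenR π₁ π₂)))
        (MS.tr (.tenR π₁ (MS.mcut A D ds Θ π₂)))
  | mcutImpR (A D : GCtx R) (ds : List R) {Δ : GCtx R} {X : GTy R} (Θ : GS Δ X)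
      {Γ : List (LTy R)} {B C : LTy R} (π : MS (A ++ (rep ds X ++ D)) (Γ ++ [B]) C) :
      MEq (MS.mcut A D ds Θ (.impR π)) (.impR (MS.mcut A D ds Θ π))
  | mcutImpL₁ (A D : GCtx R) (ds : List R) {Δ Δ₂ : GCtx R} {X : GTy R} (Θ : GS Δ X)
      (Γ₁ Γ₃ : List (LTy R)) {Γ₂ : List (LTy R)} {B C E : LTy R} (π₂ : MS Δ₂ Γ₂ B)
      (π₁ : MS (A ++ (rep ds X ++ D)) (Γ₁ ++ C :: Γ₃) E) :
      MEq (MS.mcut A (D ++ Δ₂) ds Θ (MS.tr (.impL Γ₁ Γ₃ π₂ π₁)))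
        (MS.tr (.impL Γ₁ Γ₃ π₂ (MS.mcut A D ds Θ π₁)))
  | mcutImpL₂ (A D : GCtx R) (ds : List R) {Δ Δ₁ : GCtx R} {X : GTy R} (Θ : GS Δ X)
      (Γ₁ Γ₃ : List (LTy R)) {Γ₂ : List (LTy R)} {B C E : LTy R}
      (π₂ : MS (A ++ (rep ds X ++ D)) Γ₂ B) (π₁ : MS Δ₁ (Γ₁ ++ C :: Γ₃) E) :
      MEq (MS.mcut (Δ₁ ++ A) D ds Θ (MS.tr (.impL Γ₁ Γ₃ π₂ π₁)))
        (MS.tr (.impL Γ₁ Γ₃ (MS.mcut A D ds Θ π₂) π₁))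
  | mcutGrdR (A D : GCtx R) (ds : List R) {Δ : GCtx R} {X Y : GTy R} (Θ : GS Δ X) (r : R)
      (Θ' : GS (A ++ (rep ds X ++ D)) Y) :
      MEq (MS.mcut (scale r A) (scale r D) (ds.map (r * ·)) Θ (MS.tr (.grdR r Θ')))
        (MS.tr (.grdR r (GS.mcut A D ds Θ Θ')))
  | mcutGrdL (A D : GCtx R) (ds : List R) {Δ : GCtx R} {X Y : GTy R} (Θ : GS Δ X)
      {Γ : List (LTy R)} {B : LTy R} {r : R}
      (π : MS ((A ++ (rep ds X ++ D)) ++ [(r, Y)]) Γ B) :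
      MEq (MS.mcut A D ds Θ (.grdL π))
        (.grdL (MS.tr (MS.mcut A (D ++ [(r, Y)]) ds Θ (MS.tr π))))
  | mcutLinL (A D : GCtx R) (ds : List R) {Δ : GCtx R} {X : GTy R} (Θ : GS Δ X)
      {Γ : List (LTy R)} {B C : LTy R} (π : MS (A ++ (rep ds X ++ D)) (B :: Γ) C) :
      MEq (MS.mcut A (D ++ [(1, .Lin B)]) ds Θ (MS.tr (.linL π)))
        (MS.tr (.linL (MS.mcut A D ds Θ π)))
  | mcutCut₁ (A D : GCtx R) (ds : List R) {Δ Δ₁ : GCtx R} {X : GTy R} (Θ : GS Δ X)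
      (Γ₁ Γ₃ : List (LTy R)) {Γ₂ : List (LTy R)} {B C : LTy R}
      (π₁ : MS (A ++ (rep ds X ++ D)) Γ₂ B) (π₂ : MS Δ₁ (Γ₁ ++ B :: Γ₃) C) :
      MEq (MS.mcut (Δ₁ ++ A) D ds Θ (MS.tr (.cut Γ₁ Γ₃ π₁ π₂)))
        (MS.tr (.cut Γ₁ Γ₃ (MS.mcut A D ds Θ π₁) π₂))
  | mcutCut₂ (A D : GCtx R) (ds : List R) {Δ Δ₂ : GCtx R} {X : GTy R} (Θ : GS Δ X)
      (Γ₁ Γ₃ : List (LTy R)) {Γ₂ : List (LTy R)} {B C : LTy R} (π₁ : MS Δ₂ Γ₂ B)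
      (π₂ : MS (A ++ (rep ds X ++ D)) (Γ₁ ++ B :: Γ₃) C) :
      MEq (MS.mcut A (D ++ Δ₂) ds Θ (MS.tr (.cut Γ₁ Γ₃ π₁ π₂)))
        (MS.tr (.cut Γ₁ Γ₃ π₁ (MS.mcut A D ds Θ π₂)))
  -- reduction of graded cuts: principal case
  | gcutLin {Δ₁ Δ₂ : GCtx R} {Γ : List (LTy R)} {A B : LTy R} (π₁ : MS Δ₂ [] A)
      (π₂ : MS Δ₁ (A :: Γ) B) :
      MEq (.gleft Δ₁ [] (.cut 1 (.linR π₁)) (MS.tr (.linL π₂))) (MS.tr (.cut [] Γ π₁ π₂))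
  -- reduction of linear cuts: axiom cases
  | cutIdL {Δ : GCtx R} (Γ₁ Γ₃ : List (LTy R)) {A B : LTy R} (π : MS Δ (Γ₁ ++ A :: Γ₃) B) :
      MEq (.cut Γ₁ Γ₃ (.id A) π) π.tr
  | cutIdR {Δ : GCtx R} {Γ : List (LTy R)} {A : LTy R} (π : MS Δ Γ A) :
      MEq (.cut [] [] π (.id A)) π.tr
  -- reduction of linear cuts: principal cases
  | cutTen {Δ₁ Δ₂ Δ₃ : GCtx R} (Γ₁ Γ₄ : List (LTy R)) {Γ₂ Γ₃ : List (LTy R)} {A B C : LTy R}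
      (π₁ : MS Δ₂ Γ₂ A) (π₂ : MS Δ₃ Γ₃ B) (π₃ : MS Δ₁ (Γ₁ ++ ([A, B] ++ Γ₄)) C) :
      MEq (.cut Γ₁ Γ₄ (.tenR π₁ π₂) (.lleft Γ₁ Γ₄ (.tenL A B) π₃))
        (MS.tr (.cut (Γ₁ ++ Γ₂) Γ₄ π₂ (MS.tr (.cut Γ₁ (B :: Γ₄) π₁ π₃))))
  | cutUnit {Δ : GCtx R} (Γ₁ Γ₃ : List (LTy R)) {B : LTy R} (π : MS Δ (Γ₁ ++ ([] ++ Γ₃)) B) :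
      MEq (.cut Γ₁ Γ₃ .unitR (.lleft Γ₁ Γ₃ .unitL π)) π.tr
  | cutGrd {Δ₁ Δ₂ : GCtx R} {Γ : List (LTy R)} {X : GTy R} {B : LTy R} (r : R) (Θ : GS Δ₂ X)
      (π : MS (Δ₁ ++ [(r, X)]) Γ B) :
      MEq (.cut [] Γ (.grdR r Θ) (.grdL π)) (MS.tr (.gleft Δ₁ [] (.cut r Θ) (MS.tr π)))
  | cutImp {Δ₁ Δ₂ Δ₃ : GCtx R} (Γ₁ Γ₄ : List (LTy R)) {Γ₂ Γ₃ : List (LTy R)} {A B C : LTy R}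
      (π₃ : MS Δ₃ (Γ₂ ++ [A]) B) (π₂ : MS Δ₂ Γ₃ A) (π₁ : MS Δ₁ (Γ₁ ++ B :: Γ₄) C) :
      MEq (.cut Γ₁ (Γ₃ ++ Γ₄) (.impR π₃) (.impL Γ₁ Γ₄ π₂ π₁))
        (MS.tr (MS.gswap Δ₁ Δ₃ Δ₂ [] (MS.tr (.cut Γ₁ Γ₄ (.cut Γ₂ [] π₂ π₃) π₁))))
  -- reduction of linear cuts: commuting conversions
  | cutCut {Δ₁ Δ₂ Δ₃ : GCtx R} (Γ₁ Γ₂ Γ₄ Γ₅ : List (LTy R)) {Γ₃ : List (LTy R)} {A B C : LTy R}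
      (π₁ : MS Δ₃ Γ₃ A) (π₃ : MS Δ₂ (Γ₂ ++ A :: Γ₄) B) (π₄ : MS Δ₁ (Γ₁ ++ B :: Γ₅) C) :
      MEq (.cut (Γ₁ ++ Γ₂) (Γ₄ ++ Γ₅) π₁ (MS.tr (.cut Γ₁ Γ₅ π₃ π₄)))
        (MS.tr (.cut Γ₁ Γ₅ (.cut Γ₂ Γ₄ π₁ π₃) π₄))
  | cutCutComm {Δ₁ Δ₂ Δ₃ : GCtx R} (Γ₁ Γ₃ Γ₅ : List (LTy R)) {Γ₂ Γ₄ : List (LTy R)}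
      {A B C : LTy R} (π₁ : MS Δ₃ Γ₂ A) (π₃ : MS Δ₂ Γ₄ B)
      (π₄ : MS Δ₁ (Γ₁ ++ A :: (Γ₃ ++ B :: Γ₅)) C) :
      MEq (.cut Γ₁ (Γ₃ ++ (Γ₄ ++ Γ₅)) π₁ (MS.tr (.cut (Γ₁ ++ A :: Γ₃) Γ₅ π₃ (MS.tr π₄))))
        (MS.tr (MS.gswap Δ₁ Δ₃ Δ₂ []
          (MS.tr (.cut (Γ₁ ++ (Γ₂ ++ Γ₃)) Γ₅ π₃ (MS.tr (.cut Γ₁ (Γ₃ ++ B :: Γ₅) π₁ π₄))))))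
  -- reduction of linear cuts: secondary conclusions
  | cutLleft₁ {Δ₁ Δ₂ : GCtx R} (Γ₁ Γ₂ Γ₃ Γ₄ : List (LTy R)) {P Q : List (LTy R)} {B C : LTy R}
      (κ : LStep P Q) (π₁ : MS Δ₂ (Γ₂ ++ (P ++ Γ₃)) B) (π₂ : MS Δ₁ (Γ₁ ++ B :: Γ₄) C) :
      MEq (.cut Γ₁ Γ₄ (.lleft Γ₂ Γ₃ κ π₁) π₂)
        (MS.tr (.lleft (Γ₁ ++ Γ₂) (Γ₃ ++ Γ₄) κ (MS.tr (.cut Γ₁ Γ₄ π₁ π₂))))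
  | cutGleft₁ {Δ₁ : GCtx R} (A D : GCtx R) {P Q : GCtx R} (Γ₁ Γ₃ : List (LTy R))
      {Γ₂ : List (LTy R)} {B C : LTy R} (ρ : GStep P Q) (π₁ : MS (A ++ (P ++ D)) Γ₂ B)
      (π₂ : MS Δ₁ (Γ₁ ++ B :: Γ₃) C) :
      MEq (.cut Γ₁ Γ₃ (.gleft A D ρ π₁) π₂)
        (MS.tr (.gleft (Δ₁ ++ A) D ρ (MS.tr (.cut Γ₁ Γ₃ π₁ π₂))))
  | cutImpL {Δ₁ Δ₂ Δ₃ : GCtx R} (Γ₁ Γ₂ Γ₄ Γ₅ : List (LTy R)) {Γ₃ : List (LTy R)}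
      {A B C D : LTy R} (π₃ : MS Δ₃ Γ₃ A) (π₄ : MS Δ₂ (Γ₂ ++ B :: Γ₄) C)
      (π₂ : MS Δ₁ (Γ₁ ++ C :: Γ₅) D) :
      MEq (.cut Γ₁ Γ₅ (.impL Γ₂ Γ₄ π₃ π₄) π₂)
        (MS.tr (.impL (B := B) (Γ₁ ++ Γ₂) (Γ₄ ++ Γ₅) π₃ (MS.tr (.cut Γ₁ Γ₅ π₄ π₂))))
  | cutLinL {Δ₁ Δ₂ : GCtx R} (Γ₁ Γ₃ : List (LTy R)) {Γ₂ : List (LTy R)} {A B C : LTy R}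
      (π₁ : MS Δ₂ (A :: Γ₂) B) (π₂ : MS Δ₁ (Γ₁ ++ B :: Γ₃) C) :
      MEq (.cut Γ₁ Γ₃ (.linL π₁) π₂)
        (MS.tr (.linL (A := A) (Γ := Γ₁ ++ (Γ₂ ++ Γ₃))
          (MS.lswap [] Γ₁ [A] (Γ₂ ++ Γ₃) (.cut Γ₁ Γ₃ π₁ π₂))))
  | cutGrdL {Δ₁ Δ₂ : GCtx R} (Γ₁ Γ₃ : List (LTy R)) {Γ₂ : List (LTy R)} {X : GTy R} {r : R}
      {B C : LTy R} (π₁ : MS (Δ₂ ++ [(r, X)]) Γ₂ B) (π₂ : MS Δ₁ (Γ₁ ++ B :: Γ₃) C) :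
      MEq (.cut Γ₁ Γ₃ (.grdL π₁) π₂)
        (MS.lswap [] [.Grd r X] Γ₁ (Γ₂ ++ Γ₃) (.grdL (MS.tr (.cut Γ₁ Γ₃ π₁ π₂))))
  -- reduction of linear cuts: secondary hypotheses
  | cutTenR₁ {Δ₁ Δ₂ Δ₃ : GCtx R} (Γ₁ Γ₃ : List (LTy R)) {Γ₂ Γ₄ : List (LTy R)} {A B C : LTy R}
      (π₁ : MS Δ₃ Γ₂ A) (π₃ : MS Δ₁ (Γ₁ ++ A :: Γ₃) B) (π₄ : MS Δ₂ Γ₄ C) :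
      MEq (.cut Γ₁ (Γ₃ ++ Γ₄) π₁ (MS.tr (.tenR π₃ π₄)))
        (MS.tr (MS.gswap Δ₁ Δ₃ Δ₂ [] (MS.tr (.tenR (.cut Γ₁ Γ₃ π₁ π₃) π₄))))
  | cutTenR₂ {Δ₁ Δ₂ Δ₃ : GCtx R} (Γ₂ Γ₄ : List (LTy R)) {Γ₁ Γ₃ : List (LTy R)} {A B C : LTy R}
      (π₁ : MS Δ₃ Γ₃ A) (π₃ : MS Δ₁ Γ₁ B) (π₄ : MS Δ₂ (Γ₂ ++ A :: Γ₄) C) :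
      MEq (.cut (Γ₁ ++ Γ₂) Γ₄ π₁ (MS.tr (.tenR π₃ π₄)))
        (MS.tr (.tenR π₃ (.cut Γ₂ Γ₄ π₁ π₄)))
  | cutLleftL {Δ₁ Δ₂ : GCtx R} (Γ₁ Γ₃ Γ₄ : List (LTy R)) {Γ₂ P Q : List (LTy R)} {A B : LTy R}
      (κ : LStep P Q) (π₁ : MS Δ₂ Γ₂ A) (π₂ : MS Δ₁ (Γ₁ ++ A :: (Γ₃ ++ (P ++ Γ₄))) B) :
      MEq (.cut Γ₁ (Γ₃ ++ (Q ++ Γ₄)) π₁ (MS.tr (.lleft (Γ₁ ++ A :: Γ₃) Γ₄ κ (MS.tr π₂))))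
        (MS.tr (.lleft (Γ₁ ++ (Γ₂ ++ Γ₃)) Γ₄ κ (MS.tr (.cut Γ₁ (Γ₃ ++ (P ++ Γ₄)) π₁ π₂))))
  | cutLleftR {Δ₁ Δ₂ : GCtx R} (Γ₁ Γ₃ Γ₄ : List (LTy R)) {Γ₂ P Q : List (LTy R)} {A B : LTy R}
      (κ : LStep P Q) (π₁ : MS Δ₂ Γ₂ A) (π₂ : MS Δ₁ (Γ₁ ++ (P ++ (Γ₃ ++ A :: Γ₄))) B) :
      MEq (.cut (Γ₁ ++ (Q ++ Γ₃)) Γ₄ π₁ (MS.tr (.lleft Γ₁ (Γ₃ ++ A :: Γ₄) κ π₂)))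
        (MS.tr (.lleft Γ₁ (Γ₃ ++ (Γ₂ ++ Γ₄)) κ
          (MS.tr (.cut (Γ₁ ++ (P ++ Γ₃)) Γ₄ π₁ (MS.tr π₂)))))
  | cutExL {Δ₁ Δ₂ : GCtx R} (Γ₁ Γ₃ : List (LTy R)) {Γ₂ : List (LTy R)} {A B C : LTy R}
      (π₁ : MS Δ₂ Γ₂ A) (π₂ : MS Δ₁ (Γ₁ ++ ([A, B] ++ Γ₃)) C) :
      MEq (.cut (Γ₁ ++ [B]) Γ₃ π₁ (MS.tr (.lleft Γ₁ Γ₃ (.ex A B) π₂)))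
        (MS.tr (MS.lswap Γ₁ Γ₂ [B] Γ₃ (.cut Γ₁ (B :: Γ₃) π₁ π₂)))
  | cutExR {Δ₁ Δ₂ : GCtx R} (Γ₁ Γ₃ : List (LTy R)) {Γ₂ : List (LTy R)} {A B C : LTy R}
      (π₁ : MS Δ₂ Γ₂ A) (π₂ : MS Δ₁ (Γ₁ ++ ([B, A] ++ Γ₃)) C) :
      MEq (.cut Γ₁ (B :: Γ₃) π₁ (.lleft Γ₁ Γ₃ (.ex B A) π₂))
        (MS.lswap Γ₁ [B] Γ₂ Γ₃ (MS.tr (.cut (Γ₁ ++ [B]) Γ₃ π₁ (MS.tr π₂))))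
  | cutGleft₂ {Δ₂ : GCtx R} (A D : GCtx R) {P Q : GCtx R} (Γ₁ Γ₃ : List (LTy R))
      {Γ₂ : List (LTy R)} {B C : LTy R} (ρ : GStep P Q) (π₁ : MS Δ₂ Γ₂ B)
      (π₂ : MS (A ++ (P ++ D)) (Γ₁ ++ B :: Γ₃) C) :
      MEq (.cut Γ₁ Γ₃ π₁ (.gleft A D ρ π₂))
        (MS.tr (.gleft A (D ++ Δ₂) ρ (MS.tr (.cut Γ₁ Γ₃ π₁ π₂))))
  | cutImpR {Δ₁ Δ₂ : GCtx R} (Γ₁ Γ₃ : List (LTy R)) {Γ₂ : List (LTy R)} {A B C : LTy R}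
      (π₁ : MS Δ₂ Γ₂ A) (π₂ : MS Δ₁ ((Γ₁ ++ A :: Γ₃) ++ [B]) C) :
      MEq (.cut Γ₁ Γ₃ π₁ (.impR π₂)) (.impR (MS.tr (.cut Γ₁ (Γ₃ ++ [B]) π₁ (MS.tr π₂))))
  | cutImpL₁ {Δ₁ Δ₂ Δ₃ : GCtx R} (Γ₁ Γ₂ Γ₄ Γ₅ : List (LTy R)) {Γ₃ : List (LTy R)}
      {A B C D : LTy R} (π₁ : MS Δ₃ Γ₃ A) (π₃ : MS Δ₂ (Γ₂ ++ A :: Γ₄) B)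
      (π₄ : MS Δ₁ (Γ₁ ++ C :: Γ₅) D) :
      MEq (.cut (Γ₁ ++ .imp B C :: Γ₂) (Γ₄ ++ Γ₅) π₁ (MS.tr (.impL Γ₁ Γ₅ π₃ π₄)))
        (MS.tr (.impL Γ₁ Γ₅ (.cut Γ₂ Γ₄ π₁ π₃) π₄))
  | cutImpL₂ {Δ₁ Δ₂ Δ₃ : GCtx R} (Γ₁ Γ₃ Γ₅ : List (LTy R)) {Γ₂ Γ₄ : List (LTy R)}
      {A B C D : LTy R} (π₁ : MS Δ₃ Γ₄ A) (π₃ : MS Δ₂ Γ₂ B)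
      (π₄ : MS Δ₁ (Γ₁ ++ C :: (Γ₃ ++ A :: Γ₅)) D) :
      MEq (.cut (Γ₁ ++ .imp B C :: (Γ₂ ++ Γ₃)) Γ₅ π₁
          (MS.tr (.impL Γ₁ (Γ₃ ++ A :: Γ₅) π₃ π₄)))
        (MS.tr (MS.gswap Δ₁ Δ₃ Δ₂ [] (MS.tr (.impL (B := C) Γ₁ (Γ₃ ++ (Γ₄ ++ Γ₅)) π₃
          (MS.tr (.cut (Γ₁ ++ C :: Γ₃) Γ₅ π₁ (MS.tr π₄)))))))
  | cutImpL₃ {Δ₁ Δ₂ Δ₃ : GCtx R} (Γ₁ Γ₃ Γ₅ : List (LTy R)) {Γ₂ Γ₄ : List (LTy R)}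
      {A B C D : LTy R} (π₁ : MS Δ₃ Γ₂ A) (π₃ : MS Δ₂ Γ₄ B)
      (π₄ : MS Δ₁ (Γ₁ ++ A :: (Γ₃ ++ C :: Γ₅)) D) :
      MEq (.cut Γ₁ (Γ₃ ++ .imp B C :: (Γ₄ ++ Γ₅)) π₁
          (MS.tr (.impL (B := C) (Γ₁ ++ A :: Γ₃) Γ₅ π₃ (MS.tr π₄))))
        (MS.tr (MS.gswap Δ₁ Δ₃ Δ₂ [] (MS.tr (.impL (B := C) (Γ₁ ++ (Γ₂ ++ Γ₃)) Γ₅ π₃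
          (MS.tr (.cut Γ₁ (Γ₃ ++ C :: Γ₅) π₁ π₄))))))
  | cutLinL₂ {Δ₁ Δ₂ : GCtx R} (Γ₁ Γ₃ : List (LTy R)) {Γ₂ : List (LTy R)} {A B C : LTy R}
      (π₁ : MS Δ₂ Γ₂ B) (π₂ : MS Δ₁ (A :: (Γ₁ ++ B :: Γ₃)) C) :
      MEq (.cut Γ₁ Γ₃ π₁ (.linL π₂))
        (MS.tr (MS.gswap Δ₁ Δ₂ [(1, .Lin A)] []
          (MS.tr (.linL (A := A) (Γ := Γ₁ ++ (Γ₂ ++ Γ₃)) (.cut (A :: Γ₁) Γ₃ π₁ π₂)))))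
  | cutGrdL₂ {Δ₁ Δ₂ : GCtx R} (Γ₁ Γ₃ : List (LTy R)) {Γ₂ : List (LTy R)} {X : GTy R} {r : R}
      {B C : LTy R} (π₁ : MS Δ₂ Γ₂ B) (π₂ : MS (Δ₁ ++ [(r, X)]) (Γ₁ ++ B :: Γ₃) C) :
      MEq (.cut (.Grd r X :: Γ₁) Γ₃ π₁ (.grdL π₂))
        (.grdL (MS.tr (MS.gswap Δ₁ [(r, X)] Δ₂ [] (MS.tr (.cut Γ₁ Γ₃ π₁ π₂)))))
end

end Calculus

/-! ### Models -/

section Models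

variable (R : Type u) [Semiring R] [Preorder R] [AddLeftMono R] [MulLeftMono R] [MulRightMono R]

/-- A strict exponential action `⊙` of a preordered semiring `R`, contravariant in the grade, on a
symmetric monoidal category `C`. -/
structure StrictExpAction (C : Type v) [Category.{w} C] [MonoidalCategory C]
    [SymmetricCategory C] where
  /-- The bifunctor `⊙`. -/
  act : Rᵒᵖ ⥤ C ⥤ C
  -- strict action: `1 ⊙ X = X` and `(r * s) ⊙ X = r ⊙ (s ⊙ X)`, naturally in all the arguments
  act_one : act.obj (op 1) = 𝟭 C
  act_mul (r s : R) : act.obj (op (r * s)) = act.obj (op s) ⋙ act.obj (op r)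
  act_mul_natural {r r' s s' : R} (h : r ≤ r') (k : s ≤ s') (X : C) :
    (act.map (homOfLE (mul_le_mul' h k)).op).app X ≫ (eqToHom (act_mul r s)).app X =
      (eqToHom (act_mul r' s')).app X ≫ (act.map (homOfLE h).op).app ((act.obj (op s')).obj X) ≫
        (act.obj (op r)).map ((act.map (homOfLE k).op).app X)
  -- symmetric lax monoidal in the second argument, naturally in the grade
  lax (r : R) : (act.obj (op r)).LaxBraided
  lax_natural {r s : R} (h : r ≤ s) :
    letI := lax r
    letI := lax s
    NatTrans.IsMonoidal (act.map (homOfLE h).op)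
  -- the monoidal structure is strict
  unit_eq (r : R) : (act.obj (op r)).obj (𝟙_ C) = 𝟙_ C
  ten_eq (r : R) (X Y : C) :
    (act.obj (op r)).obj (X ⊗ Y) = (act.obj (op r)).obj X ⊗ (act.obj (op r)).obj Y
  ε_eq (r : R) : letI := lax r
    Functor.LaxMonoidal.ε (act.obj (op r)) = eqToHom (unit_eq r).symm
  μ_eq (r : R) (X Y : C) : letI := lax r
    Functor.LaxMonoidal.μ (act.obj (op r)) X Y = eqToHom (ten_eq r X Y).symm
  -- symmetric colax monoidal in the first argument
  weak (X : C) : (act.obj (op 0)).obj X ⟶ 𝟙_ C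
  weak_natural {X Y : C} (f : X ⟶ Y) : (act.obj (op 0)).map f ≫ weak Y = weak X
  contr (r s : R) (X : C) :
    (act.obj (op (r + s))).obj X ⟶ (act.obj (op r)).obj X ⊗ (act.obj (op s)).obj X
  contr_natural (r s : R) {X Y : C} (f : X ⟶ Y) :
    (act.obj (op (r + s))).map f ≫ contr r s Y =
      contr r s X ≫ ((act.obj (op r)).map f ⊗ₘ (act.obj (op s)).map f)
  contr_natural_grade {r r' s s' : R} (h : r ≤ r') (k : s ≤ s') (X : C) :
    (act.map (homOfLE (add_le_add h k)).op).app X ≫ contr r s X =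
      contr r' s' X ≫ ((act.map (homOfLE h).op).app X ⊗ₘ (act.map (homOfLE k).op).app X)
  contr_weak_left (r : R) (X : C) :
    contr 0 r X ≫ weak X ▷ _ ≫ (λ_ _).hom = eqToHom (by rw [zero_add])
  contr_weak_right (r : R) (X : C) :
    contr r 0 X ≫ _ ◁ weak X ≫ (ρ_ _).hom = eqToHom (by rw [add_zero])
  contr_assoc (r s t : R) (X : C) :
    contr (r + s) t X ≫ contr r s X ▷ _ ≫ (α_ _ _ _).hom =
      eqToHom (by rw [add_assoc]) ≫ contr r (s + t) X ≫ _ ◁ contr s t X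
  contr_symm (r s : R) (X : C) :
    contr r s X = eqToHom (by rw [add_comm]) ≫ contr s r X ≫ (β_ _ _).hom
  -- compatibility of `weak` and `contr` with the strict action
  weak_mul_left (s : R) (X : C) :
    eqToHom (by rw [zero_mul]) ≫ (eqToHom (act_mul 0 s)).app X ≫ weak ((act.obj (op s)).obj X) =
      weak X
  weak_mul_right (s : R) (X : C) : letI := lax s
    eqToHom (by rw [mul_zero]) ≫ (eqToHom (act_mul s 0)).app X ≫ (act.obj (op s)).map (weak X) =
      weak X ≫ Functor.LaxMonoidal.ε (act.obj (op s))
  contr_mul_left (r s₁ s₂ : R) (X : C) : letI := lax r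
    eqToHom (by rw [mul_add]) ≫ contr (r * s₁) (r * s₂) X ≫
        ((eqToHom (act_mul r s₁)).app X ⊗ₘ (eqToHom (act_mul r s₂)).app X) ≫
        Functor.LaxMonoidal.μ (act.obj (op r)) _ _ =
      (eqToHom (act_mul r (s₁ + s₂))).app X ≫ (act.obj (op r)).map (contr s₁ s₂ X)
  contr_mul_right (s₁ s₂ r : R) (X : C) :
    eqToHom (by rw [add_mul]) ≫ contr (s₁ * r) (s₂ * r) X ≫
        ((eqToHom (act_mul s₁ r)).app X ⊗ₘ (eqToHom (act_mul s₂ r)).app X) =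
      (eqToHom (act_mul (s₁ + s₂) r)).app X ≫ contr s₁ s₂ ((act.obj (op r)).obj X)
  -- compatibility of `weak` and `contr` with the monoidal structure
  weak_unit : letI := lax 0
    Functor.LaxMonoidal.ε (act.obj (op 0)) ≫ weak (𝟙_ C) = 𝟙 _
  weak_ten (X Y : C) : letI := lax 0
    Functor.LaxMonoidal.μ (act.obj (op 0)) X Y ≫ weak (X ⊗ Y) =
      (weak X ⊗ₘ weak Y) ≫ (λ_ _).hom
  contr_unit (r s : R) : letI := lax (r + s); letI := lax r; letI := lax s
    Functor.LaxMonoidal.ε (act.obj (op (r + s))) ≫ contr r s (𝟙_ C) =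
      (λ_ _).inv ≫
        (Functor.LaxMonoidal.ε (act.obj (op r)) ⊗ₘ Functor.LaxMonoidal.ε (act.obj (op s)))
  contr_ten (r s : R) (X Y : C) : letI := lax (r + s); letI := lax r; letI := lax s
    Functor.LaxMonoidal.μ (act.obj (op (r + s))) X Y ≫ contr r s (X ⊗ Y) =
      (contr r s X ⊗ₘ contr r s Y) ≫ tensorμ _ _ _ _ ≫
        (Functor.LaxMonoidal.μ (act.obj (op r)) X Y ⊗ₘ
          Functor.LaxMonoidal.μ (act.obj (op s)) X Y)

attribute [instance] StrictExpAction.lax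

/-- A mixed graded/linear model: a symmetric monoidal adjunction `Mny ⊣ Lin` between a symmetric
monoidal category `C` and a symmetric monoidal closed category `M`, with a strict exponential
action on `C`. -/
structure MGLModel (C : Type v) [Category.{w} C] [MonoidalCategory C] [SymmetricCategory C]
    (M : Type v) [Category.{w} M] [MonoidalCategory M] [SymmetricCategory M] [MonoidalClosed M]
    extends StrictExpAction R C where
  Mny : C ⥤ M
  Lin : M ⥤ C
  laxMny : Mny.LaxBraided
  laxLin : Lin.LaxBraided
  adj : Mny ⊣ Lin
  unit_monoidal : NatTrans.IsMonoidal adj.unit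
  counit_monoidal : NatTrans.IsMonoidal adj.counit

attribute [instance] MGLModel.laxMny MGLModel.laxLin

end Models

/-! ### Interpretation -/

section Contexts

variable {C : Type v} [Category.{w} C] [MonoidalCategory C] {α : Type u} (f : α → C)

/-- The tensor product `f a₁ ⊗ (f a₂ ⊗ (⋯ ⊗ 𝟙))` of a list; the unit for the empty list. -/
def tens : List α → C
  | [] => 𝟙_ C
  | a :: L => f a ⊗ tens L

/-- The tensor product of a concatenation. -/
def split : ∀ L L' : List α, tens f (L ++ L') ≅ tens f L ⊗ tens f L'
  | [], L' => (λ_ (tens f L')).symm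
  | a :: L, L' => whiskerLeftIso (f a) (split L L') ≪≫ (α_ (f a) (tens f L) (tens f L')).symm

/-- `id ⊗ g ⊗ id`. -/
def inside {P Q : List α} (g : tens f P ⟶ tens f Q) :
    ∀ A D : List α, tens f (A ++ (P ++ D)) ⟶ tens f (A ++ (Q ++ D))
  | [], D => (split f P D).hom ≫ g ▷ tens f D ≫ (split f Q D).inv
  | a :: A, D => f a ◁ inside g A D

/-- The symmetry, exchanging two hypotheses. -/
def exch [BraidedCategory C] (a b : α) : tens f [b, a] ⟶ tens f [a, b] :=
  (α_ (f b) (f a) (𝟙_ C)).inv ≫ (β_ (f b) (f a)).hom ▷ 𝟙_ C ≫ (α_ (f a) (f b) (𝟙_ C)).hom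

/-- Given `g : Z ⊗ Γ₂ ⟶ B`, the morphism `Z ⊗ (Γ₁, Γ₂, Γ₃) ⟶ (Γ₁, B, Γ₃)`, moving `Z` past `Γ₁` by
the symmetry. -/
def plug [BraidedCategory C] {Z : C} {L₂ : List α} {b : α} (g : Z ⊗ tens f L₂ ⟶ f b)
    (L₃ : List α) : ∀ L₁ : List α, Z ⊗ tens f (L₁ ++ (L₂ ++ L₃)) ⟶ tens f (L₁ ++ b :: L₃)
  | [] => Z ◁ (split f L₂ L₃).hom ≫ (α_ Z (tens f L₂) (tens f L₃)).inv ≫ g ▷ tens f L₃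
  | a :: L₁ => (α_ Z (f a) _).inv ≫ (β_ Z (f a)).hom ▷ _ ≫ (α_ (f a) Z _).hom ≫
      f a ◁ plug g L₃ L₁

end Contexts

namespace MGLModel

open Functor.LaxMonoidal

variable {R : Type u} [Semiring R] [Preorder R] [AddLeftMono R] [MulLeftMono R] [MulRightMono R]
  {C : Type v} [Category.{w} C] [MonoidalCategory C] [SymmetricCategory C]
  {M : Type v} [Category.{w} M] [MonoidalCategory M] [SymmetricCategory M] [MonoidalClosed M]
  (𝓜 : MGLModel R C M)

/-- The functor `r ⊙ -`. -/
abbrev gr (r : R) : C ⥤ C := 𝓜.act.obj (op r)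

/-- `ε : 1 ⊙ X = X`. -/
def one (X : C) : (𝓜.gr 1).obj X ⟶ X := (eqToHom 𝓜.act_one).app X

/-- `δ : (r * s) ⊙ X = r ⊙ (s ⊙ X)`. -/
def mul (r s : R) (X : C) : (𝓜.gr (r * s)).obj X ⟶ (𝓜.gr r).obj ((𝓜.gr s).obj X) :=
  (eqToHom (𝓜.act_mul r s)).app X

/-- `n : r ⊙ J = J`. -/
def nUnit (r : R) : (𝓜.gr r).obj (𝟙_ C) ⟶ 𝟙_ C := eqToHom (𝓜.unit_eq r)

/-- `n : r ⊙ (X ⊠ Y) = (r ⊙ X) ⊠ (r ⊙ Y)`. -/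
def nTen (r : R) (X Y : C) : (𝓜.gr r).obj (X ⊗ Y) ⟶ (𝓜.gr r).obj X ⊗ (𝓜.gr r).obj Y :=
  eqToHom (𝓜.ten_eq r X Y)

/-- The colax structure of `Mny` induced by the adjunction. -/
def nMnyUnit : 𝓜.Mny.obj (𝟙_ C) ⟶ 𝟙_ M := 𝓜.Mny.map (ε 𝓜.Lin) ≫ 𝓜.adj.counit.app (𝟙_ M)

/-- The colax structure of `Mny` induced by the adjunction. -/
def nMnyTen (X Y : C) : 𝓜.Mny.obj (X ⊗ Y) ⟶ 𝓜.Mny.obj X ⊗ 𝓜.Mny.obj Y :=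
  𝓜.Mny.map (𝓜.adj.unit.app X ⊗ₘ 𝓜.adj.unit.app Y) ≫ 𝓜.Mny.map (μ 𝓜.Lin _ _) ≫
    𝓜.adj.counit.app (𝓜.Mny.obj X ⊗ 𝓜.Mny.obj Y)

mutual
/-- Interpretation of the graded types. -/
def gty : GTy R → C
  | .J => 𝟙_ C
  | .ten X Y => gty X ⊗ gty Y
  | .Lin A => 𝓜.Lin.obj (lty A)
/-- Interpretation of the linear types. -/
def lty : LTy R → M
  | .I => 𝟙_ M
  | .ten A B => lty A ⊗ lty B
  | .imp A B => (ihom (lty A)).obj (lty B)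
  | .Grd r X => 𝓜.Mny.obj ((𝓜.gr r).obj (gty X))
end

/-- `r ⊙ X`. -/
def ghyp (p : R × GTy R) : C := (𝓜.gr p.1).obj (𝓜.gty p.2)

/-- `Mny (r ⊙ X)`. -/
def mhyp (p : R × GTy R) : M := 𝓜.Mny.obj (𝓜.ghyp p)

/-- Graded contexts of the graded calculus. -/
abbrev gctx (Δ : GCtx R) : C := tens 𝓜.ghyp Δ

/-- Graded contexts of the mixed calculus. -/
abbrev mctx (Δ : GCtx R) : M := tens 𝓜.mhyp Δ

/-- Linear contexts. -/
abbrev lctx (Γ : List (LTy R)) : M := tens 𝓜.lty Γ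

/-- The action of `δ ≤ δ'`. -/
def gle : ∀ {Δ Δ' : GCtx R}, GLe Δ Δ' → (𝓜.gctx Δ' ⟶ 𝓜.gctx Δ)
  | _, _, .nil => 𝟙 _
  | _, _, .cons X h t => (𝓜.act.map (homOfLE h).op).app (𝓜.gty X) ⊗ₘ gle t

/-- The action of `δ ≤ δ'`, under `Mny`. -/
def mle : ∀ {Δ Δ' : GCtx R}, GLe Δ Δ' → (𝓜.mctx Δ' ⟶ 𝓜.mctx Δ)
  | _, _, .nil => 𝟙 _
  | _, _, .cons X h t => 𝓜.Mny.map ((𝓜.act.map (homOfLE h).op).app (𝓜.gty X)) ⊗ₘ mle t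

/-- `(r * δ) ⊙ Δ = r ⊙ (δ ⊙ Δ)`. -/
def prom (r : R) : ∀ Δ : GCtx R, 𝓜.gctx (scale r Δ) ⟶ (𝓜.gr r).obj (𝓜.gctx Δ)
  | [] => ε (𝓜.gr r)
  | p :: Δ => (𝓜.mul r p.1 (𝓜.gty p.2) ⊗ₘ prom r Δ) ≫ μ (𝓜.gr r) _ _

/-- The `n`-ary monoidal structure of `Mny`. -/
def mMny : ∀ Δ : GCtx R, 𝓜.mctx Δ ⟶ 𝓜.Mny.obj (𝓜.gctx Δ)
  | [] => ε 𝓜.Mny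
  | p :: Δ => 𝓜.mhyp p ◁ mMny Δ ≫ μ 𝓜.Mny _ _

/-- The units of the adjunction followed by the `n`-ary monoidal structure of `Lin`. -/
def mLin : ∀ Δ : GCtx R, 𝓜.gctx Δ ⟶ 𝓜.Lin.obj (𝓜.mctx Δ)
  | [] => ε 𝓜.Lin
  | p :: Δ => (𝓜.adj.unit.app (𝓜.ghyp p) ⊗ₘ mLin Δ) ≫ μ 𝓜.Lin _ _

/-- Interpretation of the linear steps. -/
def lstep : ∀ {P Q : List (LTy R)}, LStep P Q → (𝓜.lctx Q ⟶ 𝓜.lctx P)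
  | _, _, .unitL => (ρ_ (𝟙_ M)).hom
  | _, _, .tenL A B => (α_ (𝓜.lty A) (𝓜.lty B) (𝟙_ M)).hom
  | _, _, .ex A B => exch 𝓜.lty A B

mutual
/-- Interpretation of the derivations of graded sequents. -/
noncomputable def gs : ∀ {Δ : GCtx R} {X : GTy R}, GS Δ X → (𝓜.gctx Δ ⟶ 𝓜.gty X)
  | _, _, .id X => (ρ_ _).hom ≫ 𝓜.one (𝓜.gty X)
  | _, _, .sub h π => 𝓜.gle h ≫ gs π
  | _, _, .unitR => 𝟙 (𝟙_ C)
  | _, _, .tenR (Δ₁ := Δ₁) (Δ₂ := Δ₂) π₁ π₂ =>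
      (split 𝓜.ghyp Δ₁ Δ₂).hom ≫ (gs π₁ ⊗ₘ gs π₂)
  | _, _, .linR (Δ := Δ) π => 𝓜.mLin Δ ≫ 𝓜.Lin.map ((ρ_ _).inv ≫ ms π)
  | _, _, .gleft A D ρ π => inside 𝓜.ghyp (gstep ρ) A D ≫ gs π
/-- Interpretation of the graded steps in the graded calculus. -/
noncomputable def gstep : ∀ {P Q : GCtx R}, GStep P Q → (𝓜.gctx Q ⟶ 𝓜.gctx P)
  | _, _, .unitL r => (ρ_ _).hom ≫ 𝓜.nUnit r
  | _, _, .tenL r X Y => 𝓜.nTen r (𝓜.gty X) (𝓜.gty Y) ▷ 𝟙_ C ≫ (α_ _ _ _).hom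
  | _, _, .weak X => (ρ_ _).hom ≫ 𝓜.weak (𝓜.gty X)
  | _, _, .cont r s X => 𝓜.contr r s (𝓜.gty X) ▷ 𝟙_ C ≫ (α_ _ _ _).hom
  | _, _, .ex p q => exch 𝓜.ghyp p q
  | _, _, .cut r (Δ := Δ) Θ => 𝓜.prom r Δ ≫ (𝓜.gr r).map (gs Θ) ≫ (ρ_ _).inv
/-- Interpretation of the graded steps in the mixed calculus. -/
noncomputable def mstep : ∀ {P Q : GCtx R}, GStep P Q → (𝓜.mctx Q ⟶ 𝓜.mctx P)
  | _, _, .unitL r => (ρ_ _).hom ≫ 𝓜.Mny.map (𝓜.nUnit r) ≫ 𝓜.nMnyUnit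
  | _, _, .tenL r X Y =>
      (𝓜.Mny.map (𝓜.nTen r (𝓜.gty X) (𝓜.gty Y)) ≫ 𝓜.nMnyTen _ _) ▷ 𝟙_ M ≫ (α_ _ _ _).hom
  | _, _, .weak X => (ρ_ _).hom ≫ 𝓜.Mny.map (𝓜.weak (𝓜.gty X)) ≫ 𝓜.nMnyUnit
  | _, _, .cont r s X =>
      (𝓜.Mny.map (𝓜.contr r s (𝓜.gty X)) ≫ 𝓜.nMnyTen _ _) ▷ 𝟙_ M ≫ (α_ _ _ _).hom
  | _, _, .ex p q => exch 𝓜.mhyp p q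
  | _, _, .cut r (Δ := Δ) Θ =>
      𝓜.mMny (scale r Δ) ≫ 𝓜.Mny.map (𝓜.prom r Δ ≫ (𝓜.gr r).map (gs Θ)) ≫ (ρ_ _).inv
/-- Interpretation of the derivations of mixed sequents. -/
noncomputable def ms : ∀ {Δ : GCtx R} {Γ : List (LTy R)} {A : LTy R}, MS Δ Γ A →
    (𝓜.mctx Δ ⊗ 𝓜.lctx Γ ⟶ 𝓜.lty A)
  | _, _, _, .id A => (λ_ _).hom ≫ (ρ_ _).hom
  | _, Γ, _, .sub h π => 𝓜.mle h ▷ 𝓜.lctx Γ ≫ ms π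
  | _, Γ, _, .gleft A D ρ π => inside 𝓜.mhyp (mstep ρ) A D ▷ 𝓜.lctx Γ ≫ ms π
  | Δ, _, _, .lleft Γ₁ Γ₃ κ π => 𝓜.mctx Δ ◁ inside 𝓜.lty (𝓜.lstep κ) Γ₁ Γ₃ ≫ ms π
  | _, _, _, .unitR => (λ_ (𝟙_ M)).hom
  | _, _, _, .tenR (Δ₁ := Δ₁) (Δ₂ := Δ₂) (Γ₁ := Γ₁) (Γ₂ := Γ₂) π₁ π₂ =>
      ((split 𝓜.mhyp Δ₁ Δ₂).hom ⊗ₘ (split 𝓜.lty Γ₁ Γ₂).hom) ≫ tensorμ _ _ _ _ ≫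
        (ms π₁ ⊗ₘ ms π₂)
  | Δ, Γ, _, .impR (A := A) π =>
      MonoidalClosed.curry ((β_ (𝓜.lty A) (𝓜.mctx Δ ⊗ 𝓜.lctx Γ)).hom ≫ (α_ _ _ _).hom ≫
        𝓜.mctx Δ ◁ (𝓜.lctx Γ ◁ (ρ_ (𝓜.lty A)).inv ≫ (split 𝓜.lty Γ [A]).inv) ≫ ms π)
  | _, _, _, .impL Γ₁ Γ₃ (Δ₁ := Δ₁) (Δ₂ := Δ₂) (Γ₂ := Γ₂) (A := A) (B := B) π₂ π₁ =>
      (split 𝓜.mhyp Δ₁ Δ₂).hom ▷ _ ≫ (α_ _ _ _).hom ≫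
        𝓜.mctx Δ₁ ◁ plug 𝓜.lty (L₂ := .imp A B :: Γ₂) (b := B)
          ((α_ (𝓜.mctx Δ₂) (𝓜.lty (.imp A B)) (𝓜.lctx Γ₂)).inv ≫
            (β_ (𝓜.mctx Δ₂) (𝓜.lty (.imp A B))).hom ▷ 𝓜.lctx Γ₂ ≫ (α_ _ _ _).hom ≫
            𝓜.lty (.imp A B) ◁ ms π₂ ≫ (β_ (𝓜.lty (.imp A B)) (𝓜.lty A)).hom ≫
            (ihom.ev (𝓜.lty A)).app (𝓜.lty B)) Γ₃ Γ₁ ≫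
        ms π₁
  | _, _, _, .grdR r (Δ := Δ) Θ =>
      (ρ_ _).hom ≫ 𝓜.mMny (scale r Δ) ≫ 𝓜.Mny.map (𝓜.prom r Δ ≫ (𝓜.gr r).map (gs Θ))
  | Δ, _, _, .grdL (Γ := Γ) (r := r) (X := X) π =>
      (α_ (𝓜.mctx Δ) (𝓜.mhyp (r, X)) (𝓜.lctx Γ)).inv ≫
        (𝓜.mctx Δ ◁ (ρ_ _).inv ≫ (split 𝓜.mhyp Δ [(r, X)]).inv) ▷ 𝓜.lctx Γ ≫ ms π
  | _, Γ, _, .linL (Δ := Δ) (A := A) π =>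
      ((split 𝓜.mhyp Δ [(1, .Lin A)]).hom ≫ 𝓜.mctx Δ ◁ ((ρ_ _).hom ≫
        𝓜.Mny.map (𝓜.one (𝓜.Lin.obj (𝓜.lty A))) ≫ 𝓜.adj.counit.app (𝓜.lty A))) ▷ 𝓜.lctx Γ ≫
        (α_ _ _ _).hom ≫ ms π
  | _, _, _, .cut Γ₁ Γ₃ (Δ₁ := Δ₁) (Δ₂ := Δ₂) (A := A) π₁ π₂ =>
      (split 𝓜.mhyp Δ₁ Δ₂).hom ▷ _ ≫ (α_ _ _ _).hom ≫
        𝓜.mctx Δ₁ ◁ plug 𝓜.lty (b := A) (ms π₁) Γ₃ Γ₁ ≫ ms π₂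
end

end MGLModel

end MGL

-- Soundness is a simultaneous induction on the two equational theories. The congruence cases are
-- immediate, so the work lies in checking each generating equation in the model. Most of an
-- equation is bookkeeping: iterated tensor products of hypotheses, associators, symmetries, and
-- lists that are equal but not identical. The proof separates this bookkeeping from the few places
-- where the axioms of a model are used.
--
-- Lists. Tensor products of lists, with concatenation of morphisms `ten`, identifications `lc` and
-- block symmetries `br`, behave like a strict symmetric monoidal category because of `split_assoc`
-- and the hexagons for `br`. Equations between them come down to interchange (`ten_exchange`),
-- naturality of the symmetry (`ten_br`) and its involutivity. Derived rules such as block exchange,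
-- contraction of a block and multicut then become a single morphism acting on the block concerned
-- (`sem_swapBlocks`, `sem_contBlock`, `sem_mcut`).
--
-- Graded contexts. A cut of grade r applies the functor r ⊙ -. Since the action is strict, the
-- comparison `prom` between a scaled context and r ⊙ (the context) is an identity along an equality
-- of objects (`prom_eq`), and r ⊙ - sends each graded rule to the same rule with multiplied grades
-- (`prom_gstep`). This yields all conversions in the left premise of a graded cut. Cuts against
-- weakening and contraction use naturality of `weak` and `contr`, and their monoidality: on a whole
-- context they are weakening and contraction hypothesis by hypothesis (`prom_weak`, `prom_contr`).
-- All equations that concern only graded contexts are collected in `ax_sound`, for an arbitrary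
-- presheaf on the category C.
--
-- Passage to M. In a symmetric monoidal adjunction the left adjoint is strong monoidal: the colax
-- structure of `Mny` induced by the adjunction is inverse to its lax structure. Hence `mMny`
-- identifies a mixed graded context with the image of the graded one, and every graded step of the
-- mixed calculus is the image under `Mny` of the step in C (`lift_gstep`). The equations of
-- `ax_sound` therefore hold in the mixed calculus without a second proof (`ms_ax`), and other facts
-- about mixed steps are checked in C by `lift_unique`.
--
-- Mixed sequents. Graded and linear hypotheses are put into one list, which loses no information
-- (`bend_injective`). There left and structural rules are boxes acting on one block (`boxM`) and a
-- linear cut is `cutM`. The right rule of the tensor is two cuts into a pairing, the left rule of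
-- the implication contains a cut into evaluation, and derivations of an implication are compared
-- after evaluation (`ms_imp_ext`). Commuting conversions thus reduce to associativity of cuts
-- (`cutM_cutM`), commutation of independent cuts (`cutM_comm`) and sliding boxes through cuts.
-- Principal cuts and expansions of identities hold because the morphisms of corresponding left and
-- right rules are mutually inverse (tensor, unit, Grd), by a triangle identity (Lin), or by
-- currying and evaluation (implication).

universe w'
set_option linter.unusedSimpArgs false
set_option linter.unusedSectionVars false

namespace MGL

-- Concatenation of morphisms between tensor products of lists

section Lists

variable {C : Type v} [Category.{w} C] [MonoidalCategory C] {α : Type u} (f : α → C)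

/-- The identification of the tensor products of two equal lists. -/
def lc {L L' : List α} (h : L = L') : tens f L ⟶ tens f L' := eqToHom (congrArg (tens f) h)

@[simp] theorem lc_self {L : List α} (h : L = L) : lc f h = 𝟙 (tens f L) := rfl

@[simp] theorem lc_lc {L L' L'' : List α} (h : L = L') (h' : L' = L'') :
    lc f h ≫ lc f h' = lc f (h.trans h') := by subst h h'; simp

@[simp] theorem lc_lc_assoc {L L' L'' : List α} (h : L = L') (h' : L' = L'') {Z : C}
    (k : tens f L'' ⟶ Z) : lc f h ≫ lc f h' ≫ k = lc f (h.trans h') ≫ k := by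
  rw [← Category.assoc, lc_lc]

theorem lc_cons {L L' : List α} {a a' : α} (h : a :: L = a' :: L') :
    lc f h = (eqToHom (by simp_all) : f a ⟶ f a') ⊗ₘ lc f (by simp_all : L = L') := by
  obtain ⟨rfl, rfl⟩ := List.cons.inj h
  simp [tens]

theorem lc_cons_self {L L' : List α} {a : α} (h : a :: L = a :: L') :
    lc f h = f a ◁ lc f (by simp_all : L = L') := by
  have h' : L = L' := by simp_all
  subst h'; simp [tens]

theorem split_nil (L : List α) : split f [] L = (λ_ (tens f L)).symm := rfl

theorem split_cons (a : α) (L L' : List α) : split f (a :: L) L' =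
    whiskerLeftIso (f a) (split f L L') ≪≫ (α_ (f a) (tens f L) (tens f L')).symm := rfl

theorem split_lc {A A' B B' : List α} (h : A = A') (h' : B = B') :
    (split f A B).hom ≫ (lc f h ⊗ₘ lc f h') =
      lc f (by rw [h, h']) ≫ (split f A' B').hom := by
  subst h h'; simp

/-- Induction on the first list, with the coherence of the associator in the cons case. Together
with `split_nil_right` this makes concatenation of morphisms associative and unital up to `lc`. -/
theorem split_assoc (A B D : List α) : (split f (A ++ B) D).hom ≫ (split f A B).hom ▷ tens f D ≫
    (α_ _ _ _).hom = lc f (List.append_assoc A B D) ≫ (split f A (B ++ D)).hom ≫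
      tens f A ◁ (split f B D).hom := by
  induction A with
  | nil => simp [split_nil, tens]
  | cons a A ih =>
    have ih' : (split f A B).hom ▷ tens f D = (split f (A ++ B) D).inv ≫
      (lc f (List.append_assoc A B D) ≫ (split f A (B ++ D)).hom ≫
      tens f A ◁ (split f B D).hom) ≫ (α_ _ _ _).inv := by
      rw [← ih]; simp
    rw [lc_cons_self]
    simp only [List.cons_append, split_cons, Iso.trans_hom, whiskerLeftIso_hom, Iso.symm_hom,
      tens, Category.assoc, comp_whiskerRight, whisker_assoc]
    rw [ih']
    simp only [MonoidalCategory.whiskerLeft_comp, Category.assoc]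
    simp

theorem split_assoc_assoc (A B D : List α) {Z : C} (k : tens f A ⊗ tens f B ⊗ tens f D ⟶ Z) :
    (split f (A ++ B) D).hom ≫ (split f A B).hom ▷ tens f D ≫ (α_ _ _ _).hom ≫ k =
      lc f (List.append_assoc A B D) ≫ (split f A (B ++ D)).hom ≫
        tens f A ◁ (split f B D).hom ≫ k := by
  have := split_assoc f A B D =≫ k
  simpa only [Category.assoc] using this

theorem split_nil_right (L : List α) :
    (split f L []).hom = lc f (List.append_nil L) ≫ (ρ_ _).inv := by
  induction L with
  | nil => simp [split_nil, tens, unitors_inv_equal]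
  | cons a L ih =>
    simp only [split_cons, Iso.trans_hom, whiskerLeftIso_hom, ih, Iso.symm_hom]
    rw [lc_cons_self]
    simp [tens]

/-- The tensor product of morphisms between tensor products of lists. -/
def ten {P P' Q Q' : List α} (g : tens f P ⟶ tens f Q) (h : tens f P' ⟶ tens f Q') :
    tens f (P ++ P') ⟶ tens f (Q ++ Q') :=
  (split f P P').hom ≫ (g ⊗ₘ h) ≫ (split f Q Q').inv

variable {f}

theorem ten_split {P P' Q Q' : List α} (g : tens f P ⟶ tens f Q) (h : tens f P' ⟶ tens f Q') :
    ten f g h ≫ (split f Q Q').hom = (split f P P').hom ≫ (g ⊗ₘ h) := by simp [ten]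

theorem ten_split_assoc {P P' Q Q' : List α} (g : tens f P ⟶ tens f Q)
    (h : tens f P' ⟶ tens f Q') {Z : C} (k : tens f Q ⊗ tens f Q' ⟶ Z) :
    ten f g h ≫ (split f Q Q').hom ≫ k = (split f P P').hom ≫ (g ⊗ₘ h) ≫ k := by simp [ten]

theorem ten_comp {P P' Q Q' S S' : List α} (g : tens f P ⟶ tens f Q) (h : tens f P' ⟶ tens f Q')
    (g' : tens f Q ⟶ tens f S) (h' : tens f Q' ⟶ tens f S') :
    ten f g h ≫ ten f g' h' = ten f (g ≫ g') (h ≫ h') := by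
  simp [ten, MonoidalCategory.tensorHom_comp_tensorHom_assoc]

theorem ten_comp_assoc {P P' Q Q' S S' : List α} (g : tens f P ⟶ tens f Q)
    (h : tens f P' ⟶ tens f Q') (g' : tens f Q ⟶ tens f S) (h' : tens f Q' ⟶ tens f S')
    {Z : C} (k : tens f (S ++ S') ⟶ Z) :
    ten f g h ≫ ten f g' h' ≫ k = ten f (g ≫ g') (h ≫ h') ≫ k := by
  rw [← ten_comp, Category.assoc]

theorem ten_lc {P P' Q Q' : List α} (h : P = Q) (h' : P' = Q') :
    ten f (lc f h) (lc f h') = lc f (by rw [h, h']) := by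
  subst h h'; simp [ten]

@[simp] theorem ten_id_lc {P P' Q' : List α} (h' : P' = Q') :
    ten f (𝟙 (tens f P)) (lc f h') = lc f (by rw [h']) := ten_lc rfl h'

@[simp] theorem ten_lc_id {P P' Q : List α} (h : P = Q) :
    ten f (lc f h) (𝟙 (tens f P')) = lc f (by rw [h]) := ten_lc h rfl

@[simp] theorem id_ten_comp {P Q S : List α} (A : List α) (g : tens f P ⟶ tens f Q)
    (h : tens f Q ⟶ tens f S) : ten f (𝟙 (tens f A)) (g ≫ h) =
      ten f (𝟙 (tens f A)) g ≫ ten f (𝟙 (tens f A)) h := by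
  rw [ten_comp, Category.comp_id]

@[simp] theorem comp_ten_id {P Q S : List α} (A : List α) (g : tens f P ⟶ tens f Q)
    (h : tens f Q ⟶ tens f S) : ten f (g ≫ h) (𝟙 (tens f A)) =
      ten f g (𝟙 (tens f A)) ≫ ten f h (𝟙 (tens f A)) := by
  rw [ten_comp, Category.comp_id]

theorem ten_eq {P P' Q Q' : List α} (g : tens f P ⟶ tens f Q) (h : tens f P' ⟶ tens f Q') :
    ten f g h = ten f g (𝟙 (tens f P')) ≫ ten f (𝟙 (tens f Q)) h := by
  rw [ten_comp, Category.comp_id, Category.id_comp]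

/-- Interchange: actions on disjoint blocks commute. With naturality of `br`, this drives the
commuting conversions. -/
theorem ten_exchange {P P' Q Q' : List α} (g : tens f P ⟶ tens f Q) (h : tens f P' ⟶ tens f Q') :
    ten f g (𝟙 (tens f P')) ≫ ten f (𝟙 (tens f Q)) h =
      ten f (𝟙 (tens f P)) h ≫ ten f g (𝟙 (tens f Q')) := by
  rw [ten_comp, ten_comp, Category.comp_id, Category.id_comp, Category.comp_id, Category.id_comp]

theorem id_append (P Q : List α) : 𝟙 (tens f (P ++ Q)) = ten f (𝟙 (tens f P)) (𝟙 (tens f Q)) := by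
  simp [ten]

@[simp] theorem nil_ten {P Q : List α} (g : tens f P ⟶ tens f Q) :
    ten f (𝟙 (tens f [])) g = g := by
  simp [ten, split_nil, tens]

@[simp] theorem ten_id (P Q : List α) :
    ten f (𝟙 (tens f P)) (𝟙 (tens f Q)) = 𝟙 (tens f (P ++ Q)) := (id_append P Q).symm

theorem cons_ten {P Q A : List α} (a : α) (g : tens f P ⟶ tens f Q) :
    ten f (𝟙 (tens f (a :: A))) g = f a ◁ ten f (𝟙 (tens f A)) g := by
  simp [ten, split_cons, tens, ← MonoidalCategory.whiskerLeft_comp]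

theorem split_nil_right_inv (L : List α) :
    (split f L []).inv = (ρ_ _).hom ≫ lc f (List.append_nil L).symm := by
  have h : split f L [] = eqToIso (congrArg (tens f) (List.append_nil L)) ≪≫ (ρ_ _).symm :=
    Iso.ext (split_nil_right f L)
  rw [h]
  rfl

@[simp] theorem ten_nil {P Q : List α} (g : tens f P ⟶ tens f Q) :
    ten f g (𝟙 (tens f [])) = lc f (by simp) ≫ g ≫ lc f (by simp) := by
  rw [ten, split_nil_right, split_nil_right_inv]
  dsimp only [tens]
  simp

-- Oriented towards right-nested concatenations: as a rewriting rule it pushes the casts between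
-- consecutive factors, where they fuse, so that composites of boxes acquire comparable normal
-- forms.
@[simp] theorem ten_assoc {P P' P'' Q Q' Q'' : List α} (g : tens f P ⟶ tens f Q)
    (h : tens f P' ⟶ tens f Q') (k : tens f P'' ⟶ tens f Q'') :
    ten f (ten f g h) k = lc f (List.append_assoc _ _ _) ≫ ten f g (ten f h k) ≫
      lc f (List.append_assoc _ _ _).symm := by
  have e1 := split_assoc f P P' P''
  have e2 := split_assoc f Q Q' Q''
  -- Splitting the target completely makes both sides a complete splitting of the source followed by
  -- g, h and k in parallel; the two splittings agree by `split_assoc`.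
  rw [← cancel_mono ((split f (Q ++ Q') Q'').hom ≫ (split f Q Q').hom ▷ tens f Q'' ≫
    (α_ _ _ _).hom)]
  conv_rhs => rw [e2]
  simp only [ten, Category.assoc, Iso.inv_hom_id_assoc, lc_lc_assoc, lc_self, Category.id_comp,
    MonoidalCategory.tensorHom_def, comp_whiskerRight, MonoidalCategory.whiskerLeft_comp]
  simp only [← MonoidalCategory.whiskerLeft_comp, Iso.inv_hom_id, Category.comp_id]
  simp only [MonoidalCategory.whiskerLeft_comp]
  rw [MonoidalCategory.whisker_exchange_assoc, inv_hom_whiskerRight_assoc,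
    ← MonoidalCategory.whisker_exchange_assoc]
  conv_rhs => rw [← MonoidalCategory.whisker_exchange_assoc, ← split_assoc_assoc]
  simp only [associator_naturality_right_assoc,
    associator_naturality_left_assoc, associator_naturality_middle]
  simp [← MonoidalCategory.whiskerLeft_comp, MonoidalCategory.whisker_exchange]

@[simp] theorem append_id_ten {P Q : List α} (A B : List α) (g : tens f P ⟶ tens f Q) :
    ten f (𝟙 (tens f (A ++ B))) g = lc f (List.append_assoc _ _ _) ≫
      ten f (𝟙 (tens f A)) (ten f (𝟙 (tens f B)) g) ≫ lc f (List.append_assoc _ _ _).symm := by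
  rw [← ten_id, ten_assoc]

theorem ten_id_congr {P Q D D' : List α} (g : tens f P ⟶ tens f Q) (h : D = D') :
    ten f g (𝟙 (tens f D)) = lc f (by rw [h]) ≫ ten f g (𝟙 (tens f D')) ≫ lc f (by rw [h]) := by
  subst h; simp

theorem id_ten_congr {P Q D D' : List α} (g : tens f P ⟶ tens f Q) (h : D = D') :
    ten f (𝟙 (tens f D)) g = lc f (by rw [h]) ≫ ten f (𝟙 (tens f D')) g ≫ lc f (by rw [h]) := by
  subst h; simp

-- An instance of `ten_id_congr` that can serve as a rewriting rule: it right-nests the idle block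
-- behind a box.
@[simp] theorem ten_append_append {P Q : List α} (g : tens f P ⟶ tens f Q) (A B D : List α) :
    ten f g (𝟙 (tens f ((A ++ B) ++ D))) = lc f (by simp) ≫
      ten f g (𝟙 (tens f (A ++ (B ++ D)))) ≫ lc f (by simp) :=
  ten_id_congr g (List.append_assoc _ _ _)

/-- Brings the recursively defined whiskering of the interpretation into the calculus of `ten`. -/
theorem inside_eq {P Q : List α} (g : tens f P ⟶ tens f Q) (A D : List α) :
    inside f g A D = ten f (𝟙 (tens f A)) (ten f g (𝟙 (tens f D))) := by
  induction A with
  | nil => rw [nil_ten]; simp [inside, ten]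
  | cons a A ih => rw [cons_ten, ← ih]; rfl

end Lists

-- Block symmetries

section Braid

variable {C : Type v} [Category.{w} C] [MonoidalCategory C] [SymmetricCategory C] {α : Type u}
  (f : α → C)

/-- The symmetry on tensor products of lists. -/
def br (P Q : List α) : tens f (P ++ Q) ⟶ tens f (Q ++ P) :=
  (split f P Q).hom ≫ (β_ _ _).hom ≫ (split f Q P).inv

variable {f}

theorem ten_br {P P' Q Q' : List α} (g : tens f P ⟶ tens f Q) (h : tens f P' ⟶ tens f Q') :
    ten f g h ≫ br f Q Q' = br f P P' ≫ ten f h g := by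
  simp [ten, br]

@[simp]
theorem br_br (P Q : List α) : br f P Q ≫ br f Q P = 𝟙 _ := by simp [br]

instance (P Q : List α) : IsIso (br f P Q) := ⟨br f Q P, br_br P Q, br_br Q P⟩

theorem br_nil_left (P : List α) : br f [] P = lc f (by simp) := by
  rw [br, split_nil_right_inv, split_nil]
  dsimp only [tens, List.nil_append]
  simp

theorem br_nil_right (P : List α) : br f P [] = lc f (by simp) := by
  rw [br, split_nil_right, split_nil]
  dsimp only [tens, List.nil_append]
  simp

/-- The hexagon for blocks. The auxiliary equations rewrite every twofold splitting of a threefold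
concatenation by `split_assoc`; what is left is the hexagon of the symmetry of the category. -/
theorem br_append_left (A B D : List α) : br f (A ++ B) D =
    lc f (List.append_assoc _ _ _) ≫ ten f (𝟙 _) (br f B D) ≫
      lc f (List.append_assoc _ _ _).symm ≫ ten f (br f A D) (𝟙 _) ≫ lc f (by simp) := by
  have e1 := split_assoc f A B D
  have e2 := split_assoc f A D B
  have e3 := split_assoc f D A B
  have e2' : lc f (List.append_assoc _ _ _).symm ≫ (split f (A ++ D) B).hom ≫
      (split f A D).hom ▷ tens f B ≫ (α_ _ _ _).hom =
      (split f A (D ++ B)).hom ≫ tens f A ◁ (split f D B).hom := by rw [e2]; simp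
  have e3' : (split f (D ++ A) B).inv ≫ lc f (by simp) = (split f D A).hom ▷ tens f B ≫
    (α_ _ _ _).hom ≫ tens f D ◁ (split f A B).inv ≫ (split f D (A ++ B)).inv := by
    rw [Iso.inv_comp_eq, reassoc_of% e3]
    simp [← MonoidalCategory.whiskerLeft_comp_assoc]
  have e1' : (split f (A ++ B) D).hom = lc f (List.append_assoc A B D) ≫
      (split f A (B ++ D)).hom ≫ tens f A ◁ (split f B D).hom ≫ (α_ _ _ _).inv ≫
        (split f A B).inv ▷ tens f D := by
    rw [← reassoc_of% e1]; simp
  have e2'' : tens f A ◁ (split f D B).inv ≫ (split f A (D ++ B)).inv ≫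
      lc f (List.append_assoc _ _ _).symm ≫ (split f (A ++ D) B).hom =
      (α_ _ _ _).inv ≫ (split f A D).inv ▷ tens f B := by
    rw [← cancel_mono ((split f A D).hom ▷ tens f B ≫ (α_ _ _ _).hom)]
    simp only [Category.assoc, e2']
    simp
  simp only [br, ten, Category.assoc, e3', e1']
  simp only [MonoidalCategory.tensorHom_def, id_whiskerRight, Category.id_comp,
    MonoidalCategory.whiskerLeft_id, Category.comp_id, MonoidalCategory.whiskerLeft_comp,
    Category.assoc]
  rw [reassoc_of% e2'']
  simp only [BraidedCategory.braiding_naturality_left_assoc, comp_whiskerRight, Category.assoc,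
    BraidedCategory.braiding_tensor_left_hom, inv_hom_whiskerRight_assoc, Iso.inv_hom_id_assoc]

/-- The second hexagon comes from the first by symmetry: both sides are inverse to `br f (B ++ D)
A`. -/
theorem br_append_right (A B D : List α) : br f A (B ++ D) =
    lc f (List.append_assoc _ _ _).symm ≫ ten f (br f A B) (𝟙 _) ≫
      lc f (List.append_assoc _ _ _) ≫ ten f (𝟙 _) (br f A D) ≫ lc f (by simp) := by
  rw [← cancel_mono (br f (B ++ D) A), br_br, br_append_left]
  simp [ten_comp_assoc, ten_comp]

/-- `exch` lists its arguments in the order of its target, the premise of the exchange rule, and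
`br` in the order of its source; hence the reversal. -/
theorem exch_eq (a b : α) : exch f a b = br f [b] [a] := by
  have h : (β_ (f b ⊗ 𝟙_ C) (f a ⊗ 𝟙_ C)).hom = ((ρ_ (f b)).hom ⊗ₘ (ρ_ (f a)).hom) ≫
      (β_ (f b) (f a)).hom ≫ ((ρ_ (f a)).inv ⊗ₘ (ρ_ (f b)).inv) := by
    rw [BraidedCategory.braiding_naturality_assoc, MonoidalCategory.tensorHom_comp_tensorHom,
      Iso.hom_inv_id, Iso.hom_inv_id, MonoidalCategory.id_tensorHom_id, Category.comp_id]
  dsimp [exch, br, split, tens]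
  rw [h]
  simp only [MonoidalCategory.tensorHom_def, whiskerLeftIso_hom, whiskerLeftIso_inv, Iso.symm_hom,
    Iso.symm_inv]
  monoidal

end Braid

-- Interpretations valued in a presheaf, and exchange of blocks

/-- A presheaf: a family of types on which the morphisms of a category act contravariantly. -/
structure Psh (C : Type v) [Category.{w} C] where
  obj : C → Type w'
  res {X Y : C} : (X ⟶ Y) → obj Y → obj X
  res_id {X : C} (x : obj X) : res (𝟙 X) x = x
  res_comp {X Y Z : C} (f : X ⟶ Y) (g : Y ⟶ Z) (x : obj Z) : res (f ≫ g) x = res f (res g x)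

section Swap

variable {C : Type v} [Category.{w} C] [MonoidalCategory C] [SymmetricCategory C] {α : Type u}
  {f : α → C}

theorem br_cons (q : α) (Q D : List α) : br f (q :: Q) D =
    lc f (by simp : (q :: Q) ++ D = [q] ++ (Q ++ D)) ≫ ten f (𝟙 (tens f [q])) (br f Q D) ≫
      lc f (by simp) ≫ ten f (br f [q] D) (𝟙 (tens f Q)) ≫ lc f (by simp) :=
  br_append_left [q] Q D

theorem br_cons_right (p : α) (Q P : List α) : br f Q (p :: P) =
    lc f (by simp) ≫ ten f (br f Q [p]) (𝟙 (tens f P)) ≫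
      lc f (List.append_assoc _ _ _) ≫ ten f (𝟙 (tens f [p])) (br f Q P) ≫ lc f (by simp) :=
  br_append_right Q [p] P

variable (H : Psh.{v, w, w'} C) {F : List α → Type u}
    (sem : ∀ {L : List α}, F L → H.obj (tens f L))

/-- Derivations are interpreted in an arbitrary presheaf so that one computation of the derived
rules serves graded derivations, the graded context of mixed derivations and their linear context.
-/
theorem sem_cast {L L' : List α} (h : L = L') (π : F L) :
    sem (h ▸ π) = H.res (lc f h.symm) (sem π) := by
  subst h; simp [H.res_id]

variable {ex : ∀ (A D : List α) (p q : α), F (A ++ (p :: q :: D)) → F (A ++ (q :: p :: D))}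

/-- Interpretation is contravariant: from the premise `p, Q` to the conclusion `Q, p` one restricts
along the symmetry whose source is `Q, p`. Each exchange contributes one factor of the hexagon for
`br`. -/
theorem sem_movePast
    (hex : ∀ (A D : List α) (p q : α) (π : F (A ++ (p :: q :: D))),
      sem (ex A D p q π) = H.res (inside f (exch f p q) A D) (sem π))
    (p : α) (A Q D : List α) (π : F (A ++ (p :: (Q ++ D)))) :
    sem (movePast ex p A Q D π) = H.res (ten f (𝟙 (tens f A))
      (lc f (by simp) ≫ ten f (br f Q [p]) (𝟙 (tens f D)) ≫ lc f (by simp))) (sem π) := by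
  induction Q generalizing A with
  | nil =>
    simp [movePast, br_nil_left, H.res_id]
  | cons q Q ih =>
    rw [movePast, sem_cast H sem, ih, sem_cast H sem, hex, ← H.res_comp, ← H.res_comp, ← H.res_comp,
      inside_eq, exch_eq, br_cons q Q]
    congr 1
    simp

theorem sem_swapBlocks
    (hex : ∀ (A D : List α) (p q : α) (π : F (A ++ (p :: q :: D))),
      sem (ex A D p q π) = H.res (inside f (exch f p q) A D) (sem π))
    (A P Q D : List α) (π : F (A ++ (P ++ (Q ++ D)))) :
    sem (swapBlocks ex A P Q D π) = H.res (ten f (𝟙 (tens f A))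
      (lc f (by simp) ≫ ten f (br f Q P) (𝟙 (tens f D)) ≫ lc f (by simp))) (sem π) := by
  induction P generalizing A with
  | nil =>
    simp [swapBlocks, br_nil_right, H.res_id]
  | cons p P ih =>
    rw [swapBlocks, sem_movePast H sem hex, sem_cast H sem, ih, sem_cast H sem, ← H.res_comp, ← H.res_comp, ← H.res_comp,
      br_cons_right p Q P]
    congr 1
    simp
end Swap

-- Blockwise weakening, contraction and multicut

section Blocks

variable {R : Type u} [Semiring R] [Preorder R]
  {C : Type v} [Category.{w} C] [MonoidalCategory C] [SymmetricCategory C]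
  {f : R × GTy R → C} (st : ∀ {P Q : GCtx R}, GStep P Q → (tens f Q ⟶ tens f P))

/-- The morphism interpreting `weakBlock`. -/
def weakMor : ∀ Δ : GCtx R, tens f (scale 0 Δ) ⟶ tens f []
  | [] => 𝟙 _
  | p :: Δ => lc f (by simp [scale] : scale 0 (p :: Δ) = [(0, p.2)] ++ scale 0 Δ) ≫
      ten f (st (.weak p.2)) (𝟙 (tens f (scale 0 Δ))) ≫ ten f (𝟙 (tens f [])) (weakMor Δ)

/-- The morphism interpreting `contBlock`. -/
def contMor (r s : R) : ∀ Δ : GCtx R, tens f (scale (r + s) Δ) ⟶ tens f (scale r Δ ++ scale s Δ)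
  | [] => 𝟙 _
  | p :: Δ =>
      lc f (by simp [scale, add_mul] :
        scale (r + s) (p :: Δ) = [(r * p.1 + s * p.1, p.2)] ++ scale (r + s) Δ) ≫
      ten f (𝟙 (tens f [(r * p.1 + s * p.1, p.2)])) (contMor r s Δ) ≫
      ten f (st (.cont (r * p.1) (s * p.1) p.2)) (𝟙 (tens f (scale r Δ ++ scale s Δ))) ≫
      lc f (by simp : ([(r * p.1, p.2), (s * p.1, p.2)] ++ (scale r Δ ++ scale s Δ)) =
        [(r * p.1, p.2)] ++ (([(s * p.1, p.2)] ++ scale r Δ) ++ scale s Δ)) ≫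
      ten f (𝟙 _) (ten f (br f [(s * p.1, p.2)] (scale r Δ)) (𝟙 _)) ≫ lc f (by simp [scale])

/-- The morphism interpreting `contN`. -/
def contNMor (X : GTy R) : ∀ ds : List R, tens f [(ds.sum, X)] ⟶ tens f (rep ds X)
  | [] => st (.weak X)
  | d :: ds => lc f (by simp : [((d :: ds).sum, X)] = [(d + ds.sum, X)]) ≫ st (.cont d ds.sum X) ≫
      lc f (by rfl : [(d, X), (ds.sum, X)] = [(d, X)] ++ [(ds.sum, X)]) ≫
      ten f (𝟙 (tens f [(d, X)])) (contNMor X ds) ≫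
      lc f (by rfl : [(d, X)] ++ rep ds X = rep (d :: ds) X)

/-- The morphism interpreting `mcut`. -/
def mcutMor (ds : List R) {Δ : GCtx R} {X : GTy R} (Θ : GS Δ X) :
    tens f (scale ds.sum Δ) ⟶ tens f (rep ds X) :=
  st (.cut ds.sum Θ) ≫ contNMor st X ds

variable (H : Psh.{v, w, w'} C) {F : GCtx R → Type u}
    (sem : ∀ {L : GCtx R}, F L → H.obj (tens f L))
    {step : ∀ (A D : GCtx R) {P Q : GCtx R}, GStep P Q → F (A ++ (P ++ D)) → F (A ++ (Q ++ D))}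

theorem sem_tr {Δ Δ' : GCtx R} (π : F Δ) (h : Δ = Δ') :
    sem (tr π h) = H.res (lc f h.symm) (sem π) := sem_cast H sem h π

theorem sem_gswap
    (hstep : ∀ (A D : GCtx R) {P Q : GCtx R} (ρ : GStep P Q) (π : F (A ++ (P ++ D))),
      sem (step A D ρ π) = H.res (inside f (st ρ) A D) (sem π))
    (hex : ∀ p q, st (.ex p q) = exch f p q) (A P Q D : GCtx R)
    (π : F (A ++ (P ++ (Q ++ D)))) :
    sem (gswap step A P Q D π) = H.res (ten f (𝟙 (tens f A))
      (lc f (by simp) ≫ ten f (br f Q P) (𝟙 (tens f D)) ≫ lc f (by simp))) (sem π) :=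
  sem_swapBlocks H sem (fun A D p q π => by rw [← hex]; exact hstep A D (.ex p q) π) A P Q D π

theorem sem_weakBlock
    (hstep : ∀ (A D : GCtx R) {P Q : GCtx R} (ρ : GStep P Q) (π : F (A ++ (P ++ D))),
      sem (step A D ρ π) = H.res (inside f (st ρ) A D) (sem π))
    (A D : GCtx R) (Δ : GCtx R) (π : F (A ++ D)) :
    sem (weakBlock step A D Δ π) = H.res (inside f (weakMor st Δ) A D) (sem π) := by
  induction Δ with
  | nil =>
    have h : inside f (𝟙 (tens f [])) A D = 𝟙 _ := by simp [inside_eq]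
    exact ((congrArg (fun t => H.res t (sem π)) h).trans (H.res_id _)).symm
  | cons p Δ ih =>
    rw [weakBlock, sem_tr H sem, hstep, ih, ← H.res_comp, ← H.res_comp]
    congr 1
    simp only [inside_eq, weakMor]
    simp

/-- `contBlock` adds the contracted hypotheses one by one to the left context, so the induction has
to be for all `A`. -/
theorem sem_contBlock
    (hstep : ∀ (A D : GCtx R) {P Q : GCtx R} (ρ : GStep P Q) (π : F (A ++ (P ++ D))),
      sem (step A D ρ π) = H.res (inside f (st ρ) A D) (sem π))
    (hex : ∀ p q, st (.ex p q) = exch f p q) (r s : R) (D A Δ : GCtx R)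
    (π : F (A ++ (scale r Δ ++ (scale s Δ ++ D)))) :
    sem (contBlock step r s D A Δ π) =
      H.res (inside f (contMor st r s Δ) A D ≫ lc f (by simp)) (sem π) := by
  induction Δ generalizing A with
  | nil =>
    have h : inside f (𝟙 (tens f [])) A D = 𝟙 _ := by simp [inside_eq]
    exact ((congrArg (fun t => H.res t (sem π)) ((Category.comp_id _).trans h)).trans
      (H.res_id _)).symm
  | cons p Δ ih =>
    rw [contBlock, sem_tr H sem, ih, sem_tr H sem, hstep]
    erw [sem_tr H sem, sem_gswap st H sem hstep hex, sem_tr H sem]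
    simp only [← H.res_comp]
    congr 1
    simp only [inside_eq, contMor]
    -- The recursive call has grade `(r + s) * p.1` at its head, while contracting the two copies
    -- produces `r * p.1 + s * p.1`.
    rw [id_ten_congr _ (by rw [add_mul] :
      A ++ [((r + s) * p.1, p.2)] = A ++ [(r * p.1 + s * p.1, p.2)])]
    simp

theorem sem_contN
    (hstep : ∀ (A D : GCtx R) {P Q : GCtx R} (ρ : GStep P Q) (π : F (A ++ (P ++ D))),
      sem (step A D ρ π) = H.res (inside f (st ρ) A D) (sem π))
    (X : GTy R) (D A : GCtx R) (ds : List R) (π : F (A ++ (rep ds X ++ D))) :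
    sem (contN step X D A ds π) = H.res (inside f (contNMor st X ds) A D) (sem π) := by
  induction ds generalizing A with
  | nil => exact hstep A D (.weak X) π
  | cons d ds ih =>
    rw [contN]
    erw [hstep A D (.cont d ds.sum X)]
    erw [sem_tr H sem]
    rw [ih]
    erw [sem_tr H sem]
    simp only [← H.res_comp]
    congr 1
    simp only [inside_eq, contNMor]
    simp
    erw [ten_lc_id, ten_id_lc]

theorem sem_mcut
    (hstep : ∀ (A D : GCtx R) {P Q : GCtx R} (ρ : GStep P Q) (π : F (A ++ (P ++ D))),
      sem (step A D ρ π) = H.res (inside f (st ρ) A D) (sem π))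
    (A D : GCtx R) (ds : List R) {Δ : GCtx R} {X : GTy R} (Θ : GS Δ X)
    (π : F (A ++ (rep ds X ++ D))) :
    sem (mcut step A D ds Θ π) = H.res (inside f (mcutMor st ds Θ) A D) (sem π) := by
  rw [mcut, hstep, sem_contN st H sem hstep, ← H.res_comp]
  congr 1
  simp [inside_eq, mcutMor]

end Blocks
-- Lax structures on lists, and promotion of a context
theorem eqToHom_tensorHom {C : Type v} [Category.{w} C] [MonoidalCategory C] {X Y X' Y' : C} (h : X = Y) (h' : X' = Y') :
    (eqToHom h ⊗ₘ eqToHom h') = eqToHom (by rw [h, h']) := by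
  subst h h'; simp

/-- The induction step for the compatibility of an n-ary lax structure with splitting a list; the
reason is associativity of μ. It is stated for any lax functor because both r ⊙ - and `Mny` need it.
The map `φ` on the head is δ in the first case and an identity in the second. -/
theorem lax_cons {D : Type*} [Category* D] [MonoidalCategory D] {E : Type*} [Category* E]
    [MonoidalCategory E] (G : D ⥤ E) [G.LaxMonoidal] {a' L' A' B' : E} {a L A B : D}
    (φ : a' ⟶ G.obj a) (x : L' ⟶ G.obj L) (s : L ⟶ A ⊗ B) (s' : L' ⟶ A' ⊗ B')
    (g : A' ⟶ G.obj A) (h : B' ⟶ G.obj B)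
    (ih : x ≫ G.map s = s' ≫ (g ⊗ₘ h) ≫ Functor.LaxMonoidal.μ G A B) :
    ((φ ⊗ₘ x) ≫ Functor.LaxMonoidal.μ G a L) ≫ G.map (a ◁ s ≫ (α_ a A B).inv) =
      (a' ◁ s' ≫ (α_ a' A' B').inv) ≫ (((φ ⊗ₘ g) ≫ Functor.LaxMonoidal.μ G a A) ⊗ₘ h) ≫
        Functor.LaxMonoidal.μ G (a ⊗ A) B := by
  simp only [MonoidalCategory.tensorHom_def, comp_whiskerRight, Functor.map_comp, Category.assoc]
  rw [← Functor.LaxMonoidal.μ_natural_right_assoc, ← MonoidalCategory.whiskerLeft_comp_assoc, ih]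
  simp only [MonoidalCategory.tensorHom_def, MonoidalCategory.whiskerLeft_comp, Category.assoc,
    Functor.LaxMonoidal.associativity_inv]
  rw [← MonoidalCategory.whisker_exchange_assoc (Functor.LaxMonoidal.μ G a A) h]
  simp [MonoidalCategory.whisker_exchange_assoc]
  rw [← associator_inv_naturality_left_assoc, Iso.inv_hom_id_assoc,
    MonoidalCategory.whisker_exchange_assoc]

theorem lax_nil {D : Type*} [Category* D] [MonoidalCategory D] {E : Type*} [Category* E]
    [MonoidalCategory E] (G : D ⥤ E) [G.LaxMonoidal] {B' : E} {B : D} (h : B' ⟶ G.obj B) :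
    h ≫ G.map (λ_ B).inv = (λ_ B').inv ≫ (Functor.LaxMonoidal.ε G ⊗ₘ h) ≫
      Functor.LaxMonoidal.μ G (𝟙_ D) B := by
  rw [MonoidalCategory.tensorHom_def', Category.assoc,
    ← MonoidalCategory.leftUnitor_inv_naturality_assoc, Functor.LaxMonoidal.left_unitality_inv]

namespace MGLModel
open Functor.LaxMonoidal
variable {R : Type u} [Semiring R] [Preorder R] [AddLeftMono R] [MulLeftMono R] [MulRightMono R]
  {C : Type v} [Category.{w} C] [MonoidalCategory C] [SymmetricCategory C]
  {M : Type v} [Category.{w} M] [MonoidalCategory M] [SymmetricCategory M] [MonoidalClosed M]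
  (𝓜 : MGLModel R C M)

theorem mul_obj (r s : R) (X : C) :
    (𝓜.gr (r * s)).obj X = (𝓜.gr r).obj ((𝓜.gr s).obj X) :=
  Functor.congr_obj (𝓜.act_mul r s) X

theorem one_obj (X : C) : (𝓜.gr 1).obj X = X := Functor.congr_obj 𝓜.act_one X

theorem mul_eq (r s : R) (X : C) : 𝓜.mul r s X = eqToHom (𝓜.mul_obj r s X) := eqToHom_app _ _

theorem one_eq (X : C) : 𝓜.one X = eqToHom (𝓜.one_obj X) := eqToHom_app _ _

theorem mul_nat (r s : R) {X Y : C} (g : X ⟶ Y) :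
    (𝓜.gr (r * s)).map g ≫ 𝓜.mul r s Y = 𝓜.mul r s X ≫ (𝓜.gr r).map ((𝓜.gr s).map g) :=
  (eqToHom (𝓜.act_mul r s)).naturality g

theorem one_nat {X Y : C} (g : X ⟶ Y) : (𝓜.gr 1).map g ≫ 𝓜.one Y = 𝓜.one X ≫ g :=
  (eqToHom 𝓜.act_one).naturality g

theorem ε_gr (r : R) : ε (𝓜.gr r) = eqToHom (𝓜.unit_eq r).symm := 𝓜.ε_eq r

theorem μ_gr (r : R) (X Y : C) : μ (𝓜.gr r) X Y = eqToHom (𝓜.ten_eq r X Y).symm := 𝓜.μ_eq r X Y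

theorem prom_obj (r : R) (Δ : GCtx R) : 𝓜.gctx (scale r Δ) = (𝓜.gr r).obj (𝓜.gctx Δ) := by
  induction Δ with
  | nil => exact (𝓜.unit_eq r).symm
  | cons p Δ ih =>
    refine Eq.trans ?_ (𝓜.ten_eq r _ _).symm
    exact congrArg₂ (· ⊗ ·) (𝓜.mul_obj r p.1 (𝓜.gty p.2)) ih

/-- All structure maps of a strict action are identities along equalities of objects, so their
composite over a context is one too. This makes `prom` invertible, and equations built only from
`prom`, `mul` and `one`, such as `prom_scale` and `prom_one`, hold automatically. -/
theorem prom_eq (r : R) (Δ : GCtx R) : 𝓜.prom r Δ = eqToHom (𝓜.prom_obj r Δ) := by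
  induction Δ with
  | nil => exact 𝓜.ε_gr r
  | cons p Δ ih =>
    have h : (𝓜.mul r p.1 (𝓜.gty p.2) ⊗ₘ 𝓜.prom r Δ) ≫ μ (𝓜.gr r) _ _ =
        eqToHom (by rw [mul_obj, prom_obj, 𝓜.ten_eq]) := by
      rw [ih, mul_eq, μ_gr, eqToHom_tensorHom, eqToHom_trans]
    exact h

instance (r : R) (Δ : GCtx R) : IsIso (𝓜.prom r Δ) := by rw [prom_eq]; infer_instance

theorem scale_append (r : R) (A B : GCtx R) : scale r (A ++ B) = scale r A ++ scale r B := by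
  simp [scale]

theorem prom_lc (r : R) {Δ Δ' : GCtx R} (h : Δ = Δ') :
    𝓜.prom r Δ ≫ (𝓜.gr r).map (lc 𝓜.ghyp h) = lc 𝓜.ghyp (by rw [h]) ≫ 𝓜.prom r Δ' := by
  subst h; simp

/-- Not a consequence of `prom_eq`, because splitting involves associators, which r ⊙ - respects
through the coherence of μ. -/
theorem prom_append (r : R) (A B : GCtx R) :
    𝓜.prom r (A ++ B) ≫ (𝓜.gr r).map (split 𝓜.ghyp A B).hom =
      lc 𝓜.ghyp (scale_append r A B) ≫ (split 𝓜.ghyp (scale r A) (scale r B)).hom ≫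
        (𝓜.prom r A ⊗ₘ 𝓜.prom r B) ≫ μ (𝓜.gr r) _ _ := by
  induction A with
  | nil =>
    exact (lax_nil (𝓜.gr r) (𝓜.prom r B)).trans (Category.id_comp _).symm
  | cons p A ih =>
    refine (lax_cons (𝓜.gr r) (𝓜.mul r p.1 (𝓜.gty p.2)) _ _ _ _ _
      (ih.trans (Category.assoc _ _ _).symm)).trans ?_
    have e := lc_cons_self 𝓜.ghyp (congrArg ((r * p.1, p.2) :: ·) (scale_append r A B))
    refine (congrArg (· ≫ _) ((congrArg (· ≫ _) (MonoidalCategory.whiskerLeft_comp _ _ _)).trans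
      (Category.assoc _ _ _))).trans ((Category.assoc _ _ _).trans ?_)
    exact congrArg (· ≫ _) e.symm

/-- The second morphism is the action of `r` on the first. -/
def Prom (r : R) {P Q : GCtx R} (g : 𝓜.gctx Q ⟶ 𝓜.gctx P)
    (g' : 𝓜.gctx (scale r Q) ⟶ 𝓜.gctx (scale r P)) : Prop :=
  𝓜.prom r Q ≫ (𝓜.gr r).map g = g' ≫ 𝓜.prom r P

variable {𝓜}

theorem Prom.lc (r : R) {P Q : GCtx R} (h : P = Q) :
    𝓜.Prom r (lc 𝓜.ghyp h) (lc 𝓜.ghyp (by rw [h])) := 𝓜.prom_lc r h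

theorem Prom.id (r : R) (P : GCtx R) : 𝓜.Prom r (𝟙 (𝓜.gctx P)) (𝟙 _) := by simp [Prom]

theorem Prom.comp {r : R} {P Q S : GCtx R} {g : 𝓜.gctx P ⟶ 𝓜.gctx Q} {h : 𝓜.gctx Q ⟶ 𝓜.gctx S}
    {g' : 𝓜.gctx (scale r P) ⟶ 𝓜.gctx (scale r Q)} {h' : 𝓜.gctx (scale r Q) ⟶ 𝓜.gctx (scale r S)}
    (e : 𝓜.Prom r g g') (e' : 𝓜.Prom r h h') : 𝓜.Prom r (g ≫ h) (g' ≫ h') := by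
  unfold Prom at *
  rw [Functor.map_comp, reassoc_of% e, e', Category.assoc]

/-- Closure under concatenation, with `Prom.id`, `Prom.comp` and `Prom.lc`, means that the effect of
r ⊙ - has to be computed on single rules only. The casts appear because scaling distributes over
concatenation only propositionally. -/
theorem Prom.ten {r : R} {P P' Q Q' : GCtx R} {g : 𝓜.gctx P ⟶ 𝓜.gctx Q}
    {h : 𝓜.gctx P' ⟶ 𝓜.gctx Q'} {g' : 𝓜.gctx (scale r P) ⟶ 𝓜.gctx (scale r Q)}
    {h' : 𝓜.gctx (scale r P') ⟶ 𝓜.gctx (scale r Q')}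
    (e : 𝓜.Prom r g g') (e' : 𝓜.Prom r h h') : 𝓜.Prom r (ten 𝓜.ghyp g h)
      (MGL.lc 𝓜.ghyp (scale_append r P P') ≫ MGL.ten 𝓜.ghyp g' h' ≫
        MGL.lc 𝓜.ghyp (scale_append r Q Q').symm) := by
  unfold Prom at *
  rw [← cancel_mono ((𝓜.gr r).map (split 𝓜.ghyp Q Q').hom)]
  simp only [Category.assoc, prom_append, lc_lc_assoc, lc_self, Category.id_comp, ten_split_assoc]
  rw [← Functor.map_comp, ten_split, Functor.map_comp, ← Category.assoc, prom_append]
  simp only [Category.assoc, μ_natural, MonoidalCategory.tensorHom_comp_tensorHom_assoc, ← e, ← e']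
  simp only [← MonoidalCategory.tensorHom_comp_tensorHom, Category.assoc, μ_natural]

end MGLModel

-- Boxes on the first hypothesis, and shuffling two contexts

section Lists
variable {C : Type v} [Category.{w} C] [MonoidalCategory C] {α : Type u} {f : α → C}

/-- Absorbs the unit at the end of a one-element list, so that a rule deleting the head hypothesis
takes the form in which the axioms of `weak` are stated. `ten_singleton_pair` does the same for
rules that duplicate the head. -/
theorem ten_singleton_nil {a : α} (c : f a ⟶ 𝟙_ C) {L L' : List α} (h : tens f L ⟶ tens f L') :
    (ten f ((ρ_ (f a)).hom ≫ c : tens f [a] ⟶ tens f []) h : tens f ([a] ++ L) ⟶ tens f ([] ++ L')) =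
      ((c ⊗ₘ h) ≫ (λ_ _).hom : f a ⊗ tens f L ⟶ tens f L') := by
  have : (f a ◁ (λ_ (tens f L)).inv ≫ (α_ (f a) (𝟙_ C) (tens f L)).inv) ≫
     (((ρ_ (f a)).hom ≫ c) ⊗ₘ h) ≫ (λ_ _).hom = ((c ⊗ₘ h) ≫ (λ_ _).hom) := by
    simp [MonoidalCategory.tensorHom_def]
  exact this

theorem ten_singleton_pair {a b d : α} (c : f a ⟶ f b ⊗ f d) {L L' : List α}
    (h : tens f L ⟶ tens f L') :
    (ten f (c ▷ 𝟙_ C ≫ (α_ _ _ _).hom : tens f [a] ⟶ tens f [b, d]) h :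
        tens f ([a] ++ L) ⟶ tens f ([b, d] ++ L')) =
      ((c ⊗ₘ h) ≫ (α_ _ _ _).hom : f a ⊗ tens f L ⟶ f b ⊗ f d ⊗ tens f L') := by
  have : (f a ◁ (λ_ (tens f L)).inv ≫ (α_ (f a) (𝟙_ C) (tens f L)).inv) ≫
     ((c ▷ 𝟙_ C ≫ (α_ _ _ _).hom) ⊗ₘ h) ≫ ((α_ _ _ _).hom ≫ f b ◁
      ((α_ (f d) (𝟙_ C) (tens f L')).hom ≫ f d ◁ (λ_ (tens f L')).hom)) =
      ((c ⊗ₘ h) ≫ (α_ _ _ _).hom) := by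
    simp only [MonoidalCategory.tensorHom_def]
    monoidal
  exact this

variable [SymmetricCategory C]

theorem br_singleton_split (b : α) (L L' : List α) :
    (ten f (br f [b] L) (𝟙 (tens f L')) : tens f (([b] ++ L) ++ L') ⟶ tens f ((L ++ [b]) ++ L')) ≫
      lc f (by simp) ≫ (split f L (b :: L')).hom =
      (f b ◁ (split f L L').hom ≫ (α_ (f b) (tens f L) (tens f L')).inv ≫
        (β_ (f b) (tens f L)).hom ▷ tens f L' ≫ (α_ _ _ _).hom :
        f b ⊗ tens f (L ++ L') ⟶ tens f L ⊗ f b ⊗ tens f L') := by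
  have e1 : (split f (L ++ [b]) L').inv ≫ lc f (by simp : _ = L ++ ([b] ++ L')) ≫
      (split f L ([b] ++ L')).hom = (split f L [b]).hom ▷ tens f L' ≫ (α_ _ _ _).hom ≫
        tens f L ◁ (split f [b] L').inv := by
    rw [Iso.inv_comp_eq, split_assoc_assoc]; simp
  have h : (β_ (f b ⊗ 𝟙_ C) (tens f L)).hom = (ρ_ (f b)).hom ▷ _ ≫
      (β_ (f b) (tens f L)).hom ≫ _ ◁ (ρ_ (f b)).inv := by
    rw [BraidedCategory.braiding_naturality_left_assoc, MonoidalCategory.whiskerLeft_hom_inv,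
      Category.comp_id]
  have e2 : (ten f (br f [b] L) (𝟙 (tens f L')) ≫ lc f (by simp : _ = L ++ ([b] ++ L')) ≫
      (split f L ([b] ++ L')).hom) = (split f ([b] ++ L) L').hom ≫ (split f [b] L).hom ▷ tens f L' ≫
        (β_ (f b ⊗ 𝟙_ C) (tens f L)).hom ▷ tens f L' ≫ (α_ _ _ _).hom ≫
        tens f L ◁ (split f [b] L').inv := by
    simp only [ten, br, Category.assoc]
    rw [e1]
    simp only [MonoidalCategory.tensorHom_id, comp_whiskerRight, Category.assoc,
      inv_hom_whiskerRight_assoc]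
    rfl
  refine e2.trans ?_
  have e3 : (f b ◁ (split f L L').hom ≫ (α_ (f b) (tens f L) (tens f L')).inv) ≫
      (f b ◁ (λ_ (tens f L)).inv ≫ (α_ (f b) (𝟙_ C) (tens f L)).inv) ▷ tens f L' ≫
      (β_ (f b ⊗ 𝟙_ C) (tens f L)).hom ▷ tens f L' ≫ (α_ _ _ _).hom ≫
        tens f L ◁ ((α_ (f b) (𝟙_ C) (tens f L')).hom ≫ f b ◁ (λ_ (tens f L')).hom) =
      (f b ◁ (split f L L').hom ≫ (α_ (f b) (tens f L) (tens f L')).inv ≫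
        (β_ (f b) (tens f L)).hom ▷ tens f L' ≫ (α_ _ _ _).hom) := by
    rw [h]
    monoidal
  exact e3

theorem whisker_tensorμ (a b : C) {x l l' : C} (s : x ⟶ l ⊗ l') :
    a ◁ (b ◁ s ≫ (α_ b l l').inv ≫ (β_ b l).hom ▷ l' ≫ (α_ l b l').hom) ≫ (α_ a l (b ⊗ l')).inv =
      (α_ a b x).inv ≫ (a ⊗ b) ◁ s ≫ tensorμ a b l l' := by
  simp [tensorμ]

/-- After the head has been duplicated, `contMor` moves its second copy past the first copy of the
tail. This identifies that move with the middle-four interchange `tensorμ`, the form in which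
monoidality of `contr` is given. -/
theorem shuffle_split (a b : α) (L L' : List α) :
    lc f (by simp : a :: b :: (L ++ L') = [a] ++ (([b] ++ L) ++ L')) ≫
      ten f (𝟙 (tens f [a])) (ten f (br f [b] L) (𝟙 (tens f L'))) ≫ lc f (by simp) ≫
      (split f (a :: L) (b :: L')).hom = (α_ (f a) (f b) _).inv ≫
        (f a ⊗ f b) ◁ (split f L L').hom ≫ tensorμ (f a) (f b) (tens f L) (tens f L') := by
  have e : (f a ◁ ((ten f (br f [b] L) (𝟙 (tens f L')) :
      tens f (([b] ++ L) ++ L') ⟶ tens f ((L ++ [b]) ++ L')) ≫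
      lc f (by simp) ≫ (split f L (b :: L')).hom)) ≫ (α_ _ _ _).inv =
      (α_ (f a) (f b) _).inv ≫
        (f a ⊗ f b) ◁ (split f L L').hom ≫ tensorμ (f a) (f b) (tens f L) (tens f L') := by
    exact (congrArg (fun t => f a ◁ t ≫ (α_ (f a) (tens f L) (f b ⊗ tens f L')).inv)
      (br_singleton_split b L L')).trans (whisker_tensorμ (f a) (f b) _)
  refine Eq.trans ?_ e
  refine (Category.id_comp _).trans ?_
  rw [lc_cons_self, cons_ten, nil_ten]
  simp only [MonoidalCategory.whiskerLeft_comp, Category.assoc]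
  rfl

end Lists

-- Weakening and contraction of a whole context

namespace MGLModel
open Functor.LaxMonoidal
variable {R : Type u} [Semiring R] [Preorder R] [AddLeftMono R] [MulLeftMono R] [MulRightMono R]
  {C : Type v} [Category.{w} C] [MonoidalCategory C] [SymmetricCategory C]
  {M : Type v} [Category.{w} M] [MonoidalCategory M] [SymmetricCategory M] [MonoidalClosed M]
  (𝓜 : MGLModel R C M)

theorem prom_singleton (s r : R) (X : GTy R) : 𝓜.prom s [(r, X)] =
    ((ρ_ _).hom ≫ 𝓜.mul s r (𝓜.gty X) ≫ (𝓜.gr s).map (ρ_ _).inv :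
      (𝓜.gr (s * r)).obj (𝓜.gty X) ⊗ 𝟙_ C ⟶ (𝓜.gr s).obj ((𝓜.gr r).obj (𝓜.gty X) ⊗ 𝟙_ C)) := by
  have : (𝓜.mul s r (𝓜.gty X) ⊗ₘ ε (𝓜.gr s)) ≫ μ (𝓜.gr s) _ _ =
    (ρ_ _).hom ≫ 𝓜.mul s r (𝓜.gty X) ≫ (𝓜.gr s).map (ρ_ _).inv := by
    rw [← Functor.LaxMonoidal.right_unitality_inv, MonoidalCategory.tensorHom_def]
    simp
  exact this

theorem mul_weak (s : R) (X : C) : 𝓜.mul 0 s X ≫ 𝓜.weak ((𝓜.gr s).obj X) =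
    eqToHom (by rw [zero_mul]) ≫ 𝓜.weak X := by
  have := 𝓜.weak_mul_left s X
  rw [← this]; simp [mul]

theorem mul_contr (s₁ s₂ r : R) (X : C) : 𝓜.mul (s₁ + s₂) r X ≫ 𝓜.contr s₁ s₂ ((𝓜.gr r).obj X) =
    eqToHom (by rw [add_mul]) ≫ 𝓜.contr (s₁ * r) (s₂ * r) X ≫ (𝓜.mul s₁ r X ⊗ₘ 𝓜.mul s₂ r X) :=
  (𝓜.contr_mul_right s₁ s₂ r X).symm

theorem weak_step (r : R) {X Y L : C} (q : L ⟶ (𝓜.gr 0).obj Y) (k : L ⟶ 𝟙_ C)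
    (h : q ≫ 𝓜.weak Y = k) :
    ((𝓜.mul 0 r X ⊗ₘ q) ≫ μ (𝓜.gr 0) _ _) ≫ 𝓜.weak ((𝓜.gr r).obj X ⊗ Y) =
      (eqToHom (by rw [zero_mul]) ⊗ₘ 𝟙 L) ≫ (𝓜.weak X ⊗ₘ k) ≫ (λ_ _).hom := by
  rw [Category.assoc, 𝓜.weak_ten, MonoidalCategory.tensorHom_comp_tensorHom_assoc,
    MonoidalCategory.tensorHom_comp_tensorHom_assoc, Category.id_comp, h, mul_weak]

theorem contr_step (r s t : R) {X Y L K L₁ L₂ : C} (q : L ⟶ (𝓜.gr (r + s)).obj Y) (k : L ⟶ K)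
    (e : K ⟶ L₁ ⊗ L₂) (q₁ : L₁ ⟶ (𝓜.gr r).obj Y) (q₂ : L₂ ⟶ (𝓜.gr s).obj Y)
    (h : q ≫ 𝓜.contr r s Y = k ≫ e ≫ (q₁ ⊗ₘ q₂)) :
    ((𝓜.mul (r + s) t X ⊗ₘ q) ≫ μ (𝓜.gr (r + s)) _ _) ≫ 𝓜.contr r s ((𝓜.gr t).obj X ⊗ Y) =
      ((eqToHom (by rw [add_mul]) ⊗ₘ k) ≫ (𝓜.contr (r * t) (s * t) X ⊗ₘ 𝟙 _) ≫ (α_ _ _ _).hom) ≫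
        ((α_ _ _ _).inv ≫ _ ◁ e ≫ tensorμ _ _ _ _) ≫
          (((𝓜.mul r t X ⊗ₘ q₁) ≫ μ (𝓜.gr r) _ _) ⊗ₘ ((𝓜.mul s t X ⊗ₘ q₂) ≫ μ (𝓜.gr s) _ _)) := by
  rw [Category.assoc, 𝓜.contr_ten, MonoidalCategory.tensorHom_comp_tensorHom_assoc, h, mul_contr]
  simp only [Category.assoc, Iso.hom_inv_id_assoc, ← MonoidalCategory.tensorHom_comp_tensorHom,
    ← tensorμ_natural_assoc]
  simp only [← MonoidalCategory.id_tensorHom, MonoidalCategory.tensorHom_comp_tensorHom_assoc,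
    MonoidalCategory.tensorHom_comp_tensorHom, Category.assoc, Category.id_comp, Category.comp_id]

theorem eq_comp_assoc {X Y a b L K : C} (e : X ⟶ Y) (c : Y ⟶ a ⊗ b) (k : L ⟶ K)  :
    (e ⊗ₘ k) ≫ (c ⊗ₘ 𝟙 K) ≫ (α_ a b K).hom = (e ⊗ₘ 𝟙 L) ≫ (c ⊗ₘ k) ≫ (α_ a b K).hom := by
  simp only [MonoidalCategory.tensorHom_comp_tensorHom_assoc, Category.comp_id, Category.id_comp]

/-- Monoidality of `weak` lets it act factor by factor, and its compatibility with the action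
removes the inner grade of each factor. The empty context is `weak_unit`, the cons case is
`weak_step`. -/
theorem prom_weak (Δ : GCtx R) : 𝓜.prom 0 Δ ≫ 𝓜.weak (𝓜.gctx Δ) = weakMor 𝓜.gstep Δ := by
  induction Δ with
  | nil => exact 𝓜.weak_unit
  | cons p Δ ih =>
    refine (𝓜.weak_step p.1 _ _ ih).trans ?_
    have e : weakMor 𝓜.gstep (p :: Δ) =
        lc 𝓜.ghyp (by simp [scale] : scale 0 (p :: Δ) = [(0, p.2)] ++ scale 0 Δ) ≫
          ten 𝓜.ghyp (𝓜.gstep (.weak p.2)) (weakMor 𝓜.gstep Δ) := by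
      rw [ten_eq]; rfl
    exact (e.trans (congrArg₂ (· ≫ ·) (lc_cons 𝓜.ghyp (by simp [scale] : scale 0 (p :: Δ) =
      [(0, p.2)] ++ scale 0 Δ))
      (ten_singleton_nil (f := 𝓜.ghyp) (a := (0, p.2)) (𝓜.weak (𝓜.gty p.2)) _))).symm

/-- The analogue for `contr`: monoidality produces a `tensorμ` at each hypothesis, which is the
exchange built into `contMor` by `shuffle_split`. -/
theorem prom_contr (r s : R) (Δ : GCtx R) : 𝓜.prom (r + s) Δ ≫ 𝓜.contr r s (𝓜.gctx Δ) =
    contMor 𝓜.gstep r s Δ ≫ (split 𝓜.ghyp (scale r Δ) (scale s Δ)).hom ≫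
      (𝓜.prom r Δ ⊗ₘ 𝓜.prom s Δ) := by
  induction Δ with
  | nil => exact (𝓜.contr_unit r s).trans (Category.id_comp _).symm
  | cons p Δ ih =>
    refine (𝓜.contr_step r s p.1 _ _ _ _ _ ih).trans ?_
    have e : contMor 𝓜.gstep r s (p :: Δ) ≫ (split 𝓜.ghyp _ _).hom =
        (lc 𝓜.ghyp (by simp [scale, add_mul] :
          scale (r + s) (p :: Δ) = [(r * p.1 + s * p.1, p.2)] ++ scale (r + s) Δ) ≫
        (ten 𝓜.ghyp (𝟙 (tens 𝓜.ghyp [(r * p.1 + s * p.1, p.2)])) (contMor 𝓜.gstep r s Δ) ≫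
        ten 𝓜.ghyp (𝓜.gstep (.cont (r * p.1) (s * p.1) p.2))
          (𝟙 (tens 𝓜.ghyp (scale r Δ ++ scale s Δ))))) ≫
        (lc 𝓜.ghyp (by simp : (r * p.1, p.2) :: (s * p.1, p.2) :: (scale r Δ ++ scale s Δ) =
        [(r * p.1, p.2)] ++ (([(s * p.1, p.2)] ++ scale r Δ) ++ scale s Δ)) ≫
      ten 𝓜.ghyp (𝟙 _) (ten 𝓜.ghyp (br 𝓜.ghyp [(s * p.1, p.2)] (scale r Δ)) (𝟙 _)) ≫
        lc 𝓜.ghyp (by simp [scale]) ≫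
          (split 𝓜.ghyp ((r * p.1, p.2) :: scale r Δ) ((s * p.1, p.2) :: scale s Δ)).hom) := by
      rw [contMor]
      simp only [Category.assoc]
      rfl
    have e' : _ = _ ≫ (𝓜.prom r (p :: Δ) ⊗ₘ 𝓜.prom s (p :: Δ)) := e =≫ _
    refine Eq.trans ?_ (e'.symm.trans (Category.assoc _ _ _))
    refine Eq.trans ?_ (Category.assoc _ _ _).symm
    refine congrArg₂ (· ≫ ·) ?_ (congrArg₂ (· ≫ ·) (shuffle_split (f := 𝓜.ghyp) (r * p.1, p.2) (s * p.1, p.2) (scale r Δ) (scale s Δ)).symm rfl)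
    rw [ten_comp, Category.id_comp, Category.comp_id]
    have e2 := ten_singleton_pair (f := 𝓜.ghyp) (a := (r * p.1 + s * p.1, p.2))
      (b := (r * p.1, p.2)) (d := (s * p.1, p.2))
      (𝓜.contr (r * p.1) (s * p.1) (𝓜.gty p.2)) (contMor 𝓜.gstep r s Δ)
    have e3 := lc_cons 𝓜.ghyp (by simp [scale, add_mul] :
          scale (r + s) (p :: Δ) = [(r * p.1 + s * p.1, p.2)] ++ scale (r + s) Δ)
    refine Eq.trans ?_ (congrArg₂ (· ≫ ·) e3 e2).symm
    exact eq_comp_assoc _ _ _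

end MGLModel

-- Lax functors on contexts with one or two hypotheses

section Lax
open Functor.LaxMonoidal
variable {D : Type*} [Category* D] [MonoidalCategory D] {E : Type*} [Category* E]
  [MonoidalCategory E] (G : D ⥤ E) [G.LaxMonoidal]

/-- This and the next three lemmas express the n-ary structure maps on very short lists by the
binary structure and the symmetry. The functor is arbitrary because it will be r ⊙ - in `prom_gstep`
and `Mny` in `lift_gstep`. -/
theorem lax_pair_step {a b : D} {a' b' : E} (m : a' ⟶ G.obj a) (n : b' ⟶ G.obj b)
    {e : D} (t : b ⟶ e) :
    (m ⊗ₘ ((ρ_ b').hom ≫ n ≫ G.map t)) ≫ μ G a e =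
      (α_ a' b' (𝟙_ _)).inv ≫ (ρ_ _).hom ≫ ((m ⊗ₘ n) ≫ μ G a b) ≫
        G.map (a ◁ t) := by
  rw [Category.assoc, ← μ_natural_right]
  simp only [MonoidalCategory.tensorHom_def, MonoidalCategory.whiskerLeft_comp, Category.assoc]
  rw [rightUnitor_tensor_hom_assoc, Iso.inv_hom_id_assoc, MonoidalCategory.whisker_exchange_assoc]

theorem lax_one_step {X Y : D} {X' : E} (c : X ⟶ Y) (m : X' ⟶ G.obj X) :
    ((ρ_ X').hom ≫ m ≫ G.map (ρ_ X).inv) ≫ G.map ((ρ_ X).hom ≫ c) =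
      (ρ_ X').hom ≫ m ≫ G.map c := by
  simp

theorem lax_two_step {b d a : D} {b' d' a' : E} (c : a ⟶ b ⊗ d) (c' : a' ⟶ b' ⊗ d')
    (ma : a' ⟶ G.obj a) (m : b' ⊗ d' ⟶ G.obj (b ⊗ d))
    (h : ma ≫ G.map c = c' ≫ m) :
    ((ρ_ a').hom ≫ ma ≫ G.map (ρ_ a).inv) ≫ G.map (c ▷ 𝟙_ _ ≫ (α_ b d (𝟙_ _)).hom) =
      (c' ▷ 𝟙_ _ ≫ (α_ b' d' (𝟙_ _)).hom) ≫ ((α_ b' d' (𝟙_ _)).inv ≫ (ρ_ _).hom ≫ m ≫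
        G.map ((ρ_ _).inv ≫ (α_ _ _ _).hom)) := by
  have e : (ρ_ a).inv ≫ c ▷ 𝟙_ _ ≫ (α_ b d (𝟙_ _)).hom = c ≫ (ρ_ _).inv ≫ (α_ _ _ _).hom := by
    simp
  simp only [Category.assoc, ← Functor.map_comp, e]
  rw [Functor.map_comp, reassoc_of% h]
  simp

theorem lax_exch_step {D : Type*} [Category* D] [MonoidalCategory D] [BraidedCategory D]
    {E : Type*} [Category* E] [MonoidalCategory E] [BraidedCategory E] (G : D ⥤ E) [G.LaxBraided]
    {a b : D} {a' b' : E} (m : a' ⟶ G.obj a) (n : b' ⟶ G.obj b) :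
    ((α_ _ _ _).inv ≫ (ρ_ _).hom ≫ ((m ⊗ₘ n) ≫ μ G _ _) ≫
      G.map ((ρ_ _).inv ≫ (α_ _ _ _).hom)) ≫
      G.map ((α_ a b (𝟙_ _)).inv ≫ (β_ a b).hom ▷ 𝟙_ _ ≫ (α_ b a (𝟙_ _)).hom) =
    ((α_ a' b' (𝟙_ _)).inv ≫ (β_ a' b').hom ▷ 𝟙_ _ ≫ (α_ b' a' (𝟙_ _)).hom) ≫
      ((α_ _ _ _).inv ≫ (ρ_ _).hom ≫ ((n ⊗ₘ m) ≫ μ G _ _) ≫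
        G.map ((ρ_ _).inv ≫ (α_ _ _ _).hom)) := by
  have e : ((ρ_ (a ⊗ b)).inv ≫ (α_ a b (𝟙_ _)).hom) ≫ (α_ a b (𝟙_ _)).inv ≫
    (β_ a b).hom ▷ 𝟙_ _ ≫ (α_ b a (𝟙_ _)).hom = (β_ a b).hom ≫ (ρ_ _).inv ≫ (α_ _ _ _).hom := by
    simp only [Category.assoc, Iso.hom_inv_id_assoc]
    rw [rightUnitor_inv_naturality_assoc]
  simp only [Category.assoc, Iso.hom_inv_id_assoc]
  rw [← Functor.map_comp, e, Functor.map_comp, Functor.LaxBraided.braided_assoc,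
    BraidedCategory.braiding_naturality_assoc, rightUnitor_naturality_assoc]

end Lax

-- Multiplying the grades of a rule

namespace MGLModel
open Functor.LaxMonoidal
variable {R : Type u} [Semiring R] [Preorder R] [AddLeftMono R] [MulLeftMono R] [MulRightMono R]
  {C : Type v} [Category.{w} C] [MonoidalCategory C] [SymmetricCategory C]
  {M : Type v} [Category.{w} M] [MonoidalCategory M] [SymmetricCategory M] [MonoidalClosed M]
  (𝓜 : MGLModel R C M)

theorem prom_pair (s : R) (p q : R × GTy R) : 𝓜.prom s [p, q] =
    ((α_ _ _ _).inv ≫ (ρ_ _).hom ≫ ((𝓜.mul s p.1 (𝓜.gty p.2) ⊗ₘ 𝓜.mul s q.1 (𝓜.gty q.2)) ≫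
      μ (𝓜.gr s) _ _) ≫ (𝓜.gr s).map ((ρ_ _).inv ≫ (α_ _ _ _).hom) :
      (𝓜.gr (s * p.1)).obj (𝓜.gty p.2) ⊗ (𝓜.gr (s * q.1)).obj (𝓜.gty q.2) ⊗ 𝟙_ C ⟶
      (𝓜.gr s).obj ((𝓜.gr p.1).obj (𝓜.gty p.2) ⊗ (𝓜.gr q.1).obj (𝓜.gty q.2) ⊗ 𝟙_ C)) := by
  have h : 𝓜.prom s [p, q] = (𝓜.mul s p.1 (𝓜.gty p.2) ⊗ₘ 𝓜.prom s [q]) ≫ μ (𝓜.gr s) _ _ := rfl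
  refine h.trans ?_
  refine (congrArg (fun t => (𝓜.mul s p.1 (𝓜.gty p.2) ⊗ₘ t) ≫ μ (𝓜.gr s) _ _)
    (𝓜.prom_singleton s q.1 q.2)).trans ?_
  have k : (ρ_ ((𝓜.gr p.1).obj (𝓜.gty p.2) ⊗ (𝓜.gr q.1).obj (𝓜.gty q.2))).inv ≫ (α_ _ _ _).hom =
    (𝓜.gr p.1).obj (𝓜.gty p.2) ◁ (ρ_ _).inv := by monoidal
  rw [k]
  exact lax_pair_step (𝓜.gr s) _ _ _

theorem gstep_tr {P P' Q Q' : GCtx R} (ρ : GStep P Q) (hP : P = P') (hQ : Q = Q') :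
    𝓜.gstep (ρ.tr hP hQ) = lc 𝓜.ghyp hQ.symm ≫ 𝓜.gstep ρ ≫ lc 𝓜.ghyp hP := by
  subst hP hQ; simp [GStep.tr]

theorem gstep_smul_weak (s : R) (X : GTy R) : 𝓜.gstep ((GStep.weak X).smul s) =
    lc 𝓜.ghyp (by simp : [(s * 0, X)] = [((0 : R), X)]) ≫ 𝓜.gstep (.weak X) :=
  (𝓜.gstep_tr (.weak X) rfl (by simp : [((0 : R), X)] = [(s * 0, X)])).trans (congrArg (_ ≫ ·) (Category.comp_id _))

theorem gstep_smul_cont (s r t : R) (X : GTy R) : 𝓜.gstep ((GStep.cont r t X).smul s) =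
    lc 𝓜.ghyp (by simp [mul_add] : [(s * (r + t), X)] = [((s * r + s * t : R), X)]) ≫
      𝓜.gstep (.cont (s * r) (s * t) X) :=
  (𝓜.gstep_tr (.cont (s * r) (s * t) X) rfl
    (by simp [mul_add] : [((s * r + s * t : R), X)] = [(s * (r + t), X)])).trans
    (congrArg (_ ≫ ·) (Category.comp_id _))

theorem gstep_smul_cut (s r : R) {Δ : GCtx R} {X : GTy R} (Θ : GS Δ X) :
    𝓜.gstep ((GStep.cut r Θ).smul s) =
      lc 𝓜.ghyp (by simp [scale, mul_assoc, Function.comp_def] :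
        scale s (scale r Δ) = scale (s * r) Δ) ≫ 𝓜.gstep (.cut (s * r) Θ) :=
  (𝓜.gstep_tr (.cut (s * r) Θ) rfl
    (by simp [scale, mul_assoc, Function.comp_def])).trans (congrArg (_ ≫ ·) (Category.comp_id _))

theorem prom_scale (s r : R) (Δ : GCtx R) : 𝓜.prom s (scale r Δ) ≫ (𝓜.gr s).map (𝓜.prom r Δ) =
    lc 𝓜.ghyp (by simp [scale, mul_assoc, Function.comp_def]) ≫ 𝓜.prom (s * r) Δ ≫
      𝓜.mul s r (𝓜.gctx Δ) := by
  simp [prom_eq, mul_eq, eqToHom_map, lc]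

variable {𝓜}

/-- Each case is one axiom of the action: strictness for the left rules of J and ⊠, `weak_mul_right`
for weakening, `contr_mul_left` for contraction, compatibility of the lax structure with the
symmetry for exchange, and naturality of δ for a cut inside a cut. -/
theorem prom_gstep (s : R) {P Q : GCtx R} (ρ : GStep P Q) :
    𝓜.Prom s (𝓜.gstep ρ) (𝓜.gstep (ρ.smul s)) := by
  unfold Prom
  cases ρ with
  | unitL r =>
    rw [prom_singleton]
    have k : ((ρ_ _).hom ≫ 𝓜.mul s r (𝟙_ C) ≫ (𝓜.gr s).map (ρ_ _).inv) ≫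
      (𝓜.gr s).map ((ρ_ _).hom ≫ 𝓜.nUnit r) =
      ((ρ_ _).hom ≫ 𝓜.nUnit (s * r)) ≫ ε (𝓜.gr s) := by
      rw [lax_one_step, mul_eq, nUnit, eqToHom_map, eqToHom_trans, ε_gr, nUnit, Category.assoc,
        eqToHom_trans]
    exact k
  | tenL r X Y =>
    rw [prom_singleton, prom_pair]
    refine lax_two_step (𝓜.gr s) (𝓜.nTen r (𝓜.gty X) (𝓜.gty Y)) (𝓜.nTen (s * r) (𝓜.gty X) (𝓜.gty Y))
      _ _ ?_
    have k : 𝓜.mul s r (𝓜.gty X ⊗ 𝓜.gty Y) ≫ (𝓜.gr s).map (𝓜.nTen r (𝓜.gty X) (𝓜.gty Y)) =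
        𝓜.nTen (s * r) (𝓜.gty X) (𝓜.gty Y) ≫ (𝓜.mul s r (𝓜.gty X) ⊗ₘ 𝓜.mul s r (𝓜.gty Y)) ≫
          μ (𝓜.gr s) _ _ := by
      rw [mul_eq, mul_eq, mul_eq, nTen, nTen, μ_gr, eqToHom_map, eqToHom_tensorHom]
      simp only [eqToHom_trans]
    exact k
  | weak X =>
    rw [prom_singleton]
    have h := 𝓜.weak_mul_right s (𝓜.gty X)
    have h' : 𝓜.mul s 0 (𝓜.gty X) ≫ (𝓜.gr s).map (𝓜.weak (𝓜.gty X)) =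
      eqToHom (by rw [mul_zero]) ≫ 𝓜.weak (𝓜.gty X) ≫ ε (𝓜.gr s) := by
      rw [← h]; simp [mul]
    have e3 := lc_cons 𝓜.ghyp (by simp : [(s * 0, X)] = [((0 : R), X)])
    have k : ((ρ_ ((𝓜.gr (s * 0)).obj (𝓜.gty X))).hom ≫
      𝓜.mul s 0 (𝓜.gty X) ≫ (𝓜.gr s).map (ρ_ _).inv) ≫ (𝓜.gr s).map ((ρ_ _).hom ≫
        𝓜.weak (𝓜.gty X)) =
      (eqToHom (by rw [mul_zero]) ⊗ₘ 𝟙 (𝟙_ C)) ≫ ((ρ_ ((𝓜.gr 0).obj (𝓜.gty X))).hom ≫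
        𝓜.weak (𝓜.gty X)) ≫ ε (𝓜.gr s) := by
      rw [lax_one_step, h']; simp
    refine k.trans ?_
    refine Eq.trans ?_ (congrArg (· ≫ _) ((𝓜.gstep_smul_weak s X).trans (congrArg₂ (· ≫ ·) e3 rfl))).symm
    exact (Category.assoc _ _ _).symm
  | cont r t X =>
    rw [prom_singleton, prom_pair]
    have e3 := lc_cons 𝓜.ghyp (by simp [mul_add] : [(s * (r + t), X)] = [((s * r + s * t : R), X)])
    have h := 𝓜.contr_mul_left s r t (𝓜.gty X)
    have k := lax_two_step (𝓜.gr s) (𝓜.contr r t (𝓜.gty X))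
      (eqToHom (by rw [mul_add]) ≫ 𝓜.contr (s * r) (s * t) (𝓜.gty X)) (𝓜.mul s (r + t) (𝓜.gty X))
      ((𝓜.mul s r (𝓜.gty X) ⊗ₘ 𝓜.mul s t (𝓜.gty X)) ≫ μ (𝓜.gr s) _ _)
      (h.symm.trans (Category.assoc _ _ _).symm)
    refine k.trans (congrArg (· ≫ _) ?_)
    refine Eq.trans ?_ ((𝓜.gstep_smul_cont s r t X).trans (congrArg (· ≫ _) e3)).symm
    have : (eqToHom (by rw [mul_add] : (𝓜.gr (s * (r + t))).obj (𝓜.gty X) = _) ≫ 𝓜.contr (s * r) (s * t) (𝓜.gty X)) ▷ 𝟙_ C ≫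
      (α_ _ _ _).hom = (eqToHom (by rw [mul_add]) ⊗ₘ 𝟙 (𝟙_ C)) ≫
        𝓜.contr (s * r) (s * t) (𝓜.gty X) ▷ 𝟙_ C ≫ (α_ _ _ _).hom := by simp
    exact this
  | ex p q =>
    rw [prom_pair, prom_pair]
    exact lax_exch_step (𝓜.gr s) _ _
  | cut r Θ =>
    rename_i Δ X
    rw [prom_singleton]
    have h1 : 𝓜.gstep (.cut r Θ) = 𝓜.prom r Δ ≫ (𝓜.gr r).map (𝓜.gs Θ) ≫ (ρ_ _).inv := by
      rw [MGLModel.gstep]; rfl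
    have h2 : 𝓜.gstep (.cut (s * r) Θ) =
      𝓜.prom (s * r) Δ ≫ (𝓜.gr (s * r)).map (𝓜.gs Θ) ≫ (ρ_ _).inv := by
      rw [MGLModel.gstep]; rfl
    have k : 𝓜.prom s (scale r Δ) ≫ (𝓜.gr s).map (𝓜.prom r Δ ≫ (𝓜.gr r).map (𝓜.gs Θ) ≫ (ρ_ _).inv) =
      (lc 𝓜.ghyp (by simp [scale, mul_assoc, Function.comp_def]) ≫ 𝓜.prom (s * r) Δ ≫
        (𝓜.gr (s * r)).map (𝓜.gs Θ) ≫ (ρ_ _).inv) ≫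
        (ρ_ _).hom ≫ 𝓜.mul s r (𝓜.gty X) ≫ (𝓜.gr s).map (ρ_ _).inv := by
      simp only [Functor.map_comp, Category.assoc, Iso.inv_hom_id_assoc]
      rw [← Category.assoc, prom_scale, reassoc_of% 𝓜.mul_nat s r (𝓜.gs Θ)]
      simp only [Category.assoc]
    refine (congrArg (fun t => 𝓜.prom s (scale r Δ) ≫ (𝓜.gr s).map t) h1).trans (k.trans ?_)
    refine congrArg (· ≫ _) (Eq.trans ?_ (𝓜.gstep_smul_cut s r Θ).symm)
    exact congrArg₂ (· ≫ ·) rfl h2.symm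

end MGLModel

-- Approximation of grades

namespace MGLModel
open Functor.LaxMonoidal
variable {R : Type u} [Semiring R] [Preorder R] [AddLeftMono R] [MulLeftMono R] [MulRightMono R]
  {C : Type v} [Category.{w} C] [MonoidalCategory C] [SymmetricCategory C]
  {M : Type v} [Category.{w} M] [MonoidalCategory M] [SymmetricCategory M] [MonoidalClosed M]
  (𝓜 : MGLModel R C M)

/-- The action of `r ≤ s`. -/
def leq {r s : R} (h : r ≤ s) (X : C) : (𝓜.gr s).obj X ⟶ (𝓜.gr r).obj X :=
  (𝓜.act.map (homOfLE h).op).app X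

theorem leq_refl {r : R} (h : r ≤ r) (X : C) : 𝓜.leq h X = 𝟙 _ := by
  have : (homOfLE h).op = 𝟙 (op r) := Subsingleton.elim _ _
  rw [leq, this, CategoryTheory.Functor.map_id]; rfl

theorem leq_trans {r s t : R} (h : r ≤ s) (k : s ≤ t) (X : C) :
    𝓜.leq k X ≫ 𝓜.leq h X = 𝓜.leq (h.trans k) X := by
  have : (homOfLE (h.trans k)).op = (homOfLE k).op ≫ (homOfLE h).op := Subsingleton.elim _ _
  rw [leq, leq, leq, this, Functor.map_comp]; rfl

theorem leq_nat {r s : R} (h : r ≤ s) {X Y : C} (g : X ⟶ Y) :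
    (𝓜.gr s).map g ≫ 𝓜.leq h Y = 𝓜.leq h X ≫ (𝓜.gr r).map g :=
  (𝓜.act.map (homOfLE h).op).naturality g

theorem leq_mul {r r' s s' : R} (h : r ≤ r') (k : s ≤ s') (X : C) :
    𝓜.leq (mul_le_mul' h k) X ≫ 𝓜.mul r s X =
      𝓜.mul r' s' X ≫ 𝓜.leq h ((𝓜.gr s').obj X) ≫ (𝓜.gr r).map (𝓜.leq k X) :=
  𝓜.act_mul_natural h k X

theorem leq_ε {r s : R} (h : r ≤ s) : ε (𝓜.gr s) ≫ 𝓜.leq h (𝟙_ C) = ε (𝓜.gr r) := by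
  have := 𝓜.lax_natural h
  exact NatTrans.IsMonoidal.unit

theorem leq_μ {r s : R} (h : r ≤ s) (X Y : C) :
    μ (𝓜.gr s) X Y ≫ 𝓜.leq h (X ⊗ Y) = (𝓜.leq h X ⊗ₘ 𝓜.leq h Y) ≫ μ (𝓜.gr r) X Y := by
  have := 𝓜.lax_natural h
  exact NatTrans.IsMonoidal.tensor X Y

theorem nUnit_ε (r : R) : 𝓜.nUnit r ≫ ε (𝓜.gr r) = 𝟙 _ := by
  rw [nUnit, ε_gr, eqToHom_trans, eqToHom_refl]

theorem ε_nUnit (r : R) : ε (𝓜.gr r) ≫ 𝓜.nUnit r = 𝟙 _ := by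
  rw [nUnit, ε_gr, eqToHom_trans, eqToHom_refl]

theorem nTen_μ (r : R) (X Y : C) : 𝓜.nTen r X Y ≫ μ (𝓜.gr r) X Y = 𝟙 _ := by
  rw [nTen, μ_gr, eqToHom_trans, eqToHom_refl]

theorem μ_nTen (r : R) (X Y : C) : μ (𝓜.gr r) X Y ≫ 𝓜.nTen r X Y = 𝟙 _ := by
  rw [nTen, μ_gr, eqToHom_trans, eqToHom_refl]

theorem leq_nUnit {r s : R} (h : r ≤ s) : 𝓜.leq h (𝟙_ C) ≫ 𝓜.nUnit r = 𝓜.nUnit s := by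
  have := 𝓜.nUnit s ≫= (𝓜.leq_ε h) =≫ 𝓜.nUnit r
  rw [Category.assoc, reassoc_of% 𝓜.nUnit_ε, ε_nUnit, Category.comp_id] at this
  exact this

theorem leq_nTen {r s : R} (h : r ≤ s) (X Y : C) : 𝓜.leq h (X ⊗ Y) ≫ 𝓜.nTen r X Y =
    𝓜.nTen s X Y ≫ (𝓜.leq h X ⊗ₘ 𝓜.leq h Y) := by
  have := 𝓜.nTen s X Y ≫= (𝓜.leq_μ h X Y) =≫ 𝓜.nTen r X Y
  rw [Category.assoc, reassoc_of% 𝓜.nTen_μ, Category.assoc, μ_nTen, Category.comp_id] at this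
  exact this

theorem leq_contr {r r' s s' : R} (h : r ≤ r') (k : s ≤ s') (X : C) :
    𝓜.leq (add_le_add h k) X ≫ 𝓜.contr r s X =
      𝓜.contr r' s' X ≫ (𝓜.leq h X ⊗ₘ 𝓜.leq k X) := 𝓜.contr_natural_grade h k X

theorem gle_cons {r s : R} (X : GTy R) (h : r ≤ s) {Δ Δ' : GCtx R} (t : GLe Δ Δ') :
    𝓜.gle (.cons X h t) = 𝓜.leq h (𝓜.gty X) ⊗ₘ 𝓜.gle t := rfl

theorem gle_self : ∀ {Δ : GCtx R} (h : GLe Δ Δ), 𝓜.gle h = 𝟙 _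
  | _, .nil => rfl
  | _, .cons X h t => by
    rw [gle_cons, leq_refl, gle_self t]
    exact MonoidalCategory.id_tensorHom_id _ _

theorem gle_trans : ∀ {Δ₁ Δ₂ Δ₃ : GCtx R} (h : GLe Δ₁ Δ₂) (k : GLe Δ₂ Δ₃),
    𝓜.gle (h.trans k) = 𝓜.gle k ≫ 𝓜.gle h
  | _, _, _, .nil, .nil => (Category.id_comp _).symm
  | _, _, _, .cons X h t, .cons _ h' t' => by
    rw [GLe.trans, gle_cons, gle_cons, gle_cons, gle_trans t t', ← leq_trans (h := h) (k := h')]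
    exact (MonoidalCategory.tensorHom_comp_tensorHom _ _ _ _).symm

theorem gle_append : ∀ {Δ₁ Δ₁' Δ₂ Δ₂' : GCtx R} (h : GLe Δ₁ Δ₁') (k : GLe Δ₂ Δ₂'),
    𝓜.gle (h.append k) = ten 𝓜.ghyp (𝓜.gle h) (𝓜.gle k)
  | _, _, _, _, .nil, k => (nil_ten (f := 𝓜.ghyp) (𝓜.gle k)).symm
  | _, _, _, _, .cons X h t, k => by
    rw [GLe.append, gle_cons, gle_append t k, ten]
    have e : ∀ {a a' L L' A A' B B' : C} (g : a ⟶ a') (s : L ⟶ A ⊗ B) (i : A ⟶ A') (j : B ⟶ B')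
      (s' : A' ⊗ B' ⟶ L'), (g ⊗ₘ (s ≫ (i ⊗ₘ j) ≫ s')) =
        (a ◁ s ≫ (α_ a A B).inv) ≫ ((g ⊗ₘ i) ⊗ₘ j) ≫ (α_ a' A' B').hom ≫ a' ◁ s' := by
      intros
      rw [Category.assoc, ← associator_inv_naturality_assoc, Iso.inv_hom_id_assoc,
        ← MonoidalCategory.id_tensorHom, ← MonoidalCategory.id_tensorHom,
        MonoidalCategory.tensorHom_comp_tensorHom, MonoidalCategory.tensorHom_comp_tensorHom,
        Category.id_comp, Category.comp_id]
    exact e _ _ _ _ _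

/-- Naturality of promotion in the grades. The empty context and μ are handled by monoidality of the
transformation for `r ≤ s`, the head hypothesis by naturality of δ in both grades. -/
theorem gle_scale {r s : R} (h : r ≤ s) : ∀ {Δ Δ' : GCtx R} (k : GLe Δ Δ'),
    𝓜.gle (GLe.scale h k) ≫ 𝓜.prom r Δ =
      𝓜.prom s Δ' ≫ 𝓜.leq h (𝓜.gctx Δ') ≫ (𝓜.gr r).map (𝓜.gle k)
  | _, _, .nil => by
    refine (Category.id_comp _).trans ?_
    have : ε (𝓜.gr r) = ε (𝓜.gr s) ≫ 𝓜.leq h (𝟙_ C) ≫ (𝓜.gr r).map (𝟙 _) := by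
      rw [CategoryTheory.Functor.map_id, Category.comp_id, leq_ε]
    exact this
  | _, _, .cons (r := a) (s := b) (Δ := Δ) (Δ' := Δ') X h' t => by
    have ih := gle_scale h t
    have e : (𝓜.leq (mul_le_mul' h h') (𝓜.gty X) ⊗ₘ 𝓜.gle (GLe.scale h t)) ≫
        (𝓜.mul r a (𝓜.gty X) ⊗ₘ 𝓜.prom r Δ) ≫ μ (𝓜.gr r) _ _ =
      ((𝓜.mul s b (𝓜.gty X) ⊗ₘ 𝓜.prom s Δ') ≫ μ (𝓜.gr s) _ _) ≫
        𝓜.leq h ((𝓜.gr b).obj (𝓜.gty X) ⊗ 𝓜.gctx Δ') ≫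
          (𝓜.gr r).map (𝓜.leq h' (𝓜.gty X) ⊗ₘ 𝓜.gle t) := by
      rw [MonoidalCategory.tensorHom_comp_tensorHom_assoc, 𝓜.leq_mul h h', ih, Category.assoc,
        reassoc_of% 𝓜.leq_μ, ← μ_natural]
      simp only [MonoidalCategory.tensorHom_comp_tensorHom_assoc, Category.assoc]
    exact e

theorem gle_single {r s : R} (h : r ≤ s) (X : GTy R) :
    𝓜.gle (GLe.single h X) = 𝓜.leq h (𝓜.gty X) ▷ 𝟙_ C := MonoidalCategory.tensorHom_id _ _

theorem gle_double {r s r' s' : R} (h : r ≤ s) (h' : r' ≤ s') (X Y : GTy R) :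
    𝓜.gle (GLe.double h h' X Y) = (𝓜.leq h (𝓜.gty X) ⊗ₘ 𝓜.leq h' (𝓜.gty Y) ▷ 𝟙_ C) :=
  congrArg (𝓜.leq h (𝓜.gty X) ⊗ₘ ·) (MonoidalCategory.tensorHom_id _ _)

theorem gle_inside (A D : GCtx R) {P Q : GCtx R} (h : GLe P Q) :
    𝓜.gle (GLe.inside A D h) = inside 𝓜.ghyp (𝓜.gle h) A D := by
  rw [GLe.inside, gle_append, gle_append, gle_self, gle_self, inside_eq]

theorem single_unitL {r s : R} (h : r ≤ s) : 𝓜.gle (GLe.single h .J) ≫ 𝓜.gstep (.unitL r) =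
    𝓜.gstep (.unitL s) := by
  rw [gle_single]
  have e : 𝓜.leq h (𝟙_ C) ▷ 𝟙_ C ≫ (ρ_ _).hom ≫ 𝓜.nUnit r = (ρ_ _).hom ≫ 𝓜.nUnit s := by
    rw [rightUnitor_naturality_assoc, leq_nUnit]
  exact e

/-- Shared by the left rule of ⊠ and by contraction, the two rules that replace one hypothesis by
two. -/
theorem pair_naturality {a a' b b' d d' : C} (t : a ⟶ a') (c' : a' ⟶ b' ⊗ d') (c : a ⟶ b ⊗ d)
    (x : b ⟶ b') (y : d ⟶ d') (h : t ≫ c' = c ≫ (x ⊗ₘ y)) :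
    t ▷ 𝟙_ C ≫ (c' ▷ 𝟙_ C ≫ (α_ _ _ _).hom) = (c ▷ 𝟙_ C ≫ (α_ _ _ _).hom) ≫
      (x ⊗ₘ (y ▷ 𝟙_ C)) := by
  rw [← comp_whiskerRight_assoc, h]
  simp [MonoidalCategory.tensorHom_def]

theorem single_tenL {r s : R} (h : r ≤ s) (X Y : GTy R) :
    𝓜.gle (GLe.single h (.ten X Y)) ≫ 𝓜.gstep (.tenL r X Y) =
      𝓜.gstep (.tenL s X Y) ≫ 𝓜.gle (GLe.double h h X Y) := by
  rw [gle_single, gle_double]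
  exact pair_naturality _ _ _ _ _ (𝓜.leq_nTen h _ _)

theorem single_cont {r₁ r₂ s₁ s₂ : R} (h : r₁ ≤ r₂) (k : s₁ ≤ s₂) (X : GTy R) :
    𝓜.gle (GLe.single (add_le_add h k) X) ≫ 𝓜.gstep (.cont r₁ s₁ X) =
      𝓜.gstep (.cont r₂ s₂ X) ≫ 𝓜.gle (GLe.double h k X X) := by
  rw [gle_single, gle_double]
  exact pair_naturality _ _ _ _ _ (𝓜.leq_contr h k _)

theorem gstep_cut (r : R) {Δ : GCtx R} {X : GTy R} (Θ : GS Δ X) :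
    𝓜.gstep (.cut r Θ) = 𝓜.prom r Δ ≫ (𝓜.gr r).map (𝓜.gs Θ) ≫ (ρ_ _).inv := by
  rw [MGLModel.gstep]; rfl

theorem scale_cut {r s : R} (h : r ≤ s) {Δ Δ' : GCtx R} (k : GLe Δ Δ') {X : GTy R} (Θ : GS Δ X) :
    𝓜.gle (GLe.scale h k) ≫ 𝓜.gstep (.cut r Θ) =
      𝓜.gstep (.cut s (.sub k Θ)) ≫ 𝓜.gle (GLe.single h X) := by
  rw [gle_single, gstep_cut, gstep_cut, MGLModel.gs]
  have e : 𝓜.gle (GLe.scale h k) ≫ 𝓜.prom r Δ ≫ (𝓜.gr r).map (𝓜.gs Θ) ≫ (ρ_ _).inv =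
    (𝓜.prom s Δ' ≫ (𝓜.gr s).map (𝓜.gle k ≫ 𝓜.gs Θ) ≫ (ρ_ _).inv) ≫ 𝓜.leq h (𝓜.gty X) ▷ 𝟙_ C := by
    simp only [Category.assoc]
    rw [reassoc_of% 𝓜.gle_scale h k, ← rightUnitor_inv_naturality, reassoc_of% 𝓜.leq_nat,
      Functor.map_comp, Category.assoc]
  exact e

-- The adjunction, and mixed contexts as images of graded contexts

theorem unit_ε : ε 𝓜.Lin ≫ 𝓜.Lin.map (ε 𝓜.Mny) = 𝓜.adj.unit.app (𝟙_ C) := by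
  have := 𝓜.unit_monoidal
  have h := NatTrans.IsMonoidal.unit (τ := 𝓜.adj.unit)
  simpa using h.symm

theorem unit_μ (X Y : C) : (𝓜.adj.unit.app X ⊗ₘ 𝓜.adj.unit.app Y) ≫ μ 𝓜.Lin _ _ ≫
    𝓜.Lin.map (μ 𝓜.Mny X Y) = 𝓜.adj.unit.app (X ⊗ Y) := by
  have := 𝓜.unit_monoidal
  have h := NatTrans.IsMonoidal.tensor (τ := 𝓜.adj.unit) X Y
  simpa using h.symm

theorem counit_ε : ε 𝓜.Mny ≫ 𝓜.Mny.map (ε 𝓜.Lin) ≫ 𝓜.adj.counit.app (𝟙_ M) = 𝟙 _ := by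
  have := 𝓜.counit_monoidal
  have h := NatTrans.IsMonoidal.unit (τ := 𝓜.adj.counit)
  simpa using h

theorem counit_μ (A B : M) : μ 𝓜.Mny _ _ ≫ 𝓜.Mny.map (μ 𝓜.Lin A B) ≫
    𝓜.adj.counit.app (A ⊗ B) = (𝓜.adj.counit.app A ⊗ₘ 𝓜.adj.counit.app B) := by
  have := 𝓜.counit_monoidal
  have h := NatTrans.IsMonoidal.tensor (τ := 𝓜.adj.counit) A B
  simpa using h

theorem ε_nMnyUnit : ε 𝓜.Mny ≫ 𝓜.nMnyUnit = 𝟙 _ := 𝓜.counit_ε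

/-- Doctrinal adjunction: naturality of the counit, monoidality of the unit and a triangle identity
give one composite; the other is monoidality of the counit. The binary structure is inverted in the
same way by `μ_nMnyTen` and `nMnyTen_μ`. -/
theorem nMnyUnit_ε : 𝓜.nMnyUnit ≫ ε 𝓜.Mny = 𝟙 _ := by
  have h : 𝓜.adj.counit.app (𝟙_ M) ≫ ε 𝓜.Mny =
      𝓜.Mny.map (𝓜.Lin.map (ε 𝓜.Mny)) ≫ 𝓜.adj.counit.app (𝓜.Mny.obj (𝟙_ C)) :=
    (𝓜.adj.counit.naturality (ε 𝓜.Mny)).symm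
  rw [nMnyUnit, Category.assoc, h, ← Functor.map_comp_assoc, unit_ε]
  exact 𝓜.adj.left_triangle_components _

theorem μ_nMnyTen (X Y : C) : μ 𝓜.Mny X Y ≫ 𝓜.nMnyTen X Y = 𝟙 _ := by
  rw [nMnyTen, ← μ_natural_assoc]
  refine (congrArg (_ ≫ ·) (𝓜.counit_μ (𝓜.Mny.obj X) (𝓜.Mny.obj Y))).trans ?_
  refine (MonoidalCategory.tensorHom_comp_tensorHom _ _ _ _).trans ?_
  refine (congrArg₂ (· ⊗ₘ ·) (𝓜.adj.left_triangle_components X)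
    (𝓜.adj.left_triangle_components Y)).trans (MonoidalCategory.id_tensorHom_id _ _)

theorem nMnyTen_μ (X Y : C) : 𝓜.nMnyTen X Y ≫ μ 𝓜.Mny X Y = 𝟙 _ := by
  have h : 𝓜.adj.counit.app (𝓜.Mny.obj X ⊗ 𝓜.Mny.obj Y) ≫ μ 𝓜.Mny X Y =
      𝓜.Mny.map (𝓜.Lin.map (μ 𝓜.Mny X Y)) ≫ 𝓜.adj.counit.app (𝓜.Mny.obj (X ⊗ Y)) :=
    (𝓜.adj.counit.naturality (μ 𝓜.Mny X Y)).symm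
  rw [nMnyTen, Category.assoc, Category.assoc, h, ← Functor.map_comp_assoc, ← Functor.map_comp_assoc,
    Category.assoc, unit_μ]
  exact 𝓜.adj.left_triangle_components _

instance : IsIso (ε 𝓜.Mny) := ⟨𝓜.nMnyUnit, 𝓜.ε_nMnyUnit, 𝓜.nMnyUnit_ε⟩

instance (X Y : C) : IsIso (μ 𝓜.Mny X Y) := ⟨𝓜.nMnyTen X Y, 𝓜.μ_nMnyTen X Y, 𝓜.nMnyTen_μ X Y⟩

theorem isIso_mMny (Δ : GCtx R) : IsIso (𝓜.mMny Δ) := by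
  induction Δ with
  | nil => exact inferInstanceAs (IsIso (ε 𝓜.Mny))
  | cons p Δ ih =>
    exact inferInstanceAs (IsIso (𝓜.Mny.obj (𝓜.ghyp p) ◁ 𝓜.mMny Δ ≫
      μ 𝓜.Mny (𝓜.ghyp p) (𝓜.gctx Δ)))

instance (Δ : GCtx R) : IsIso (𝓜.mMny Δ) := 𝓜.isIso_mMny Δ

theorem mMny_lc {Δ Δ' : GCtx R} (h : Δ = Δ') :
    𝓜.mMny Δ ≫ 𝓜.Mny.map (lc 𝓜.ghyp h) = lc 𝓜.mhyp h ≫ 𝓜.mMny Δ' := by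
  subst h; simp

theorem mMny_append (A B : GCtx R) :
    𝓜.mMny (A ++ B) ≫ 𝓜.Mny.map (split 𝓜.ghyp A B).hom =
      (split 𝓜.mhyp A B).hom ≫ (𝓜.mMny A ⊗ₘ 𝓜.mMny B) ≫ μ 𝓜.Mny _ _ := by
  induction A with
  | nil => exact lax_nil 𝓜.Mny (𝓜.mMny B)
  | cons p A ih =>
    have e := lax_cons 𝓜.Mny (𝟙 (𝓜.Mny.obj (𝓜.ghyp p))) _ _ _ _ _ ih
    rw [MonoidalCategory.id_tensorHom, MonoidalCategory.id_tensorHom] at e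
    exact e

/-- In other words, `mLin` is the transpose of the inverse of `mMny`. Through this the rules for Lin
reduce to naturality and the triangle identities. -/
theorem mLin_mMny (Δ : GCtx R) :
    𝓜.mLin Δ ≫ 𝓜.Lin.map (𝓜.mMny Δ) = 𝓜.adj.unit.app (𝓜.gctx Δ) := by
  induction Δ with
  | nil => exact 𝓜.unit_ε
  | cons p Δ ih =>
    have e : ((𝓜.adj.unit.app (𝓜.ghyp p) ⊗ₘ 𝓜.mLin Δ) ≫ μ 𝓜.Lin _ _) ≫
        𝓜.Lin.map (𝓜.Mny.obj (𝓜.ghyp p) ◁ 𝓜.mMny Δ ≫ μ 𝓜.Mny (𝓜.ghyp p) (𝓜.gctx Δ)) =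
        𝓜.adj.unit.app (𝓜.ghyp p ⊗ 𝓜.gctx Δ) := by
      rw [Functor.map_comp, Category.assoc, ← μ_natural_right_assoc, ← unit_μ, ← ih]
      simp [MonoidalCategory.tensorHom_def]
    exact e

/-- The second morphism is the image of the first under `Mny`. -/
def Lift {P Q : GCtx R} (g : 𝓜.gctx Q ⟶ 𝓜.gctx P) (g' : 𝓜.mctx Q ⟶ 𝓜.mctx P) : Prop :=
  𝓜.mMny Q ≫ 𝓜.Mny.map g = g' ≫ 𝓜.mMny P

theorem mMny_singleton (p : R × GTy R) : 𝓜.mMny [p] = ((ρ_ _).hom ≫ 𝟙 _ ≫ 𝓜.Mny.map (ρ_ _).inv :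
    𝓜.Mny.obj (𝓜.ghyp p) ⊗ 𝟙_ M ⟶ 𝓜.Mny.obj (𝓜.ghyp p ⊗ 𝟙_ C)) := by
  have : 𝓜.Mny.obj (𝓜.ghyp p) ◁ ε 𝓜.Mny ≫ μ 𝓜.Mny _ _ = (ρ_ _).hom ≫ 𝟙 _ ≫ 𝓜.Mny.map (ρ_ _).inv := by
    rw [← Functor.LaxMonoidal.right_unitality_inv]
    simp
  exact this

theorem mMny_pair (p q : R × GTy R) : 𝓜.mMny [p, q] =
    ((α_ _ _ _).inv ≫ (ρ_ _).hom ≫ ((𝟙 _ ⊗ₘ 𝟙 _) ≫ μ 𝓜.Mny _ _) ≫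
      𝓜.Mny.map ((ρ_ _).inv ≫ (α_ _ _ _).hom) :
      𝓜.Mny.obj (𝓜.ghyp p) ⊗ 𝓜.Mny.obj (𝓜.ghyp q) ⊗ 𝟙_ M ⟶
        𝓜.Mny.obj (𝓜.ghyp p ⊗ 𝓜.ghyp q ⊗ 𝟙_ C)) := by
  have h : 𝓜.mMny [p, q] = (𝟙 (𝓜.mhyp p) ⊗ₘ 𝓜.mMny [q]) ≫ μ 𝓜.Mny _ _ :=
    congrArg (· ≫ μ 𝓜.Mny _ _) (MonoidalCategory.id_tensorHom _ _).symm
  refine h.trans ?_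
  refine (congrArg (fun t => (𝟙 (𝓜.mhyp p) ⊗ₘ t) ≫ μ 𝓜.Mny _ _) (𝓜.mMny_singleton q)).trans ?_
  have k : (ρ_ (𝓜.ghyp p ⊗ 𝓜.ghyp q)).inv ≫ (α_ _ _ _).hom = 𝓜.ghyp p ◁ (ρ_ _).inv := by monoidal
  rw [k]
  exact lax_pair_step 𝓜.Mny (𝟙 (𝓜.Mny.obj (𝓜.ghyp p))) (𝟙 (𝓜.Mny.obj (𝓜.ghyp q))) _

theorem mstep_cut (r : R) {Δ : GCtx R} {X : GTy R} (Θ : GS Δ X) :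
    𝓜.mstep (.cut r Θ) = 𝓜.mMny (scale r Δ) ≫ 𝓜.Mny.map (𝓜.prom r Δ ≫ (𝓜.gr r).map (𝓜.gs Θ)) ≫
      (ρ_ _).inv := by
  rw [MGLModel.mstep]; rfl

variable {𝓜}

theorem lift_lc {P Q : GCtx R} (h : P = Q) : 𝓜.Lift (lc 𝓜.ghyp h) (lc 𝓜.mhyp h) := 𝓜.mMny_lc h

theorem lift_id (P : GCtx R) : 𝓜.Lift (𝟙 (𝓜.gctx P)) (𝟙 _) := by simp [Lift]

theorem lift_comp {P Q S : GCtx R} {g : 𝓜.gctx P ⟶ 𝓜.gctx Q} {h : 𝓜.gctx Q ⟶ 𝓜.gctx S}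
    {g' : 𝓜.mctx P ⟶ 𝓜.mctx Q} {h' : 𝓜.mctx Q ⟶ 𝓜.mctx S}
    (e : 𝓜.Lift g g') (e' : 𝓜.Lift h h') : 𝓜.Lift (g ≫ h) (g' ≫ h') := by
  unfold Lift at *
  rw [Functor.map_comp, reassoc_of% e, e', Category.assoc]

theorem lift_ten {P P' Q Q' : GCtx R} {g : 𝓜.gctx P ⟶ 𝓜.gctx Q}
    {h : 𝓜.gctx P' ⟶ 𝓜.gctx Q'} {g' : 𝓜.mctx P ⟶ 𝓜.mctx Q} {h' : 𝓜.mctx P' ⟶ 𝓜.mctx Q'}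
    (e : 𝓜.Lift g g') (e' : 𝓜.Lift h h') : 𝓜.Lift (ten 𝓜.ghyp g h) (ten 𝓜.mhyp g' h') := by
  unfold Lift at *
  rw [← cancel_mono (𝓜.Mny.map (split 𝓜.ghyp Q Q').hom)]
  simp only [Category.assoc, mMny_append, ten_split_assoc]
  rw [← Functor.map_comp, ten_split, Functor.map_comp, ← Category.assoc, mMny_append]
  simp only [Category.assoc, μ_natural, MonoidalCategory.tensorHom_comp_tensorHom_assoc, ← e, ← e']
  simp only [← MonoidalCategory.tensorHom_comp_tensorHom, Category.assoc, μ_natural]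

theorem lift_inside {P Q : GCtx R} {g : 𝓜.gctx P ⟶ 𝓜.gctx Q} {g' : 𝓜.mctx P ⟶ 𝓜.mctx Q}
    (e : 𝓜.Lift g g') (A D : GCtx R) : 𝓜.Lift (inside 𝓜.ghyp g A D) (inside 𝓜.mhyp g' A D) := by
  rw [inside_eq, inside_eq]
  exact lift_ten (lift_id A) (lift_ten e (lift_id D))

theorem lift_gle : ∀ {Δ Δ' : GCtx R} (h : GLe Δ Δ'), 𝓜.Lift (𝓜.gle h) (𝓜.mle h)
  | _, _, .nil => lift_id []
  | _, _, .cons (Δ := Δ) (Δ' := Δ') X h t => by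
    have ih : _ = _ := lift_gle t
    have e : (𝓜.Mny.obj _ ◁ 𝓜.mMny Δ' ≫ μ 𝓜.Mny _ _) ≫ 𝓜.Mny.map (𝓜.leq h (𝓜.gty X) ⊗ₘ 𝓜.gle t) =
      (𝓜.Mny.map (𝓜.leq h (𝓜.gty X)) ⊗ₘ 𝓜.mle t) ≫ 𝓜.Mny.obj _ ◁ 𝓜.mMny Δ ≫ μ 𝓜.Mny _ _ := by
      rw [Category.assoc, ← μ_natural]
      simp only [← MonoidalCategory.id_tensorHom, MonoidalCategory.tensorHom_comp_tensorHom_assoc,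
        ih, Category.id_comp, Category.comp_id]
    exact e

/-- In the mixed calculus the left rules, weakening and contraction are the graded morphisms under
`Mny` followed by its colax structure, which cancels against the lax structure contained in `mMny`.
Exchange uses that `Mny` is symmetric, and a cut is an image by definition. -/
theorem lift_gstep {P Q : GCtx R} (ρ : GStep P Q) : 𝓜.Lift (𝓜.gstep ρ) (𝓜.mstep ρ) := by
  unfold Lift
  cases ρ with
  | unitL r =>
    rw [mMny_singleton]
    have k : ((ρ_ _).hom ≫ 𝟙 _ ≫ 𝓜.Mny.map (ρ_ ((𝓜.gr r).obj (𝟙_ C))).inv) ≫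
      𝓜.Mny.map ((ρ_ _).hom ≫ 𝓜.nUnit r) =
      ((ρ_ _).hom ≫ 𝓜.Mny.map (𝓜.nUnit r) ≫ 𝓜.nMnyUnit) ≫ ε 𝓜.Mny := by
      rw [lax_one_step]
      simp only [Category.assoc, Category.id_comp, nMnyUnit_ε, Category.comp_id]
    exact k
  | tenL r X Y =>
    rw [mMny_singleton, mMny_pair]
    refine lax_two_step 𝓜.Mny (𝓜.nTen r (𝓜.gty X) (𝓜.gty Y)) _ _ _ ?_
    have k : 𝟙 _ ≫ 𝓜.Mny.map (𝓜.nTen r (𝓜.gty X) (𝓜.gty Y)) =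
      (𝓜.Mny.map (𝓜.nTen r (𝓜.gty X) (𝓜.gty Y)) ≫ 𝓜.nMnyTen _ _) ≫
        (𝟙 _ ⊗ₘ 𝟙 _) ≫ μ 𝓜.Mny _ _ := by
      simp only [Category.assoc, Category.id_comp, nMnyTen_μ, Category.comp_id,
        MonoidalCategory.id_tensorHom_id]
    exact k
  | weak X =>
    rw [mMny_singleton]
    have k : ((ρ_ _).hom ≫ 𝟙 _ ≫ 𝓜.Mny.map (ρ_ ((𝓜.gr 0).obj (𝓜.gty X))).inv) ≫
      𝓜.Mny.map ((ρ_ _).hom ≫ 𝓜.weak (𝓜.gty X)) =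
      ((ρ_ _).hom ≫ 𝓜.Mny.map (𝓜.weak (𝓜.gty X)) ≫ 𝓜.nMnyUnit) ≫ ε 𝓜.Mny := by
      rw [lax_one_step]
      simp only [Category.assoc, Category.id_comp, nMnyUnit_ε, Category.comp_id]
    exact k
  | cont r t X =>
    rw [mMny_singleton, mMny_pair]
    refine lax_two_step 𝓜.Mny (𝓜.contr r t (𝓜.gty X)) _ _ _ ?_
    have k : 𝟙 _ ≫ 𝓜.Mny.map (𝓜.contr r t (𝓜.gty X)) =
      (𝓜.Mny.map (𝓜.contr r t (𝓜.gty X)) ≫ 𝓜.nMnyTen _ _) ≫ (𝟙 _ ⊗ₘ 𝟙 _) ≫ μ 𝓜.Mny _ _ := by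
      simp only [Category.assoc, Category.id_comp, nMnyTen_μ, Category.comp_id,
        MonoidalCategory.id_tensorHom_id]
    exact k
  | ex p q =>
    rw [mMny_pair, mMny_pair]
    exact lax_exch_step 𝓜.Mny _ _
  | cut r Θ =>
    rename_i Δ X
    rw [mMny_singleton]
    have k : 𝓜.mMny (scale r Δ) ≫ 𝓜.Mny.map (𝓜.prom r Δ ≫ (𝓜.gr r).map (𝓜.gs Θ) ≫ (ρ_ _).inv) =
      (𝓜.mMny (scale r Δ) ≫ 𝓜.Mny.map (𝓜.prom r Δ ≫ (𝓜.gr r).map (𝓜.gs Θ)) ≫ (ρ_ _).inv) ≫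
        (ρ_ _).hom ≫ 𝟙 _ ≫ 𝓜.Mny.map (ρ_ _).inv := by
      simp only [Category.assoc, Category.id_comp, Iso.inv_hom_id_assoc, Functor.map_comp]
    refine (congrArg (fun t => 𝓜.mMny (scale r Δ) ≫ 𝓜.Mny.map t) (𝓜.gstep_cut r Θ)).trans
      (k.trans (congrArg (· ≫ _) (𝓜.mstep_cut r Θ).symm))

end MGLModel

-- Graded equations on the hypotheses concerned

namespace MGLModel
open Functor.LaxMonoidal
variable {R : Type u} [Semiring R] [Preorder R] [AddLeftMono R] [MulLeftMono R] [MulRightMono R]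
  {C : Type v} [Category.{w} C] [MonoidalCategory C] [SymmetricCategory C]
  {M : Type v} [Category.{w} M] [MonoidalCategory M] [SymmetricCategory M] [MonoidalClosed M]
  (𝓜 : MGLModel R C M)

theorem lc_singleton {r s : R} (h : r = s) (X : GTy R) :
    lc 𝓜.ghyp (by rw [h] : [(r, X)] = [(s, X)]) =
      (eqToHom (by rw [h]) ▷ 𝟙_ C : (𝓜.gr r).obj (𝓜.gty X) ⊗ 𝟙_ C ⟶ (𝓜.gr s).obj (𝓜.gty X) ⊗ 𝟙_ C) := by
  subst h
  exact (MonoidalCategory.id_whiskerRight _ _).symm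

theorem cont_weak_left (r : R) (X : GTy R) :
    𝓜.gstep (.cont 0 r X) ≫ ten 𝓜.ghyp (𝓜.gstep (.weak X)) (𝟙 (tens 𝓜.ghyp [(r, X)])) =
      lc 𝓜.ghyp (by rw [zero_add] : [(0 + r, X)] = [(r, X)]) := by
  have e := ten_singleton_nil (f := 𝓜.ghyp) (a := (0, X)) (L := [(r, X)]) (L' := [(r, X)])
    (𝓜.weak (𝓜.gty X)) (𝟙 _)
  refine (congrArg (_ ≫ ·) e).trans ?_
  rw [𝓜.lc_singleton (zero_add r) X, ← 𝓜.contr_weak_left]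
  have k : ∀ {a b d : C} (c : a ⟶ b ⊗ d) (t : b ⟶ 𝟙_ C), (c ▷ 𝟙_ C ≫ (α_ _ _ _).hom) ≫
    (t ⊗ₘ 𝟙 (d ⊗ 𝟙_ C)) ≫ (λ_ (d ⊗ 𝟙_ C)).hom = (c ≫ t ▷ d ≫ (λ_ d).hom) ▷ 𝟙_ C := by
    intro a b d c t
    simp only [MonoidalCategory.tensorHom_def]
    monoidal
  exact k _ _

theorem cont_weak_right (r : R) (X : GTy R) :
    𝓜.gstep (.cont r 0 X) ≫ ten 𝓜.ghyp (𝟙 (tens 𝓜.ghyp [(r, X)])) (𝓜.gstep (.weak X)) =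
      lc 𝓜.ghyp (by rw [add_zero] : [(r + 0, X)] = [(r, X)]) := by
  have e := cons_ten (f := 𝓜.ghyp) (A := []) (r, X) (𝓜.gstep (.weak X))
  refine (congrArg (_ ≫ ·) (e.trans (congrArg (_ ◁ ·) (nil_ten (f := 𝓜.ghyp) _)))).trans ?_
  rw [𝓜.lc_singleton (add_zero r) X, ← 𝓜.contr_weak_right]
  have k : ∀ {a b d : C} (c : a ⟶ b ⊗ d) (t : d ⟶ 𝟙_ C), (c ▷ 𝟙_ C ≫ (α_ _ _ _).hom) ≫
    b ◁ ((ρ_ d).hom ≫ t) = (c ≫ b ◁ t ≫ (ρ_ b).hom) ▷ 𝟙_ C ≫ (b ◁ 𝟙 (𝟙_ C)) := by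
    intro a b d c t
    rw [MonoidalCategory.whiskerLeft_id]
    monoidal
  refine (k _ _).trans ?_
  rw [MonoidalCategory.whiskerLeft_id]
  exact Category.comp_id _

theorem cont_symm (r s : R) (X : GTy R) : 𝓜.gstep (.cont r s X) =
    lc 𝓜.ghyp (by rw [add_comm] : [(r + s, X)] = [(s + r, X)]) ≫ 𝓜.gstep (.cont s r X) ≫
      exch 𝓜.ghyp (r, X) (s, X) := by
  rw [𝓜.lc_singleton (add_comm r s) X]
  have k : ∀ {a a' b d : C} (e : a ⟶ a') (c : a' ⟶ d ⊗ b),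
    (e ≫ c ≫ (β_ d b).hom) ▷ 𝟙_ C ≫ (α_ b d (𝟙_ C)).hom = e ▷ 𝟙_ C ≫ (c ▷ 𝟙_ C ≫ (α_ _ _ _).hom) ≫
      (α_ d b (𝟙_ C)).inv ≫ (β_ d b).hom ▷ 𝟙_ C ≫ (α_ b d (𝟙_ C)).hom := by
    intros; simp
  refine Eq.trans ?_ (k _ _)
  exact congrArg (fun t => t ▷ 𝟙_ C ≫ (α_ _ _ (𝟙_ C)).hom) (𝓜.contr_symm r s (𝓜.gty X))

theorem cont_assoc (r s t : R) (X : GTy R) :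
    𝓜.gstep (.cont (r + s) t X) ≫ ten 𝓜.ghyp (𝓜.gstep (.cont r s X)) (𝟙 (tens 𝓜.ghyp [(t, X)])) =
      lc 𝓜.ghyp (by rw [add_assoc] : [(r + s + t, X)] = [(r + (s + t), X)]) ≫
        𝓜.gstep (.cont r (s + t) X) ≫
        ten 𝓜.ghyp (𝟙 (tens 𝓜.ghyp [(r, X)])) (𝓜.gstep (.cont s t X)) := by
  have e := cons_ten (f := 𝓜.ghyp) (A := []) (r, X) (𝓜.gstep (.cont s t X))
  have e' := e.trans (congrArg (_ ◁ ·) (nil_ten (f := 𝓜.ghyp) _))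
  have e1 := ten_singleton_pair (f := 𝓜.ghyp) (a := (r + s, X)) (b := (r, X)) (d := (s, X))
    (𝓜.contr r s (𝓜.gty X)) (𝟙 (tens 𝓜.ghyp [(t, X)]))
  refine (congrArg (_ ≫ ·) e1).trans ?_
  refine Eq.trans ?_ (congrArg₂ (· ≫ ·) (𝓜.lc_singleton (add_assoc r s t) X).symm
    (congrArg (_ ≫ ·) e'.symm))
  have h := 𝓜.contr_assoc r s t (𝓜.gty X)
  have k : ∀ {a a' b d e b' d' : C} (c : a ⟶ b ⊗ d) (c' : b ⟶ b' ⊗ d') (i : a ⟶ a')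
      (j : a' ⟶ b' ⊗ e) (j' : e ⟶ d' ⊗ d)
      (_ : c ≫ c' ▷ d ≫ (α_ _ _ _).hom = i ≫ j ≫ b' ◁ j'),
      (c ▷ 𝟙_ C ≫ (α_ _ _ _).hom) ≫ (c' ⊗ₘ 𝟙 (d ⊗ 𝟙_ C)) ≫ (α_ _ _ _).hom =
      i ▷ 𝟙_ C ≫ (j ▷ 𝟙_ C ≫ (α_ _ _ _).hom) ≫ b' ◁ (j' ▷ 𝟙_ C ≫ (α_ _ _ _).hom) := by
    intro a a' b d e b' d' c c' i j j' h
    have h' := congrArg (fun t => t ▷ 𝟙_ C ≫ (α_ _ _ (𝟙_ C)).hom ≫ b' ◁ (α_ _ _ _).hom) h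
    simp only [MonoidalCategory.tensorHom_def] at h' ⊢
    refine Eq.trans ?_ (h'.trans ?_) <;> monoidal
  exact k _ _ _ _ _ h

/-- The source of all conversions in the left premise of a graded cut: an operation on the context
of the premise reappears, scaled, on the context of the conclusion. -/
theorem cut_of_prom {s : R} {Δ Δ' : GCtx R} {X : GTy R} (Θ : GS Δ X) (Θ' : GS Δ' X)
    {g : 𝓜.gctx Δ' ⟶ 𝓜.gctx Δ} {g' : 𝓜.gctx (scale s Δ') ⟶ 𝓜.gctx (scale s Δ)}
    (h : 𝓜.Prom s g g') (e : 𝓜.gs Θ' = g ≫ 𝓜.gs Θ) :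
    𝓜.gstep (.cut s Θ') = g' ≫ 𝓜.gstep (.cut s Θ) := by
  unfold Prom at h
  rw [gstep_cut, gstep_cut, e, Functor.map_comp, Category.assoc, reassoc_of% h]
  rfl

theorem lc_singleton_eq {p q : R × GTy R} (h : p = q) (i : 𝓜.ghyp p ⟶ 𝓜.ghyp q)
    (hi : i = eqToHom (by rw [h])) : (i ▷ 𝟙_ C : tens 𝓜.ghyp [p] ⟶ tens 𝓜.ghyp [q]) =
      lc 𝓜.ghyp (by rw [h] : [p] = [q]) := by
  subst h hi
  exact MonoidalCategory.id_whiskerRight _ _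

theorem cut_id (r : R) (X : GTy R) : 𝓜.gstep (.cut r (.id X)) =
    lc 𝓜.ghyp (by simp [scale] : scale r [(1, X)] = [(r, X)]) := by
  refine (𝓜.gstep_cut r _).trans ?_
  have h : 𝓜.gs (.id X) = (ρ_ _).hom ≫ 𝓜.one (𝓜.gty X) := by rw [MGLModel.gs]; rfl
  have k : ((ρ_ _).hom ≫ 𝓜.mul r 1 (𝓜.gty X) ≫ (𝓜.gr r).map (ρ_ _).inv) ≫
      (𝓜.gr r).map ((ρ_ _).hom ≫ 𝓜.one (𝓜.gty X)) ≫ (ρ_ _).inv =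
      (eqToHom (by rw [mul_one]) ▷ 𝟙_ C :
        (𝓜.gr (r * 1)).obj (𝓜.gty X) ⊗ 𝟙_ C ⟶ (𝓜.gr r).obj (𝓜.gty X) ⊗ 𝟙_ C) := by
    rw [← Category.assoc, lax_one_step, mul_eq, one_eq, eqToHom_map, eqToHom_trans,
      Category.assoc, rightUnitor_inv_naturality, Iso.hom_inv_id_assoc]
  refine (congrArg₂ (fun t u => t ≫ (𝓜.gr r).map u ≫ (ρ_ _).inv)
    (𝓜.prom_singleton r 1 X) h).trans ?_
  refine k.trans ?_
  exact 𝓜.lc_singleton_eq (p := (r * 1, X)) (by rw [mul_one]) _ rfl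

/-- Promoting a concatenated context ends in the lax structure of r ⊙ -, and the left rule begins
with its inverse; once they cancel, the two cuts stand side by side. -/
theorem cut_ten (r : R) {Δ₁ Δ₂ : GCtx R} {X Y : GTy R} (Θ₁ : GS Δ₁ X) (Θ₂ : GS Δ₂ Y) :
    𝓜.gstep (.cut r (.tenR Θ₁ Θ₂)) ≫ 𝓜.gstep (.tenL r X Y) =
      lc 𝓜.ghyp (scale_append r Δ₁ Δ₂) ≫
        ten 𝓜.ghyp (𝓜.gstep (.cut r Θ₁)) (𝓜.gstep (.cut r Θ₂)) := by
  have h : 𝓜.gs (.tenR Θ₁ Θ₂) = (split 𝓜.ghyp Δ₁ Δ₂).hom ≫ (𝓜.gs Θ₁ ⊗ₘ 𝓜.gs Θ₂) := by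
    rw [MGLModel.gs]; rfl
  have k0 : 𝓜.prom r (Δ₁ ++ Δ₂) ≫ (𝓜.gr r).map ((split 𝓜.ghyp Δ₁ Δ₂).hom ≫
      (𝓜.gs Θ₁ ⊗ₘ 𝓜.gs Θ₂)) ≫ (ρ_ ((𝓜.gr r).obj (𝓜.gty X ⊗ 𝓜.gty Y))).inv =
      lc 𝓜.ghyp (scale_append r Δ₁ Δ₂) ≫
      (split 𝓜.ghyp (scale r Δ₁) (scale r Δ₂)).hom ≫ ((𝓜.prom r Δ₁ ≫ (𝓜.gr r).map (𝓜.gs Θ₁)) ⊗ₘ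
        (𝓜.prom r Δ₂ ≫ (𝓜.gr r).map (𝓜.gs Θ₂))) ≫ μ (𝓜.gr r) _ _ ≫ (ρ_ _).inv := by
    rw [Functor.map_comp, Category.assoc, ← Category.assoc, prom_append]
    simp only [Category.assoc, ← μ_natural_assoc, MonoidalCategory.tensorHom_comp_tensorHom_assoc]
  have h' := ((𝓜.gstep_cut r _).trans (congrArg (fun t => 𝓜.prom r (Δ₁ ++ Δ₂) ≫
    (𝓜.gr r).map t ≫ (ρ_ _).inv) h)).trans k0
  -- The hypothesis `m ≫ n = 𝟙` is where μ meets its inverse `nTen`; the rest is coherence of the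
  -- units.
  have k : ∀ {a b x y z : C} (g : a ⟶ x) (h : b ⟶ y) (m : x ⊗ y ⟶ z) (n : z ⟶ x ⊗ y)
      (_ : m ≫ n = 𝟙 _), (g ⊗ₘ h) ≫ m ≫ (ρ_ _).inv ≫ n ▷ 𝟙_ C ≫ (α_ x y (𝟙_ C)).hom =
        ((g ≫ (ρ_ x).inv) ⊗ₘ (h ≫ (ρ_ y).inv)) ≫ (α_ _ _ _).hom ≫ x ◁ (λ_ _).hom := by
    intro a b x y z g h m n e
    rw [← rightUnitor_inv_naturality_assoc, reassoc_of% e, ← MonoidalCategory.tensorHom_comp_tensorHom, Category.assoc]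
    congr 1
    simp only [MonoidalCategory.tensorHom_def]
    monoidal
  have k' := k (𝓜.prom r Δ₁ ≫ (𝓜.gr r).map (𝓜.gs Θ₁)) (𝓜.prom r Δ₂ ≫ (𝓜.gr r).map (𝓜.gs Θ₂))
    (μ (𝓜.gr r) _ _) (𝓜.nTen r _ _) (𝓜.μ_nTen r _ _)
  refine (congrArg (· ≫ _) h').trans ?_
  have k2 := congrArg (fun t => lc 𝓜.ghyp (scale_append r Δ₁ Δ₂) ≫
      (split 𝓜.ghyp (scale r Δ₁) (scale r Δ₂)).hom ≫ t) k'
  rw [ten, gstep_cut, gstep_cut]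
  simp only [Category.assoc] at k2
  have assoc : ∀ {a b c d e x y : C} (p : a ⟶ b) (q : b ⟶ c) (g : c ⟶ d) (m : d ⟶ e) (n : e ⟶ x)
      (o : x ⟶ y), (p ≫ q ≫ g ≫ m ≫ n) ≫ o = p ≫ q ≫ g ≫ m ≫ n ≫ o := by
    intros; simp only [Category.assoc]
  refine (assoc _ _ _ _ _ _).trans (k2.trans ?_)
  rfl

theorem cut_unit (r : R) : 𝓜.gstep (.cut r .unitR) ≫ 𝓜.gstep (.unitL r) =
    𝟙 (tens 𝓜.ghyp []) := by
  have h : 𝓜.gs .unitR = 𝟙 (𝟙_ C) := by rw [MGLModel.gs]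
  have k : (ε (𝓜.gr r) ≫ (𝓜.gr r).map (𝟙 (𝟙_ C)) ≫ (ρ_ _).inv) ≫ (ρ_ _).hom ≫ 𝓜.nUnit r =
      𝟙 (𝟙_ C) := by
    rw [CategoryTheory.Functor.map_id, Category.id_comp, Category.assoc, Iso.inv_hom_id_assoc,
      ε_nUnit]
  refine Eq.trans (congrArg (· ≫ _) ?_) k
  exact (𝓜.gstep_cut r _).trans (congrArg (fun t => ε (𝓜.gr r) ≫ (𝓜.gr r).map t ≫ (ρ_ _).inv) h)

/-- By naturality of `weak` the derivation disappears, leaving the weakening of its promoted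
context, to which `prom_weak` applies. -/
theorem cut_weak {Δ : GCtx R} {X : GTy R} (Θ : GS Δ X) :
    𝓜.gstep (.cut 0 Θ) ≫ 𝓜.gstep (.weak X) = weakMor 𝓜.gstep Δ := by
  rw [← prom_weak, ← 𝓜.weak_natural (𝓜.gs Θ)]
  have k : (𝓜.prom 0 Δ ≫ (𝓜.gr 0).map (𝓜.gs Θ) ≫ (ρ_ _).inv) ≫ (ρ_ _).hom ≫ 𝓜.weak (𝓜.gty X) =
      𝓜.prom 0 Δ ≫ (𝓜.gr 0).map (𝓜.gs Θ) ≫ 𝓜.weak (𝓜.gty X) := by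
    simp only [Category.assoc, Iso.inv_hom_id_assoc]
  exact (congrArg (· ≫ _) (𝓜.gstep_cut 0 Θ)).trans k

/-- Naturality of `contr` duplicates the derivation at the two grades, and `prom_contr` turns the
duplication of its context into hypothesis-wise contraction. -/
theorem cut_cont (r s : R) {Δ : GCtx R} {X : GTy R} (Θ : GS Δ X) :
    𝓜.gstep (.cut (r + s) Θ) ≫ 𝓜.gstep (.cont r s X) =
      contMor 𝓜.gstep r s Δ ≫ ten 𝓜.ghyp (𝓜.gstep (.cut r Θ)) (𝓜.gstep (.cut s Θ)) := by
  have h := 𝓜.prom_contr r s Δ =≫ ((𝓜.gr r).map (𝓜.gs Θ) ⊗ₘ (𝓜.gr s).map (𝓜.gs Θ))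
  rw [Category.assoc, ← 𝓜.contr_natural] at h
  have k : ∀ {a b x : C} (q : a ⟶ b) (c : b ⟶ x), (q ≫ (ρ_ _).inv) ≫ c ▷ 𝟙_ C = q ≫ c ≫ (ρ_ _).inv := by
    intros; simp
  have k' : (𝓜.prom (r + s) Δ ≫ (𝓜.gr (r + s)).map (𝓜.gs Θ) ≫ (ρ_ _).inv) ≫
      𝓜.contr r s (𝓜.gty X) ▷ 𝟙_ C ≫ (α_ _ _ _).hom =
      contMor 𝓜.gstep r s Δ ≫ (split 𝓜.ghyp (scale r Δ) (scale s Δ)).hom ≫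
        ((𝓜.prom r Δ ≫ (𝓜.gr r).map (𝓜.gs Θ) ≫ (ρ_ _).inv) ⊗ₘ
          (𝓜.prom s Δ ≫ (𝓜.gr s).map (𝓜.gs Θ) ≫ (ρ_ _).inv)) ≫ (α_ _ _ _).hom ≫ _ ◁ (λ_ _).hom := by
    have h' := h =≫ ((ρ_ _).inv ≫ (α_ _ _ (𝟙_ C)).hom)
    simp only [Category.assoc] at h'
    have e1 : 𝓜.contr r s (𝓜.gty X) ≫ (ρ_ _).inv ≫ (α_ _ _ (𝟙_ C)).hom = (ρ_ _).inv ≫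
      𝓜.contr r s (𝓜.gty X) ▷ 𝟙_ C ≫ (α_ _ _ _).hom := by simp
    rw [e1] at h'
    simp only [Category.assoc, h']
    congr 2
    simp only [← MonoidalCategory.tensorHom_comp_tensorHom, Category.assoc]
    congr 2
    simp only [MonoidalCategory.tensorHom_def]
    monoidal
  refine (congrArg (· ≫ _) (𝓜.gstep_cut (r + s) Θ)).trans (k'.trans ?_)
  rw [ten, gstep_cut, gstep_cut]
  rfl

end MGLModel

-- Multicuts and multiplication of grades

/-- The presheaf represented by `Z`. -/
def Psh.hom {C : Type v} [Category.{w} C] (Z : C) : Psh.{v, w, w} C where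
  obj X := X ⟶ Z
  res f g := f ≫ g
  res_id := Category.id_comp
  res_comp _ _ _ := Category.assoc _ _ _

section Lists
variable {C : Type v} [Category.{w} C] [MonoidalCategory C] {α : Type u} {f : α → C}

theorem lc_cut_contN {L L' L'' P P' Q Q' : List α} (a : L = L') (a' : L' = L'')
    (g : tens f L'' ⟶ tens f P) (b : P = P') (b' : P' = P) (c : tens f P ⟶ tens f Q) (d : Q = Q') :
    (lc f a ≫ lc f a' ≫ g ≫ lc f b) ≫ lc f b' ≫ c ≫ lc f d =
      lc f (a.trans a') ≫ (g ≫ c) ≫ lc f d := by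
  simp

/-- Pure bookkeeping, with the lists as variables so that only composites of casts have to be
compared. -/
theorem lc_cont_contN {L₁ L₂ L₃ L₄ L₅ L₆ L₇ L₈ L₉ T P P' Q Q' : List α}
    (a₁ : L₁ = L₂) (a₂ : L₂ = L₃) (a₃ : L₃ = L₄) (g : tens f L₄ ⟶ tens f L₅) (a₄ : L₅ = L₆)
    (a₅ : L₆ = L₇) (a₆ : L₇ = T ++ P) (b₁ : P = P') (c : tens f P' ⟶ tens f Q') (b₂ : Q' = Q)
    (a₇ : T ++ Q = L₈) (a₈ : L₈ = L₉) (e₁ : L₁ = L₄) (e₂ : L₅ = T ++ P') {L₁₀ : List α}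
    (e₃ : T ++ Q' = L₁₀) (e₄ : L₁₀ = L₉) :
    lc f a₁ ≫ (lc f a₂ ≫ lc f a₃ ≫ g ≫ lc f a₄) ≫ lc f a₅ ≫
      (lc f a₆ ≫ ten f (𝟙 (tens f T)) (lc f b₁ ≫ c ≫ lc f b₂) ≫ lc f a₇) ≫ lc f a₈ =
    lc f e₁ ≫ (lc f rfl ≫ g ≫ lc f e₂ ≫ ten f (𝟙 (tens f T)) c ≫ lc f e₃) ≫ lc f e₄ := by
  simp

end Lists

namespace MGLModel
open Functor.LaxMonoidal
variable {R : Type u} [Semiring R] [Preorder R] [AddLeftMono R] [MulLeftMono R] [MulRightMono R]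
  {C : Type v} [Category.{w} C] [MonoidalCategory C] [SymmetricCategory C]
  {M : Type v} [Category.{w} M] [MonoidalCategory M] [SymmetricCategory M] [MonoidalClosed M]
  (𝓜 : MGLModel R C M)

theorem gs_gleft (A D : GCtx R) {P Q : GCtx R} {Y : GTy R} (ρ : GStep P Q)
    (π : GS (A ++ (P ++ D)) Y) :
    𝓜.gs (.gleft A D ρ π) = inside 𝓜.ghyp (𝓜.gstep ρ) A D ≫ 𝓜.gs π := by
  rw [MGLModel.gs]

theorem gs_sub {Δ Δ' : GCtx R} {X : GTy R} (h : GLe Δ Δ') (π : GS Δ X) :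
    𝓜.gs (.sub h π) = 𝓜.gle h ≫ 𝓜.gs π := by
  rw [MGLModel.gs]

theorem gs_tr {Δ Δ' : GCtx R} {X : GTy R} (π : GS Δ X) (h : Δ = Δ') :
    𝓜.gs (π.tr h) = lc 𝓜.ghyp h.symm ≫ 𝓜.gs π :=
  sem_cast (Psh.hom (𝓜.gty X)) (F := fun Δ => GS Δ X) 𝓜.gs h π

theorem gs_mcut (A D : GCtx R) (ds : List R) {Δ : GCtx R} {X Y : GTy R} (Θ : GS Δ X)
    (π : GS (A ++ (rep ds X ++ D)) Y) :
    𝓜.gs (GS.mcut A D ds Θ π) = inside 𝓜.ghyp (mcutMor 𝓜.gstep ds Θ) A D ≫ 𝓜.gs π :=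
  sem_mcut 𝓜.gstep (Psh.hom (𝓜.gty Y)) (F := fun Δ => GS Δ Y) 𝓜.gs (step := GS.step Y)
    (fun A D _ _ ρ π => 𝓜.gs_gleft A D ρ π) A D ds Θ π

theorem cont_congr {r s t : R} (X : GTy R) (h : s = t) : 𝓜.gstep (.cont r s X) =
    lc 𝓜.ghyp (by rw [h] : [(r + s, X)] = [(r + t, X)]) ≫ 𝓜.gstep (.cont r t X) ≫
      lc 𝓜.ghyp (by rw [h] : [(r, X), (t, X)] = [(r, X), (s, X)]) := by
  subst h; simp

theorem cut_congr {r s : R} (h : r = s) {Δ : GCtx R} {X : GTy R} (Θ : GS Δ X) :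
    𝓜.gstep (.cut r Θ) =
    lc 𝓜.ghyp (by rw [h] : scale r Δ = scale s Δ) ≫ 𝓜.gstep (.cut s Θ) ≫
      lc 𝓜.ghyp (by rw [h] : [(s, X)] = [(r, X)]) := by
  subst h; simp

theorem scale_rep (s : R) (ds : List R) (X : GTy R) :
    scale s (rep ds X) = rep (ds.map (s * ·)) X := by simp [scale, rep, Function.comp_def]

/-- An n-ary contraction is an iteration of binary ones, each scaled by `prom_gstep`; closure of
`Prom` under composition and concatenation does the rest. -/
theorem prom_contN (s : R) (X : GTy R) (ds : List R) :
    𝓜.Prom s (contNMor 𝓜.gstep X ds)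
      (lc 𝓜.ghyp (by simp [scale, sum_map_mul] :
          scale s [(ds.sum, X)] = [((ds.map (s * ·)).sum, X)]) ≫
        contNMor 𝓜.gstep X (ds.map (s * ·)) ≫ lc 𝓜.ghyp (scale_rep s ds X).symm) := by
  induction ds with
  | nil =>
    have h := 𝓜.prom_gstep s (.weak X)
    rw [gstep_smul_weak] at h
    exact h.trans (congrArg (· ≫ _) (congrArg (_ ≫ ·) (Category.comp_id _).symm))
  | cons d ds ih =>
    have h1 := 𝓜.prom_gstep s (.cont d ds.sum X)
    -- Scaling gives the second hypothesis the grade `s * ds.sum`, whereas the induction hypothesis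
    -- yields the sum of the scaled list; distributivity identifies the two.
    rw [gstep_smul_cont, 𝓜.cont_congr X (sum_map_mul s ds).symm] at h1
    have h := (Prom.lc (𝓜 := 𝓜) s (by simp : [((d :: ds).sum, X)] = [(d + ds.sum, X)])).comp
      (h1.comp ((Prom.lc s (by rfl : [(d, X), (ds.sum, X)] = [(d, X)] ++ [(ds.sum, X)])).comp
        (((Prom.id s [(d, X)]).ten ih).comp
          (Prom.lc s (by rfl : [(d, X)] ++ rep ds X = rep (d :: ds) X)))))
    unfold Prom at h ⊢
    refine h.trans (congrArg (· ≫ _) ?_)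
    exact lc_cont_contN (f := 𝓜.ghyp) _ _ _ _ _ _ _ _ _ _ _ _ _ _ _ _

theorem prom_mcut (s : R) (ds : List R) {Δ : GCtx R} {X : GTy R} (Θ : GS Δ X) :
    𝓜.Prom s (mcutMor 𝓜.gstep ds Θ)
      (lc 𝓜.ghyp (by simp [scale, sum_map_mul, mul_assoc, Function.comp_def] :
          scale s (scale ds.sum Δ) = scale (ds.map (s * ·)).sum Δ) ≫
        mcutMor 𝓜.gstep (ds.map (s * ·)) Θ ≫ lc 𝓜.ghyp (scale_rep s ds X).symm) := by
  have h := 𝓜.prom_gstep s (.cut ds.sum Θ)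
  rw [gstep_smul_cut, 𝓜.cut_congr (sum_map_mul s ds).symm] at h
  have h' := h.comp (𝓜.prom_contN s X ds)
  exact h'.trans (congrArg (· ≫ _) (lc_cut_contN (f := 𝓜.ghyp) _ _ _ _ _ _ _))

theorem prom_inside {s : R} {P Q : GCtx R} {g : 𝓜.gctx P ⟶ 𝓜.gctx Q}
    {g' : 𝓜.gctx (scale s P) ⟶ 𝓜.gctx (scale s Q)} (h : 𝓜.Prom s g g') (A D : GCtx R) :
    𝓜.Prom s (inside 𝓜.ghyp g A D)
      (lc 𝓜.ghyp (by simp [scale_append]) ≫ inside 𝓜.ghyp g' (scale s A) (scale s D) ≫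
        lc 𝓜.ghyp (by simp [scale_append])) := by
  have := (Prom.id s A).ten (h.ten (Prom.id s D))
  rw [inside_eq, inside_eq]
  simpa using this

end MGLModel

-- Commuting, nested and parallel actions on blocks

section Lists
variable {C : Type v} [Category.{w} C] [MonoidalCategory C] {α : Type u} {f : α → C}

theorem inside_comm (A B D : List α) {P Q S T : List α} (g : tens f P ⟶ tens f Q)
    (m : tens f S ⟶ tens f T) :
    inside f m (A ++ (P ++ B)) D ≫ lc f (by simp) ≫ inside f g A (B ++ (T ++ D)) =
      lc f (by simp) ≫ inside f g A (B ++ (S ++ D)) ≫ lc f (by simp) ≫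
        inside f m (A ++ (Q ++ B)) D ≫ lc f (by simp) := by
  have e := congrArg (ten f (𝟙 (tens f A)))
    (ten_exchange g (ten f (𝟙 (tens f B)) (ten f m (𝟙 (tens f D)))))
  simp only [inside_eq]
  simp at e ⊢
  rw [e]

theorem inside_comm' (A B D : List α) {P Q S T : List α} (g : tens f P ⟶ tens f Q)
    (m : tens f S ⟶ tens f T) :
    inside f g A (B ++ (S ++ D)) ≫ lc f (by simp) ≫ inside f m (A ++ (Q ++ B)) D ≫
        lc f (by simp) =
      lc f (by simp) ≫ inside f m (A ++ (P ++ B)) D ≫ lc f (by simp) ≫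
        inside f g A (B ++ (T ++ D)) := by
  rw [inside_comm]
  simp

/-- An operation inside the context of a cut's left premise and the cut itself form one action on
the larger block. The equalities of lists are parameters because scaled contexts decompose only
propositionally. -/
theorem inside_nest (A B E D : List α) {P P' Q Q' S S' T : List α} (m : tens f P ⟶ tens f Q)
    (c : tens f T ⟶ tens f S) (h₁ : P' = P) (h₂ : Q = Q') (h₃ : B ++ (Q' ++ E) = T)
    (h₄ : S' = B ++ (P' ++ E)) :
    inside f m (A ++ B) (E ++ D) ≫ lc f (by simp [← h₃, h₂]) ≫ inside f c A D =
      lc f (by simp [h₁, h₄]) ≫ inside f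
        ((lc f h₄ ≫ inside f (lc f h₁ ≫ m ≫ lc f h₂) B E ≫ lc f h₃) ≫ c) A D := by
  subst h₁ h₂ h₃ h₄
  simp [inside_eq]

/-- The common shape of the principal cut for ⊠ and of the cut against a contraction: two
consecutive steps become a rearrangement `k` of the context followed by two independent cuts. -/
theorem inside_two (A D : List α) {P Q S T : List α} {p q : α} (g : tens f T ⟶ tens f S)
    (h : tens f S ⟶ tens f [p, q]) (k : tens f T ⟶ tens f (P ++ Q))
    (a : tens f P ⟶ tens f [p]) (b : tens f Q ⟶ tens f [q])
    (e : g ≫ h = k ≫ ten f a b) :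
    inside f g A D ≫ inside f h A D = inside f k A D ≫ lc f (by simp) ≫
      inside f b (A ++ P) D ≫ lc f (by simp) ≫ inside f a A ([q] ++ D) := by
  have e' := congrArg (fun t => ten f (𝟙 (tens f A)) (ten f t (𝟙 (tens f D)))) e
  have e2 := ten_eq a b
  rw [ten_exchange] at e2
  rw [e2] at e'
  simp only [inside_eq]
  simpa using e'

variable [SymmetricCategory C]

theorem inside_exch_left (A D : List α) {S : List α} {p q : α} (c : tens f S ⟶ tens f [p]) :
    inside f c (A ++ [q]) D ≫ lc f (by simp) ≫ inside f (exch f p q) A D =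
      lc f (by simp) ≫ ten f (𝟙 (tens f A))
        (lc f (by simp : [q] ++ (S ++ D) = ([q] ++ S) ++ D) ≫ ten f (br f [q] S) (𝟙 (tens f D)) ≫
        lc f (by simp : (S ++ [q]) ++ D = S ++ ([q] ++ D))) ≫ inside f c A ([q] ++ D) := by
  have e := congrArg (fun t => ten f (𝟙 (tens f A)) (ten f t (𝟙 (tens f D))))
    (ten_br (𝟙 (tens f [q])) c)
  simp only [inside_eq, exch_eq]
  simp at e ⊢
  rw [e]

theorem inside_exch_right (A D : List α) {S : List α} {p q : α} (c : tens f S ⟶ tens f [p]) :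
    inside f c A ([q] ++ D) ≫ inside f (exch f q p) A D =
      ten f (𝟙 (tens f A)) (lc f (by simp : S ++ ([q] ++ D) = (S ++ [q]) ++ D) ≫
        ten f (br f S [q]) (𝟙 (tens f D)) ≫
        lc f (by simp : ([q] ++ S) ++ D = [q] ++ (S ++ D))) ≫ lc f (by simp) ≫
        inside f c (A ++ [q]) D ≫ lc f (by simp) := by
  have e := congrArg (fun t => ten f (𝟙 (tens f A)) (ten f t (𝟙 (tens f D))))
    (ten_br c (𝟙 (tens f [q])))
  simp only [inside_eq, exch_eq]
  simp at e ⊢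
  rw [← e]
  simp

end Lists

-- Soundness of the equations on graded contexts

namespace MGLModel
open Functor.LaxMonoidal
variable {R : Type u} [Semiring R] [Preorder R] [AddLeftMono R] [MulLeftMono R] [MulRightMono R]
  {C : Type v} [Category.{w} C] [MonoidalCategory C] [SymmetricCategory C]
  {M : Type v} [Category.{w} M] [MonoidalCategory M] [SymmetricCategory M] [MonoidalClosed M]
  (𝓜 : MGLModel R C M)

theorem inside_congr {P Q : GCtx R} {g g' : 𝓜.gctx P ⟶ 𝓜.gctx Q} (h : g = g') (A D : GCtx R) :
    ten 𝓜.ghyp (𝟙 (tens 𝓜.ghyp A)) (ten 𝓜.ghyp g (𝟙 (tens 𝓜.ghyp D))) =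
      ten 𝓜.ghyp (𝟙 (tens 𝓜.ghyp A)) (ten 𝓜.ghyp g' (𝟙 (tens 𝓜.ghyp D))) := by rw [h]

/-- Only the action of steps and approximations by restriction along their interpretation in C is
used, not which calculus the derivations belong to. Graded derivations use a representable presheaf,
mixed ones use `mnyPsh`. Each case places an equation on the hypotheses concerned into the
surrounding context. -/
theorem ax_sound (H : Psh.{v, w, w'} C) {F : GCtx R → Type u}
    (sem : ∀ {L : GCtx R}, F L → H.obj (tens 𝓜.ghyp L))
    {step : ∀ (A D : GCtx R) {P Q : GCtx R}, GStep P Q → F (A ++ (P ++ D)) → F (A ++ (Q ++ D))}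
    {sub : ∀ {Δ Δ' : GCtx R}, GLe Δ Δ' → F Δ → F Δ'}
    (hstep : ∀ (A D : GCtx R) {P Q : GCtx R} (ρ : GStep P Q) (π : F (A ++ (P ++ D))),
      sem (step A D ρ π) = H.res (inside 𝓜.ghyp (𝓜.gstep ρ) A D) (sem π))
    (hsub : ∀ {Δ Δ' : GCtx R} (h : GLe Δ Δ') (π : F Δ), sem (sub h π) = H.res (𝓜.gle h) (sem π))
    {Δ : GCtx R} {π π' : F Δ} (e : Ax step sub π π') : sem π = sem π' := by
  have hmcut := @sem_mcut R _ _ C _ _ _ 𝓜.ghyp 𝓜.gstep H F @sem @step hstep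
  have hswap := @sem_gswap R _ _ C _ _ _ 𝓜.ghyp 𝓜.gstep H F @sem @step hstep (fun _ _ => rfl)
  have htr := @sem_tr R _ _ C _ _ _ 𝓜.ghyp H F @sem
  cases e with
  | contUnitL A D r X π =>
    have e := 𝓜.inside_congr (𝓜.cont_weak_left r X) A D
    rw [hstep, hstep, htr, ← H.res_comp]
    congr 1
    simpa [inside_eq] using e
  | contUnitR A D r X π =>
    have e := 𝓜.inside_congr (𝓜.cont_weak_right r X) A D
    rw [hstep, htr, hstep, htr, htr, ← H.res_comp, ← H.res_comp, ← H.res_comp]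
    congr 1
    simpa [inside_eq] using e
  | contSym A D r s X π =>
    have e := 𝓜.inside_congr (𝓜.cont_symm r s X) A D
    rw [hstep, htr, hstep, hstep, ← H.res_comp, ← H.res_comp]
    congr 1
    have h : 𝓜.gstep (.ex (r, X) (s, X)) = exch 𝓜.ghyp (r, X) (s, X) := rfl
    rw [h]
    simpa [inside_eq] using e
  | contAssoc A D r s t X π =>
    have e := 𝓜.inside_congr (𝓜.cont_assoc r s t X) A D
    rw [hstep, hstep, htr, hstep, htr, hstep, htr, ← H.res_comp, ← H.res_comp, ← H.res_comp, ← H.res_comp, ← H.res_comp]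
    congr 1
    simpa [inside_eq] using e
  | exEx A D p q π =>
    rw [hstep, hstep, ← H.res_comp]
    have e : 𝓜.gstep (.ex q p) ≫ 𝓜.gstep (.ex p q) = 𝟙 _ := by
      refine (congrArg₂ (· ≫ ·) (exch_eq (f := 𝓜.ghyp) q p) (exch_eq (f := 𝓜.ghyp) p q)).trans ?_
      exact br_br [p] [q]
    have e' := 𝓜.inside_congr e A D
    refine (congrArg (fun t => H.res t (sem π)) ?_).trans (H.res_id _)
    simpa [inside_eq] using e'
  | subRefl h π => rw [hsub, gle_self, H.res_id]
  | subTrans h h' π => rw [hsub, hsub, hsub, gle_trans, H.res_comp]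
  | subStep h h' ρ π =>
    rw [hstep, hsub, hsub, hstep, ← H.res_comp, ← H.res_comp]
    congr 1
    simp only [gle_append, gle_self, inside_eq, ten_comp, Category.id_comp, Category.comp_id]
  | contMono A D X h h' π =>
    rw [hstep, hsub, hsub, hstep, ← H.res_comp, ← H.res_comp]
    congr 1
    have e := 𝓜.inside_congr (𝓜.single_cont h h' X) A D
    rw [gle_inside, gle_inside]
    simpa [inside_eq] using e.symm
  | subUnitL A D h π =>
    rw [hstep, hsub, hstep, ← H.res_comp]
    congr 1
    have e := 𝓜.inside_congr (𝓜.single_unitL h) A D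
    rw [gle_inside]
    simpa [inside_eq] using e
  | subTenL A D X Y h π =>
    rw [hstep, hsub, hstep, hsub, ← H.res_comp, ← H.res_comp]
    congr 1
    have e := 𝓜.inside_congr (𝓜.single_tenL h X Y) A D
    rw [gle_inside, gle_inside]
    simpa [inside_eq] using e
  | multMono A D h h' Θ π =>
    rename_i X
    rw [hstep, hsub, hsub, hstep, ← H.res_comp, ← H.res_comp]
    congr 1
    have e := 𝓜.inside_congr (𝓜.scale_cut h h' Θ) A D
    rw [gle_inside, gle_inside]
    simpa [inside_eq] using e.symm
  | mcutStepL A B D ds ρ Θ π =>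
    rw [hmcut]
    erw [htr]
    rw [hstep]
    erw [htr]
    rw [hstep]
    erw [htr]
    rw [hmcut]
    erw [htr]
    simp only [← H.res_comp]
    exact congrArg (fun t => H.res t (sem π)) (inside_comm A B D (𝓜.gstep ρ) _)
  | mcutStepR A B D ds ρ Θ π =>
    rw [hmcut]
    erw [htr]
    rw [hstep]
    erw [htr, htr]
    rw [hstep]
    erw [htr]
    rw [hmcut]
    simp only [← H.res_comp]
    exact congrArg (fun t => H.res t (sem π)) (inside_comm' A B D _ (𝓜.gstep ρ))
  | mcutCut A B C D s ds Θ₁ Θ₂ π =>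
    -- The multicut inside the left premise is pulled out of s ⊙ - by `prom_mcut`, which multiplies
    -- its grades by `s`.
    have e := 𝓜.cut_of_prom Θ₂ (GS.mcut B C ds Θ₁ Θ₂)
      (𝓜.prom_inside (𝓜.prom_mcut s ds Θ₁) B C) (𝓜.gs_mcut B C ds Θ₁ Θ₂)
    rw [hmcut]
    erw [htr]
    rw [hstep]
    erw [htr]
    rw [hstep, e]
    simp only [← H.res_comp]
    exact congrArg (fun t => H.res t (sem π)) (inside_nest A (scale s B) (scale s C) D _ _ _ _ _ _)
  | cutId A D r X π =>
    have e := 𝓜.inside_congr (𝓜.cut_id r X) A D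
    rw [hstep, htr]
    congr 1
    simpa [inside_eq] using e
  | cutTen A D r Θ₁ Θ₂ π =>
    rw [hstep, hstep]
    erw [htr]
    rw [hstep]
    erw [htr]
    rw [hstep]
    simp only [← H.res_comp]
    refine congrArg (fun t => H.res t (sem π)) ((inside_two A D _ _ _ _ _
      (𝓜.cut_ten r Θ₁ Θ₂)).trans ?_)
    rw [inside_eq, ten_lc_id, ten_id_lc, lc_lc_assoc]
  | cutUnit A D r π =>
    have e := 𝓜.inside_congr (𝓜.cut_unit r) A D
    rw [hstep, hstep]
    erw [htr]
    rw [← H.res_comp]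
    refine congrArg (fun t => H.res t (sem π)) ?_
    have e' : inside 𝓜.ghyp (𝓜.gstep (.cut r .unitR)) A D ≫
        inside 𝓜.ghyp (𝓜.gstep (.unitL r)) A D = 𝟙 (tens 𝓜.ghyp (A ++ ([] ++ D))) := by
      simp only [inside_eq]
      rw [ten_comp, Category.comp_id, ten_comp, Category.comp_id]
      exact e.trans ((congrArg _ (ten_id [] D)).trans (ten_id A _))
    exact e'.trans (lc_self _ _).symm
  | cutWeak A D Θ π =>
    have e := 𝓜.inside_congr (𝓜.cut_weak Θ) A D
    rw [hstep, hstep, ← H.res_comp, sem_weakBlock 𝓜.gstep H sem hstep]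
    congr 1
    simpa [inside_eq] using e
  | cutCont A D r s Θ π =>
    rw [hstep, hstep, sem_contBlock 𝓜.gstep H sem hstep (fun _ _ => rfl)]
    erw [htr]
    rw [hstep]
    erw [htr]
    rw [hstep]
    simp only [← H.res_comp]
    refine congrArg (fun t => H.res t (sem π)) ((inside_two A D _ _ _ _ _
      (𝓜.cut_cont r s Θ)).trans ?_)
    simp only [Category.assoc]
    congr 1
    exact (lc_lc_assoc _ _ _ _).symm
  | cutExL A D r q Θ π =>
    rw [hstep]
    erw [htr]
    rw [hstep]
    erw [htr]
    rw [hswap]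
    erw [htr]
    rw [hstep]
    simp only [← H.res_comp]
    refine congrArg (fun t => H.res t (sem π)) ((inside_exch_left A D _).trans ?_)
    rw [lc_self]
    exact congrArg (lc 𝓜.ghyp _ ≫ ·) (congrArg (ten 𝓜.ghyp _ _ ≫ ·) (Category.id_comp _).symm)
  | cutExR A D r q Θ π =>
    rw [hstep, hstep, hswap]
    erw [htr]
    rw [hstep]
    erw [htr]
    simp only [← H.res_comp]
    exact congrArg (fun t => H.res t (sem π)) (inside_exch_right A D _)
  | cutStep A B C D s ρ Θ π =>
    rename_i P Q Y
    have e := 𝓜.cut_of_prom Θ (.gleft B C ρ Θ)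
      (𝓜.prom_inside (𝓜.prom_gstep s ρ) B C) (𝓜.gs_gleft B C ρ Θ)
    rw [hstep]
    erw [htr]
    rw [hstep]
    erw [htr]
    rw [hstep, e]
    simp only [← H.res_comp]
    refine congrArg (fun t => H.res t (sem π)) ?_
    -- Unlike in the multicut case, the inner step carries no casts of its own, so two of the
    -- equalities are trivial and the resulting identities are removed.
    have k := inside_nest (f := 𝓜.ghyp) A (scale s B) (scale s C) D (𝓜.gstep (ρ.smul s))
      (𝓜.gstep (.cut s Θ)) rfl rfl (by simp [scale_append]) (by simp [scale_append] :
        scale s (B ++ (Q ++ C)) =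
        scale s B ++ (scale s Q ++ scale s C))
    rw [lc_self, lc_self, Category.id_comp, Category.comp_id] at k
    refine Eq.trans ?_ (congrArg (lc 𝓜.ghyp (by simp [scale_append]) ≫ ·) k.symm)
    rw [lc_lc_assoc]
    exact (Category.id_comp _).symm

end MGLModel

-- Boxes and cuts in a single list

section Boxes
variable {C : Type v} [Category.{w} C] [MonoidalCategory C] {α : Type u} {f : α → C}

@[simp] theorem ten_append_append₂ {P Q : List α} (g : tens f P ⟶ tens f Q) (A B D E : List α) :
    ten f g (𝟙 (tens f (A ++ ((B ++ D) ++ E)))) = lc f (by simp) ≫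
      ten f g (𝟙 (tens f (A ++ (B ++ (D ++ E))))) ≫ lc f (by simp) :=
  ten_id_congr g (by simp)

/-- Used, with `comp_lc_eq`, to strip the casts off the ends of one side of an interchange equation,
so that this side occurs literally inside a longer composite. -/
theorem lc_comp_eq {L L' : List α} {Z : C} (h : L = L') (x : tens f L' ⟶ Z) (y : tens f L ⟶ Z) :
    lc f h ≫ x = y ↔ x = lc f h.symm ≫ y := by
  subst h; simp

theorem comp_lc_eq {L L' : List α} {Z : C} (h : L = L') (x : Z ⟶ tens f L) (y : Z ⟶ tens f L') :
    x ≫ lc f h = y ↔ x = y ≫ lc f h.symm := by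
  subst h; simp

/-- `g` applied to the block `P` of a list, followed by `y`. -/
def boxM (A D : List α) {P Q L L' : List α} {Z : C} (h : L = A ++ (P ++ D))
    (g : tens f P ⟶ tens f Q) (k : A ++ (Q ++ D) = L') (y : tens f L' ⟶ Z) : tens f L ⟶ Z :=
  lc f h ≫ ten f (𝟙 (tens f A)) (ten f g (𝟙 (tens f D))) ≫ lc f k ≫ y

@[simp] theorem lc_boxM (A D : List α) {P Q L L' L'' : List α} {Z : C} (e : L'' = L)
    (h : L = A ++ (P ++ D)) (g : tens f P ⟶ tens f Q) (k : A ++ (Q ++ D) = L')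
    (y : tens f L' ⟶ Z) : lc f e ≫ boxM A D h g k y = boxM A D (e.trans h) g k y := by
  simp [boxM]

@[simp] theorem boxM_lc (A D : List α) {P Q L L' L'' : List α} {Z : C}
    (h : L = A ++ (P ++ D)) (g : tens f P ⟶ tens f Q) (k : A ++ (Q ++ D) = L') (e : L' = L'')
    (y : tens f L'' ⟶ Z) : boxM A D h g k (lc f e ≫ y) = boxM A D h g (k.trans e) y := by
  simp [boxM]

@[simp] theorem boxM_comp (A D : List α) {P Q L L' : List α} {Z Z' : C}
    (h : L = A ++ (P ++ D)) (g : tens f P ⟶ tens f Q) (k : A ++ (Q ++ D) = L')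
    (y : tens f L' ⟶ Z) (z : Z ⟶ Z') : boxM A D h g k y ≫ z = boxM A D h g k (y ≫ z) := by
  simp [boxM]

theorem boxM_eq_lc (A D : List α) {P Q L L' : List α} {Z : C} (h : L = A ++ (P ++ D))
    (e : P = Q) (k : A ++ (Q ++ D) = L') (y : tens f L' ⟶ Z) :
    boxM A D h (lc f e) k y = lc f (by rw [h, e, k]) ≫ y := by
  subst e k; simp [boxM]

theorem boxM_lc_comp (A D : List α) {P P' Q L L' : List α} {Z : C} (h : L = A ++ (P ++ D))
    (e : P = P') (g : tens f P' ⟶ tens f Q) (k : A ++ (Q ++ D) = L') (y : tens f L' ⟶ Z) :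
    boxM A D h (lc f e ≫ g) k y = boxM A D (by rw [h, e]) g k y := by
  subst e; simp [boxM]

theorem boxM_comp_lc (A D : List α) {P Q Q' L L' : List α} {Z : C} (h : L = A ++ (P ++ D))
    (g : tens f P ⟶ tens f Q) (e : Q = Q') (k : A ++ (Q' ++ D) = L') (y : tens f L' ⟶ Z) :
    boxM A D h (g ≫ lc f e) k y = boxM A D h g (by rw [e, k]) y := by
  subst e; simp [boxM]

theorem boxM_boxM (A D : List α) {P Q S L L' L'' : List α} {Z : C} (h : L = A ++ (P ++ D))
    (g : tens f P ⟶ tens f Q) (k : A ++ (Q ++ D) = L'') (h' : L'' = A ++ (Q ++ D))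
    (g' : tens f Q ⟶ tens f S) (k' : A ++ (S ++ D) = L') (y : tens f L' ⟶ Z) :
    boxM A D h g k (boxM A D h' g' k' y) = boxM A D h (g ≫ g') k' y := by
  subst h k k'; simp [boxM]

theorem boxM_ten (A D : List α) {P P' Q Q' L L' : List α} {Z : C}
    (h : L = A ++ ((P ++ P') ++ D)) (g : tens f P ⟶ tens f Q) (g' : tens f P' ⟶ tens f Q')
    (k : A ++ ((Q ++ Q') ++ D) = L') (y : tens f L' ⟶ Z) :
    boxM A D h (ten f g g') k y = boxM A (P' ++ D) (by simp [h]) g rfl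
      (boxM (A ++ Q) D (by simp) g' (by simp [← k]) y) := by
  subst h k; rw [ten_eq]; simp [boxM]

theorem boxM_comm (A B D : List α) {P Q S T L L' L'' : List α} {Z : C} (g : tens f P ⟶ tens f Q)
    (m : tens f S ⟶ tens f T) (h : L = A ++ (P ++ (B ++ (S ++ D))))
    (k : A ++ (Q ++ (B ++ (S ++ D))) = L'') (h' : L'' = (A ++ (Q ++ B)) ++ (S ++ D))
    (k' : (A ++ (Q ++ B)) ++ (T ++ D) = L') (y : tens f L' ⟶ Z) :
    boxM A (B ++ (S ++ D)) h g k (boxM (A ++ (Q ++ B)) D h' m k' y) =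
      boxM (A ++ (P ++ B)) D (by simp [h]) m rfl
        (boxM A (B ++ (T ++ D)) (by simp) g (by simp [← k']) y) := by
  subst h k k'
  have e := congrArg (ten f (𝟙 (tens f A)))
    (ten_exchange g (ten f (𝟙 (tens f B)) (ten f m (𝟙 (tens f D)))))
  simp at e
  simp [boxM, reassoc_of% e]

theorem boxM_nest (A B E D : List α) {P Q L L' K K' T : List α} {Z : C} (h : L = A ++ (K ++ D))
    (hm : K = B ++ (P ++ E)) (m : tens f P ⟶ tens f Q) (km : B ++ (Q ++ E) = K')
    (c : tens f K' ⟶ tens f T) (k : A ++ (T ++ D) = L') (y : tens f L' ⟶ Z) :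
    boxM A D h (boxM B E hm m km c) k y =
      boxM (A ++ B) (E ++ D) (by simp [h, hm]) m rfl
        (boxM A D (by simp [← km]) c k y) := by
  subst h hm km k
  simp [boxM]

variable [SymmetricCategory C]

/-- `x` applied to the blocks `D₂` and `G₂`, which are brought together by the symmetry, followed
by `y`. -/
def cutM (D₁ D₂ G₁ G₂ G₃ : List α) {A K L L' : List α} {Z : C}
    (h : L = (D₁ ++ D₂) ++ (G₁ ++ (G₂ ++ G₃))) (hx : D₂ ++ G₂ = K) (x : tens f K ⟶ tens f A)
    (k : D₁ ++ (G₁ ++ (A ++ G₃)) = L') (y : tens f L' ⟶ Z) : tens f L ⟶ Z :=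
  boxM D₁ (G₂ ++ G₃) (by simp [h] : L = D₁ ++ ((D₂ ++ G₁) ++ (G₂ ++ G₃))) (br f D₂ G₁) rfl
    (boxM (D₁ ++ G₁) G₃ (by simp [← hx] : _ = (D₁ ++ G₁) ++ (K ++ G₃)) x (by simp [← k]) y)

@[simp] theorem lc_cutM (D₁ D₂ G₁ G₂ G₃ : List α) {A K L L' L'' : List α} {Z : C} (e : L'' = L)
    (h : L = (D₁ ++ D₂) ++ (G₁ ++ (G₂ ++ G₃))) (hx : D₂ ++ G₂ = K) (x : tens f K ⟶ tens f A)
    (k : D₁ ++ (G₁ ++ (A ++ G₃)) = L') (y : tens f L' ⟶ Z) :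
    lc f e ≫ cutM D₁ D₂ G₁ G₂ G₃ h hx x k y = cutM D₁ D₂ G₁ G₂ G₃ (e.trans h) hx x k y := by
  simp [cutM]

@[simp] theorem cutM_lc (D₁ D₂ G₁ G₂ G₃ : List α) {A K L L' L'' : List α} {Z : C}
    (h : L = (D₁ ++ D₂) ++ (G₁ ++ (G₂ ++ G₃))) (hx : D₂ ++ G₂ = K) (x : tens f K ⟶ tens f A)
    (k : D₁ ++ (G₁ ++ (A ++ G₃)) = L') (e : L' = L'') (y : tens f L'' ⟶ Z) :
    cutM D₁ D₂ G₁ G₂ G₃ h hx x k (lc f e ≫ y) = cutM D₁ D₂ G₁ G₂ G₃ h hx x (k.trans e) y := by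
  simp [cutM]

/-- Associativity of cut. By the hexagons both sides perform the same block moves, up to one
interchange: carrying `D₂` past `G₁` is independent of carrying `D₃` past `G₂` and applying `x`. -/
theorem cutM_cutM (D₁ D₂ D₃ G₁ G₂ G₃ G₄ G₅ : List α) {A B K K' L L' L'' : List α} {Z : C}
    (h : L = ((D₁ ++ D₂) ++ D₃) ++ ((G₁ ++ G₂) ++ (G₃ ++ (G₄ ++ G₅)))) (hx : D₃ ++ G₃ = K)
    (x : tens f K ⟶ tens f A) (k : (D₁ ++ D₂) ++ ((G₁ ++ G₂) ++ (A ++ (G₄ ++ G₅))) = L')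
    (h' : L' = (D₁ ++ D₂) ++ (G₁ ++ ((G₂ ++ (A ++ G₄)) ++ G₅)))
    (hx' : D₂ ++ (G₂ ++ (A ++ G₄)) = K') (x' : tens f K' ⟶ tens f B)
    (k' : D₁ ++ (G₁ ++ (B ++ G₅)) = L'') (y : tens f L'' ⟶ Z) :
    cutM (D₁ ++ D₂) D₃ (G₁ ++ G₂) G₃ (G₄ ++ G₅) h hx x k
        (cutM D₁ D₂ G₁ (G₂ ++ (A ++ G₄)) G₅ h' hx' x' k' y) =
      cutM D₁ (D₂ ++ D₃) G₁ (G₂ ++ (G₃ ++ G₄)) G₅ (by simp [h]) rfl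
        (cutM D₂ D₃ G₂ G₃ G₄ rfl hx x hx' x') k' y := by
  subst h hx k hx' k'
  have e := congrArg (ten f (𝟙 (tens f D₁))) (ten_exchange (br f D₂ G₁)
    ((lc f (by simp) ≫ ten f (br f D₃ G₂) (𝟙 (tens f (G₃ ++ (G₄ ++ G₅)))) ≫ lc f (by simp) ≫
      ten f (𝟙 (tens f G₂)) (ten f x (𝟙 (tens f (G₄ ++ G₅)))) :
      tens f (D₃ ++ (G₂ ++ (G₃ ++ (G₄ ++ G₅)))) ⟶ tens f (G₂ ++ (A ++ (G₄ ++ G₅))))))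
  simp at e
  -- The casts at the ends of the normalized equation go to its other side, in two passes; then it
  -- can rewrite inside the normal form of the goal. The same manoeuvre recurs in the lemmas that
  -- follow.
  simp only [← Category.assoc, comp_lc_eq] at e
  simp only [Category.assoc, lc_comp_eq] at e
  simp [cutM, boxM, br_append_left, br_append_right]
  simp [reassoc_of% e]

/-- Cuts into different linear hypotheses are independent, but their graded contexts are appended in
the order of the cuts, hence the leading symmetry. Here `m` and `m'` are the two cuts as single
actions; `e` slides `D₂` past the first, and `e'` interchanges them. -/
theorem cutM_comm (D₁ D₂ D₃ G₁ G₂ G₃ G₄ G₅ : List α) {A B K K' L L' L'' : List α} {Z : C}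
    (h : L = ((D₁ ++ D₂) ++ D₃) ++ (G₁ ++ (G₂ ++ (G₃ ++ (G₄ ++ G₅))))) (hx : D₃ ++ G₂ = K)
    (x : tens f K ⟶ tens f A) (k : (D₁ ++ D₂) ++ (G₁ ++ (A ++ (G₃ ++ (G₄ ++ G₅)))) = L')
    (h' : L' = (D₁ ++ D₂) ++ ((G₁ ++ (A ++ G₃)) ++ (G₄ ++ G₅)))
    (hx' : D₂ ++ G₄ = K') (x' : tens f K' ⟶ tens f B)
    (k' : D₁ ++ ((G₁ ++ (A ++ G₃)) ++ (B ++ G₅)) = L'') (y : tens f L'' ⟶ Z) :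
    cutM (D₁ ++ D₂) D₃ G₁ G₂ (G₃ ++ (G₄ ++ G₅)) h hx x k
        (cutM D₁ D₂ (G₁ ++ (A ++ G₃)) G₄ G₅ h' hx' x' k' y) =
      boxM D₁ (G₁ ++ (G₂ ++ (G₃ ++ (G₄ ++ G₅)))) (by simp [h]) (br f D₂ D₃) rfl
        (cutM (D₁ ++ D₃) D₂ (G₁ ++ (G₂ ++ G₃)) G₄ G₅ (by simp) hx' x' rfl
          (cutM D₁ D₃ G₁ G₂ (G₃ ++ (B ++ G₅)) (by simp) hx x (by simp [← k']) y)) := by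
  subst h hx k hx' k'
  let m : tens f ((D₃ ++ G₁) ++ G₂) ⟶ tens f (G₁ ++ A) :=
    ten f (br f D₃ G₁) (𝟙 (tens f G₂)) ≫ lc f (List.append_assoc _ _ _) ≫ ten f (𝟙 (tens f G₁)) x
  let m' : tens f (D₂ ++ (G₃ ++ (G₄ ++ G₅))) ⟶ tens f (G₃ ++ (B ++ G₅)) :=
    lc f (by simp) ≫ ten f (br f D₂ G₃) (𝟙 (tens f (G₄ ++ G₅))) ≫ lc f (by simp) ≫
      ten f (𝟙 (tens f G₃)) (ten f x' (𝟙 (tens f G₅)))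
  have e := congrArg (fun t => ten f (𝟙 (tens f D₁)) (ten f t (𝟙 (tens f (G₃ ++ (G₄ ++ G₅))))))
    (ten_br (𝟙 (tens f D₂)) m)
  have e' := congrArg (ten f (𝟙 (tens f D₁)))
    (ten_exchange m m')
  simp [m, m', br_append_left, br_append_right] at e
  simp only [← Category.assoc, comp_lc_eq] at e
  simp only [Category.assoc, lc_comp_eq] at e
  simp [m, m', br_append_left, br_append_right] at e'
  simp only [← Category.assoc, comp_lc_eq] at e'
  simp only [Category.assoc, lc_comp_eq] at e'
  simp [cutM, boxM, br_append_left, br_append_right, reassoc_of% e, reassoc_of% e']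

theorem cutM_exL (D₁ D₂ G₁ B G₂ G₃ : List α) {A K L L' L'' : List α} {Z : C}
    (h : L = (D₁ ++ D₂) ++ ((G₁ ++ B) ++ (G₂ ++ G₃))) (hx : D₂ ++ G₂ = K)
    (x : tens f K ⟶ tens f A) (k : D₁ ++ ((G₁ ++ B) ++ (A ++ G₃)) = L')
    (h' : L' = (D₁ ++ G₁) ++ ((B ++ A) ++ G₃)) (k' : (D₁ ++ G₁) ++ ((A ++ B) ++ G₃) = L'')
    (y : tens f L'' ⟶ Z) :
    cutM D₁ D₂ (G₁ ++ B) G₂ G₃ h hx x k (boxM (D₁ ++ G₁) G₃ h' (br f B A) k' y) =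
      boxM ((D₁ ++ D₂) ++ G₁) G₃ (by simp [h]) (br f B G₂) rfl
        (cutM D₁ D₂ G₁ G₂ (B ++ G₃) (by simp) hx x (by simp [← k']) y) := by
  subst h hx k k'
  have e := congrArg (fun t => ten f (𝟙 (tens f D₁)) (ten f (𝟙 (tens f G₁)) (ten f t (𝟙 (tens f G₃)))))
    (ten_br (𝟙 (tens f B)) x)
  have e' := congrArg (ten f (𝟙 (tens f D₁)))
    (ten_exchange (br f D₂ G₁) (ten f (br f B G₂) (𝟙 (tens f G₃))))
  -- `D₂` crosses `B` to reach its place, and naturality of the exchange makes `B` cross `D₂` back;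
  -- the two crossings cancel.
  have e'' := congrArg (fun t => ten f (𝟙 (tens f D₁)) (ten f (𝟙 (tens f G₁))
    (ten f t (𝟙 (tens f (G₂ ++ G₃)))))) (br_br D₂ B)
  simp only [comp_ten_id, id_ten_comp, ten_id] at e''
  simp [br_append_left, br_append_right] at e
  simp only [← Category.assoc, comp_lc_eq] at e
  simp only [Category.assoc, lc_comp_eq] at e
  simp [br_append_left, br_append_right] at e'
  simp only [← Category.assoc, comp_lc_eq] at e'
  simp only [Category.assoc, lc_comp_eq] at e'
  simp [cutM, boxM, br_append_left, br_append_right, reassoc_of% e, reassoc_of% e', reassoc_of% e'']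

theorem cutM_exR (D₁ D₂ G₁ B G₂ G₃ : List α) {A K L L' L'' : List α} {Z : C}
    (h : L = (D₁ ++ D₂) ++ (G₁ ++ (G₂ ++ (B ++ G₃)))) (hx : D₂ ++ G₂ = K)
    (x : tens f K ⟶ tens f A) (k : D₁ ++ (G₁ ++ (A ++ (B ++ G₃))) = L')
    (h' : L' = (D₁ ++ G₁) ++ ((A ++ B) ++ G₃)) (k' : (D₁ ++ G₁) ++ ((B ++ A) ++ G₃) = L'')
    (y : tens f L'' ⟶ Z) :
    cutM D₁ D₂ G₁ G₂ (B ++ G₃) h hx x k (boxM (D₁ ++ G₁) G₃ h' (br f A B) k' y) =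
      boxM ((D₁ ++ D₂) ++ G₁) G₃ (by simp [h]) (br f G₂ B) rfl
        (cutM D₁ D₂ (G₁ ++ B) G₂ G₃ (by simp) hx x (by simp [← k']) y) := by
  subst h hx k k'
  have e := congrArg (fun t => ten f (𝟙 (tens f D₁)) (ten f (𝟙 (tens f G₁)) (ten f t (𝟙 (tens f G₃)))))
    (ten_br x (𝟙 (tens f B)))
  have e' := congrArg (ten f (𝟙 (tens f D₁)))
    (ten_exchange (br f D₂ G₁) (ten f (br f G₂ B) (𝟙 (tens f G₃))))
  simp [br_append_left, br_append_right] at e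
  simp only [← Category.assoc, comp_lc_eq] at e
  simp only [Category.assoc, lc_comp_eq] at e
  simp [br_append_left, br_append_right] at e'
  simp only [← Category.assoc, comp_lc_eq] at e'
  simp only [Category.assoc, lc_comp_eq] at e'
  simp [cutM, boxM, br_append_left, br_append_right, reassoc_of% e, reassoc_of% e']

/-- This and the next four lemmas slide a box through a cut, one for each block in which it may act:
`D₁`, `G₁`, `G₃` for the right premise, `D₂`, `G₂` for the left. The reason is interchange, together
with naturality of the symmetry when the block is one of those that cross, `D₂` or `G₁`. -/
theorem cutM_boxD₁ (A D D₂ G₁ G₂ G₃ : List α) {P Q T K L L' L'' : List α} {Z : C}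
    (g : tens f P ⟶ tens f Q) (h : L = ((A ++ (P ++ D)) ++ D₂) ++ (G₁ ++ (G₂ ++ G₃)))
    (hx : D₂ ++ G₂ = K) (x : tens f K ⟶ tens f T) (k : (A ++ (P ++ D)) ++ (G₁ ++ (T ++ G₃)) = L')
    (h' : L' = A ++ (P ++ (D ++ (G₁ ++ (T ++ G₃)))))
    (k' : A ++ (Q ++ (D ++ (G₁ ++ (T ++ G₃)))) = L'') (y : tens f L'' ⟶ Z) :
    cutM (A ++ (P ++ D)) D₂ G₁ G₂ G₃ h hx x k (boxM A (D ++ (G₁ ++ (T ++ G₃))) h' g k' y) =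
      boxM A (D ++ (D₂ ++ (G₁ ++ (G₂ ++ G₃)))) (by simp [h]) g rfl
        (cutM (A ++ (Q ++ D)) D₂ G₁ G₂ G₃ (by simp) hx x (by simp [← k']) y) := by
  subst h hx k k'
  let m : tens f (D₂ ++ (G₁ ++ (G₂ ++ G₃))) ⟶ tens f (G₁ ++ (T ++ G₃)) :=
    lc f (by simp) ≫ ten f (br f D₂ G₁) (𝟙 (tens f (G₂ ++ G₃))) ≫ lc f (by simp) ≫
      ten f (𝟙 (tens f G₁)) (ten f x (𝟙 (tens f G₃)))
  have e' := congrArg (ten f (𝟙 (tens f A)))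
    (ten_exchange g (ten f (𝟙 (tens f D)) m))
  simp [m, br_append_left, br_append_right] at e'
  simp only [← Category.assoc, comp_lc_eq] at e'
  simp only [Category.assoc, lc_comp_eq] at e'
  simp [cutM, boxM, br_append_left, br_append_right, reassoc_of% e']

theorem cutM_boxG₁ (D₁ D₂ A D G₂ G₃ : List α) {P Q T K L L' L'' : List α} {Z : C}
    (g : tens f P ⟶ tens f Q) (h : L = (D₁ ++ D₂) ++ ((A ++ (P ++ D)) ++ (G₂ ++ G₃)))
    (hx : D₂ ++ G₂ = K) (x : tens f K ⟶ tens f T) (k : D₁ ++ ((A ++ (P ++ D)) ++ (T ++ G₃)) = L')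
    (h' : L' = (D₁ ++ A) ++ (P ++ (D ++ (T ++ G₃))))
    (k' : (D₁ ++ A) ++ (Q ++ (D ++ (T ++ G₃))) = L'') (y : tens f L'' ⟶ Z) :
    cutM D₁ D₂ (A ++ (P ++ D)) G₂ G₃ h hx x k (boxM (D₁ ++ A) (D ++ (T ++ G₃)) h' g k' y) =
      boxM ((D₁ ++ D₂) ++ A) (D ++ (G₂ ++ G₃)) (by simp [h]) g rfl
        (cutM D₁ D₂ (A ++ (Q ++ D)) G₂ G₃ (by simp) hx x (by simp [← k']) y) := by
  subst h hx k k'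
  have e := congrArg (fun t => ten f (𝟙 (tens f D₁)) (ten f t (𝟙 (tens f (G₂ ++ G₃)))))
    (ten_br (𝟙 (tens f D₂)) (ten f (𝟙 (tens f A)) (ten f g (𝟙 (tens f D)))))
  have e' := congrArg (ten f (𝟙 (tens f D₁))) (congrArg (ten f (𝟙 (tens f A)))
    (ten_exchange g (ten f (𝟙 (tens f D)) (ten f x (𝟙 (tens f G₃))))))
  simp [br_append_left, br_append_right] at e
  simp only [← Category.assoc, comp_lc_eq] at e
  simp only [Category.assoc, lc_comp_eq] at e
  simp [br_append_left, br_append_right] at e'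
  simp only [← Category.assoc, comp_lc_eq] at e'
  simp only [Category.assoc, lc_comp_eq] at e'
  simp [cutM, boxM, br_append_left, br_append_right, reassoc_of% e, reassoc_of% e']

theorem cutM_boxG₃ (D₁ D₂ G₁ G₂ A D : List α) {P Q T K L L' L'' : List α} {Z : C}
    (g : tens f P ⟶ tens f Q) (h : L = (D₁ ++ D₂) ++ (G₁ ++ (G₂ ++ (A ++ (P ++ D)))))
    (hx : D₂ ++ G₂ = K) (x : tens f K ⟶ tens f T) (k : D₁ ++ (G₁ ++ (T ++ (A ++ (P ++ D)))) = L')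
    (h' : L' = (D₁ ++ (G₁ ++ (T ++ A))) ++ (P ++ D))
    (k' : (D₁ ++ (G₁ ++ (T ++ A))) ++ (Q ++ D) = L'') (y : tens f L'' ⟶ Z) :
    cutM D₁ D₂ G₁ G₂ (A ++ (P ++ D)) h hx x k (boxM (D₁ ++ (G₁ ++ (T ++ A))) D h' g k' y) =
      boxM ((D₁ ++ D₂) ++ (G₁ ++ (G₂ ++ A))) D (by simp [h]) g rfl
        (cutM D₁ D₂ G₁ G₂ (A ++ (Q ++ D)) (by simp) hx x (by simp [← k']) y) := by
  subst h hx k k'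
  let m : tens f ((D₂ ++ G₁) ++ G₂) ⟶ tens f (G₁ ++ T) :=
    ten f (br f D₂ G₁) (𝟙 (tens f G₂)) ≫ lc f (List.append_assoc _ _ _) ≫ ten f (𝟙 (tens f G₁)) x
  have e' := congrArg (ten f (𝟙 (tens f D₁)))
    (ten_exchange m (ten f (𝟙 (tens f A)) (ten f g (𝟙 (tens f D)))))
  simp [m, br_append_left, br_append_right] at e'
  simp only [← Category.assoc, comp_lc_eq] at e'
  simp only [Category.assoc, lc_comp_eq] at e'
  simp [cutM, boxM, br_append_left, br_append_right, reassoc_of% e']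

theorem cutM_boxD₂ (D₁ A D G₁ G₂ G₃ : List α) {P Q T K K' L L' : List α} {Z : C}
    (g : tens f P ⟶ tens f Q) (h : L = (D₁ ++ (A ++ (P ++ D))) ++ (G₁ ++ (G₂ ++ G₃)))
    (hx : (A ++ (P ++ D)) ++ G₂ = K) (h' : K = A ++ (P ++ (D ++ G₂)))
    (k' : A ++ (Q ++ (D ++ G₂)) = K') (x : tens f K' ⟶ tens f T)
    (k : D₁ ++ (G₁ ++ (T ++ G₃)) = L') (y : tens f L' ⟶ Z) :
    cutM D₁ (A ++ (P ++ D)) G₁ G₂ G₃ h hx (boxM A (D ++ G₂) h' g k' x) k y =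
      boxM (D₁ ++ A) (D ++ (G₁ ++ (G₂ ++ G₃))) (by simp [h]) g rfl
        (cutM D₁ (A ++ (Q ++ D)) G₁ G₂ G₃ (by simp) (by simp [← k']) x k y) := by
  subst h hx k k'
  have e := congrArg (fun t => ten f (𝟙 (tens f D₁)) (ten f t (𝟙 (tens f (G₂ ++ G₃)))))
    (ten_br (ten f (𝟙 (tens f A)) (ten f g (𝟙 (tens f D)))) (𝟙 (tens f G₁)))
  simp [br_append_left, br_append_right] at e
  simp only [← Category.assoc, comp_lc_eq] at e
  simp only [Category.assoc, lc_comp_eq] at e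
  simp [cutM, boxM, br_append_left, br_append_right, reassoc_of% e]

theorem cutM_boxG₂ (D₁ D₂ G₁ A D G₃ : List α) {P Q T K K' L L' : List α} {Z : C}
    (g : tens f P ⟶ tens f Q) (h : L = (D₁ ++ D₂) ++ (G₁ ++ ((A ++ (P ++ D)) ++ G₃)))
    (hx : D₂ ++ (A ++ (P ++ D)) = K) (h' : K = (D₂ ++ A) ++ (P ++ D))
    (k' : (D₂ ++ A) ++ (Q ++ D) = K') (x : tens f K' ⟶ tens f T)
    (k : D₁ ++ (G₁ ++ (T ++ G₃)) = L') (y : tens f L' ⟶ Z) :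
    cutM D₁ D₂ G₁ (A ++ (P ++ D)) G₃ h hx (boxM (D₂ ++ A) D h' g k' x) k y =
      boxM ((D₁ ++ D₂) ++ (G₁ ++ A)) (D ++ G₃) (by simp [h]) g rfl
        (cutM D₁ D₂ G₁ (A ++ (Q ++ D)) G₃ (by simp) (by simp [← k']) x k y) := by
  subst h hx k k'
  have e := congrArg (ten f (𝟙 (tens f D₁)))
    (ten_exchange (br f D₂ G₁) (ten f (𝟙 (tens f A)) (ten f g (𝟙 (tens f (D ++ G₃))))))
  simp [br_append_left, br_append_right] at e
  simp only [← Category.assoc, comp_lc_eq] at e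
  simp only [Category.assoc, lc_comp_eq] at e
  simp [cutM, boxM, br_append_left, br_append_right, reassoc_of% e]

theorem cutM_nil (D₁ G₁ G₂ G₃ : List α) {A K L L' : List α} {Z : C}
    (h : L = (D₁ ++ []) ++ (G₁ ++ (G₂ ++ G₃))) (hx : [] ++ G₂ = K) (x : tens f K ⟶ tens f A)
    (k : D₁ ++ (G₁ ++ (A ++ G₃)) = L') (y : tens f L' ⟶ Z) :
    cutM D₁ [] G₁ G₂ G₃ h hx x k y =
      boxM (D₁ ++ G₁) G₃ (by simp [h, ← hx]) x (by simp [← k]) y := by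
  subst h hx k
  simp [cutM, boxM, br_nil_left]

theorem cutM_id (D G : List α) {A K L L' : List α} (h : L = ([] ++ D) ++ ([] ++ (G ++ [])))
    (hx : D ++ G = K) (x : tens f K ⟶ tens f A) (k : [] ++ ([] ++ (A ++ [])) = L')
    (e : L' = A) : cutM [] D [] G [] h hx x k (lc f e) = lc f (by simp [h, hx]) ≫ x := by
  subst h hx k
  simp [cutM, boxM, br_nil_right]

/-- For a box that makes the first linear hypothesis of the left premise graded, as the left rule of
Grd does. In the conclusion this hypothesis stands behind `G₁`, so it first returns past `G₁`; its
image then belongs to the graded context that travels with the cut. -/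
theorem cutM_boxL (D₁ D₂ G₁ G₂ G₃ : List α) {P Q T K K' L L' : List α} {Z : C}
    (g : tens f P ⟶ tens f Q) (h : L = (D₁ ++ D₂) ++ (G₁ ++ ((P ++ G₂) ++ G₃)))
    (hx : D₂ ++ (P ++ G₂) = K) (h' : K = D₂ ++ (P ++ G₂)) (k' : D₂ ++ (Q ++ G₂) = K')
    (x : tens f K' ⟶ tens f T) (k : D₁ ++ (G₁ ++ (T ++ G₃)) = L') (y : tens f L' ⟶ Z) :
    cutM D₁ D₂ G₁ (P ++ G₂) G₃ h hx (boxM D₂ G₂ h' g k' x) k y =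
      boxM (D₁ ++ D₂) (G₂ ++ G₃) (by simp [h]) (br f G₁ P) rfl
        (boxM (D₁ ++ D₂) (G₁ ++ (G₂ ++ G₃)) (by simp) g rfl
          (cutM D₁ (D₂ ++ Q) G₁ G₂ G₃ (by simp) (by simp [← k']) x k y)) := by
  subst h hx k k'
  have e := congrArg (fun t => ten f (𝟙 (tens f D₁)) (ten f (𝟙 (tens f D₂))
    (ten f t (𝟙 (tens f (G₂ ++ G₃))))))
    (ten_br g (𝟙 (tens f G₁)))
  have e' := congrArg (ten f (𝟙 (tens f D₁)))
    (ten_exchange (br f D₂ G₁) (ten f g (𝟙 (tens f (G₂ ++ G₃)))))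
  have e'' := congrArg (fun t => ten f (𝟙 (tens f D₁)) (ten f (𝟙 (tens f D₂))
    (ten f t (𝟙 (tens f (G₂ ++ G₃)))))) (br_br G₁ P)
  simp only [comp_ten_id, id_ten_comp, ten_id] at e''
  simp at e
  simp only [← Category.assoc, comp_lc_eq] at e
  simp only [Category.assoc, lc_comp_eq] at e
  simp at e'
  simp only [← Category.assoc, comp_lc_eq] at e'
  simp only [Category.assoc, lc_comp_eq] at e'
  simp [cutM, boxM, br_append_left, br_append_right, reassoc_of% e, reassoc_of% e', reassoc_of% e'']

/-- The same kind of box in the right premise. Its result must stand before `D₂`, but in the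
conclusion the border between graded and linear hypotheses comes after `D₂`; this costs the symmetry
of `D₂` and `Q`. -/
theorem cutM_boxM_left (D₁ D₂ G₁ G₂ G₃ : List α) {P Q T K L L' L'' : List α} {Z : C}
    (g : tens f P ⟶ tens f Q) (h : L = (D₁ ++ D₂) ++ ((P ++ G₁) ++ (G₂ ++ G₃)))
    (hx : D₂ ++ G₂ = K) (x : tens f K ⟶ tens f T) (k : D₁ ++ ((P ++ G₁) ++ (T ++ G₃)) = L')
    (h' : L' = D₁ ++ (P ++ (G₁ ++ (T ++ G₃)))) (k' : D₁ ++ (Q ++ (G₁ ++ (T ++ G₃))) = L'')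
    (y : tens f L'' ⟶ Z) :
    cutM D₁ D₂ (P ++ G₁) G₂ G₃ h hx x k (boxM D₁ (G₁ ++ (T ++ G₃)) h' g k' y) =
      boxM (D₁ ++ D₂) (G₁ ++ (G₂ ++ G₃)) (by simp [h]) g rfl
        (boxM D₁ (G₁ ++ (G₂ ++ G₃)) (by simp) (br f D₂ Q) rfl
          (cutM (D₁ ++ Q) D₂ G₁ G₂ G₃ (by simp) hx x (by simp [← k']) y)) := by
  subst h hx k k'
  let m : tens f (D₂ ++ (G₁ ++ (G₂ ++ G₃))) ⟶ tens f (G₁ ++ (T ++ G₃)) :=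
    lc f (by simp) ≫ ten f (br f D₂ G₁) (𝟙 (tens f (G₂ ++ G₃))) ≫ lc f (by simp) ≫
      ten f (𝟙 (tens f G₁)) (ten f x (𝟙 (tens f G₃)))
  have e := congrArg (fun t => ten f (𝟙 (tens f D₁)) (ten f t (𝟙 (tens f (G₁ ++ (G₂ ++ G₃))))))
    (ten_br (𝟙 (tens f D₂)) g)
  have e' := congrArg (ten f (𝟙 (tens f D₁))) (ten_exchange g m)
  simp at e
  simp only [← Category.assoc, comp_lc_eq] at e
  simp only [Category.assoc, lc_comp_eq] at e
  simp [m] at e'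
  simp only [← Category.assoc, comp_lc_eq] at e'
  simp only [Category.assoc, lc_comp_eq] at e'
  simp [cutM, boxM, br_append_left, br_append_right, reassoc_of% e, reassoc_of% e']

end Boxes
-- Coherence for moving an object past a tensor factor
section Coherence
variable {C : Type v} [Category.{w} C] [MonoidalCategory C]

theorem whisker_assoc_inv_tensor {A A' B B' D D' X X' : C} (a : A ⟶ A') (b : B ⟶ B') (d : D ⟶ D')
    (s : X ⟶ B ⊗ D) (s' : X' ⟶ B' ⊗ D') (x : X ⟶ X') (h : s ≫ (b ⊗ₘ d) = x ≫ s') :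
    (A ◁ s ≫ (α_ A B D).inv) ≫ ((a ⊗ₘ b) ⊗ₘ d) = (a ⊗ₘ x) ≫ A' ◁ s' ≫ (α_ A' B' D').inv := by
  rw [Category.assoc, ← MonoidalCategory.associator_inv_naturality,
    ← MonoidalCategory.id_tensorHom, ← MonoidalCategory.id_tensorHom,
    MonoidalCategory.tensorHom_comp_tensorHom_assoc, MonoidalCategory.tensorHom_comp_tensorHom_assoc,
    h, Category.id_comp, Category.comp_id]

variable [SymmetricCategory C]

theorem braid_unit_assoc (D A L : C) : D ◁ (A ◁ (λ_ L).inv ≫ (α_ A (𝟙_ C) L).inv) ≫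
    (α_ D (A ⊗ 𝟙_ C) L).inv ≫
      ((β_ D (A ⊗ 𝟙_ C)).hom ≫ (α_ A (𝟙_ C) D).hom ≫ A ◁ (λ_ D).hom) ▷ L ≫ (α_ A D L).hom =
    (α_ D A L).inv ≫ (β_ D A).hom ▷ L ≫ (α_ A D L).hom := by
  have h : (β_ D (A ⊗ 𝟙_ C)).hom = D ◁ (ρ_ A).hom ≫ (β_ D A).hom ≫ (ρ_ A).inv ▷ D := by
    simp [← BraidedCategory.braiding_naturality_right_assoc]
  rw [h]
  monoidal

theorem braid_cons {T A L V Y W W' : C} (s : W ⟶ T ⊗ A ⊗ L) (l : W ⟶ W') (s' : W' ⟶ V ⊗ L)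
    (t : V ⟶ T ⊗ A ⊗ 𝟙_ C) (j : Y ≅ T ⊗ L)
    (h : l ≫ s' ≫ t ▷ L ≫ (α_ _ _ _).hom = s ≫ T ◁ (A ◁ (λ_ L).inv ≫ (α_ A (𝟙_ C) L).inv)) :
    s ≫ (α_ T A L).inv ≫ (β_ T A).hom ▷ L ≫ (α_ A T L).hom =
      l ≫ (s' ≫ (t ≫ (β_ T (A ⊗ 𝟙_ C)).hom ≫ (α_ A (𝟙_ C) T).hom ≫ A ◁ (λ_ T).hom) ▷ L ≫
        (α_ A T L).hom ≫ A ◁ j.inv) ≫ A ◁ j.hom := by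
  have h' : l ≫ s' ≫ t ▷ L = s ≫ T ◁ (A ◁ (λ_ L).inv ≫ (α_ A (𝟙_ C) L).inv) ≫
      (α_ _ _ _).inv := by
    rw [← cancel_mono (α_ T (A ⊗ 𝟙_ C) L).hom]
    simpa using h
  simp only [Category.assoc, MonoidalCategory.comp_whiskerRight, ← MonoidalCategory.whiskerLeft_comp, Iso.inv_hom_id,
    MonoidalCategory.whiskerLeft_id, Category.comp_id]
  rw [reassoc_of% h']
  have := braid_unit_assoc T A L
  simp only [MonoidalCategory.comp_whiskerRight, Category.assoc] at this
  rw [this]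

theorem braid_assoc_natural {Z Z' : C} (z : Z' ⟶ Z) (A L : C) :
    ((α_ Z' A L).inv ≫ (β_ Z' A).hom ▷ L ≫ (α_ A Z' L).hom) ≫ A ◁ z ▷ L =
      z ▷ (A ⊗ L) ≫ (α_ Z A L).inv ≫ (β_ Z A).hom ▷ L ≫ (α_ A Z L).hom := by
  rw [Category.assoc, Category.assoc, ← associator_naturality_middle,
    ← MonoidalCategory.comp_whiskerRight_assoc, ← BraidedCategory.braiding_naturality_left,
    MonoidalCategory.comp_whiskerRight_assoc, ← associator_inv_naturality_left_assoc]

theorem braid_assoc_natural_right {Z A A' L L' : C} (j : A ⟶ A') (n : L ⟶ L') :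
    ((α_ Z A L).inv ≫ (β_ Z A).hom ▷ L ≫ (α_ A Z L).hom) ≫ (j ⊗ₘ Z ◁ n) =
      Z ◁ (j ⊗ₘ n) ≫ (α_ Z A' L').inv ≫ (β_ Z A').hom ▷ L' ≫ (α_ A' Z L').hom := by
  have h : Z ◁ (j ⊗ₘ n) ≫ (α_ Z A' L').inv = (α_ Z A L).inv ≫ (Z ◁ j) ▷ L ≫ (Z ⊗ A') ◁ n := by
    simp [MonoidalCategory.tensorHom_def]
  rw [reassoc_of% h, MonoidalCategory.whisker_exchange_assoc,
    ← MonoidalCategory.comp_whiskerRight_assoc, BraidedCategory.braiding_naturality_right]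
  simp [MonoidalCategory.tensorHom_def]

theorem braid_assoc_natural_of_eq {Z A A' W W' L L' L'' T : C} (j : A ⟶ A') (p : Z ⊗ W ⟶ T)
    (m' : T ⟶ W') (m : W ⟶ L) (l : L ⟶ L') (p' : Z ⊗ L' ⟶ L'') (l' : L'' ⟶ W')
    (h : p ≫ m' = Z ◁ m ≫ Z ◁ l ≫ p' ≫ l') :
    ((α_ Z A W).inv ≫ (β_ Z A).hom ▷ W ≫ (α_ A Z W).hom ≫ A ◁ p) ≫ (j ⊗ₘ m') =
      Z ◁ (j ⊗ₘ m) ≫ Z ◁ (A' ◁ l) ≫ ((α_ Z A' L').inv ≫ (β_ Z A').hom ▷ L' ≫ (α_ A' Z L').hom ≫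
        A' ◁ p') ≫ A' ◁ l' := by
  have h1 : A ◁ p ≫ (j ⊗ₘ m') = (j ⊗ₘ Z ◁ (m ≫ l)) ≫ A' ◁ (p' ≫ l') := by
    rw [← MonoidalCategory.id_tensorHom A p, ← MonoidalCategory.id_tensorHom A' (p' ≫ l'),
      MonoidalCategory.tensorHom_comp_tensorHom, MonoidalCategory.tensorHom_comp_tensorHom, h]
    simp
  have h2 := braid_assoc_natural_right (Z := Z) j (m ≫ l) =≫ (A' ◁ (p' ≫ l'))
  simp only [Category.assoc] at h2
  simp only [Category.assoc, h1]
  rw [h2, ← MonoidalCategory.whiskerLeft_comp, ← MonoidalCategory.whiskerLeft_comp_assoc,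
    ← MonoidalCategory.id_tensorHom A' l, MonoidalCategory.tensorHom_comp_tensorHom, Category.comp_id]

theorem whisker_tensor_of_eq {Z A A' B B' X X' T T' : C} (s : X ⟶ A ⊗ B) (s' : X' ⟶ A' ⊗ B')
    (a : A ≅ A') (b : B ⟶ B') (t : X ⟶ X') (e : s ≫ (a.hom ⊗ₘ b) = t ≫ s') (g : Z ⊗ A ⟶ T)
    (j : T ⟶ T') : (Z ◁ s ≫ (α_ _ _ _).inv ≫ g ▷ B) ≫ (j ⊗ₘ b) =
      Z ◁ t ≫ (Z ◁ s' ≫ (α_ _ _ _).inv ≫ (Z ◁ a.inv ≫ g ≫ j) ▷ B') := by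
  rw [← MonoidalCategory.whiskerLeft_comp_assoc, ← e]
  have k : (a.hom ⊗ₘ b) ≫ a.inv ▷ B' = A ◁ b := by
    simp [MonoidalCategory.tensorHom_def, ← MonoidalCategory.whisker_exchange_assoc]
  rw [MonoidalCategory.comp_whiskerRight, ← associator_inv_naturality_middle_assoc,
    ← MonoidalCategory.whiskerLeft_comp_assoc, Category.assoc s, k]
  simp only [MonoidalCategory.tensorHom_def, MonoidalCategory.whiskerLeft_comp,
    MonoidalCategory.comp_whiskerRight, Category.assoc]
  rw [associator_inv_naturality_right_assoc, ← MonoidalCategory.whisker_exchange,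
    ← MonoidalCategory.whisker_exchange_assoc]

theorem comp_assoc₄ {A B D E T G : C} (s : A ⟶ B) (x : B ⟶ D) (y : D ⟶ E) (z : E ⟶ T) (p : T ⟶ G) :
    s ≫ x ≫ y ≫ z ≫ p = (s ≫ x ≫ y ≫ z) ≫ p := by simp

theorem comp_assoc₃ {A B D E T : C} (s : A ⟶ B) (x : B ⟶ D) (y : D ⟶ E) (z : E ⟶ T) :
    (s ≫ x ≫ y) ≫ z = s ≫ x ≫ y ≫ z := by simp

end Coherence

-- Renaming the entries of a list along isomorphisms

section Transport
variable {C : Type v} [Category.{w} C] [MonoidalCategory C] {α : Type u} {β : Type u}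
  {f : β → C} {F : α → C} {φ : β → α} (i : ∀ b, f b ≅ F (φ b))

/-- The tensor product of a list whose entries are renamed. -/
def mapI : ∀ L : List β, tens f L ≅ tens F (L.map φ)
  | [] => Iso.refl (𝟙_ C)
  | b :: L => i b ⊗ᵢ mapI L

instance {L L' : List α} (h : L = L') : IsIso (lc F h) := inferInstanceAs (IsIso (eqToHom _))

theorem mapI_lc {L L' : List β} (h : L = L') :
    lc f h ≫ (mapI i L').hom = (mapI i L).hom ≫ lc F (by rw [h]) := by
  subst h; simp

theorem split_map (A B : List β) : (split f A B).hom ≫ ((mapI i A).hom ⊗ₘ (mapI i B).hom) =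
    (mapI i (A ++ B)).hom ≫ lc F (List.map_append) ≫ (split F (A.map φ) (B.map φ)).hom := by
  induction A with
  | nil =>
    have : (λ_ (tens f B)).inv ≫ (𝟙 (𝟙_ C) ⊗ₘ (mapI i B).hom) =
      (mapI i B).hom ≫ 𝟙 _ ≫ (λ_ (tens F (B.map φ))).inv := by simp
    exact this
  | cons a A ih =>
    refine (whisker_assoc_inv_tensor (i a).hom (mapI i A).hom (mapI i B).hom (split f A B).hom
      (split F (A.map φ) (B.map φ)).hom ((mapI i (A ++ B)).hom ≫ lc F List.map_append)
      (by rw [ih, Category.assoc])).trans ?_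
    have h : ((i a).hom ⊗ₘ (mapI i (A ++ B)).hom ≫ lc F List.map_append) =
        ((i a).hom ⊗ₘ (mapI i (A ++ B)).hom) ≫ F (φ a) ◁ lc F List.map_append := by
      rw [← MonoidalCategory.id_tensorHom, MonoidalCategory.tensorHom_comp_tensorHom,
        Category.comp_id]
    rw [h, Category.assoc]
    refine congrArg₂ (· ≫ ·) rfl ?_
    exact congrArg₂ (· ≫ ·) (lc_cons_self F _).symm rfl

theorem split_map_inv (A B : List β) :
    (split F (A.map φ) (B.map φ)).hom ≫ ((mapI i A).inv ⊗ₘ (mapI i B).inv) =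
      lc F (List.map_append).symm ≫ (mapI i (A ++ B)).inv ≫ (split f A B).hom := by
  rw [← cancel_mono ((mapI i A).hom ⊗ₘ (mapI i B).hom)]
  simp only [Category.assoc, split_map, MonoidalCategory.tensorHom_comp_tensorHom,
    Iso.inv_hom_id, MonoidalCategory.id_tensorHom_id, Category.comp_id]
  simp

/-- The morphism between renamed lists corresponding to `g`. -/
def tm {P Q : List β} (g : tens f P ⟶ tens f Q) : tens F (P.map φ) ⟶ tens F (Q.map φ) :=
  (mapI i P).inv ≫ g ≫ (mapI i Q).hom

theorem tm_id (P : List β) : tm i (𝟙 (tens f P)) = 𝟙 _ := by simp [tm]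

theorem tm_comp {P Q S : List β} (g : tens f P ⟶ tens f Q) (h : tens f Q ⟶ tens f S) :
    tm i (g ≫ h) = tm i g ≫ tm i h := by simp [tm]

theorem tm_lc {P Q : List β} (h : P = Q) : tm i (lc f h) = lc F (by rw [h]) := by
  subst h; simp [tm]

theorem tm_ten {P P' Q Q' : List β} (g : tens f P ⟶ tens f Q) (h : tens f P' ⟶ tens f Q') :
    tm i (ten f g h) = lc F List.map_append ≫ ten F (tm i g) (tm i h) ≫
      lc F (List.map_append).symm := by
  rw [← cancel_mono (lc F (List.map_append : (Q ++ Q').map φ = _) ≫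
    (split F (Q.map φ) (Q'.map φ)).hom), ← cancel_epi (mapI i (P ++ P')).hom]
  simp only [tm, Category.assoc, Iso.hom_inv_id_assoc, lc_lc_assoc, lc_self, Category.id_comp]
  rw [ten_split, ← split_map, ten_split_assoc]
  simp only [MonoidalCategory.tensorHom_comp_tensorHom]
  rw [← MonoidalCategory.tensorHom_comp_tensorHom, ← reassoc_of% split_map]
  simp

theorem tm_inside {P Q : List β} (g : tens f P ⟶ tens f Q) (A D : List β) :
    tm i (inside f g A D) = lc F (by simp) ≫ ten F (𝟙 (tens F (A.map φ)))
      (ten F (tm i g) (𝟙 (tens F (D.map φ)))) ≫ lc F (by simp) := by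
  rw [inside_eq, tm_ten, tm_ten, tm_id, tm_id]
  simp

variable [SymmetricCategory C]

theorem tm_br (P Q : List β) : tm i (br f P Q) = lc F List.map_append ≫
    br F (P.map φ) (Q.map φ) ≫ lc F (List.map_append).symm := by
  rw [← cancel_mono (lc F (List.map_append : (Q ++ P).map φ = _) ≫
    (split F (Q.map φ) (P.map φ)).hom), ← cancel_epi (mapI i (P ++ Q)).hom]
  simp only [tm, Category.assoc, Iso.hom_inv_id_assoc, lc_lc_assoc, lc_self, Category.id_comp]
  rw [← split_map]
  simp only [br, Category.assoc, Iso.inv_hom_id_assoc, Iso.inv_hom_id, Category.comp_id]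
  rw [← BraidedCategory.braiding_naturality, reassoc_of% split_map]

end Transport

-- Plugging as a block symmetry followed by a box

section Plug
variable {C : Type v} [Category.{w} C] [MonoidalCategory C] [SymmetricCategory C] {α : Type u}
  {f : α → C}

theorem plug_natural {Z Z' : C} (z : Z' ⟶ Z) {L₂ : List α} {b : α} (g : Z ⊗ tens f L₂ ⟶ f b)
    (L₃ L₁ : List α) : plug f (z ▷ _ ≫ g) L₃ L₁ = z ▷ _ ≫ plug f g L₃ L₁ := by
  induction L₁ with
  | nil =>
    have : Z' ◁ (split f L₂ L₃).hom ≫ (α_ _ _ _).inv ≫ (z ▷ _ ≫ g) ▷ tens f L₃ =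
        z ▷ _ ≫ Z ◁ (split f L₂ L₃).hom ≫ (α_ _ _ _).inv ≫ g ▷ tens f L₃ := by
      rw [MonoidalCategory.comp_whiskerRight, ← associator_inv_naturality_left_assoc,
        MonoidalCategory.whisker_exchange_assoc]
    exact this
  | cons a L₁ ih =>
    have e := braid_assoc_natural z (f a) (tens f (L₁ ++ (L₂ ++ L₃))) =≫ (f a ◁ plug f g L₃ L₁)
    simp only [Category.assoc] at e
    simp only [plug, ih, MonoidalCategory.whiskerLeft_comp]
    exact e

theorem split_cons_right (D L : List α) (a : α) :
    (split f D (a :: L)).hom ≫ (α_ (tens f D) (f a) (tens f L)).inv ≫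
      (β_ (tens f D) (f a)).hom ▷ tens f L ≫ (α_ (f a) (tens f D) (tens f L)).hom =
    lc f (by simp) ≫ ten f (br f D [a]) (𝟙 (tens f L)) ≫ f a ◁ (split f D L).hom := by
  have e : lc f (by simp) ≫ (split f (D ++ [a]) L).hom ≫ (split f D [a]).hom ▷ tens f L ≫
      (α_ _ _ _).hom = (split f D (a :: L)).hom ≫ tens f D ◁ (split f [a] L).hom := by
    rw [split_assoc]
    exact (lc_lc_assoc f _ _ _).trans (Category.id_comp _)
  refine (braid_cons (split f D (a :: L)).hom _ _ (split f D [a]).hom (split f D L) e).trans ?_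
  have e' : ten f (br f D [a]) (𝟙 (tens f L)) = (split f (D ++ [a]) L).hom ≫
    br f D [a] ▷ tens f L ≫ (split f ([a] ++ D) L).inv := by
    simp [ten]
  rw [e']
  rfl

/-- `plug` carries its extra object past `L₁` one entry at a time. When that object is the tensor
product of a list, the hexagon turns these moves into one block symmetry. -/
theorem plug_eq (D L₂ L₃ L₁ : List α) {b : α} (g : tens f D ⊗ tens f L₂ ⟶ f b) :
    (split f D (L₁ ++ (L₂ ++ L₃))).hom ≫ plug f g L₃ L₁ =
      lc f (List.append_assoc _ _ _).symm ≫ ten f (br f D L₁) (𝟙 (tens f (L₂ ++ L₃))) ≫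
        lc f (by simp : _ = L₁ ++ ((D ++ L₂) ++ L₃)) ≫ ten f (𝟙 (tens f L₁))
          (ten f ((split f D L₂).hom ≫ g ≫ (ρ_ _).inv : tens f (D ++ L₂) ⟶ tens f [b])
            (𝟙 (tens f L₃))) := by
  induction L₁ with
  | nil =>
    have e := split_assoc f D L₂ L₃
    have : (split f D (L₂ ++ L₃)).hom ≫ tens f D ◁ (split f L₂ L₃).hom ≫ (α_ _ _ _).inv ≫
        g ▷ tens f L₃ = lc f (by simp) ≫ ((split f (D ++ L₂) L₃).hom ≫
          ((split f D L₂).hom ≫ g ≫ (ρ_ _).inv) ▷ tens f L₃ ≫ (α_ _ _ _).hom ≫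
            f b ◁ (λ_ (tens f L₃)).hom) := by
      have e' := lc f (List.append_assoc D L₂ L₃).symm ≫= e
      rw [lc_lc_assoc, lc_self, Category.id_comp] at e'
      rw [← reassoc_of% e']
      simp
    refine this.trans ?_
    rw [br_nil_right, ten_lc_id, nil_ten, lc_lc_assoc, lc_lc_assoc]
    refine congrArg₂ (· ≫ ·) rfl ?_
    rw [ten, MonoidalCategory.tensorHom_id]
    rfl
  | cons a L₁ ih =>
    have e := split_cons_right D (L₁ ++ (L₂ ++ L₃)) a =≫ (f a ◁ plug f g L₃ L₁)
    have e1 : f a ◁ (split f D (L₁ ++ (L₂ ++ L₃))).hom ≫ f a ◁ plug f g L₃ L₁ = _ :=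
      (MonoidalCategory.whiskerLeft_comp _ _ _).symm.trans (congrArg (f a ◁ ·) ih)
    -- Whiskering by the head is an action beside a one-element idle block, which brings the cons
    -- case into the calculus of `ten`.
    have e2 {P Q : List α} (m : tens f P ⟶ tens f Q) : f a ◁ m = ten f (𝟙 (tens f [a])) m := by
      rw [cons_ten, nil_ten]
    have e3 {P Q : List α} (m : tens f P ⟶ tens f Q) : ten f (𝟙 (tens f (a :: L₁))) m =
        ten f (𝟙 (tens f [a])) (ten f (𝟙 (tens f L₁)) m) := by
      rw [cons_ten, e2]
    refine (comp_assoc₄ _ _ _ _ _).trans (e.trans ((comp_assoc₃ _ _ _ _).trans ?_))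
    refine (congrArg₂ (· ≫ ·) rfl (congrArg₂ (· ≫ ·) rfl (e1.trans (e2 _)))).trans ?_
    rw [e3, br_cons_right a D L₁]
    simp
    rfl

theorem plug_map {β : Type u} {f₀ : β → C} {φ : β → α} (i : ∀ b, f₀ b ≅ f (φ b)) {Z : C}
    {L₂ : List β} {b : β} (g : Z ⊗ tens f₀ L₂ ⟶ f₀ b) (L₃ L₁ : List β) :
    plug f₀ g L₃ L₁ ≫ (mapI i (L₁ ++ b :: L₃)).hom = Z ◁ (mapI i (L₁ ++ (L₂ ++ L₃))).hom ≫
      Z ◁ lc f (by simp) ≫ plug f (b := φ b) (Z ◁ (mapI i L₂).inv ≫ g ≫ (i b).hom) (L₃.map φ)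
        (L₁.map φ) ≫ lc f (by simp) := by
  induction L₁ with
  | nil =>
    refine (whisker_tensor_of_eq (split f₀ L₂ L₃).hom (split f (L₂.map φ) (L₃.map φ)).hom
      (mapI i L₂) (mapI i L₃).hom ((mapI i (L₂ ++ L₃)).hom ≫ lc f (by simp))
      (by rw [split_map, Category.assoc]) g (i b).hom).trans ?_
    rw [MonoidalCategory.whiskerLeft_comp, Category.assoc]
    refine congrArg₂ (· ≫ ·) rfl (congrArg₂ (· ≫ ·) rfl ?_)
    exact (Category.comp_id _).symm
  | cons a L₁ ih =>
    refine (braid_assoc_natural_of_eq (i a).hom _ _ _ _ _ _ ih).trans ?_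
    refine congrArg₂ (· ≫ ·) rfl (congrArg₂ (· ≫ ·) ?_ (congrArg₂ (· ≫ ·) rfl ?_))
    · exact congrArg (Z ◁ ·) (lc_cons_self f _).symm
    · exact (lc_cons_self f _).symm

end Plug
-- Morphisms out of two lists as morphisms out of one
section Bend
variable {C : Type v} [Category.{w} C] [MonoidalCategory C] {α β₁ β₂ : Type u}
  {f₁ : β₁ → C} {f₂ : β₂ → C} {F : α → C} {φ₁ : β₁ → α} {φ₂ : β₂ → α}
  (i₁ : ∀ b, f₁ b ≅ F (φ₁ b)) (i₂ : ∀ b, f₂ b ≅ F (φ₂ b))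

/-- A morphism out of the tensor product of two lists, as a morphism out of the concatenation of
the renamed lists. -/
def bx {D : List β₁} {G : List β₂} {b : β₂} (x : tens f₁ D ⊗ tens f₂ G ⟶ f₂ b) :
    tens F (D.map φ₁ ++ G.map φ₂) ⟶ tens F [φ₂ b] :=
  (split F (D.map φ₁) (G.map φ₂)).hom ≫ ((mapI i₁ D).inv ⊗ₘ (mapI i₂ G).inv) ≫ x ≫ (i₂ b).hom ≫
    (ρ_ (F (φ₂ b))).inv

theorem bx_injective {D : List β₁} {G : List β₂} {b : β₂} {x y : tens f₁ D ⊗ tens f₂ G ⟶ f₂ b}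
    (h : bx i₁ i₂ x = bx i₁ i₂ y) : x = y := by
  unfold bx at h
  rw [cancel_epi, cancel_epi] at h
  have h' := h =≫ ((ρ_ (F (φ₂ b))).hom ≫ (i₂ b).inv)
  have e (z : tens f₁ D ⊗ tens f₂ G ⟶ f₂ b) :
      (z ≫ (i₂ b).hom ≫ (ρ_ (F (φ₂ b))).inv) ≫ (ρ_ (F (φ₂ b))).hom ≫ (i₂ b).inv = z := by simp
  exact (e x).symm.trans (h'.trans (e y))

theorem bx_left {D D' : List β₁} {G : List β₂} {b : β₂} (g : tens f₁ D' ⟶ tens f₁ D)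
    (x : tens f₁ D ⊗ tens f₂ G ⟶ f₂ b) :
    bx i₁ i₂ (g ▷ tens f₂ G ≫ x) = ten F (tm i₁ g) (𝟙 _) ≫ bx i₁ i₂ x := by
  have e : (tm i₁ g ⊗ₘ 𝟙 (tens F (G.map φ₂))) ≫ ((mapI i₁ D).inv ⊗ₘ (mapI i₂ G).inv) =
      ((mapI i₁ D').inv ⊗ₘ (mapI i₂ G).inv) ≫ g ▷ tens f₂ G := by
    rw [← MonoidalCategory.tensorHom_id, MonoidalCategory.tensorHom_comp_tensorHom,
      MonoidalCategory.tensorHom_comp_tensorHom]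
    simp [tm]
  rw [bx, bx, ten_split_assoc, reassoc_of% e, Category.assoc]

theorem bx_right {D : List β₁} {G G' : List β₂} {b : β₂} (g : tens f₂ G' ⟶ tens f₂ G)
    (x : tens f₁ D ⊗ tens f₂ G ⟶ f₂ b) :
    bx i₁ i₂ (tens f₁ D ◁ g ≫ x) = ten F (𝟙 _) (tm i₂ g) ≫ bx i₁ i₂ x := by
  have e : (𝟙 (tens F (D.map φ₁)) ⊗ₘ tm i₂ g) ≫ ((mapI i₁ D).inv ⊗ₘ (mapI i₂ G).inv) =
      ((mapI i₁ D).inv ⊗ₘ (mapI i₂ G').inv) ≫ tens f₁ D ◁ g := by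
    rw [← MonoidalCategory.id_tensorHom, MonoidalCategory.tensorHom_comp_tensorHom,
      MonoidalCategory.tensorHom_comp_tensorHom]
    simp [tm]
  rw [bx, bx, ten_split_assoc, reassoc_of% e, Category.assoc]

theorem bx_inside_left {P Q : List β₁} (A E : List β₁) {G : List β₂} {b : β₂}
    (g : tens f₁ Q ⟶ tens f₁ P) (x : tens f₁ (A ++ (P ++ E)) ⊗ tens f₂ G ⟶ f₂ b) :
    bx i₁ i₂ (inside f₁ g A E ▷ tens f₂ G ≫ x) =
      boxM (A.map φ₁) (E.map φ₁ ++ G.map φ₂) (by simp) (tm i₁ g) (by simp) (bx i₁ i₂ x) := by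
  rw [bx_left, tm_inside]
  simp [boxM]

theorem bx_inside_right {P Q : List β₂} (A E : List β₂) {D : List β₁} {b : β₂}
    (g : tens f₂ Q ⟶ tens f₂ P) (x : tens f₁ D ⊗ tens f₂ (A ++ (P ++ E)) ⟶ f₂ b) :
    bx i₁ i₂ (tens f₁ D ◁ inside f₂ g A E ≫ x) =
      boxM (D.map φ₁ ++ A.map φ₂) (E.map φ₂) (by simp) (tm i₂ g) (by simp) (bx i₁ i₂ x) := by
  rw [bx_right, tm_inside]
  simp [boxM]

variable [SymmetricCategory C]

/-- Identifies the interpretation of a linear cut with `cutM`. In the proof `e2` expresses `cutM`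
through `plug` by `plug_eq`, `e3` compares plugging before and after renaming, and the remaining
equations say that splitting commutes with renaming and with casts. -/
theorem bx_plug (D₁ D₂ : List β₁) (G₁ G₂ G₃ : List β₂) {b c : β₂}
    (x : tens f₁ D₂ ⊗ tens f₂ G₂ ⟶ f₂ b) (y : tens f₁ D₁ ⊗ tens f₂ (G₁ ++ b :: G₃) ⟶ f₂ c) :
    bx i₁ i₂ ((split f₁ D₁ D₂).hom ▷ _ ≫ (α_ _ _ _).hom ≫ tens f₁ D₁ ◁ plug f₂ x G₃ G₁ ≫ y) =
      cutM (D₁.map φ₁) (D₂.map φ₁) (G₁.map φ₂) (G₂.map φ₂) (G₃.map φ₂) (by simp) rfl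
        (bx i₁ i₂ x) (by simp) (bx i₁ i₂ y) := by
  let g : tens F (D₂.map φ₁) ⊗ tens F (G₂.map φ₂) ⟶ F (φ₂ b) :=
    ((mapI i₁ D₂).inv ⊗ₘ (mapI i₂ G₂).inv) ≫ x ≫ (i₂ b).hom
  have hx : bx i₁ i₂ x = (split F (D₂.map φ₁) (G₂.map φ₂)).hom ≫ g ≫ (ρ_ (F (φ₂ b))).inv := by
    simp only [bx, g, Category.assoc]
    rfl
  have h₀ : (D₁ ++ D₂).map φ₁ = D₁.map φ₁ ++ D₂.map φ₁ := List.map_append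
  have h₁ : (G₁ ++ (G₂ ++ G₃)).map φ₂ = G₁.map φ₂ ++ (G₂.map φ₂ ++ G₃.map φ₂) := by simp
  have h₂ : G₁.map φ₂ ++ φ₂ b :: G₃.map φ₂ = (G₁ ++ b :: G₃).map φ₂ := by simp
  have e2 : cutM (D₁.map φ₁) (D₂.map φ₁) (G₁.map φ₂) (G₂.map φ₂) (G₃.map φ₂) (by simp) rfl
        (bx i₁ i₂ x) (by simp) (bx i₁ i₂ y) =
      lc F (show (D₁ ++ D₂).map φ₁ ++ (G₁ ++ (G₂ ++ G₃)).map φ₂ = D₁.map φ₁ ++ (D₂.map φ₁ ++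
          (G₁.map φ₂ ++ (G₂.map φ₂ ++ G₃.map φ₂))) by simp) ≫
        ten F (𝟙 (tens F (D₁.map φ₁)))
          ((split F (D₂.map φ₁) (G₁.map φ₂ ++ (G₂.map φ₂ ++ G₃.map φ₂))).hom ≫
            plug F g (G₃.map φ₂) (G₁.map φ₂)) ≫ lc F (by rw [h₂]) ≫ bx i₁ i₂ y := by
    rw [plug_eq (D₂.map φ₁) (G₂.map φ₂) (G₃.map φ₂) (G₁.map φ₂) g, hx]
    simp [cutM, boxM]
    rfl
  have hg : g = (mapI i₁ D₂).inv ▷ _ ≫ (tens f₁ D₂ ◁ (mapI i₂ G₂).inv ≫ x ≫ (i₂ b).hom) := by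
    simp [g, MonoidalCategory.tensorHom_def]
  have e3 : plug F g (G₃.map φ₂) (G₁.map φ₂) ≫ lc F h₂ ≫ (mapI i₂ (G₁ ++ b :: G₃)).inv =
      (mapI i₁ D₂).inv ▷ _ ≫ tens f₁ D₂ ◁ lc F h₁.symm ≫
        tens f₁ D₂ ◁ (mapI i₂ (G₁ ++ (G₂ ++ G₃))).inv ≫ plug f₂ x G₃ G₁ := by
    rw [hg, plug_natural, ← cancel_mono (mapI i₂ (G₁ ++ b :: G₃)).hom]
    simp only [Category.assoc, Iso.inv_hom_id, Category.comp_id, plug_map]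
    simp only [← MonoidalCategory.whiskerLeft_comp_assoc, Iso.inv_hom_id_assoc, lc_lc, lc_self,
      MonoidalCategory.whiskerLeft_id, Category.id_comp, Category.assoc]
  have e4 : lc F (show D₁.map φ₁ ++ (G₁.map φ₂ ++ φ₂ b :: G₃.map φ₂) = _ by rw [h₂]) ≫
      (split F (D₁.map φ₁) ((G₁ ++ b :: G₃).map φ₂)).hom =
      (split F (D₁.map φ₁) (G₁.map φ₂ ++ φ₂ b :: G₃.map φ₂)).hom ≫
        (lc F rfl ⊗ₘ lc F h₂) := by
    rw [split_lc]
  have e5 : (split F ((D₁ ++ D₂).map φ₁) ((G₁ ++ (G₂ ++ G₃)).map φ₂)).hom ≫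
      (lc F h₀ ⊗ₘ lc F h₁) = lc F (by rw [h₀, h₁]) ≫
        (split F (D₁.map φ₁ ++ D₂.map φ₁) (G₁.map φ₂ ++ (G₂.map φ₂ ++ G₃.map φ₂))).hom := by
    rw [split_lc]
  have e6 : (mapI i₁ (D₁ ++ D₂)).inv ≫ (split f₁ D₁ D₂).hom = lc F h₀ ≫
      (split F (D₁.map φ₁) (D₂.map φ₁)).hom ≫ ((mapI i₁ D₁).inv ⊗ₘ (mapI i₁ D₂).inv) := by
    rw [split_map_inv]; simp
  have e7 : ((mapI i₁ (D₁ ++ D₂)).inv ⊗ₘ (mapI i₂ (G₁ ++ (G₂ ++ G₃))).inv) ≫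
      (split f₁ D₁ D₂).hom ▷ _ ≫ (α_ _ _ _).hom =
      (lc F h₀ ⊗ₘ lc F h₁) ≫ (split F (D₁.map φ₁) (D₂.map φ₁)).hom ▷ _ ≫ (α_ _ _ _).hom ≫
        ((mapI i₁ D₁).inv ⊗ₘ ((mapI i₁ D₂).inv ⊗ₘ
          (lc F h₁.symm ≫ (mapI i₂ (G₁ ++ (G₂ ++ G₃))).inv))) := by
    rw [← MonoidalCategory.tensorHom_id, MonoidalCategory.tensorHom_comp_tensorHom_assoc, e6,
      ← associator_naturality, ← MonoidalCategory.tensorHom_id,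
      MonoidalCategory.tensorHom_comp_tensorHom_assoc,
      MonoidalCategory.tensorHom_comp_tensorHom_assoc]
    simp
  have e8 : ((mapI i₁ D₁).inv ⊗ₘ ((mapI i₁ D₂).inv ⊗ₘ
      (lc F h₁.symm ≫ (mapI i₂ (G₁ ++ (G₂ ++ G₃))).inv))) ≫ tens f₁ D₁ ◁ plug f₂ x G₃ G₁ =
      (𝟙 _ ⊗ₘ plug F g (G₃.map φ₂) (G₁.map φ₂)) ≫ (lc F rfl ⊗ₘ lc F h₂) ≫
        ((mapI i₁ D₁).inv ⊗ₘ (mapI i₂ (G₁ ++ b :: G₃)).inv) := by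
    simp only [← MonoidalCategory.id_tensorHom, MonoidalCategory.tensorHom_comp_tensorHom, e3]
    simp [MonoidalCategory.tensorHom_def]
  rw [e2, bx, bx]
  simp only [Category.assoc]
  rw [reassoc_of% e7, reassoc_of% e5, reassoc_of% e8, reassoc_of% e4,
    ten_split_assoc, split_assoc_assoc]
  simp [MonoidalCategory.tensorHom_def]

end Bend
-- Mixed derivations over a single list of hypotheses
/-- The hypotheses of a mixed sequent, in a single list: the graded hypotheses. -/
def gl {R : Type u} (Δ : GCtx R) : List ((R × GTy R) ⊕ LTy R) := Δ.map Sum.inl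

/-- The hypotheses of a mixed sequent, in a single list: the linear hypotheses. -/
def ll {R : Type u} (Γ : List (LTy R)) : List ((R × GTy R) ⊕ LTy R) := Γ.map Sum.inr

section
variable {R : Type u}
@[simp] theorem gl_append (Δ Δ' : GCtx R) : gl (Δ ++ Δ') = gl Δ ++ gl Δ' := List.map_append
@[simp] theorem gl_cons (p : R × GTy R) (Δ : GCtx R) : gl (p :: Δ) = .inl p :: gl Δ := by simp [gl]
@[simp] theorem gl_nil : gl ([] : GCtx R) = [] := by simp [gl]
@[simp] theorem ll_append (Γ Γ' : List (LTy R)) : ll (Γ ++ Γ') = ll Γ ++ ll Γ' := List.map_append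
@[simp] theorem ll_cons (A : LTy R) (Γ : List (LTy R)) : ll (A :: Γ) = .inr A :: ll Γ := by simp [ll]
@[simp] theorem ll_nil : ll ([] : List (LTy R)) = [] := by simp [ll]
end

namespace MGLModel
open Functor.LaxMonoidal
variable {R : Type u} [Semiring R] [Preorder R] [AddLeftMono R] [MulLeftMono R] [MulRightMono R]
  {C : Type v} [Category.{w} C] [MonoidalCategory C] [SymmetricCategory C]
  {M : Type v} [Category.{w} M] [MonoidalCategory M] [SymmetricCategory M] [MonoidalClosed M]
  (𝓜 : MGLModel R C M)

/-- The interpretation of the hypotheses of mixed sequents. -/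
def hyp : (R × GTy R) ⊕ LTy R → M := Sum.elim 𝓜.mhyp 𝓜.lty

/-- The renaming isomorphisms are identities here; together with `iL` this instantiates the general
lemmas on renamed lists with graded hypotheses on the left of the sum type and linear ones on the
right. -/
def iG (p : R × GTy R) : 𝓜.mhyp p ≅ 𝓜.hyp (.inl p) := Iso.refl _

def iL (A : LTy R) : 𝓜.lty A ≅ 𝓜.hyp (.inr A) := Iso.refl _

/-- A morphism between graded contexts, in the list of all hypotheses. -/
def gm {P Q : GCtx R} (g : 𝓜.mctx P ⟶ 𝓜.mctx Q) : tens 𝓜.hyp (gl P) ⟶ tens 𝓜.hyp (gl Q) :=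
  tm 𝓜.iG g

/-- A morphism between linear contexts, in the list of all hypotheses. -/
def lm {P Q : List (LTy R)} (g : 𝓜.lctx P ⟶ 𝓜.lctx Q) : tens 𝓜.hyp (ll P) ⟶ tens 𝓜.hyp (ll Q) :=
  tm 𝓜.iL g

/-- The interpretation of a mixed derivation, as a morphism from the list of all hypotheses. -/
def bend {Δ : GCtx R} {Γ : List (LTy R)} {A : LTy R} (x : 𝓜.mctx Δ ⊗ 𝓜.lctx Γ ⟶ 𝓜.lty A) :
    tens 𝓜.hyp (gl Δ ++ ll Γ) ⟶ tens 𝓜.hyp [.inr A] := bx 𝓜.iG 𝓜.iL x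

/-- The interpretation of a mixed derivation, as a morphism from the list of all hypotheses. -/
noncomputable def sm {Δ : GCtx R} {Γ : List (LTy R)} {A : LTy R} (π : MS Δ Γ A) :
    tens 𝓜.hyp (gl Δ ++ ll Γ) ⟶ tens 𝓜.hyp [.inr A] := 𝓜.bend (𝓜.ms π)

theorem bend_injective {Δ : GCtx R} {Γ : List (LTy R)} {A : LTy R}
    {x y : 𝓜.mctx Δ ⊗ 𝓜.lctx Γ ⟶ 𝓜.lty A} (h : 𝓜.bend x = 𝓜.bend y) : x = y :=
  bx_injective _ _ h

theorem ms_eq_of_sm {Δ : GCtx R} {Γ : List (LTy R)} {A : LTy R} {π π' : MS Δ Γ A}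
    (h : 𝓜.sm π = 𝓜.sm π') : 𝓜.ms π = 𝓜.ms π' := 𝓜.bend_injective h

theorem gm_comp {P Q S : GCtx R} (g : 𝓜.mctx P ⟶ 𝓜.mctx Q) (h : 𝓜.mctx Q ⟶ 𝓜.mctx S) :
    𝓜.gm (g ≫ h) = 𝓜.gm g ≫ 𝓜.gm h := tm_comp _ g h

theorem gm_lc {P Q : GCtx R} (h : P = Q) :
    𝓜.gm (lc 𝓜.mhyp h) = lc 𝓜.hyp (by rw [h]) := tm_lc _ h

theorem gm_ten {P P' Q Q' : GCtx R} (g : 𝓜.mctx P ⟶ 𝓜.mctx Q) (h : 𝓜.mctx P' ⟶ 𝓜.mctx Q') :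
    𝓜.gm (ten 𝓜.mhyp g h) = lc 𝓜.hyp (gl_append P P') ≫ ten 𝓜.hyp (𝓜.gm g) (𝓜.gm h) ≫
      lc 𝓜.hyp (gl_append Q Q').symm := tm_ten _ g h

theorem gm_id (P : GCtx R) : 𝓜.gm (𝟙 (𝓜.mctx P)) = 𝟙 _ := tm_id _ P

theorem gm_br (P Q : GCtx R) : 𝓜.gm (br 𝓜.mhyp P Q) = lc 𝓜.hyp (gl_append P Q) ≫
    br 𝓜.hyp (gl P) (gl Q) ≫ lc 𝓜.hyp (gl_append Q P).symm := tm_br _ P Q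

theorem lm_br (P Q : List (LTy R)) : 𝓜.lm (br 𝓜.lty P Q) = lc 𝓜.hyp (ll_append P Q) ≫
    br 𝓜.hyp (ll P) (ll Q) ≫ lc 𝓜.hyp (ll_append Q P).symm := tm_br _ P Q

theorem bend_gm {Δ Δ' : GCtx R} {Γ : List (LTy R)} {A : LTy R} (g : 𝓜.mctx Δ' ⟶ 𝓜.mctx Δ)
    (x : 𝓜.mctx Δ ⊗ 𝓜.lctx Γ ⟶ 𝓜.lty A) :
    𝓜.bend (g ▷ 𝓜.lctx Γ ≫ x) = boxM [] (ll Γ) rfl (𝓜.gm g) rfl (𝓜.bend x) := by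
  refine (bx_left 𝓜.iG 𝓜.iL g x).trans ?_
  change ten 𝓜.hyp (𝓜.gm g) (𝟙 (tens 𝓜.hyp (ll Γ))) ≫ 𝓜.bend x = _
  simp [boxM]

theorem bend_inside {P Q : GCtx R} (A D : GCtx R) {Γ : List (LTy R)} {B : LTy R}
    (g : 𝓜.mctx Q ⟶ 𝓜.mctx P) (x : 𝓜.mctx (A ++ (P ++ D)) ⊗ 𝓜.lctx Γ ⟶ 𝓜.lty B) :
    𝓜.bend (inside 𝓜.mhyp g A D ▷ 𝓜.lctx Γ ≫ x) =
      boxM (gl A) (gl D ++ ll Γ) (by simp) (𝓜.gm g) (by simp) (𝓜.bend x) :=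
  bx_inside_left 𝓜.iG 𝓜.iL A D g x

theorem bend_inside_right {P Q : List (LTy R)} (A E : List (LTy R)) {D : GCtx R} {B : LTy R}
    (g : 𝓜.lctx Q ⟶ 𝓜.lctx P) (x : 𝓜.mctx D ⊗ 𝓜.lctx (A ++ (P ++ E)) ⟶ 𝓜.lty B) :
    𝓜.bend (𝓜.mctx D ◁ inside 𝓜.lty g A E ≫ x) =
      boxM (gl D ++ ll A) (ll E) (by simp) (𝓜.lm g) (by simp) (𝓜.bend x) :=
  bx_inside_right 𝓜.iG 𝓜.iL A E g x

theorem bend_plug (D₁ D₂ : GCtx R) (G₁ G₂ G₃ : List (LTy R)) {b c : LTy R}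
    (x : 𝓜.mctx D₂ ⊗ 𝓜.lctx G₂ ⟶ 𝓜.lty b) (y : 𝓜.mctx D₁ ⊗ 𝓜.lctx (G₁ ++ b :: G₃) ⟶ 𝓜.lty c) :
    𝓜.bend ((split 𝓜.mhyp D₁ D₂).hom ▷ _ ≫ (α_ _ _ _).hom ≫
        𝓜.mctx D₁ ◁ plug 𝓜.lty x G₃ G₁ ≫ y) =
      cutM (gl D₁) (gl D₂) (ll G₁) (ll G₂) (ll G₃) (by simp) rfl (𝓜.bend x) (by simp) (𝓜.bend y) :=
  bx_plug 𝓜.iG 𝓜.iL D₁ D₂ G₁ G₂ G₃ x y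

theorem sm_tr {Δ Δ' : GCtx R} {Γ Γ' : List (LTy R)} {A : LTy R} (π : MS Δ Γ A) (h : Δ = Δ')
    (h' : Γ = Γ') : 𝓜.sm (π.tr h h') = lc 𝓜.hyp (by rw [h, h']) ≫ 𝓜.sm π := by
  subst h h'
  rw [lc_self, Category.id_comp]
  rfl

theorem sm_sub {Δ Δ' : GCtx R} {Γ : List (LTy R)} {A : LTy R} (h : GLe Δ Δ') (π : MS Δ Γ A) :
    𝓜.sm (.sub h π) = boxM [] (ll Γ) rfl (𝓜.gm (𝓜.mle h)) rfl (𝓜.sm π) := by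
  rw [sm, MGLModel.ms]
  exact 𝓜.bend_gm _ _

theorem sm_gleft (A D : GCtx R) {P Q : GCtx R} {Γ : List (LTy R)} {B : LTy R} (ρ : GStep P Q)
    (π : MS (A ++ (P ++ D)) Γ B) : 𝓜.sm (.gleft A D ρ π) =
      boxM (gl A) (gl D ++ ll Γ) (by simp) (𝓜.gm (𝓜.mstep ρ)) (by simp) (𝓜.sm π) := by
  rw [sm, MGLModel.ms]
  exact 𝓜.bend_inside _ _ _ _

theorem sm_lleft {Δ : GCtx R} (Γ₁ Γ₃ : List (LTy R)) {P Q : List (LTy R)} {B : LTy R}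
    (κ : LStep P Q) (π : MS Δ (Γ₁ ++ (P ++ Γ₃)) B) : 𝓜.sm (.lleft Γ₁ Γ₃ κ π) =
      boxM (gl Δ ++ ll Γ₁) (ll Γ₃) (by simp) (𝓜.lm (𝓜.lstep κ)) (by simp) (𝓜.sm π) := by
  rw [sm, MGLModel.ms]
  exact 𝓜.bend_inside_right _ _ _ _

theorem sm_cut (Γ₁ Γ₃ : List (LTy R)) {Δ₁ Δ₂ : GCtx R} {Γ₂ : List (LTy R)} {A B : LTy R}
    (π₁ : MS Δ₂ Γ₂ A) (π₂ : MS Δ₁ (Γ₁ ++ A :: Γ₃) B) : 𝓜.sm (.cut Γ₁ Γ₃ π₁ π₂) =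
      cutM (gl Δ₁) (gl Δ₂) (ll Γ₁) (ll Γ₂) (ll Γ₃) (by simp) rfl (𝓜.sm π₁) (by simp)
        (𝓜.sm π₂) := by
  rw [sm, MGLModel.ms]
  exact 𝓜.bend_plug _ _ _ _ _ _ _

theorem sm_id (A : LTy R) : 𝓜.sm (.id A) = 𝟙 (tens 𝓜.hyp [.inr A]) := by
  rw [sm, MGLModel.ms]
  have h (X : M) : (λ_ (X ⊗ 𝟙_ M)).inv ≫ (𝟙 (𝟙_ M) ⊗ₘ (𝟙 X ⊗ₘ 𝟙 (𝟙_ M))) ≫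
      ((λ_ (X ⊗ 𝟙_ M)).hom ≫ (ρ_ X).hom) ≫ 𝟙 X ≫ (ρ_ X).inv = 𝟙 _ := by simp
  exact h (𝓜.lty A)

/-- Whiskering by a linear context, as a presheaf on the graded contexts. -/
def mPsh (Γ : List (LTy R)) (B : LTy R) : Psh.{v, w, w} M where
  obj X := X ⊗ 𝓜.lctx Γ ⟶ 𝓜.lty B
  res f g := f ▷ _ ≫ g
  res_id := by simp
  res_comp := by simp

theorem ms_gleft (A D : GCtx R) {P Q : GCtx R} {Γ : List (LTy R)} {B : LTy R} (ρ : GStep P Q)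
    (π : MS (A ++ (P ++ D)) Γ B) :
    𝓜.ms (.gleft A D ρ π) = inside 𝓜.mhyp (𝓜.mstep ρ) A D ▷ 𝓜.lctx Γ ≫ 𝓜.ms π := by
  rw [MGLModel.ms]

theorem sm_mcut (A D : GCtx R) (ds : List R) {Δ : GCtx R} {X : GTy R} {Γ : List (LTy R)}
    {B : LTy R} (Θ : GS Δ X) (π : MS (A ++ (rep ds X ++ D)) Γ B) : 𝓜.sm (MS.mcut A D ds Θ π) =
      boxM (gl A) (gl D ++ ll Γ) (by simp) (𝓜.gm (mcutMor 𝓜.mstep ds Θ)) (by simp) (𝓜.sm π) := by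
  have h := sem_mcut 𝓜.mstep (𝓜.mPsh Γ B) (F := fun Δ => MS Δ Γ B) 𝓜.ms (step := MS.step Γ B)
    (fun A D _ _ ρ π => 𝓜.ms_gleft A D ρ π) A D ds Θ π
  exact (congrArg 𝓜.bend h).trans (𝓜.bend_inside _ _ _ _)

theorem sm_gswap (A P Q D : GCtx R) {Γ : List (LTy R)} {B : LTy R}
    (π : MS (A ++ (P ++ (Q ++ D))) Γ B) : 𝓜.sm (MS.gswap A P Q D π) =
      boxM (gl A) (gl D ++ ll Γ) (by simp) (br 𝓜.hyp (gl Q) (gl P)) (by simp) (𝓜.sm π) := by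
  have h := sem_gswap 𝓜.mstep (𝓜.mPsh Γ B) (F := fun Δ => MS Δ Γ B) 𝓜.ms (step := MS.step Γ B)
    (fun A D _ _ ρ π => 𝓜.ms_gleft A D ρ π) (fun p q => by rw [MGLModel.mstep]) A P Q D π
  refine (congrArg 𝓜.bend h).trans ((𝓜.bend_gm _ _).trans ?_)
  simp only [gm_ten, gm_comp, gm_lc, gm_br, gm_id]
  simp [boxM, sm]

/-- Whiskering by a graded context, as a presheaf on the linear contexts. -/
def lPsh (Δ : GCtx R) (B : LTy R) : Psh.{v, w, w} M where
  obj X := 𝓜.mctx Δ ⊗ X ⟶ 𝓜.lty B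
  res f g := _ ◁ f ≫ g
  res_id := by simp
  res_comp := by simp

theorem lm_comp {P Q S : List (LTy R)} (g : 𝓜.lctx P ⟶ 𝓜.lctx Q) (h : 𝓜.lctx Q ⟶ 𝓜.lctx S) :
    𝓜.lm (g ≫ h) = 𝓜.lm g ≫ 𝓜.lm h := tm_comp _ g h

theorem lm_lc {P Q : List (LTy R)} (h : P = Q) :
    𝓜.lm (lc 𝓜.lty h) = lc 𝓜.hyp (by rw [h]) := tm_lc _ h

theorem lm_ten {P P' Q Q' : List (LTy R)} (g : 𝓜.lctx P ⟶ 𝓜.lctx Q)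
    (h : 𝓜.lctx P' ⟶ 𝓜.lctx Q') :
    𝓜.lm (ten 𝓜.lty g h) = lc 𝓜.hyp (ll_append P P') ≫ ten 𝓜.hyp (𝓜.lm g) (𝓜.lm h) ≫
      lc 𝓜.hyp (ll_append Q Q').symm := tm_ten _ g h

theorem lm_id (P : List (LTy R)) : 𝓜.lm (𝟙 (𝓜.lctx P)) = 𝟙 _ := tm_id _ P

theorem bend_lm {Δ : GCtx R} {Γ Γ' : List (LTy R)} {A : LTy R} (g : 𝓜.lctx Γ' ⟶ 𝓜.lctx Γ)
    (x : 𝓜.mctx Δ ⊗ 𝓜.lctx Γ ⟶ 𝓜.lty A) :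
    𝓜.bend (𝓜.mctx Δ ◁ g ≫ x) = ten 𝓜.hyp (𝟙 (tens 𝓜.hyp (gl Δ))) (𝓜.lm g) ≫ 𝓜.bend x :=
  bx_right 𝓜.iG 𝓜.iL g x

theorem sm_lswap {Δ : GCtx R} (Γ₁ P Q Γ₃ : List (LTy R)) {B : LTy R}
    (π : MS Δ (Γ₁ ++ (P ++ (Q ++ Γ₃))) B) : 𝓜.sm (MS.lswap Γ₁ P Q Γ₃ π) =
      boxM (gl Δ ++ ll Γ₁) (ll Γ₃) (by simp) (br 𝓜.hyp (ll Q) (ll P)) (by simp) (𝓜.sm π) := by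
  have h := sem_swapBlocks (𝓜.lPsh Δ B) (F := fun Γ => MS Δ Γ B) 𝓜.ms
    (ex := fun Γ₁ Γ₃ A B => .lleft Γ₁ Γ₃ (.ex A B))
    (fun Γ₁ Γ₃ A B π => by rw [MGLModel.ms]; rfl) Γ₁ P Q Γ₃ π
  refine (congrArg 𝓜.bend h).trans ((𝓜.bend_lm _ _).trans ?_)
  simp only [lm_ten, lm_comp, lm_lc, lm_br, lm_id]
  simp [boxM, sm]

end MGLModel

-- Rules across the border of the two contexts, and the right rule of the tensor

section Lists
variable {C : Type v} [Category.{w} C] [MonoidalCategory C] {α β₁ β₂ : Type u}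
  {f₁ : β₁ → C} {f₂ : β₂ → C} {F : α → C} {φ₁ : β₁ → α} {φ₂ : β₂ → α}
  (i₁ : ∀ b, f₁ b ≅ F (φ₁ b)) (i₂ : ∀ b, f₂ b ≅ F (φ₂ b))

theorem split_assoc_inv {f : α → C} (A B D : List α) : (split f A (B ++ D)).hom ≫
    tens f A ◁ (split f B D).hom ≫ (α_ _ _ _).inv =
    lc f (List.append_assoc A B D).symm ≫ (split f (A ++ B) D).hom ≫
      (split f A B).hom ▷ tens f D := by
  have h := split_assoc f A B D
  rw [eq_comm, lc_comp_eq] at h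
  rw [← Category.assoc, ← cancel_mono (α_ (tens f A) (tens f B) (tens f D)).hom]
  simp only [Category.assoc, Iso.inv_hom_id, Category.comp_id]
  exact h

theorem split_four {f : α → C} (A B D E : List α) :
    (split f (A ++ B) (D ++ E)).hom ≫ ((split f A B).hom ⊗ₘ (split f D E).hom) =
      lc f (by simp) ≫ (split f A ((B ++ D) ++ E)).hom ≫ tens f A ◁ (split f (B ++ D) E).hom ≫
        tens f A ◁ ((split f B D).hom ▷ tens f E) ≫ tens f A ◁ (α_ _ _ _).hom ≫
          (α_ _ _ _).inv := by
  have h := congrArg (tens f A ◁ ·) (split_assoc f B D E)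
  simp only [MonoidalCategory.whiskerLeft_comp] at h
  have e : (split f A ((B ++ D) ++ E)).hom ≫ tens f A ◁ lc f (List.append_assoc B D E) =
      lc f (by simp) ≫ (split f A (B ++ (D ++ E))).hom := by
    rw [← split_lc f rfl (List.append_assoc B D E)]; simp
  rw [reassoc_of% h, reassoc_of% e, lc_lc_assoc]
  have k : tens f A ◁ tens f B ◁ (split f D E).hom ≫ (α_ _ _ _).inv = (α_ _ _ _).inv ≫
    (tens f A ⊗ tens f B) ◁ (split f D E).hom := by simp
  rw [k, reassoc_of% split_assoc_inv]
  simp [MonoidalCategory.tensorHom_def]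

theorem obj_toLeft {D D' B B' G G' A A' : C} (d : D' ⟶ D) (b : B' ⟶ B) (g : G' ⟶ G)
    (e : B ⟶ A) (a : A ≅ A') :
    (d ⊗ₘ (b ⊗ₘ g)) ≫ (α_ _ _ _).inv ≫ (D ◁ (e ≫ (ρ_ _).inv)) ▷ G =
      D' ◁ ((B' ◁ (λ_ G').inv ≫ (α_ B' (𝟙_ C) G').inv) ≫ (((b ≫ e ≫ a.hom) ▷ 𝟙_ C) ⊗ₘ 𝟙 G')) ≫
        (α_ _ _ _).inv ≫ ((d ⊗ₘ (a.inv ⊗ₘ 𝟙 (𝟙_ C))) ⊗ₘ g) := by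
  have h₁ : (B' ◁ (λ_ G').inv ≫ (α_ B' (𝟙_ C) G').inv) ≫ (((b ≫ e ≫ a.hom) ▷ 𝟙_ C) ⊗ₘ 𝟙 G') ≫
      ((a.inv ⊗ₘ 𝟙 (𝟙_ C)) ⊗ₘ g) = ((b ≫ e) ⊗ₘ g) ≫ A ◁ (λ_ G).inv ≫ (α_ A (𝟙_ C) G).inv := by
    have n : ((b ≫ e) ⊗ₘ g) ≫ A ◁ (λ_ G).inv = B' ◁ (λ_ G').inv ≫ ((b ≫ e) ⊗ₘ (𝟙 _ ⊗ₘ g)) := by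
      rw [← MonoidalCategory.id_tensorHom, ← MonoidalCategory.id_tensorHom,
        MonoidalCategory.tensorHom_comp_tensorHom, MonoidalCategory.tensorHom_comp_tensorHom]
      simp
    rw [← MonoidalCategory.tensorHom_id, MonoidalCategory.tensorHom_comp_tensorHom,
      MonoidalCategory.tensorHom_comp_tensorHom, reassoc_of% n, associator_inv_naturality]
    simp
  have h₂ : (α_ D A G).inv ≫ (D ◁ (ρ_ A).inv) ▷ G =
      D ◁ (A ◁ (λ_ G).inv ≫ (α_ A (𝟙_ C) G).inv) ≫ (α_ _ _ _).inv := by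
    monoidal
  have h₃ {X X' X'' : C} (p : X ⟶ X') (q : X' ⟶ X'') : D' ◁ p ≫ (d ⊗ₘ q) = (d ⊗ₘ (p ≫ q)) := by
    rw [← MonoidalCategory.id_tensorHom, MonoidalCategory.tensorHom_comp_tensorHom,
      Category.id_comp]
  have h₄ : (d ⊗ₘ (b ⊗ₘ g)) ≫ D ◁ e ▷ G = (d ⊗ₘ ((b ≫ e) ⊗ₘ g)) := by
    rw [← MonoidalCategory.id_tensorHom, ← MonoidalCategory.tensorHom_id,
      MonoidalCategory.tensorHom_comp_tensorHom, MonoidalCategory.tensorHom_comp_tensorHom,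
      Category.comp_id, Category.comp_id]
  have h₅ {X : C} (q : G' ⟶ G) (r : B' ⟶ A) (k : A ⊗ G ⟶ X) :
      (d ⊗ₘ ((r ⊗ₘ q) ≫ k)) = (d ⊗ₘ (r ⊗ₘ q)) ≫ D ◁ k := by
    rw [← MonoidalCategory.id_tensorHom, MonoidalCategory.tensorHom_comp_tensorHom,
      Category.comp_id]
  rw [← associator_inv_naturality, reassoc_of% h₃, Category.assoc, h₁,
    MonoidalCategory.whiskerLeft_comp, MonoidalCategory.comp_whiskerRight,
    ← associator_inv_naturality_middle_assoc, h₂, reassoc_of% h₄, h₅ g, Category.assoc]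

theorem obj_toRight {D D' B B' G G' A A' : C} (d : D' ⟶ D) (a : A' ⟶ A) (g : G' ⟶ G)
    (e : A ⟶ B) (b : B ≅ B') :
    ((d ⊗ₘ (a ⊗ₘ 𝟙 (𝟙_ C))) ⊗ₘ g) ≫ (D ◁ ((ρ_ _).hom ≫ e)) ▷ G ≫ (α_ _ _ _).hom =
      (α_ _ _ _).hom ≫ D' ◁ ((((a ≫ e ≫ b.hom) ▷ 𝟙_ C) ⊗ₘ 𝟙 G') ≫
        ((α_ B' (𝟙_ C) G').hom ≫ B' ◁ (λ_ G').hom)) ≫ (d ⊗ₘ (b.inv ⊗ₘ g)) := by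
  have h₁ : ((a ⊗ₘ 𝟙 (𝟙_ C)) ⊗ₘ g) ≫ (α_ A (𝟙_ C) G).hom ≫ A ◁ (λ_ G).hom ≫ e ▷ G =
      ((((a ≫ e ≫ b.hom) ▷ 𝟙_ C) ⊗ₘ 𝟙 G') ≫ ((α_ B' (𝟙_ C) G').hom ≫ B' ◁ (λ_ G').hom)) ≫
        (b.inv ⊗ₘ g) := by
    have n : B' ◁ (λ_ G').hom ≫ (b.inv ⊗ₘ g) = (b.inv ⊗ₘ (𝟙 _ ⊗ₘ g)) ≫ B ◁ (λ_ G).hom := by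
      rw [← MonoidalCategory.id_tensorHom, ← MonoidalCategory.id_tensorHom,
        MonoidalCategory.tensorHom_comp_tensorHom, MonoidalCategory.tensorHom_comp_tensorHom]
      simp
    have n₂ : (α_ A (𝟙_ C) G).hom ≫ A ◁ (λ_ G).hom ≫ e ▷ G =
        ((e ⊗ₘ 𝟙 _) ⊗ₘ 𝟙 _) ≫ (α_ B (𝟙_ C) G).hom ≫ B ◁ (λ_ G).hom := by
      rw [MonoidalCategory.tensorHom_id, MonoidalCategory.tensorHom_id,
        associator_naturality_left_assoc, MonoidalCategory.whisker_exchange]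
    rw [Category.assoc, Category.assoc, n, n₂, ← associator_naturality_assoc,
      MonoidalCategory.tensorHom_comp_tensorHom_assoc,
      MonoidalCategory.tensorHom_comp_tensorHom_assoc, ← MonoidalCategory.tensorHom_id,
      MonoidalCategory.tensorHom_comp_tensorHom, MonoidalCategory.tensorHom_comp_tensorHom]
    simp
  have h₂ : (D ◁ (ρ_ A).hom) ▷ G ≫ (α_ D A G).hom =
      (α_ _ _ _).hom ≫ D ◁ ((α_ A (𝟙_ C) G).hom ≫ A ◁ (λ_ G).hom) := by
    monoidal
  rw [MonoidalCategory.whiskerLeft_comp, MonoidalCategory.comp_whiskerRight, Category.assoc,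
    associator_naturality_middle, reassoc_of% h₂, associator_naturality_assoc,
    ← MonoidalCategory.id_tensorHom D, ← MonoidalCategory.id_tensorHom D,
    ← MonoidalCategory.id_tensorHom D',
    MonoidalCategory.tensorHom_comp_tensorHom,
    MonoidalCategory.tensorHom_comp_tensorHom,
    MonoidalCategory.tensorHom_comp_tensorHom, Category.assoc, h₁]
  simp

theorem obj_toLeft_comp {D D' B B' G G' A A' S W T T' : C} (d : D' ⟶ D) (b : B' ⟶ B) (g : G' ⟶ G)
    (e : B ⟶ A) (a : A ≅ A') (s : S ⟶ D' ⊗ (B' ⊗ G')) (p : D ⊗ (A ⊗ 𝟙_ C) ⟶ W) (x : W ⊗ G ⟶ T)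
    (t : T ⟶ T') :
    s ≫ (d ⊗ₘ (b ⊗ₘ g)) ≫ ((α_ _ _ _).inv ≫ (D ◁ (e ≫ (ρ_ _).inv) ≫ p) ▷ G ≫ x) ≫ t =
      s ≫ D' ◁ ((B' ◁ (λ_ G').inv ≫ (α_ B' (𝟙_ C) G').inv) ≫
        (((b ≫ e ≫ a.hom) ▷ 𝟙_ C) ⊗ₘ 𝟙 G')) ≫
        (α_ _ _ _).inv ≫ (((d ⊗ₘ (a.inv ⊗ₘ 𝟙 (𝟙_ C))) ≫ p) ⊗ₘ g) ≫ x ≫ t := by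
  have h : (((d ⊗ₘ (a.inv ⊗ₘ 𝟙 (𝟙_ C))) ≫ p) ⊗ₘ g) =
      ((d ⊗ₘ (a.inv ⊗ₘ 𝟙 (𝟙_ C))) ⊗ₘ g) ≫ p ▷ G := by
    rw [← MonoidalCategory.tensorHom_id, MonoidalCategory.tensorHom_comp_tensorHom,
      Category.comp_id]
  rw [h]
  simp only [Category.assoc]
  rw [← reassoc_of% obj_toLeft d b g e a, MonoidalCategory.comp_whiskerRight, Category.assoc]

theorem obj_toRight_comp {D D' B B' G G' A A' W T T' : C} (d : D' ⟶ D) (a : A' ⟶ A) (g : G' ⟶ G)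
    (e : A ⟶ B) (b : B ≅ B') (p : W ⟶ D ⊗ (A ⊗ 𝟙_ C))
    (q : D' ⊗ (A' ⊗ 𝟙_ C) ⟶ W) (hq : q ≫ p = (d ⊗ₘ (a ⊗ₘ 𝟙 (𝟙_ C)))) (x : D ⊗ (B ⊗ G) ⟶ T)
    (t : T ⟶ T') :
    (q ⊗ₘ g) ≫ ((p ≫ D ◁ ((ρ_ _).hom ≫ e)) ▷ G ≫ (α_ _ _ _).hom ≫ x) ≫ t =
      (α_ _ _ _).hom ≫ D' ◁ ((((a ≫ e ≫ b.hom) ▷ 𝟙_ C) ⊗ₘ 𝟙 G') ≫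
        ((α_ B' (𝟙_ C) G').hom ≫ B' ◁ (λ_ G').hom)) ≫ (d ⊗ₘ (b.inv ⊗ₘ g)) ≫ x ≫ t := by
  have h : (q ⊗ₘ g) ≫ p ▷ G = ((d ⊗ₘ (a ⊗ₘ 𝟙 (𝟙_ C))) ⊗ₘ g) := by
    rw [← MonoidalCategory.tensorHom_id, MonoidalCategory.tensorHom_comp_tensorHom,
      Category.comp_id, hq]
  rw [MonoidalCategory.comp_whiskerRight]
  simp only [Category.assoc]
  rw [reassoc_of% h]
  rw [reassoc_of% obj_toRight d a g e b]

theorem comp_tensor {X X' X'' Y Y' : C} (p : X ⟶ X') (q : X' ⟶ X'') (g : Y ⟶ Y') :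
    ((p ≫ q) ⊗ₘ g) = p ▷ Y ≫ (q ⊗ₘ g) := by
  rw [← MonoidalCategory.tensorHom_id, MonoidalCategory.tensorHom_comp_tensorHom,
    Category.id_comp]

theorem boxM_bx_left (D : List β₁) (P : List α) (G : List β₂) {a : β₁} {c : β₂}
    (m : tens F P ⟶ tens F [φ₁ a]) (x : tens f₁ (D ++ [a]) ⊗ tens f₂ G ⟶ f₂ c) :
    boxM (D.map φ₁) (G.map φ₂) rfl m (by simp) (bx i₁ i₂ x) =
      (split F (D.map φ₁) (P ++ G.map φ₂)).hom ≫ tens F (D.map φ₁) ◁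
        ((split F P (G.map φ₂)).hom ≫ (m ⊗ₘ 𝟙 (tens F (G.map φ₂)))) ≫ (α_ _ _ _).inv ≫
        ((((mapI i₁ D).inv ⊗ₘ (mapI i₁ [a]).inv) ≫ (split f₁ D [a]).inv) ⊗ₘ (mapI i₂ G).inv) ≫
        x ≫ (i₂ c).hom ≫ (ρ_ (F (φ₂ c))).inv := by
  have k := split_map_inv i₁ D [a]
  rw [eq_comm, lc_comp_eq, ← Iso.eq_comp_inv] at k
  have l : lc F (show D.map φ₁ ++ ([φ₁ a] ++ G.map φ₂) = _ by simp) ≫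
      (split F ((D ++ [a]).map φ₁) (G.map φ₂)).hom =
      lc F (List.append_assoc _ _ _).symm ≫ (split F (D.map φ₁ ++ [φ₁ a]) (G.map φ₂)).hom ≫
        (lc F (by simp) ⊗ₘ lc F rfl) := by
    rw [split_lc, lc_lc_assoc]
  have n := split_assoc_inv (f := F) (D.map φ₁) [φ₁ a] (G.map φ₂)
  have h : (lc F (by simp : D.map φ₁ ++ [φ₁ a] = (D ++ [a]).map φ₁) ⊗ₘ
      lc F (rfl : G.map φ₂ = G.map φ₂)) ≫ ((mapI i₁ (D ++ [a])).inv ⊗ₘ (mapI i₂ G).inv) =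
      (split F (D.map φ₁) [φ₁ a]).hom ▷ tens F (G.map φ₂) ≫
      ((((mapI i₁ D).inv ⊗ₘ (mapI i₁ [a]).inv) ≫ (split f₁ D [a]).inv) ⊗ₘ (mapI i₂ G).inv) := by
    rw [k, ← MonoidalCategory.tensorHom_id, MonoidalCategory.tensorHom_comp_tensorHom,
      MonoidalCategory.tensorHom_comp_tensorHom]
    simp
    rfl
  unfold bx boxM
  rw [reassoc_of% l, reassoc_of% h, ← reassoc_of% n, lc_self, Category.id_comp, ten_split_assoc]
  simp only [← MonoidalCategory.id_tensorHom, MonoidalCategory.tensorHom_comp_tensorHom_assoc,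
    ten_split, Category.id_comp, Category.assoc]
  rfl

theorem boxM_bx_right (D : List β₁) (G : List β₂) {a : β₁} {c : β₂}
    (m : tens F [φ₁ a] ⟶ tens F [φ₂ c]) {b : β₂} (x : tens f₁ D ⊗ tens f₂ (c :: G) ⟶ f₂ b) :
    boxM (D.map φ₁) (G.map φ₂) (by simp : (D ++ [a]).map φ₁ ++ G.map φ₂ = _) m rfl (bx i₁ i₂ x) =
      (split F ((D ++ [a]).map φ₁) (G.map φ₂)).hom ≫
        (((lc F (List.map_append) ≫ (split F (D.map φ₁) [φ₁ a]).hom)) ▷ tens F (G.map φ₂)) ≫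
        (α_ _ _ _).hom ≫ tens F (D.map φ₁) ◁ ((m ⊗ₘ 𝟙 (tens F (G.map φ₂))) ≫
          (split F [φ₂ c] (G.map φ₂)).inv) ≫ ((mapI i₁ D).inv ⊗ₘ (mapI i₂ (c :: G)).inv) ≫
        x ≫ (i₂ b).hom ≫ (ρ_ (F (φ₂ b))).inv := by
  have l : (split F ((D ++ [a]).map φ₁) (G.map φ₂)).hom ≫
      (lc F (List.map_append : (D ++ [a]).map φ₁ = D.map φ₁ ++ [φ₁ a]) ▷ tens F (G.map φ₂)) =
      lc F (by simp) ≫ (split F (D.map φ₁ ++ [φ₁ a]) (G.map φ₂)).hom := by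
    refine Eq.trans ?_ (split_lc F (List.map_append : (D ++ [a]).map φ₁ = D.map φ₁ ++ [φ₁ a]) rfl)
    simp
  have n := split_assoc F (D.map φ₁) [φ₁ a] (G.map φ₂)
  unfold bx boxM
  rw [MonoidalCategory.comp_whiskerRight]
  simp only [Category.assoc]
  rw [reassoc_of% l, reassoc_of% n, lc_lc_assoc, lc_self, Category.id_comp]
  refine congrArg₂ (· ≫ ·) rfl ?_
  refine (ten_split_assoc (f := F) (𝟙 (tens F (D.map φ₁))) (ten F m (𝟙 (tens F (G.map φ₂)))) _).trans ?_
  refine congrArg₂ (· ≫ ·) rfl ?_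
  have q : (𝟙 (tens F (D.map φ₁)) ⊗ₘ ten F m (𝟙 (tens F (G.map φ₂)))) =
      tens F (D.map φ₁) ◁ (split F [φ₁ a] (G.map φ₂)).hom ≫ tens F (D.map φ₁) ◁
        ((m ⊗ₘ 𝟙 (tens F (G.map φ₂))) ≫ (split F [φ₂ c] (G.map φ₂)).inv) := by
    rw [← MonoidalCategory.whiskerLeft_comp, ← MonoidalCategory.id_tensorHom]
    rfl
  exact (congrArg (· ≫ _) q).trans (Category.assoc _ _ _)

/-- The last graded hypothesis and the first linear one occupy the same place in the single list.
Hence a rule that moves a hypothesis across the border is a box on that place: the left rule of Grd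
in this direction, that of Lin in `bx_toRight`. -/
theorem bx_toLeft (D : List β₁) (G : List β₂) {a : β₁} {b c : β₂} (e : f₂ b ⟶ f₁ a)
    (x : tens f₁ (D ++ [a]) ⊗ tens f₂ G ⟶ f₂ c) :
    bx i₁ i₂ (G := b :: G) ((α_ (tens f₁ D) (f₂ b) (tens f₂ G)).inv ≫
        (tens f₁ D ◁ (e ≫ (ρ_ _).inv) ≫ (split f₁ D [a]).inv) ▷ tens f₂ G ≫ x) =
      boxM (D.map φ₁) (G.map φ₂) (P := [φ₂ b]) (Q := [φ₁ a]) rfl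
        (((i₂ b).inv ≫ e ≫ (i₁ a).hom) ▷ 𝟙_ C) (by simp) (bx i₁ i₂ x) := by
  refine Eq.trans ?_ (boxM_bx_left i₁ i₂ D [φ₂ b] G _ x).symm
  exact obj_toLeft_comp (mapI i₁ D).inv (i₂ b).inv (mapI i₂ G).inv e (i₁ a) _
    (split f₁ D [a]).inv x _

theorem bx_toRight (D : List β₁) (G : List β₂) {a : β₁} {b c : β₂} (e : f₁ a ⟶ f₂ b)
    (x : tens f₁ D ⊗ tens f₂ (b :: G) ⟶ f₂ c) :
    bx i₁ i₂ (((split f₁ D [a]).hom ≫ tens f₁ D ◁ ((ρ_ _).hom ≫ e)) ▷ tens f₂ G ≫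
        (α_ _ _ _).hom ≫ x) =
      boxM (D.map φ₁) (G.map φ₂) (P := [φ₁ a]) (Q := [φ₂ b]) (by simp)
        (((i₁ a).inv ≫ e ≫ (i₂ b).hom) ▷ 𝟙_ C) rfl (bx i₁ i₂ x) := by
  have hq := split_map_inv i₁ D [a]
  rw [eq_comm, lc_comp_eq, ← Iso.eq_comp_inv] at hq
  simp only [Category.assoc] at hq
  have h : (mapI i₁ (D ++ [a])).inv ⊗ₘ (mapI i₂ G).inv =
    ((lc F (List.map_append) ≫ (split F (D.map φ₁) [φ₁ a]).hom)) ▷ tens F (G.map φ₂) ≫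
      ((((mapI i₁ D).inv ⊗ₘ ((i₁ a).inv ⊗ₘ 𝟙 (𝟙_ C))) ≫ (split f₁ D [a]).inv) ⊗ₘ
        (mapI i₂ G).inv) := by
    refine Eq.trans (congrArg (· ⊗ₘ (mapI i₂ G).inv) (hq.trans ?_)) (comp_tensor _ _ _)
    exact (Category.assoc _ _ _).symm
  refine Eq.trans ?_ (boxM_bx_right i₁ i₂ D G (((i₁ a).inv ≫ e ≫ (i₂ b).hom) ▷ 𝟙_ C) x).symm
  refine Eq.trans ?_ (congrArg₂ (· ≫ ·) rfl (congrArg₂ (· ≫ ·) rfl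
    (obj_toRight_comp (mapI i₁ D).inv (i₁ a).inv (mapI i₂ G).inv e (i₂ b)
    (split f₁ D [a]).hom (((mapI i₁ D).inv ⊗ₘ ((i₁ a).inv ⊗ₘ 𝟙 (𝟙_ C))) ≫ (split f₁ D [a]).inv)
      ((Category.assoc _ _ _).trans ((congrArg _ (Iso.inv_hom_id _)).trans (Category.comp_id _)))
      x _)))
  unfold bx
  rw [h]
  exact congrArg₂ (· ≫ ·) rfl (Category.assoc _ _ _)

variable [SymmetricCategory C]

/-- `tensorμ` is, up to associators, the symmetry of the two inner factors, and after a fourfold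
splitting these are the two middle blocks. -/
theorem split_tensorμ {f : α → C} (A B D E : List α) :
    (split f (A ++ B) (D ++ E)).hom ≫ ((split f A B).hom ⊗ₘ (split f D E).hom) ≫
      tensorμ _ _ _ _ = lc f (by simp) ≫
      ten f (𝟙 (tens f A)) (ten f (br f B D) (𝟙 (tens f E))) ≫ lc f (by simp) ≫
      (split f (A ++ D) (B ++ E)).hom ≫ ((split f A D).hom ⊗ₘ (split f B E).hom) := by
  rw [reassoc_of% split_four, split_four]
  simp only [ten_split_assoc, lc_lc_assoc, lc_self, Category.id_comp]
  have e (Y : C) (k : tens f A ⊗ (tens f D ⊗ tens f B) ⊗ tens f E ⟶ Y) :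
      tens f A ◁ (split f D B).inv ▷ tens f E ≫ tens f A ◁ (split f D B).hom ▷ tens f E ≫ k = k := by
    rw [← MonoidalCategory.whiskerLeft_comp_assoc, ← MonoidalCategory.comp_whiskerRight]
    simp
  simp [tensorμ, br, ten, e]

theorem cutM_pair {f : α → C} (D₁ D₂ G₁ G₂ : List α) {A B L : List α} {Z : C}
    (h : L = (D₁ ++ D₂) ++ (G₁ ++ (G₂ ++ []))) (x : tens f (D₁ ++ G₁) ⟶ tens f A)
    (y : tens f (D₂ ++ G₂) ⟶ tens f B) (k : D₁ ++ (G₁ ++ (B ++ [])) = ([] ++ D₁) ++ ([] ++ (G₁ ++ B)))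
    (p : tens f (A ++ B) ⟶ Z) :
    cutM D₁ D₂ G₁ G₂ [] h rfl y k (cutM [] D₁ [] G₁ B rfl rfl x rfl p) =
      lc f (by simp [h]) ≫ ten f (𝟙 (tens f D₁)) (ten f (br f D₂ G₁) (𝟙 (tens f G₂))) ≫
        lc f (by simp : _ = (D₁ ++ G₁) ++ (D₂ ++ G₂)) ≫ ten f x y ≫ p := by
  subst h
  have e : ten f (𝟙 (tens f (D₁ ++ G₁))) y ≫ ten f x (𝟙 (tens f B)) = ten f x y := by
    rw [ten_comp]; simp
  rw [← e]
  simp [cutM, boxM, br_nil_right, ten_id_congr _ (List.append_nil G₂)]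

theorem obj_pair {X Y A B A' B' T T' : C} (x : X ⟶ A) (y : Y ⟶ B) (a : A ≅ A') (b : B ≅ B')
    (e : A ⊗ B ⟶ T) (c : T ⟶ T') :
    ((x ≫ a.hom ≫ (ρ_ A').inv) ⊗ₘ (y ≫ b.hom ≫ (ρ_ B').inv)) ≫
      ((α_ A' (𝟙_ C) (B' ⊗ 𝟙_ C)).hom ≫ A' ◁ (λ_ (B' ⊗ 𝟙_ C)).hom) ≫ (α_ A' B' (𝟙_ C)).inv ≫
        (((a.inv ⊗ₘ b.inv) ≫ e ≫ c) ▷ 𝟙_ C) = (x ⊗ₘ y) ≫ e ≫ c ≫ (ρ_ T').inv := by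
  have h : ((ρ_ A').inv ⊗ₘ (ρ_ B').inv) ≫
      ((α_ A' (𝟙_ C) (B' ⊗ 𝟙_ C)).hom ≫ A' ◁ (λ_ (B' ⊗ 𝟙_ C)).hom) ≫ (α_ A' B' (𝟙_ C)).inv =
      (ρ_ (A' ⊗ B')).inv := by monoidal
  rw [← MonoidalCategory.tensorHom_comp_tensorHom, ← MonoidalCategory.tensorHom_comp_tensorHom]
  simp only [Category.assoc] at h ⊢
  rw [reassoc_of% h, ← rightUnitor_inv_naturality]
  simp

/-- The morphism of lists given by a morphism out of a binary tensor product. -/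
def pairI {a b c : β₂} (e : f₂ a ⊗ f₂ b ⟶ f₂ c) :
    tens F ([φ₂ a] ++ [φ₂ b]) ⟶ tens F [φ₂ c] :=
  (α_ (F (φ₂ a)) (F (φ₂ b)) (𝟙_ C)).inv ≫ ((((i₂ a).inv ⊗ₘ (i₂ b).inv) ≫ e ≫ (i₂ c).hom) ▷ 𝟙_ C)

/-- Reading a parallel pair as two successive cuts makes the conversions for the tensor instances of
conversions of cuts. The morphism `e` is arbitrary so that evaluation can take the place of pairing,
in `bx_apply` and `bx_eval`. -/
theorem bx_tensor {D₁ D₂ : List β₁} {G₁ G₂ : List β₂} {a b c : β₂} (e : f₂ a ⊗ f₂ b ⟶ f₂ c)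
    (x : tens f₁ D₁ ⊗ tens f₂ G₁ ⟶ f₂ a) (y : tens f₁ D₂ ⊗ tens f₂ G₂ ⟶ f₂ b) :
    bx i₁ i₂ (((split f₁ D₁ D₂).hom ⊗ₘ (split f₂ G₁ G₂).hom) ≫ tensorμ _ _ _ _ ≫ (x ⊗ₘ y) ≫ e) =
      cutM (D₁.map φ₁) (D₂.map φ₁) (G₁.map φ₂) (G₂.map φ₂) [] (A := [φ₂ b]) (by simp) rfl
        (bx i₁ i₂ y) rfl
        (cutM [] (D₁.map φ₁) [] (G₁.map φ₂) [φ₂ b] (A := [φ₂ a]) (by simp) rfl (bx i₁ i₂ x) rfl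
          (pairI i₂ e)) := by
  have h₁ : ((mapI i₁ (D₁ ++ D₂)).inv ⊗ₘ (mapI i₂ (G₁ ++ G₂)).inv) ≫
      ((split f₁ D₁ D₂).hom ⊗ₘ (split f₂ G₁ G₂).hom) =
      (lc F List.map_append ⊗ₘ lc F List.map_append) ≫
      ((split F (D₁.map φ₁) (D₂.map φ₁)).hom ⊗ₘ (split F (G₁.map φ₂) (G₂.map φ₂)).hom) ≫
        (((mapI i₁ D₁).inv ⊗ₘ (mapI i₁ D₂).inv) ⊗ₘ ((mapI i₂ G₁).inv ⊗ₘ (mapI i₂ G₂).inv)) := by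
    have k₁ := split_map_inv i₁ D₁ D₂
    have k₂ := split_map_inv i₂ G₁ G₂
    rw [eq_comm, lc_comp_eq] at k₁ k₂
    simp only [MonoidalCategory.tensorHom_comp_tensorHom, k₁, k₂]
  have h₂ := split_tensorμ (f := F) (D₁.map φ₁) (D₂.map φ₁) (G₁.map φ₂) (G₂.map φ₂)
  have h₃ : ten F (bx i₁ i₂ x) (bx i₁ i₂ y) ≫ pairI i₂ e =
      (split F (D₁.map φ₁ ++ G₁.map φ₂) (D₂.map φ₁ ++ G₂.map φ₂)).hom ≫
        (((split F (D₁.map φ₁) (G₁.map φ₂)).hom ≫ ((mapI i₁ D₁).inv ⊗ₘ (mapI i₂ G₁).inv) ≫ x) ⊗ₘ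
        ((split F (D₂.map φ₁) (G₂.map φ₂)).hom ≫ ((mapI i₁ D₂).inv ⊗ₘ (mapI i₂ G₂).inv) ≫ y)) ≫
        e ≫ (i₂ c).hom ≫ (ρ_ (F (φ₂ c))).inv := by
    have k {D : List β₁} {G : List β₂} {b : β₂} (x : tens f₁ D ⊗ tens f₂ G ⟶ f₂ b) :
        bx i₁ i₂ x = ((split F (D.map φ₁) (G.map φ₂)).hom ≫
          ((mapI i₁ D).inv ⊗ₘ (mapI i₂ G).inv) ≫ x) ≫ (i₂ b).hom ≫ (ρ_ (F (φ₂ b))).inv := by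
      simp only [bx, Category.assoc]
      rfl
    rw [k, k]
    refine (Category.assoc _ _ _).trans (congrArg₂ (· ≫ ·) rfl ?_)
    refine (Category.assoc _ _ _).trans ?_
    exact (obj_pair ((split F (D₁.map φ₁) (G₁.map φ₂)).hom ≫
      ((mapI i₁ D₁).inv ⊗ₘ (mapI i₂ G₁).inv) ≫ x)
      ((split F (D₂.map φ₁) (G₂.map φ₂)).hom ≫ ((mapI i₁ D₂).inv ⊗ₘ (mapI i₂ G₂).inv) ≫ y)
      (i₂ a) (i₂ b) e (i₂ c).hom)
  have h₄ : (((mapI i₁ D₁).inv ⊗ₘ (mapI i₁ D₂).inv) ⊗ₘ ((mapI i₂ G₁).inv ⊗ₘ (mapI i₂ G₂).inv)) ≫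
      tensorμ _ _ _ _ = tensorμ _ _ _ _ ≫ 
      (((mapI i₁ D₁).inv ⊗ₘ (mapI i₂ G₁).inv) ⊗ₘ ((mapI i₁ D₂).inv ⊗ₘ (mapI i₂ G₂).inv)) := by
    simp only [MonoidalCategory.tensorμ_natural]
  have h₅ : (split F ((D₁ ++ D₂).map φ₁) ((G₁ ++ G₂).map φ₂)).hom ≫
      (lc F List.map_append ⊗ₘ lc F List.map_append) = lc F (by simp) ≫
      (split F (D₁.map φ₁ ++ D₂.map φ₁) (G₁.map φ₂ ++ G₂.map φ₂)).hom := split_lc F _ _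
  rw [cutM_pair, h₃, bx]
  simp only [Category.assoc]
  rw [reassoc_of% h₁, reassoc_of% h₅, reassoc_of% h₄, reassoc_of% h₂]
  simp only [MonoidalCategory.tensorHom_comp_tensorHom_assoc, lc_lc_assoc, Category.assoc]
  rfl

end Lists
-- Application as a cut
section Lists
variable {C : Type v} [Category.{w} C] [MonoidalCategory C] {α β₁ β₂ : Type u}
  {f₁ : β₁ → C} {f₂ : β₂ → C} {F : α → C} {φ₁ : β₁ → α} {φ₂ : β₂ → α}
  (i₁ : ∀ b, f₁ b ≅ F (φ₁ b)) (i₂ : ∀ b, f₂ b ≅ F (φ₂ b))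

theorem obj_id {X Y : C} (i : X ≅ Y) : (λ_ (Y ⊗ 𝟙_ C)).inv ≫
    (𝟙 (𝟙_ C) ⊗ₘ (i.inv ⊗ₘ 𝟙 (𝟙_ C))) ≫ ((λ_ (X ⊗ 𝟙_ C)).hom ≫ (ρ_ X).hom) ≫ i.hom ≫
      (ρ_ Y).inv = 𝟙 _ := by
  rw [MonoidalCategory.id_tensorHom, MonoidalCategory.tensorHom_id, Category.assoc,
    MonoidalCategory.leftUnitor_naturality_assoc, Iso.inv_hom_id_assoc,
    MonoidalCategory.rightUnitor_naturality_assoc, Iso.inv_hom_id_assoc, Iso.hom_inv_id]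

theorem bx_id (b : β₂) : bx (D := []) (G := [b]) i₁ i₂ ((λ_ (f₂ b ⊗ 𝟙_ C)).hom ≫ (ρ_ (f₂ b)).hom) =
    𝟙 (tens F [φ₂ b]) := obj_id (i₂ b)

variable [SymmetricCategory C]

theorem obj_apply {D A G B E : C} (y : D ⊗ G ⟶ B) (e : A ⊗ B ⟶ E) :
    ((λ_ D).inv ⊗ₘ (A ◁ (λ_ G).inv ≫ (α_ A (𝟙_ C) G).inv)) ≫ tensorμ _ _ _ _ ≫
      (((λ_ (A ⊗ 𝟙_ C)).hom ≫ (ρ_ A).hom) ⊗ₘ y) ≫ e =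
    (α_ D A G).inv ≫ (β_ D A).hom ▷ G ≫ (α_ A D G).hom ≫ A ◁ y ≫ e := by
  have h : ((λ_ D).inv ⊗ₘ (A ◁ (λ_ G).inv ≫ (α_ A (𝟙_ C) G).inv)) ≫ tensorμ _ _ _ _ ≫
      ((λ_ (A ⊗ 𝟙_ C)).hom ≫ (ρ_ A).hom) ▷ (D ⊗ G) =
    (α_ D A G).inv ≫ (β_ D A).hom ▷ G ≫ (α_ A D G).hom := by
    simp [tensorμ, MonoidalCategory.tensorHom_def]
    monoidal
  rw [MonoidalCategory.tensorHom_def (_ ≫ _) y, Category.assoc, reassoc_of% h]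

theorem cutM_nil_lc {f : α → C} (D₁ G₁ G₃ : List α) {A G₂ L L' : List α} {Z : C}
    (h : L = (D₁ ++ []) ++ (G₁ ++ (G₂ ++ G₃))) (hx : [] ++ G₂ = G₂) (e : G₂ = A)
    (k : D₁ ++ (G₁ ++ (A ++ G₃)) = L') (y : tens f L' ⟶ Z) :
    cutM D₁ [] G₁ G₂ G₃ h hx (lc f e) k y = lc f (by simp [h, ← k, e]) ≫ y := by
  rw [cutM_nil, boxM_eq_lc]

/-- The case of `bx_tensor` in which the left factor is an identity derivation; the cut against it
is a mere cast. -/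
theorem bx_apply (D : List β₁) (G : List β₂) {a b c : β₂} (e : f₂ a ⊗ f₂ b ⟶ f₂ c)
    (y : tens f₁ D ⊗ tens f₂ G ⟶ f₂ b) :
    bx i₁ i₂ (G := a :: G) ((α_ (tens f₁ D) (f₂ a) (tens f₂ G)).inv ≫
        (β_ (tens f₁ D) (f₂ a)).hom ▷ tens f₂ G ≫ (α_ _ _ _).hom ≫ f₂ a ◁ y ≫ e) =
      cutM [] (D.map φ₁) [φ₂ a] (G.map φ₂) [] (A := [φ₂ b]) (by simp) rfl (bx i₁ i₂ y) rfl
        (pairI i₂ e) := by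
  have h := bx_tensor i₁ i₂ (D₁ := []) (G₁ := [a]) (D₂ := D) (G₂ := G) e
    ((λ_ (f₂ a ⊗ 𝟙_ C)).hom ≫ (ρ_ (f₂ a)).hom) y
  rw [bx_id] at h
  refine (congrArg (bx (D := D) (G := a :: G) i₁ i₂) (obj_apply y e)).symm.trans (h.trans ?_)
  refine (congrArg (cutM [] (D.map φ₁) [φ₂ a] (G.map φ₂) [] _ _ _ _)
    (cutM_nil_lc (A := [φ₂ a]) [] [] [φ₂ b] _ rfl rfl rfl (pairI i₂ e))).trans ?_
  rw [cutM_lc]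

theorem obj_nil_right {L L' D Y B : C} (l : L ⟶ L') (m : L' ⟶ D) (x : D ⊗ 𝟙_ C ⟶ B) (y : B ⟶ Y) :
    (l ≫ (ρ_ L').inv) ≫ (m ⊗ₘ 𝟙 (𝟙_ C)) ≫ x ≫ y = l ≫ m ≫ ((ρ_ D).inv ≫ x) ≫ y := by
  simp

theorem bx_nil_right {D : List β₁} {b : β₂} (x : tens f₁ D ⊗ tens f₂ [] ⟶ f₂ b) :
    bx i₁ i₂ x = lc F (List.append_nil _) ≫ (mapI i₁ D).inv ≫
      ((ρ_ (tens f₁ D)).inv ≫ x) ≫ (i₂ b).hom ≫ (ρ_ (F (φ₂ b))).inv :=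
  (congrArg (· ≫ _) (split_nil_right (f := F) (D.map φ₁))).trans (obj_nil_right _ _ x _)

theorem obj_app {D G G' A H B : C} (s : G' ⟶ G ⊗ (A ⊗ 𝟙_ C)) (x : D ⊗ G ⟶ H) (e : H ⊗ A ⟶ B) :
    ((ρ_ D).inv ⊗ₘ s) ≫ tensorμ _ _ _ _ ≫ (x ⊗ₘ ((λ_ (A ⊗ 𝟙_ C)).hom ≫ (ρ_ A).hom)) ≫ e =
      D ◁ (s ≫ G ◁ (ρ_ A).hom) ≫ (α_ D G A).inv ≫ x ▷ A ≫ e := by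
  have h : ((ρ_ D).inv ⊗ₘ s) ≫ tensorμ _ _ _ _ ≫
      (D ⊗ G) ◁ ((λ_ (A ⊗ 𝟙_ C)).hom ≫ (ρ_ A).hom) =
    D ◁ (s ≫ G ◁ (ρ_ A).hom) ≫ (α_ D G A).inv := by
    have h' : D ◁ s = D ◁ (s ≫ G ◁ (ρ_ A).hom) ≫ D ◁ G ◁ (ρ_ A).inv := by simp
    rw [MonoidalCategory.tensorHom_def', h']
    simp only [Category.assoc]
    congr 1
    simp [tensorμ]
    monoidal
  rw [MonoidalCategory.tensorHom_def' x, Category.assoc, reassoc_of% h]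

theorem cutM_nil_nil {f : α → C} (D G G₃ : List α) {A K L L' : List α} {Z : C}
    (h : L = ([] ++ D) ++ ([] ++ (G ++ G₃))) (hx : D ++ G = K) (x : tens f K ⟶ tens f A)
    (k : [] ++ ([] ++ (A ++ G₃)) = L') (y : tens f L' ⟶ Z) :
    cutM [] D [] G G₃ h hx x k y = boxM [] G₃ (by simp [h, ← hx]) x k y := by
  subst h hx k
  simp [cutM, boxM, br_nil_right]

theorem bx_eval_aux (D : List β₁) (G : List β₂) {a b c : β₂}
    (x : tens F (D.map φ₁ ++ G.map φ₂) ⟶ tens F [φ₂ a]) (p : tens F ([φ₂ a] ++ [φ₂ b]) ⟶ tens F [φ₂ c])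
    (z : tens f₁ D ⊗ tens f₂ (G ++ [b]) ⟶ f₂ c)
    (h : bx i₁ i₂ (lc f₁ (List.append_nil D) ▷ _ ≫ z) =
      cutM (D.map φ₁) [] (G.map φ₂) [φ₂ b] [] (A := [φ₂ b]) (K := [φ₂ b]) (by simp) rfl
        (𝟙 (tens F [φ₂ b])) rfl
        (cutM [] (D.map φ₁) [] (G.map φ₂) [φ₂ b] (A := [φ₂ a]) (by simp) rfl x rfl p)) :
    boxM [] [φ₂ b] (by simp) x rfl p = bx i₁ i₂ z := by
  rw [bx_left, tm_lc, ten_lc_id, lc_comp_eq] at h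
  rw [h, ← lc_self F (rfl : [φ₂ b] = [φ₂ b]), cutM_nil_lc, cutM_nil_nil]
  simp

/-- Dually, the right factor is an identity. `bx_eval_aux` removes the empty graded context that
this factor leaves behind. -/
theorem bx_eval (D : List β₁) (G : List β₂) {a b c : β₂} (e : f₂ a ⊗ f₂ b ⟶ f₂ c)
    (x : tens f₁ D ⊗ tens f₂ G ⟶ f₂ a) :
    boxM [] [φ₂ b] (P := D.map φ₁ ++ G.map φ₂) (Q := [φ₂ a]) (by simp) (bx i₁ i₂ x) rfl
        (pairI i₂ e) =
      bx i₁ i₂ (tens f₁ D ◁ ((split f₂ G [b]).hom ≫ tens f₂ G ◁ (ρ_ (f₂ b)).hom) ≫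
        (α_ (tens f₁ D) (tens f₂ G) (f₂ b)).inv ≫ x ▷ f₂ b ≫ e) := by
  have h := bx_tensor i₁ i₂ (D₁ := D) (G₁ := G) (D₂ := []) (G₂ := [b]) e x
    ((λ_ (f₂ b ⊗ 𝟙_ C)).hom ≫ (ρ_ (f₂ b)).hom)
  rw [bx_id] at h
  have k : ((split f₁ D []).hom ⊗ₘ (split f₂ G [b]).hom) = lc f₁ (List.append_nil D) ▷ _ ≫
      ((ρ_ (tens f₁ D)).inv ⊗ₘ (split f₂ G [b]).hom) := by
    rw [split_nil_right, ← MonoidalCategory.tensorHom_id,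
      MonoidalCategory.tensorHom_comp_tensorHom, Category.id_comp]
    rfl
  have k' : ((split f₁ D []).hom ⊗ₘ (split f₂ G [b]).hom) ≫ tensorμ _ _ _ _ ≫
      (x ⊗ₘ ((λ_ (f₂ b ⊗ 𝟙_ C)).hom ≫ (ρ_ (f₂ b)).hom)) ≫ e =
      lc f₁ (List.append_nil D) ▷ _ ≫ tens f₁ D ◁ ((split f₂ G [b]).hom ≫
        tens f₂ G ◁ (ρ_ (f₂ b)).hom) ≫
        (α_ (tens f₁ D) (tens f₂ G) (f₂ b)).inv ≫ x ▷ f₂ b ≫ e := by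
    refine (congrArg (· ≫ _) k).trans ((Category.assoc _ _ _).trans ?_)
    exact congrArg (_ ≫ ·) (obj_app _ x e)
  exact bx_eval_aux i₁ i₂ D G _ _ _ ((congrArg (bx i₁ i₂) k').symm.trans h)

end Lists
-- Interpretation of the mixed rules, and inverse pairs of rules
namespace MGLModel
open Functor.LaxMonoidal
variable {R : Type u} [Semiring R] [Preorder R] [AddLeftMono R] [MulLeftMono R] [MulRightMono R]
  {C : Type v} [Category.{w} C] [MonoidalCategory C] [SymmetricCategory C]
  {M : Type v} [Category.{w} M] [MonoidalCategory M] [SymmetricCategory M] [MonoidalClosed M]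
  (𝓜 : MGLModel R C M)

theorem refl_conj {M : Type v} [Category.{w} M] [MonoidalCategory M] {X Y : M} (e : X ⟶ Y) (Z : M) :
    ((Iso.refl X).inv ≫ e ≫ (Iso.refl Y).hom) ▷ Z = e ▷ Z := by simp

/-- The pairing of two linear hypotheses. -/
def pairT (A B : LTy R) : tens 𝓜.hyp ([.inr A] ++ [.inr B]) ⟶ tens 𝓜.hyp [.inr (.ten A B)] :=
  pairI (c := .ten A B) 𝓜.iL (𝟙 (𝓜.lty A ⊗ 𝓜.lty B))

/-- Evaluation. -/
noncomputable def evM (A B : LTy R) :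
    tens 𝓜.hyp ([.inr (.imp A B)] ++ [.inr A]) ⟶ tens 𝓜.hyp [.inr B] :=
  pairI (a := .imp A B) 𝓜.iL
    ((β_ ((ihom (𝓜.lty A)).obj (𝓜.lty B)) (𝓜.lty A)).hom ≫ (ihom.ev (𝓜.lty A)).app (𝓜.lty B))

/-- A linear hypothesis `Grd r X` is a graded hypothesis `r ⊙ X`. -/
def grdM (r : R) (X : GTy R) :
    tens 𝓜.hyp [.inr (.Grd r X)] ⟶ tens 𝓜.hyp [.inl (r, X)] :=
  (𝟙 (𝓜.mhyp (r, X)) ▷ 𝟙_ M : 𝓜.mhyp (r, X) ⊗ 𝟙_ M ⟶ 𝓜.mhyp (r, X) ⊗ 𝟙_ M)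

/-- The interpretation of the left rule of `Lin`. -/
def linM (A : LTy R) : tens 𝓜.hyp [.inl (1, .Lin A)] ⟶ tens 𝓜.hyp [.inr A] :=
  ((𝓜.Mny.map (𝓜.one (𝓜.Lin.obj (𝓜.lty A))) ≫ 𝓜.adj.counit.app (𝓜.lty A)) ▷ 𝟙_ M :)

theorem sm_tenR {Δ₁ Δ₂ : GCtx R} {Γ₁ Γ₂ : List (LTy R)} {A B : LTy R} (π₁ : MS Δ₁ Γ₁ A)
    (π₂ : MS Δ₂ Γ₂ B) : 𝓜.sm (.tenR π₁ π₂) =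
      cutM (gl Δ₁) (gl Δ₂) (ll Γ₁) (ll Γ₂) [] (A := [.inr B]) (by simp) rfl (𝓜.sm π₂) rfl
        (cutM [] (gl Δ₁) [] (ll Γ₁) [.inr B] (A := [.inr A]) (by simp) rfl (𝓜.sm π₁) rfl
          (𝓜.pairT A B)) := by
  rw [sm, MGLModel.ms]
  have h := bx_tensor (c := .ten A B) 𝓜.iG 𝓜.iL (𝟙 (𝓜.lty A ⊗ 𝓜.lty B)) (𝓜.ms π₁) (𝓜.ms π₂)
  exact (congrArg 𝓜.bend (congrArg (fun t => _ ≫ _ ≫ t) (Category.comp_id _)).symm).trans h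

theorem sm_impL (Γ₁ Γ₃ : List (LTy R)) {Δ₁ Δ₂ : GCtx R} {Γ₂ : List (LTy R)} {A B C : LTy R}
    (π₂ : MS Δ₂ Γ₂ A) (π₁ : MS Δ₁ (Γ₁ ++ B :: Γ₃) C) : 𝓜.sm (.impL Γ₁ Γ₃ π₂ π₁) =
      cutM (gl Δ₁) (gl Δ₂) (ll Γ₁) (.inr (.imp A B) :: ll Γ₂) (ll Γ₃) (A := [.inr B])
        (by simp) rfl
        (cutM [] (gl Δ₂) [.inr (.imp A B)] (ll Γ₂) [] (A := [.inr A]) (by simp) rfl (𝓜.sm π₂) rfl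
          (𝓜.evM A B)) (by simp) (𝓜.sm π₁) := by
  rw [sm, MGLModel.ms]
  refine (𝓜.bend_plug Δ₁ Δ₂ Γ₁ (.imp A B :: Γ₂) Γ₃ _ _).trans ?_
  exact congrArg (fun t => cutM _ _ _ _ _ _ _ t _ _)
    (bx_apply (a := .imp A B) 𝓜.iG 𝓜.iL Δ₂ Γ₂ _ (𝓜.ms π₂))

theorem sm_grdL {Δ : GCtx R} {Γ : List (LTy R)} {B : LTy R} {r : R} {X : GTy R}
    (π : MS (Δ ++ [(r, X)]) Γ B) : 𝓜.sm (.grdL π) =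
      boxM (gl Δ) (ll Γ) (P := [.inr (.Grd r X)]) (by simp) (𝓜.grdM r X) (by simp) (𝓜.sm π) := by
  rw [sm, MGLModel.ms]
  have h := bx_toLeft (b := .Grd r X) (a := (r, X)) 𝓜.iG 𝓜.iL Δ Γ (𝟙 (𝓜.mhyp (r, X))) (𝓜.ms π)
  refine (congrArg (𝓜.bend (Γ := .Grd r X :: Γ)) (congrArg (fun t => _ ≫ (_ ◁ t ≫ _) ▷ _ ≫ _)
    (Category.id_comp _)).symm).trans (h.trans ?_)
  exact congrArg (fun t => boxM _ _ _ t _ _) (refl_conj _ _)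

theorem sm_linL {Δ : GCtx R} {Γ : List (LTy R)} {A B : LTy R} (π : MS Δ (A :: Γ) B) :
    𝓜.sm (.linL π) =
      boxM (gl Δ) (ll Γ) (Q := [.inr A]) (by simp) (𝓜.linM A) (by simp) (𝓜.sm π) := by
  rw [sm, MGLModel.ms]
  refine (bx_toRight (a := (1, .Lin A)) 𝓜.iG 𝓜.iL Δ Γ _ (𝓜.ms π)).trans ?_
  exact congrArg (fun t => boxM _ _ _ t _ _) (refl_conj _ _)

/-- Application of a function to one more hypothesis. -/
noncomputable def apM {Δ : GCtx R} {Γ : List (LTy R)} {A B : LTy R}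
    (x : 𝓜.mctx Δ ⊗ 𝓜.lctx Γ ⟶ 𝓜.lty (.imp A B)) : 𝓜.mctx Δ ⊗ 𝓜.lctx (Γ ++ [A]) ⟶ 𝓜.lty B :=
  (𝓜.mctx Δ ◁ ((split 𝓜.lty Γ [A]).hom ≫ 𝓜.lctx Γ ◁ (ρ_ (𝓜.lty A)).hom) ≫
    (α_ (𝓜.mctx Δ) (𝓜.lctx Γ) (𝓜.lty A)).inv ≫
    (x ▷ 𝓜.lty A : _ ⟶ (ihom (𝓜.lty A)).obj (𝓜.lty B) ⊗ 𝓜.lty A) ≫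
    (β_ ((ihom (𝓜.lty A)).obj (𝓜.lty B)) (𝓜.lty A)).hom ≫ (ihom.ev (𝓜.lty A)).app (𝓜.lty B))

theorem boxM_evM {Δ : GCtx R} {Γ : List (LTy R)} {A B : LTy R} (π : MS Δ Γ (.imp A B))
    (h : gl Δ ++ ll (Γ ++ [A]) = [] ++ ((gl Δ ++ ll Γ) ++ [.inr A])) :
    boxM [] [.inr A] h (𝓜.sm π) rfl (𝓜.evM A B) = 𝓜.bend (𝓜.apM (𝓜.ms π)) :=
  bx_eval (a := .imp A B) 𝓜.iG 𝓜.iL Δ Γ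
    ((β_ ((ihom (𝓜.lty A)).obj (𝓜.lty B)) (𝓜.lty A)).hom ≫ (ihom.ev (𝓜.lty A)).app (𝓜.lty B))
    (𝓜.ms π)

/-- Up to the symmetry and an invertible splitting, application to a new hypothesis is uncurrying.
-/
theorem apM_injective {Δ : GCtx R} {Γ : List (LTy R)} {A B : LTy R}
    {x y : 𝓜.mctx Δ ⊗ 𝓜.lctx Γ ⟶ 𝓜.lty (.imp A B)} (h : 𝓜.apM x = 𝓜.apM y) : x = y := by
  have k {D G G' A B : M} (s : G' ≅ G ⊗ (A ⊗ 𝟙_ M)) (x y : D ⊗ G ⟶ (ihom A).obj B)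
      (h : D ◁ (s.hom ≫ G ◁ (ρ_ A).hom) ≫ (α_ D G A).inv ≫ x ▷ A ≫ (β_ _ A).hom ≫
          (ihom.ev A).app B =
        D ◁ (s.hom ≫ G ◁ (ρ_ A).hom) ≫ (α_ D G A).inv ≫ y ▷ A ≫ (β_ _ A).hom ≫
          (ihom.ev A).app B) : x = y := by
    rw [cancel_epi, cancel_epi, BraidedCategory.braiding_naturality_left_assoc,
      BraidedCategory.braiding_naturality_left_assoc, cancel_epi] at h
    apply MonoidalClosed.uncurry_injective
    rwa [MonoidalClosed.uncurry_eq, MonoidalClosed.uncurry_eq]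
  exact k (split 𝓜.lty Γ [A]) x y h

theorem apM_impR {Δ : GCtx R} {Γ : List (LTy R)} {A B : LTy R} (π : MS Δ (Γ ++ [A]) B) :
    𝓜.apM (𝓜.ms (.impR π)) = 𝓜.ms π := by
  have k {D G G' A B : M} (s : G' ≅ G ⊗ (A ⊗ 𝟙_ M)) (x : D ⊗ G' ⟶ B) :
      D ◁ (s.hom ≫ G ◁ (ρ_ A).hom) ≫ (α_ D G A).inv ≫
        MonoidalClosed.curry ((β_ A (D ⊗ G)).hom ≫ (α_ _ _ _).hom ≫
          D ◁ (G ◁ (ρ_ A).inv ≫ s.inv) ≫ x) ▷ A ≫ (β_ _ A).hom ≫ (ihom.ev A).app B = x := by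
    rw [BraidedCategory.braiding_naturality_left_assoc,
      MonoidalClosed.whiskerLeft_curry_ihom_ev_app, SymmetricCategory.symmetry_assoc,
      Iso.inv_hom_id_assoc, ← MonoidalCategory.whiskerLeft_comp_assoc]
    simp
  rw [MGLModel.ms]
  exact k (split 𝓜.lty Γ [A]) (𝓜.ms π)

/-- Reduces equations between derivations of an implication to equations after evaluation; by
`boxM_sm_impR` the right rule of ⊸ then disappears, and no currying remains in its conversions. -/
theorem ms_imp_ext {Δ : GCtx R} {Γ : List (LTy R)} {A B : LTy R} {π π' : MS Δ Γ (.imp A B)}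
    (h : boxM [] [.inr A] rfl (𝓜.sm π) rfl (𝓜.evM A B) =
      boxM [] [.inr A] rfl (𝓜.sm π') rfl (𝓜.evM A B)) : 𝓜.ms π = 𝓜.ms π' := by
  have k := congrArg (lc 𝓜.hyp (by simp : gl Δ ++ ll (Γ ++ [A]) = _) ≫ ·) h
  simp only [lc_boxM, boxM_evM] at k
  exact 𝓜.apM_injective (𝓜.bend_injective k)

theorem boxM_sm_impR {Δ : GCtx R} {Γ : List (LTy R)} {A B : LTy R} (π : MS Δ (Γ ++ [A]) B)
    {L : List ((R × GTy R) ⊕ LTy R)} (h : L = [] ++ ((gl Δ ++ ll Γ) ++ [.inr A])) :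
    boxM [] [.inr A] h (𝓜.sm (.impR π)) rfl (𝓜.evM A B) = lc 𝓜.hyp (by simp [h]) ≫ 𝓜.sm π := by
  rw [← lc_comp_eq (h := by simp [h]), lc_boxM, boxM_evM, apM_impR, sm]

/-- Since `mMny` is invertible, a morphism of mixed contexts is determined by the graded morphism
that it lifts, so equations between lifts can be checked in C. -/
theorem lift_unique {P Q : GCtx R} {g : 𝓜.gctx Q ⟶ 𝓜.gctx P} {g' g'' : 𝓜.mctx Q ⟶ 𝓜.mctx P}
    (h : 𝓜.Lift g g') (h' : 𝓜.Lift g g'') : g' = g'' :=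
  (cancel_mono (𝓜.mMny P)).mp (h.symm.trans h')

theorem lift_contN (X : GTy R) (ds : List R) :
    𝓜.Lift (contNMor 𝓜.gstep X ds) (contNMor 𝓜.mstep X ds) := by
  induction ds with
  | nil => exact lift_gstep _
  | cons d ds ih =>
    exact lift_comp (lift_lc _) (lift_comp (lift_gstep (.cont d ds.sum X)) (lift_comp (lift_lc _)
      (lift_comp (lift_ten (lift_id [(d, X)]) ih) (lift_lc _))))

theorem lift_mcut (ds : List R) {Δ : GCtx R} {X : GTy R} (Θ : GS Δ X) :
    𝓜.Lift (mcutMor 𝓜.gstep ds Θ) (mcutMor 𝓜.mstep ds Θ) :=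
  lift_comp (lift_gstep _) (𝓜.lift_contN X ds)

/-- Pairing and the left rule of the tensor are mutually inverse. This composite gives the expansion
of the identity; the other one, `pairT_tenL`, gives the principal cut. The unit is treated in the
same way below. -/
theorem tenL_pairT (A B : LTy R) : 𝓜.lm (𝓜.lstep (.tenL A B)) ≫ 𝓜.pairT A B = 𝟙 _ := by
  have k (X Y : M) : ((Iso.refl (X ⊗ Y)) ⊗ᵢ (Iso.refl (𝟙_ M))).inv ≫ (α_ X Y (𝟙_ M)).hom ≫
      (Iso.refl X ⊗ᵢ (Iso.refl Y ⊗ᵢ Iso.refl (𝟙_ M))).hom ≫ (α_ X Y (𝟙_ M)).inv ≫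
      (((Iso.refl X).inv ⊗ₘ (Iso.refl Y).inv) ≫ 𝟙 (X ⊗ Y) ≫ (Iso.refl (X ⊗ Y)).hom) ▷ 𝟙_ M =
      𝟙 _ := by simp
  refine (Category.assoc _ _ _).trans ((congrArg (_ ≫ ·) (Category.assoc _ _ _)).trans ?_)
  exact k (𝓜.lty A) (𝓜.lty B)

theorem pairT_tenL (A B : LTy R) : 𝓜.pairT A B ≫ 𝓜.lm (𝓜.lstep (.tenL A B)) = 𝟙 _ := by
  have k (X Y : M) : ((α_ X Y (𝟙_ M)).inv ≫
      (((Iso.refl X).inv ⊗ₘ (Iso.refl Y).inv) ≫ 𝟙 (X ⊗ Y) ≫ (Iso.refl (X ⊗ Y)).hom) ▷ 𝟙_ M) ≫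
      ((Iso.refl (X ⊗ Y)) ⊗ᵢ (Iso.refl (𝟙_ M))).inv ≫ (α_ X Y (𝟙_ M)).hom ≫
      (Iso.refl X ⊗ᵢ (Iso.refl Y ⊗ᵢ Iso.refl (𝟙_ M))).hom =
      𝟙 _ := by simp
  exact k (𝓜.lty A) (𝓜.lty B)

theorem sm_unitR_unitL : (𝓜.sm .unitR : tens 𝓜.hyp [] ⟶ _) ≫ 𝓜.lm (𝓜.lstep .unitL) = 𝟙 _ := by
  rw [sm, MGLModel.ms]
  have k : ((λ_ (𝟙_ M)).inv ≫ (𝟙 (𝟙_ M) ⊗ₘ 𝟙 (𝟙_ M)) ≫ (λ_ (𝟙_ M)).hom ≫ 𝟙 (𝟙_ M) ≫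
      (ρ_ (𝟙_ M)).inv) ≫ (Iso.refl (𝟙_ M) ⊗ᵢ Iso.refl (𝟙_ M)).inv ≫ (ρ_ (𝟙_ M)).hom ≫
      𝟙 (𝟙_ M) = 𝟙 _ := by simp
  exact k

theorem unitL_sm_unitR : 𝓜.lm (𝓜.lstep .unitL) ≫ (𝓜.sm .unitR : tens 𝓜.hyp [] ⟶ _) = 𝟙 _ := by
  rw [sm, MGLModel.ms]
  have k : ((Iso.refl (𝟙_ M) ⊗ᵢ Iso.refl (𝟙_ M)).inv ≫ (ρ_ (𝟙_ M)).hom ≫ 𝟙 (𝟙_ M)) ≫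
      (λ_ (𝟙_ M)).inv ≫ (𝟙 (𝟙_ M) ⊗ₘ 𝟙 (𝟙_ M)) ≫ (λ_ (𝟙_ M)).hom ≫ 𝟙 (𝟙_ M) ≫
      (ρ_ (𝟙_ M)).inv = 𝟙 _ := by simp
  exact k

/-- The inverse of `grdM`. -/
def grdMinv (r : R) (X : GTy R) :
    tens 𝓜.hyp [.inl (r, X)] ⟶ tens 𝓜.hyp [.inr (.Grd r X)] :=
  (𝟙 (𝓜.mhyp (r, X)) ▷ 𝟙_ M : 𝓜.mhyp (r, X) ⊗ 𝟙_ M ⟶ 𝓜.mhyp (r, X) ⊗ 𝟙_ M)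

theorem grdM_inv (r : R) (X : GTy R) : 𝓜.grdM r X ≫ 𝓜.grdMinv r X = 𝟙 _ := by
  have k (X : M) : 𝟙 X ▷ 𝟙_ M ≫ 𝟙 X ▷ 𝟙_ M = 𝟙 _ := by simp
  exact k _

theorem grdMinv_grdM (r : R) (X : GTy R) : 𝓜.grdMinv r X ≫ 𝓜.grdM r X = 𝟙 _ := 𝓜.grdM_inv r X

/-- Makes the laws of graded cuts available for the right rule of Grd: it is a graded cut whose
resulting graded hypothesis is reread as a linear one. -/
theorem sm_grdR (r : R) {Δ : GCtx R} {X : GTy R} (Θ : GS Δ X) :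
    𝓜.sm (.grdR r Θ) = lc 𝓜.hyp (List.append_nil _) ≫ 𝓜.gm (𝓜.mstep (.cut r Θ)) ≫
      𝓜.grdMinv r X := by
  rw [sm, MGLModel.ms, mstep_cut]
  refine (bx_nil_right (b := .Grd r X) 𝓜.iG 𝓜.iL _).trans (congrArg (_ ≫ ·) ?_)
  have k {D D' X Y : M} (m : D ⟶ D') (a : D' ⟶ X) (b : X ⟶ Y) :
      m ≫ ((ρ_ D').inv ≫ (ρ_ D').hom ≫ a ≫ b) ≫ (Iso.refl Y).hom ≫ (ρ_ Y).inv =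
      (m ≫ (a ≫ b ≫ (ρ_ Y).inv) ≫ (Iso.refl Y ⊗ᵢ Iso.refl (𝟙_ M)).hom) ≫ 𝟙 Y ▷ 𝟙_ M := by
    simp
  exact k _ _ _

theorem scale_one (Δ : GCtx R) : scale 1 Δ = Δ := by simp [scale]

theorem prom_one (Δ : GCtx R) :
    𝓜.prom 1 Δ ≫ 𝓜.one (𝓜.gctx Δ) = lc 𝓜.ghyp (scale_one Δ) := by
  rw [prom_eq, one_eq, eqToHom_trans]
  rfl

/-- Once composed with `mMny`, the claim is compared under the bijection of the adjunction, where
naturality of the unit and a triangle identity turn it into `mLin_mMny`. -/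
theorem mLin_counit (Δ : GCtx R) :
    𝓜.mMny Δ ≫ 𝓜.Mny.map (𝓜.mLin Δ) ≫ 𝓜.adj.counit.app (𝓜.mctx Δ) = 𝟙 _ := by
  rw [← cancel_mono (𝓜.mMny Δ), Category.assoc, Category.id_comp]
  have h : (𝓜.Mny.map (𝓜.mLin Δ) ≫ 𝓜.adj.counit.app (𝓜.mctx Δ)) ≫ 𝓜.mMny Δ = 𝟙 _ := by
    apply (𝓜.adj.homEquiv _ _).injective
    rw [Adjunction.homEquiv_unit, Adjunction.homEquiv_unit, Functor.map_comp, Functor.map_comp,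
      Category.assoc, Adjunction.unit_naturality_assoc,
      Adjunction.right_triangle_components_assoc, mLin_mMny, CategoryTheory.Functor.map_id]
    exact (Category.comp_id _).symm
  rw [h, Category.comp_id]

/-- The computation behind the principal cut for Lin. The grade 1 is removed by `prom_one` and
naturality of ε, naturality of the counit brings the interpretation of `π` out of `Mny` and `Lin`,
and `mLin_counit` cancels the rest. -/
theorem mstep_linR {Δ : GCtx R} {A : LTy R} (π : MS Δ [] A) :
    (𝓜.mMny (scale 1 Δ) ≫ 𝓜.Mny.map (𝓜.prom 1 Δ ≫ (𝓜.gr 1).map (𝓜.gs (.linR π)))) ≫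
      𝓜.Mny.map (𝓜.one (𝓜.Lin.obj (𝓜.lty A))) ≫ 𝓜.adj.counit.app (𝓜.lty A) =
      lc 𝓜.mhyp (scale_one Δ) ≫ (ρ_ _).inv ≫ 𝓜.ms π := by
  rw [MGLModel.gs]
  have e (g : 𝓜.gctx Δ ⟶ 𝓜.Lin.obj (𝓜.lty A)) :
      (𝓜.mMny (scale 1 Δ) ≫ 𝓜.Mny.map (𝓜.prom 1 Δ ≫ (𝓜.gr 1).map g)) ≫
        𝓜.Mny.map (𝓜.one (𝓜.Lin.obj (𝓜.lty A))) ≫ 𝓜.adj.counit.app (𝓜.lty A) =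
      lc 𝓜.mhyp (scale_one Δ) ≫ 𝓜.mMny Δ ≫ 𝓜.Mny.map g ≫ 𝓜.adj.counit.app (𝓜.lty A) := by
    rw [Category.assoc, ← Functor.map_comp_assoc, Category.assoc, one_nat, ← Category.assoc (𝓜.prom 1 Δ),
      prom_one, Functor.map_comp, Category.assoc, reassoc_of% 𝓜.mMny_lc]
  have k (h : 𝓜.mctx Δ ⟶ 𝓜.lty A) : 𝓜.mMny Δ ≫ 𝓜.Mny.map (𝓜.mLin Δ ≫ 𝓜.Lin.map h) ≫
      𝓜.adj.counit.app (𝓜.lty A) = h := by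
    have n : 𝓜.Mny.map (𝓜.Lin.map h) ≫ 𝓜.adj.counit.app _ = 𝓜.adj.counit.app _ ≫ h :=
      𝓜.adj.counit.naturality h
    rw [Functor.map_comp, Category.assoc, n]
    exact (congrArg (_ ≫ ·) (Category.assoc _ _ _).symm).trans ((Category.assoc _ _ _).symm.trans
      ((congrArg (· ≫ h) (𝓜.mLin_counit Δ)).trans (Category.id_comp h)))
  exact (e _).trans (congrArg (_ ≫ ·) (k _))

theorem mstep_cut_linR {Δ : GCtx R} {A : LTy R} (π : MS Δ [] A) :
    𝓜.gm (𝓜.mstep (.cut 1 (.linR π))) ≫ 𝓜.linM A = lc 𝓜.hyp (by simp [scale]) ≫ 𝓜.sm π := by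
  rw [sm, mstep_cut]
  refine Eq.trans ?_ (congrArg (_ ≫ ·) (bx_nil_right 𝓜.iG 𝓜.iL (𝓜.ms π)).symm)
  have k {D₀ D D' X Y Z : M} (m : D ⟶ D') (a : D' ⟶ X) (b : X ⟶ Y) (c : Y ⟶ Z) (l : D' ⟶ D₀) (d : D₀ ⟶ Z)
      (h : (a ≫ b) ≫ c = l ≫ d) :
      (m ≫ (a ≫ b ≫ (ρ_ Y).inv) ≫ (Iso.refl Y ⊗ᵢ Iso.refl (𝟙_ M)).hom) ≫ c ▷ 𝟙_ M =
        (m ≫ l) ≫ d ≫ (Iso.refl Z).hom ≫ (ρ_ Z).inv := by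
    have := h =≫ (ρ_ Z).inv
    simp only [Category.assoc] at this
    simp [← this]
  refine (k _ _ _ _ _ _ (𝓜.mstep_linR π)).trans ?_
  have hl : (mapI 𝓜.iG (scale 1 Δ)).inv ≫ lc 𝓜.mhyp (scale_one Δ) =
      lc 𝓜.hyp (by simp [scale]) ≫ (mapI 𝓜.iG Δ).inv := by
    rw [Iso.inv_comp_eq, ← Category.assoc, Iso.eq_comp_inv]
    exact mapI_lc 𝓜.iG _
  have k' {A A' B D D' E : M} {m : A ⟶ B} {l : B ⟶ D} {a : A ⟶ A'} {b : A' ⟶ D} (h : m ≫ l = a ≫ b)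
      {a' : A ⟶ E} {a'' : E ⟶ A'} (h' : a = a' ≫ a'') (x : D ⟶ D') :
      (m ≫ l) ≫ x = a' ≫ a'' ≫ b ≫ x := by simp [h, h']
  exact k' hl (lc_lc _ _ _).symm _

end MGLModel

-- Sliding laws with decompositions of blocks as hypotheses

section Laws
variable {C : Type v} [Category.{w} C] [MonoidalCategory C] [SymmetricCategory C] {α : Type u}
  {f : α → C}

/-- Here and below the decomposition of the blocks is a hypothesis, so that the laws can rewrite
terms whose blocks, coming from `gl` and `ll` of concatenations, have the required shape only
propositionally. -/
theorem boxM_swap (A B D : List α) {A' D' P Q S T L L' L'' : List α} {Z : C}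
    (g : tens f P ⟶ tens f Q) (m : tens f S ⟶ tens f T) (h : L = A ++ (P ++ D'))
    (k : A ++ (Q ++ D') = L'') (h' : L'' = A' ++ (S ++ D)) (k' : A' ++ (T ++ D) = L')
    (y : tens f L' ⟶ Z) (hA : A' = A ++ (Q ++ B)) (hD : D' = B ++ (S ++ D)) :
    boxM A D' h g k (boxM A' D h' m k' y) =
      boxM (A ++ (P ++ B)) D (by simp [h, hD]) m rfl
        (boxM A (B ++ (T ++ D)) (by simp) g (by simp [← k', hA]) y) := by
  subst hA hD
  exact boxM_comm ..

theorem cutM_of_boxD₁ (A D D₂ G₁ G₂ G₃ : List α) {D₁ E P Q T K L L' L'' : List α} {Z : C}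
    (g : tens f P ⟶ tens f Q) (h : L = (D₁ ++ D₂) ++ (G₁ ++ (G₂ ++ G₃)))
    (hx : D₂ ++ G₂ = K) (x : tens f K ⟶ tens f T) (k : D₁ ++ (G₁ ++ (T ++ G₃)) = L')
    (h' : L' = A ++ (P ++ E)) (k' : A ++ (Q ++ E) = L'') (y : tens f L'' ⟶ Z)
    (hD : D₁ = A ++ (P ++ D)) (hE : E = D ++ (G₁ ++ (T ++ G₃))) :
    cutM D₁ D₂ G₁ G₂ G₃ h hx x k (boxM A E h' g k' y) =
      boxM A (D ++ (D₂ ++ (G₁ ++ (G₂ ++ G₃)))) (by simp [h, hD]) g rfl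
        (cutM (A ++ (Q ++ D)) D₂ G₁ G₂ G₃ (by simp) hx x (by simp [← k', hE]) y) := by
  subst hD hE
  exact cutM_boxD₁ ..

theorem cutM_of_boxG₁ (D₁ D₂ A D G₂ G₃ : List α) {A' E G₁ P Q T K L L' L'' : List α} {Z : C}
    (g : tens f P ⟶ tens f Q) (h : L = (D₁ ++ D₂) ++ (G₁ ++ (G₂ ++ G₃)))
    (hx : D₂ ++ G₂ = K) (x : tens f K ⟶ tens f T) (k : D₁ ++ (G₁ ++ (T ++ G₃)) = L')
    (h' : L' = A' ++ (P ++ E)) (k' : A' ++ (Q ++ E) = L'') (y : tens f L'' ⟶ Z)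
    (hG : G₁ = A ++ (P ++ D)) (hA : A' = D₁ ++ A) (hE : E = D ++ (T ++ G₃)) :
    cutM D₁ D₂ G₁ G₂ G₃ h hx x k (boxM A' E h' g k' y) =
      boxM ((D₁ ++ D₂) ++ A) (D ++ (G₂ ++ G₃)) (by simp [h, hG]) g rfl
        (cutM D₁ D₂ (A ++ (Q ++ D)) G₂ G₃ (by simp) hx x (by simp [← k', hA, hE]) y) := by
  subst hG hA hE
  exact cutM_boxG₁ ..

theorem cutM_of_boxG₃ (D₁ D₂ G₁ G₂ A D : List α) {A' G₃ P Q T K L L' L'' : List α} {Z : C}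
    (g : tens f P ⟶ tens f Q) (h : L = (D₁ ++ D₂) ++ (G₁ ++ (G₂ ++ G₃)))
    (hx : D₂ ++ G₂ = K) (x : tens f K ⟶ tens f T) (k : D₁ ++ (G₁ ++ (T ++ G₃)) = L')
    (h' : L' = A' ++ (P ++ D)) (k' : A' ++ (Q ++ D) = L'') (y : tens f L'' ⟶ Z)
    (hG : G₃ = A ++ (P ++ D)) (hA : A' = D₁ ++ (G₁ ++ (T ++ A))) :
    cutM D₁ D₂ G₁ G₂ G₃ h hx x k (boxM A' D h' g k' y) =
      boxM ((D₁ ++ D₂) ++ (G₁ ++ (G₂ ++ A))) D (by simp [h, hG]) g rfl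
        (cutM D₁ D₂ G₁ G₂ (A ++ (Q ++ D)) (by simp) hx x (by simp [← k', hA]) y) := by
  subst hG hA
  exact cutM_boxG₃ ..

theorem cutM_of_boxD₂ (D₁ A D G₁ G₂ G₃ : List α) {D₂ E P Q T K K' L L' : List α} {Z : C}
    (g : tens f P ⟶ tens f Q) (h : L = (D₁ ++ D₂) ++ (G₁ ++ (G₂ ++ G₃)))
    (hx : D₂ ++ G₂ = K) (h' : K = A ++ (P ++ E)) (k' : A ++ (Q ++ E) = K') (x : tens f K' ⟶ tens f T)
    (k : D₁ ++ (G₁ ++ (T ++ G₃)) = L') (y : tens f L' ⟶ Z)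
    (hD : D₂ = A ++ (P ++ D)) (hE : E = D ++ G₂) :
    cutM D₁ D₂ G₁ G₂ G₃ h hx (boxM A E h' g k' x) k y =
      boxM (D₁ ++ A) (D ++ (G₁ ++ (G₂ ++ G₃))) (by simp [h, hD]) g rfl
        (cutM D₁ (A ++ (Q ++ D)) G₁ G₂ G₃ (by simp) (by simp [← k', hE]) x k y) := by
  subst hD hE
  exact cutM_boxD₂ ..

theorem cutM_of_boxG₂ (D₁ D₂ G₁ A D G₃ : List α) {A' E G₂ P Q T K K' L L' : List α} {Z : C}
    (g : tens f P ⟶ tens f Q) (h : L = (D₁ ++ D₂) ++ (G₁ ++ (G₂ ++ G₃)))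
    (hx : D₂ ++ G₂ = K) (h' : K = A' ++ (P ++ E))
    (k' : A' ++ (Q ++ E) = K') (x : tens f K' ⟶ tens f T)
    (k : D₁ ++ (G₁ ++ (T ++ G₃)) = L') (y : tens f L' ⟶ Z)
    (hG : G₂ = A ++ (P ++ D)) (hA : A' = D₂ ++ A) (hE : E = D) :
    cutM D₁ D₂ G₁ G₂ G₃ h hx (boxM A' E h' g k' x) k y =
      boxM ((D₁ ++ D₂) ++ (G₁ ++ A)) (D ++ G₃) (by simp [h, hG]) g rfl
        (cutM D₁ D₂ G₁ (A ++ (Q ++ D)) G₃ (by simp) (by simp [← k', hA, hE]) x k y) := by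
  subst hG hA hE
  exact cutM_boxG₂ ..

theorem boxM_id (A D : List α) {P L L' : List α} {Z : C} (h : L = A ++ (P ++ D))
    (k : A ++ (P ++ D) = L') (y : tens f L' ⟶ Z) :
    boxM A D h (𝟙 (tens f P)) k y = lc f (h.trans k) ≫ y := by
  subst k; simp [boxM]

end Laws

-- Approximation and graded multicuts commute with the mixed rules

namespace MGLModel
open Functor.LaxMonoidal
variable {R : Type u} [Semiring R] [Preorder R] [AddLeftMono R] [MulLeftMono R] [MulRightMono R]
  {C : Type v} [Category.{w} C] [MonoidalCategory C] [SymmetricCategory C]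
  {M : Type v} [Category.{w} M] [MonoidalCategory M] [SymmetricCategory M] [MonoidalClosed M]
  (𝓜 : MGLModel R C M)

theorem mle_append {Δ₁ Δ₁' Δ₂ Δ₂' : GCtx R} (h : GLe Δ₁ Δ₁') (k : GLe Δ₂ Δ₂') :
    𝓜.mle (h.append k) = ten 𝓜.mhyp (𝓜.mle h) (𝓜.mle k) := by
  refine 𝓜.lift_unique (lift_gle (h.append k)) ?_
  rw [gle_append]
  exact lift_ten (lift_gle h) (lift_gle k)

theorem mle_self {Δ : GCtx R} (h : GLe Δ Δ) : 𝓜.mle h = 𝟙 _ := by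
  refine 𝓜.lift_unique (lift_gle h) ?_
  rw [gle_self]
  exact lift_id Δ

theorem sm_sub_append {Δ₁ Δ₁' Δ₂ Δ₂' : GCtx R} {Γ : List (LTy R)} {A : LTy R} (h₁ : GLe Δ₁ Δ₁')
    (h₂ : GLe Δ₂ Δ₂') (π : MS (Δ₁ ++ Δ₂) Γ A) : 𝓜.sm (.sub (h₁.append h₂) π) =
      boxM [] (gl Δ₂' ++ ll Γ) (by simp) (𝓜.gm (𝓜.mle h₁)) rfl
        (boxM (gl Δ₁) (ll Γ) (by simp) (𝓜.gm (𝓜.mle h₂)) (by simp) (𝓜.sm π)) := by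
  rw [sm_sub, mle_append, gm_ten, boxM_lc_comp, boxM_comp_lc, boxM_ten]
  rfl

theorem sub_lleft {Δ Δ' : GCtx R} (h : GLe Δ Δ') (Γ₁ Γ₃ : List (LTy R)) {P Q : List (LTy R)}
    {B : LTy R} (κ : LStep P Q) (π : MS Δ (Γ₁ ++ (P ++ Γ₃)) B) :
    𝓜.sm (.lleft Γ₁ Γ₃ κ (.sub h π)) = 𝓜.sm (.sub h (.lleft Γ₁ Γ₃ κ π)) := by
  simp only [sm_lleft, sm_sub]
  rw [boxM_swap [] (ll Γ₁) (ll Γ₃) (hA := by simp) (hD := by simp)]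
  simp
  simp [boxM]

theorem sub_tenR {Δ₁ Δ₁' Δ₂ Δ₂' : GCtx R} {Γ₁ Γ₂ : List (LTy R)} {A B : LTy R} (h₁ : GLe Δ₁ Δ₁')
    (h₂ : GLe Δ₂ Δ₂') (π₁ : MS Δ₁ Γ₁ A) (π₂ : MS Δ₂ Γ₂ B) :
    𝓜.sm (.tenR (.sub h₁ π₁) (.sub h₂ π₂)) = 𝓜.sm (.sub (h₁.append h₂) (.tenR π₁ π₂)) := by
  simp only [sm_tenR, sm_sub_append]
  simp only [sm_sub]
  rw [cutM_of_boxD₂ (gl Δ₁') [] [] (hD := by simp) (hE := by simp),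
    cutM_of_boxD₂ [] [] [] (hD := by simp) (hE := by simp)]
  simp only [List.nil_append, List.append_nil]
  rw [cutM_of_boxD₁ [] [] (hD := by simp) (hE := by simp),
    boxM_swap [] [] _ (hA := by simp) (hD := by simp)]
  simp
  simp [boxM]

theorem sub_cut (Γ₁ Γ₃ : List (LTy R)) {Δ₁ Δ₁' Δ₂ Δ₂' : GCtx R} {Γ₂ : List (LTy R)} {A B : LTy R}
    (h₁ : GLe Δ₁ Δ₁') (h₂ : GLe Δ₂ Δ₂') (π₁ : MS Δ₂ Γ₂ A) (π₂ : MS Δ₁ (Γ₁ ++ A :: Γ₃) B) :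
    𝓜.sm (.cut Γ₁ Γ₃ (.sub h₂ π₁) (.sub h₁ π₂)) =
      𝓜.sm (.sub (h₁.append h₂) (.cut Γ₁ Γ₃ π₁ π₂)) := by
  simp only [sm_cut, sm_sub_append]
  simp only [sm_sub]
  rw [cutM_of_boxD₁ [] [] (hD := by simp) (hE := by simp),
    cutM_of_boxD₂ _ [] [] (hD := by simp) (hE := by simp)]
  simp
  simp [boxM]

theorem sub_impL (Γ₁ Γ₃ : List (LTy R)) {Δ₁ Δ₁' Δ₂ Δ₂' : GCtx R} {Γ₂ : List (LTy R)} {A B C : LTy R}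
    (h₁ : GLe Δ₁ Δ₁') (h₂ : GLe Δ₂ Δ₂') (π₂ : MS Δ₂ Γ₂ A) (π₁ : MS Δ₁ (Γ₁ ++ B :: Γ₃) C) :
    𝓜.sm (.impL Γ₁ Γ₃ (.sub h₂ π₂) (.sub h₁ π₁)) =
      𝓜.sm (.sub (h₁.append h₂) (.impL Γ₁ Γ₃ π₂ π₁)) := by
  simp only [sm_impL, sm_sub_append]
  simp only [sm_sub]
  rw [cutM_of_boxD₂ [] [] [] (hD := by simp) (hE := by simp)]
  simp only [List.nil_append, List.append_nil]
  rw [cutM_of_boxD₂ _ [] [] (hD := by simp) (hE := by simp),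
    cutM_of_boxD₁ [] [] (hD := by simp) (hE := by simp)]
  simp
  rw [boxM_swap [] [] _ (hA := by simp) (hD := by simp)]
  simp
  simp [boxM, cutM]

theorem sub_impR {Δ Δ' : GCtx R} (h : GLe Δ Δ') {Γ : List (LTy R)} {A B : LTy R}
    (π : MS Δ (Γ ++ [A]) B) : 𝓜.ms (.impR (.sub h π)) = 𝓜.ms (.sub h (.impR π)) := by
  apply ms_imp_ext
  rw [boxM_sm_impR]
  simp only [sm_sub]
  rw [boxM_nest, boxM_sm_impR]
  simp

theorem sub_grdL {Δ Δ' : GCtx R} {Γ : List (LTy R)} {B : LTy R} {r : R} {X : GTy R}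
    (h : GLe Δ Δ') (π : MS (Δ ++ [(r, X)]) Γ B) :
    𝓜.sm (.grdL (.sub (h.append (.refl _)) π)) = 𝓜.sm (.sub h (.grdL π)) := by
  simp only [sm_grdL, sm_sub_append]
  simp only [sm_sub, sm_grdL]
  rw [mle_self, gm_id, boxM_id, boxM_swap [] [] _ (hA := by simp) (hD := by simp)]
  simp
  simp [boxM]

theorem sub_linL {Δ Δ' : GCtx R} {Γ : List (LTy R)} {A B : LTy R} (h : GLe Δ Δ')
    (π : MS Δ (A :: Γ) B) :
    𝓜.sm (.linL (.sub h π)) = 𝓜.sm (.sub (h.append (.refl _)) (.linL π)) := by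
  simp only [sm_linL, sm_sub_append]
  simp only [sm_sub, sm_linL]
  rw [mle_self, gm_id, boxM_id, lc_boxM, boxM_swap [] [] _ (hA := by simp) (hD := by simp)]
  simp
  simp [boxM]

theorem mcut_lleft (A D : GCtx R) (ds : List R) {Δ : GCtx R} {X : GTy R} (Θ : GS Δ X)
    (Γ₁ Γ₃ : List (LTy R)) {P Q : List (LTy R)} {B : LTy R} (κ : LStep P Q)
    (π : MS (A ++ (rep ds X ++ D)) (Γ₁ ++ (P ++ Γ₃)) B) :
    𝓜.sm (MS.mcut A D ds Θ (.lleft Γ₁ Γ₃ κ π)) = 𝓜.sm (.lleft Γ₁ Γ₃ κ (MS.mcut A D ds Θ π)) := by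
  simp only [sm_lleft, sm_mcut]
  rw [boxM_swap _ (gl D ++ ll Γ₁) (ll Γ₃) (hA := by simp) (hD := by simp)]
  simp
  simp [boxM]

/-- The right rule of the tensor being two nested cuts, the box of the multicut leaves the inner cut
through its left premise and then the outer cut through its right premise. For the other premise, in
`mcut_tenR₂`, only the outer cut is crossed. -/
theorem mcut_tenR₁ (A D : GCtx R) (ds : List R) {Δ Δ₂ : GCtx R} {X : GTy R} (Θ : GS Δ X)
    {Γ₁ Γ₂ : List (LTy R)} {B C : LTy R} (π₁ : MS (A ++ (rep ds X ++ D)) Γ₁ B)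
    (π₂ : MS Δ₂ Γ₂ C) : 𝓜.sm (MS.mcut A (D ++ Δ₂) ds Θ (MS.tr (.tenR π₁ π₂) (by simp only [List.append_assoc]))) =
      𝓜.sm (MS.tr (.tenR (MS.mcut A D ds Θ π₁) π₂) (by simp only [List.append_assoc])) := by
  simp only [sm_tr, sm_tenR, sm_mcut]
  rw [cutM_of_boxD₂ [] (gl A) (gl D) (hD := by simp) (hE := by simp)]
  simp only [List.nil_append, List.append_nil]
  rw [cutM_of_boxD₁ (gl A) (gl D) (hD := by simp) (hE := by simp)]
  simp
  simp [boxM, cutM]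

theorem mcut_tenR₂ (A D : GCtx R) (ds : List R) {Δ Δ₁ : GCtx R} {X : GTy R} (Θ : GS Δ X)
    {Γ₁ Γ₂ : List (LTy R)} {B C : LTy R} (π₁ : MS Δ₁ Γ₁ B)
    (π₂ : MS (A ++ (rep ds X ++ D)) Γ₂ C) :
    𝓜.sm (MS.mcut (Δ₁ ++ A) D ds Θ (MS.tr (.tenR π₁ π₂) (by simp only [List.append_assoc]))) =
      𝓜.sm (MS.tr (.tenR π₁ (MS.mcut A D ds Θ π₂)) (by simp only [List.append_assoc])) := by
  simp only [sm_tr, sm_tenR, sm_mcut]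
  rw [cutM_of_boxD₂ _ (gl A) (gl D) (hD := by simp) (hE := by simp)]
  simp
  simp [boxM]

theorem mcut_impR (A D : GCtx R) (ds : List R) {Δ : GCtx R} {X : GTy R} (Θ : GS Δ X)
    {Γ : List (LTy R)} {B C : LTy R} (π : MS (A ++ (rep ds X ++ D)) (Γ ++ [B]) C) :
    𝓜.ms (MS.mcut A D ds Θ (.impR π)) = 𝓜.ms (.impR (MS.mcut A D ds Θ π)) := by
  apply ms_imp_ext
  rw [boxM_sm_impR]
  simp only [sm_mcut]
  rw [boxM_nest, boxM_sm_impR]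
  simp

theorem mcut_impL₁ (A D : GCtx R) (ds : List R) {Δ Δ₂ : GCtx R} {X : GTy R} (Θ : GS Δ X)
    (Γ₁ Γ₃ : List (LTy R)) {Γ₂ : List (LTy R)} {B C E : LTy R} (π₂ : MS Δ₂ Γ₂ B)
    (π₁ : MS (A ++ (rep ds X ++ D)) (Γ₁ ++ C :: Γ₃) E) :
    𝓜.sm (MS.mcut A (D ++ Δ₂) ds Θ (MS.tr (.impL Γ₁ Γ₃ π₂ π₁) (by simp only [List.append_assoc]))) =
      𝓜.sm (MS.tr (.impL Γ₁ Γ₃ π₂ (MS.mcut A D ds Θ π₁)) (by simp only [List.append_assoc])) := by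
  simp only [sm_tr, sm_impL, sm_mcut]
  rw [cutM_of_boxD₁ (gl A) (gl D) (hD := by simp) (hE := by simp)]
  simp
  simp [boxM]

theorem mcut_impL₂ (A D : GCtx R) (ds : List R) {Δ Δ₁ : GCtx R} {X : GTy R} (Θ : GS Δ X)
    (Γ₁ Γ₃ : List (LTy R)) {Γ₂ : List (LTy R)} {B C E : LTy R}
    (π₂ : MS (A ++ (rep ds X ++ D)) Γ₂ B) (π₁ : MS Δ₁ (Γ₁ ++ C :: Γ₃) E) :
    𝓜.sm (MS.mcut (Δ₁ ++ A) D ds Θ (MS.tr (.impL Γ₁ Γ₃ π₂ π₁) (by simp only [List.append_assoc]))) =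
      𝓜.sm (MS.tr (.impL Γ₁ Γ₃ (MS.mcut A D ds Θ π₂) π₁) (by simp only [List.append_assoc])) := by
  simp only [sm_tr, sm_impL, sm_mcut]
  rw [cutM_of_boxD₂ [] (gl A) (gl D) (hD := by simp) (hE := by simp)]
  simp only [List.nil_append, List.append_nil]
  rw [cutM_of_boxD₂ _ (gl A) (gl D) (hD := by simp) (hE := by simp)]
  simp
  simp [boxM, cutM]

theorem mcut_grdL (A D : GCtx R) (ds : List R) {Δ : GCtx R} {X Y : GTy R} (Θ : GS Δ X)
    {Γ : List (LTy R)} {B : LTy R} {r : R}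
    (π : MS ((A ++ (rep ds X ++ D)) ++ [(r, Y)]) Γ B) :
    𝓜.sm (MS.mcut A D ds Θ (.grdL π)) =
      𝓜.sm (.grdL (MS.tr (MS.mcut A (D ++ [(r, Y)]) ds Θ (MS.tr π (by simp only [List.append_assoc])))
        (by simp only [List.append_assoc]))) := by
  simp only [sm_tr, sm_grdL, sm_mcut]
  rw [boxM_swap _ (gl D) _ (hA := by simp) (hD := by simp)]
  simp
  simp [boxM]

theorem mcut_linL (A D : GCtx R) (ds : List R) {Δ : GCtx R} {X : GTy R} (Θ : GS Δ X)
    {Γ : List (LTy R)} {B C : LTy R} (π : MS (A ++ (rep ds X ++ D)) (B :: Γ) C) :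
    𝓜.sm (MS.mcut A (D ++ [(1, .Lin B)]) ds Θ (MS.tr (.linL π) (by simp only [List.append_assoc]))) =
      𝓜.sm (MS.tr (.linL (MS.mcut A D ds Θ π)) (by simp only [List.append_assoc])) := by
  simp only [sm_tr, sm_linL, sm_mcut]
  simp only [lc_boxM]
  rw [boxM_swap _ (gl D) _ (hA := by simp) (hD := by simp)]
  simp
  simp [boxM]

theorem mcut_cut₁ (A D : GCtx R) (ds : List R) {Δ Δ₁ : GCtx R} {X : GTy R} (Θ : GS Δ X)
    (Γ₁ Γ₃ : List (LTy R)) {Γ₂ : List (LTy R)} {B C : LTy R}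
    (π₁ : MS (A ++ (rep ds X ++ D)) Γ₂ B) (π₂ : MS Δ₁ (Γ₁ ++ B :: Γ₃) C) :
    𝓜.sm (MS.mcut (Δ₁ ++ A) D ds Θ (MS.tr (.cut Γ₁ Γ₃ π₁ π₂) (by simp only [List.append_assoc]))) =
      𝓜.sm (MS.tr (.cut Γ₁ Γ₃ (MS.mcut A D ds Θ π₁) π₂) (by simp only [List.append_assoc])) := by
  simp only [sm_tr, sm_cut, sm_mcut]
  rw [cutM_of_boxD₂ _ (gl A) (gl D) (hD := by simp) (hE := by simp)]
  simp
  simp [boxM]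

theorem mcut_cut₂ (A D : GCtx R) (ds : List R) {Δ Δ₂ : GCtx R} {X : GTy R} (Θ : GS Δ X)
    (Γ₁ Γ₃ : List (LTy R)) {Γ₂ : List (LTy R)} {B C : LTy R} (π₁ : MS Δ₂ Γ₂ B)
    (π₂ : MS (A ++ (rep ds X ++ D)) (Γ₁ ++ B :: Γ₃) C) :
    𝓜.sm (MS.mcut A (D ++ Δ₂) ds Θ (MS.tr (.cut Γ₁ Γ₃ π₁ π₂) (by simp only [List.append_assoc]))) =
      𝓜.sm (MS.tr (.cut Γ₁ Γ₃ π₁ (MS.mcut A D ds Θ π₂)) (by simp only [List.append_assoc])) := by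
  simp only [sm_tr, sm_cut, sm_mcut]
  rw [cutM_of_boxD₁ (gl A) (gl D) (hD := by simp) (hE := by simp)]
  simp
  simp [boxM]

end MGLModel

-- Laws of cuts for the linear cut reductions

section Laws
variable {C : Type v} [Category.{w} C] [MonoidalCategory C] [SymmetricCategory C] {α : Type u}
  {f : α → C}

theorem cutM_of_cutM (D₂ D₃ G₂ G₃ G₄ : List α) {D₁ E G₁ N G₅ A B K K' M L L' : List α} {Z : C}
    (h : L = (D₁ ++ E) ++ (G₁ ++ (N ++ G₅))) (hm : E ++ N = M)
    (h' : M = (D₂ ++ D₃) ++ (G₂ ++ (G₃ ++ G₄))) (hx : D₃ ++ G₃ = K) (x : tens f K ⟶ tens f A)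
    (k' : D₂ ++ (G₂ ++ (A ++ G₄)) = K') (x' : tens f K' ⟶ tens f B)
    (k : D₁ ++ (G₁ ++ (B ++ G₅)) = L') (y : tens f L' ⟶ Z)
    (hD : E = D₂ ++ D₃) (hG : N = G₂ ++ (G₃ ++ G₄)) :
    cutM D₁ E G₁ N G₅ h hm (cutM D₂ D₃ G₂ G₃ G₄ h' hx x k' x') k y =
      cutM (D₁ ++ D₂) D₃ (G₁ ++ G₂) G₃ (G₄ ++ G₅) (by simp [h, hD, hG]) hx x rfl
        (cutM D₁ D₂ G₁ (G₂ ++ (A ++ G₄)) G₅ (by simp) k' x' k y) := by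
  subst hD hG hm
  exact (cutM_cutM ..).symm

theorem cutM_comm_of (D₁ D₂ G₃ G₄ G₅ : List α) {E D₃ G₁ G₂ G A B N K K' L L' L'' : List α} {Z : C}
    (h : L = (E ++ D₃) ++ (G₁ ++ (G₂ ++ G))) (hx : D₃ ++ G₂ = K)
    (x : tens f K ⟶ tens f A) (k : E ++ (G₁ ++ (A ++ G)) = L')
    (h' : L' = (D₁ ++ D₂) ++ (N ++ (G₄ ++ G₅)))
    (hx' : D₂ ++ G₄ = K') (x' : tens f K' ⟶ tens f B)
    (k' : D₁ ++ (N ++ (B ++ G₅)) = L'') (y : tens f L'' ⟶ Z)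
    (hE : E = D₁ ++ D₂) (hN : N = G₁ ++ (A ++ G₃)) (hG : G = G₃ ++ (G₄ ++ G₅)) :
    cutM E D₃ G₁ G₂ G h hx x k (cutM D₁ D₂ N G₄ G₅ h' hx' x' k' y) =
      boxM D₁ (G₁ ++ (G₂ ++ (G₃ ++ (G₄ ++ G₅)))) (by simp [h, hE, hG]) (br f D₂ D₃) rfl
        (cutM (D₁ ++ D₃) D₂ (G₁ ++ (G₂ ++ G₃)) G₄ G₅ (by simp) hx' x' rfl
          (cutM D₁ D₃ G₁ G₂ (G₃ ++ (B ++ G₅)) (by simp) hx x (by simp [← k', hN]) y)) := by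
  subst hE hN hG
  exact cutM_comm ..

theorem cutM_exL_of {D₁ D₂ G G₁ B G₂ G₃ G₃' A A' K L L' L'' : List α} {Z : C}
    (h : L = (D₁ ++ D₂) ++ (G ++ (G₂ ++ G₃))) (hx : D₂ ++ G₂ = K)
    (x : tens f K ⟶ tens f A) (k : D₁ ++ (G ++ (A ++ G₃)) = L')
    (h' : L' = A' ++ ((B ++ A) ++ G₃')) (k' : A' ++ ((A ++ B) ++ G₃') = L'')
    (y : tens f L'' ⟶ Z) (hG : G = G₁ ++ B) (hA : A' = D₁ ++ G₁) (h₃ : G₃' = G₃) :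
    cutM D₁ D₂ G G₂ G₃ h hx x k (boxM A' G₃' h' (br f B A) k' y) =
      boxM ((D₁ ++ D₂) ++ G₁) G₃ (by simp [h, hG]) (br f B G₂) rfl
        (cutM D₁ D₂ G₁ G₂ (B ++ G₃) (by simp) hx x (by simp [← k', hA, h₃]) y) := by
  subst hG hA h₃
  exact cutM_exL ..

theorem cutM_exR_of {D₁ D₂ G₁ B G₂ G G₃ A A' K L L' L'' : List α} {Z : C}
    (h : L = (D₁ ++ D₂) ++ (G₁ ++ (G₂ ++ G))) (hx : D₂ ++ G₂ = K)
    (x : tens f K ⟶ tens f A) (k : D₁ ++ (G₁ ++ (A ++ G)) = L')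
    (h' : L' = A' ++ ((A ++ B) ++ G₃)) (k' : A' ++ ((B ++ A) ++ G₃) = L'')
    (y : tens f L'' ⟶ Z) (hG : G = B ++ G₃) (hA : A' = D₁ ++ G₁) :
    cutM D₁ D₂ G₁ G₂ G h hx x k (boxM A' G₃ h' (br f A B) k' y) =
      boxM ((D₁ ++ D₂) ++ G₁) G₃ (by simp [h, hG]) (br f G₂ B) rfl
        (cutM D₁ D₂ (G₁ ++ B) G₂ G₃ (by simp) hx x (by simp [← k', hA]) y) := by
  subst hG hA
  exact cutM_exR ..

theorem cutM_of_boxL {D₁ D₂ G₁ N G₂ G₃ P Q T K K' L L' : List α} {Z : C}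
    (g : tens f P ⟶ tens f Q) (h : L = (D₁ ++ D₂) ++ (G₁ ++ (N ++ G₃)))
    (hx : D₂ ++ N = K) (h' : K = D₂ ++ (P ++ G₂)) (k' : D₂ ++ (Q ++ G₂) = K')
    (x : tens f K' ⟶ tens f T) (k : D₁ ++ (G₁ ++ (T ++ G₃)) = L') (y : tens f L' ⟶ Z)
    (hN : N = P ++ G₂) :
    cutM D₁ D₂ G₁ N G₃ h hx (boxM D₂ G₂ h' g k' x) k y =
      boxM (D₁ ++ D₂) (G₂ ++ G₃) (by simp [h, hN]) (br f G₁ P) rfl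
        (boxM (D₁ ++ D₂) (G₁ ++ (G₂ ++ G₃)) (by simp) g rfl
          (cutM D₁ (D₂ ++ Q) G₁ G₂ G₃ (by simp) (by simp [← k']) x k y)) := by
  subst hN
  exact cutM_boxL ..

theorem cutM_of_boxM_left (G₁ : List α) {D₁ D₂ N E G₂ G₃ P Q T K L L' L'' : List α} {Z : C}
    (g : tens f P ⟶ tens f Q) (h : L = (D₁ ++ D₂) ++ (N ++ (G₂ ++ G₃)))
    (hx : D₂ ++ G₂ = K) (x : tens f K ⟶ tens f T) (k : D₁ ++ (N ++ (T ++ G₃)) = L')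
    (h' : L' = D₁ ++ (P ++ E)) (k' : D₁ ++ (Q ++ E) = L'')
    (y : tens f L'' ⟶ Z) (hN : N = P ++ G₁) (hE : E = G₁ ++ (T ++ G₃)) :
    cutM D₁ D₂ N G₂ G₃ h hx x k (boxM D₁ E h' g k' y) =
      boxM (D₁ ++ D₂) (G₁ ++ (G₂ ++ G₃)) (by simp [h, hN]) g rfl
        (boxM D₁ (G₁ ++ (G₂ ++ G₃)) (by simp) (br f D₂ Q) rfl
          (cutM (D₁ ++ Q) D₂ G₁ G₂ G₃ (by simp) hx x (by simp [← k', hE]) y)) := by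
  subst hN hE
  exact cutM_boxM_left ..

/-- For the left rule of Lin in the right premise. Its graded hypothesis `P` must pass `D₂` to reach
the border, and `D₂` then crosses the new linear hypothesis `Q` on the way to its place; by
naturality these crossings cancel, which is `e''`. -/
theorem cutM_boxM_right (D₁ : List α) {D₂ N E G₁ G₂ G₃ P Q T K L L' L'' : List α} {Z : C}
    (g : tens f P ⟶ tens f Q) (h : L = (N ++ D₂) ++ (G₁ ++ (G₂ ++ G₃)))
    (hx : D₂ ++ G₂ = K) (x : tens f K ⟶ tens f T) (k : N ++ (G₁ ++ (T ++ G₃)) = L')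
    (h' : L' = D₁ ++ (P ++ E)) (k' : D₁ ++ (Q ++ E) = L'')
    (y : tens f L'' ⟶ Z) (hN : N = D₁ ++ P) (hE : E = G₁ ++ (T ++ G₃)) :
    cutM N D₂ G₁ G₂ G₃ h hx x k (boxM D₁ E h' g k' y) =
      boxM D₁ (G₁ ++ (G₂ ++ G₃)) (by simp [h, hN]) (br f P D₂) rfl
        (boxM (D₁ ++ D₂) (G₁ ++ (G₂ ++ G₃)) (by simp) g rfl
          (cutM D₁ D₂ (Q ++ G₁) G₂ G₃ (by simp) hx x (by simp [← k', hE]) y)) := by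
  subst hN hE h hx k k'
  let m : tens f (D₂ ++ (G₁ ++ (G₂ ++ G₃))) ⟶ tens f (G₁ ++ (T ++ G₃)) :=
    lc f (by simp) ≫ ten f (br f D₂ G₁) (𝟙 (tens f (G₂ ++ G₃))) ≫ lc f (by simp) ≫
      ten f (𝟙 (tens f G₁)) (ten f x (𝟙 (tens f G₃)))
  have e := congrArg (fun t => ten f (𝟙 (tens f D₁)) (ten f t (𝟙 (tens f (G₁ ++ (G₂ ++ G₃))))))
    (ten_br (𝟙 (tens f D₂)) g)
  have e' := congrArg (ten f (𝟙 (tens f D₁))) (ten_exchange g m)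
  have e'' := congrArg (fun t => ten f (𝟙 (tens f D₁)) (ten f t (𝟙 (tens f (G₁ ++ (G₂ ++ G₃))))))
    (br_br P D₂)
  simp only [comp_ten_id, id_ten_comp, ten_id] at e''
  simp at e
  simp only [← Category.assoc, comp_lc_eq] at e
  simp only [Category.assoc, lc_comp_eq] at e
  simp [m] at e'
  simp only [← Category.assoc, comp_lc_eq] at e'
  simp only [Category.assoc, lc_comp_eq] at e'
  simp [cutM, boxM, br_append_left, br_append_right, reassoc_of% e, reassoc_of% e', reassoc_of% e'']

/-- For the left rule of Lin in the left premise, where the last entry of the graded block has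
become linear. As a linear hypothesis it stands after `G₁`, so it has to be brought back past `G₁`
first. -/
theorem cutM_move {D₁ E D₂ A G₁ G₂ G₃ T K L L' : List α} {Z : C}
    (h : L = (D₁ ++ E) ++ (G₁ ++ (G₂ ++ G₃)))
    (hx : E ++ G₂ = K) (x : tens f K ⟶ tens f T) (k : D₁ ++ (G₁ ++ (T ++ G₃)) = L')
    (y : tens f L' ⟶ Z) (hE : E = D₂ ++ A) :
    cutM D₁ E G₁ G₂ G₃ h hx x k y =
      boxM (D₁ ++ D₂) (G₂ ++ G₃) (by simp [h, hE]) (br f A G₁) rfl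
        (cutM D₁ D₂ G₁ (A ++ G₂) G₃ (by simp) (by simp [← hx, hE]) x k y) := by
  subst hE h hx k
  simp [cutM, boxM, br_append_left]

theorem cutM_nil_mid (D₁ D₂ G₂ G₃ : List α) {A K L L' : List α} {Z : C}
    (h : L = (D₁ ++ D₂) ++ ([] ++ (G₂ ++ G₃))) (hx : D₂ ++ G₂ = K) (x : tens f K ⟶ tens f A)
    (k : D₁ ++ ([] ++ (A ++ G₃)) = L') (y : tens f L' ⟶ Z) :
    cutM D₁ D₂ [] G₂ G₃ h hx x k y = boxM D₁ G₃ (by simp [h, ← hx]) x k y := by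
  subst h hx k
  simp [cutM, boxM, br_nil_right]

theorem boxM_cutM {D₁ D₂ G₁ G₂ G₃ E A B K L L' S L'' : List α} {Z : C}
    (h' : S = [] ++ (L ++ E)) (h : L = (D₁ ++ D₂) ++ (G₁ ++ (G₂ ++ G₃))) (hx : D₂ ++ G₂ = K)
    (x : tens f K ⟶ tens f A) (k : D₁ ++ (G₁ ++ (A ++ G₃)) = L') (y : tens f L' ⟶ tens f B)
    (k' : [] ++ (B ++ E) = L'') (z : tens f L'' ⟶ Z) :
    boxM [] E h' (cutM D₁ D₂ G₁ G₂ G₃ h hx x k y) k' z =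
      cutM D₁ D₂ G₁ G₂ (G₃ ++ E) (by simp [h', h]) hx x (by simp [← k]) (boxM [] E rfl y k' z) := by
  subst h' h hx k k'
  simp [cutM, boxM]

theorem boxM_boxM_of {A D A' D' P Q S T L L' L'' : List α} {Z : C} (h : L = A ++ (P ++ D))
    (g : tens f P ⟶ tens f Q) (k : A ++ (Q ++ D) = L') (h' : L' = A' ++ (S ++ D'))
    (m : tens f S ⟶ tens f T) (k' : A' ++ (T ++ D') = L'') (y : tens f L'' ⟶ Z) (e : Q = S)
    (hA : A' = A) (hD : D' = D) :
    boxM A D h g k (boxM A' D' h' m k' y) =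
      boxM A D h (g ≫ lc f e ≫ m) (by simp [← k', hA, hD]) y := by
  subst e hA hD
  rw [boxM_boxM, lc_self, Category.id_comp]

theorem boxM_br_br {A D A' D' P Q L L' L'' : List α} {Z : C} (h : L = A ++ ((P ++ Q) ++ D))
    (k : A ++ ((Q ++ P) ++ D) = L') (h' : L' = A' ++ ((Q ++ P) ++ D'))
    (k' : A' ++ ((P ++ Q) ++ D') = L'') (y : tens f L'' ⟶ Z) (hA : A' = A) (hD : D' = D) :
    boxM A D h (br f P Q) k (boxM A' D' h' (br f Q P) k' y) =
      lc f (by simp [h, ← k', hA, hD]) ≫ y := by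
  subst hA hD
  rw [boxM_boxM, br_br, boxM_id]

end Laws

-- Soundness of the linear cut reductions and expansions

namespace MGLModel
open Functor.LaxMonoidal
variable {R : Type u} [Semiring R] [Preorder R] [AddLeftMono R] [MulLeftMono R] [MulRightMono R]
  {C : Type v} [Category.{w} C] [MonoidalCategory C] [SymmetricCategory C]
  {M : Type v} [Category.{w} M] [MonoidalCategory M] [SymmetricCategory M] [MonoidalClosed M]
  (𝓜 : MGLModel R C M)

theorem lm_ex (A B : LTy R) : 𝓜.lm (𝓜.lstep (.ex A B)) =
    lc 𝓜.hyp (by simp) ≫ br 𝓜.hyp [.inr B] [.inr A] ≫ lc 𝓜.hyp (by simp) := by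
  rw [MGLModel.lstep, exch_eq, lm_br]
  rfl

theorem lcut_exEx {Δ : GCtx R} (Γ₁ Γ₃ : List (LTy R)) (A B : LTy R) {C : LTy R}
    (π : MS Δ (Γ₁ ++ ([A, B] ++ Γ₃)) C) :
    𝓜.sm (.lleft Γ₁ Γ₃ (.ex B A) (.lleft Γ₁ Γ₃ (.ex A B) π)) = 𝓜.sm π := by
  simp only [sm_lleft]
  rw [boxM_boxM, ← lm_comp]
  have e : 𝓜.lstep (.ex B A) ≫ 𝓜.lstep (.ex A B) = 𝟙 _ := by
    rw [MGLModel.lstep, MGLModel.lstep, exch_eq, exch_eq]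
    exact br_br _ _
  rw [e, lm_id, boxM_id, lc_self, Category.id_comp]

theorem cut_cut {Δ₁ Δ₂ Δ₃ : GCtx R} (Γ₁ Γ₂ Γ₄ Γ₅ : List (LTy R)) {Γ₃ : List (LTy R)} {A B C : LTy R}
    (π₁ : MS Δ₃ Γ₃ A) (π₃ : MS Δ₂ (Γ₂ ++ A :: Γ₄) B) (π₄ : MS Δ₁ (Γ₁ ++ B :: Γ₅) C) :
    𝓜.sm (.cut (Γ₁ ++ Γ₂) (Γ₄ ++ Γ₅) π₁ (MS.tr (.cut Γ₁ Γ₅ π₃ π₄))) =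
      𝓜.sm (MS.tr (.cut Γ₁ Γ₅ (.cut Γ₂ Γ₄ π₁ π₃) π₄)) := by
  simp only [sm_tr, sm_cut]
  rw [cutM_of_cutM (hD := by simp) (hG := by simp)]
  simp
  simp [cutM, boxM]

theorem cut_cut_comm {Δ₁ Δ₂ Δ₃ : GCtx R} (Γ₁ Γ₃ Γ₅ : List (LTy R)) {Γ₂ Γ₄ : List (LTy R)}
    {A B C : LTy R} (π₁ : MS Δ₃ Γ₂ A) (π₃ : MS Δ₂ Γ₄ B)
    (π₄ : MS Δ₁ (Γ₁ ++ A :: (Γ₃ ++ B :: Γ₅)) C) :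
    𝓜.sm (.cut Γ₁ (Γ₃ ++ (Γ₄ ++ Γ₅)) π₁ (MS.tr (.cut (Γ₁ ++ A :: Γ₃) Γ₅ π₃ (MS.tr π₄)))) =
      𝓜.sm (MS.tr (MS.gswap Δ₁ Δ₃ Δ₂ [] (MS.tr (.cut (Γ₁ ++ (Γ₂ ++ Γ₃)) Γ₅ π₃
        (MS.tr (.cut Γ₁ (Γ₃ ++ B :: Γ₅) π₁ π₄)))))) := by
  simp only [sm_tr, sm_gswap, sm_cut]
  simp only [lc_cutM]
  rw [cutM_comm_of _ _ (ll Γ₃) (hE := by simp) (hN := by simp) (hG := by simp)]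
  simp
  simp [cutM, boxM]

theorem cut_lleft₁ {Δ₁ Δ₂ : GCtx R} (Γ₁ Γ₂ Γ₃ Γ₄ : List (LTy R)) {P Q : List (LTy R)} {B C : LTy R}
    (κ : LStep P Q) (π₁ : MS Δ₂ (Γ₂ ++ (P ++ Γ₃)) B) (π₂ : MS Δ₁ (Γ₁ ++ B :: Γ₄) C) :
    𝓜.sm (.cut Γ₁ Γ₄ (.lleft Γ₂ Γ₃ κ π₁) π₂) =
      𝓜.sm (MS.tr (.lleft (Γ₁ ++ Γ₂) (Γ₃ ++ Γ₄) κ (MS.tr (.cut Γ₁ Γ₄ π₁ π₂)))) := by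
  simp only [sm_tr, sm_lleft, sm_cut]
  rw [cutM_of_boxG₂ _ _ _ (ll Γ₂) (ll Γ₃) (hG := by simp) (hA := by simp) (hE := by simp)]
  simp
  simp [cutM, boxM]

theorem cut_gleft₁ {Δ₁ : GCtx R} (A D : GCtx R) {P Q : GCtx R} (Γ₁ Γ₃ : List (LTy R))
    {Γ₂ : List (LTy R)} {B C : LTy R} (ρ : GStep P Q) (π₁ : MS (A ++ (P ++ D)) Γ₂ B)
    (π₂ : MS Δ₁ (Γ₁ ++ B :: Γ₃) C) : 𝓜.sm (.cut Γ₁ Γ₃ (.gleft A D ρ π₁) π₂) =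
      𝓜.sm (MS.tr (.gleft (Δ₁ ++ A) D ρ (MS.tr (.cut Γ₁ Γ₃ π₁ π₂)))) := by
  simp only [sm_tr, sm_gleft, sm_cut]
  rw [cutM_of_boxD₂ _ (gl A) (gl D) (hD := by simp) (hE := by simp)]
  simp
  simp [cutM, boxM]

theorem cut_impL {Δ₁ Δ₂ Δ₃ : GCtx R} (Γ₁ Γ₂ Γ₄ Γ₅ : List (LTy R)) {Γ₃ : List (LTy R)}
    {A B C D : LTy R} (π₃ : MS Δ₃ Γ₃ A) (π₄ : MS Δ₂ (Γ₂ ++ B :: Γ₄) C)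
    (π₂ : MS Δ₁ (Γ₁ ++ C :: Γ₅) D) : 𝓜.sm (.cut Γ₁ Γ₅ (.impL Γ₂ Γ₄ π₃ π₄) π₂) =
      𝓜.sm (MS.tr (.impL (B := B) (Γ₁ ++ Γ₂) (Γ₄ ++ Γ₅) π₃ (MS.tr (.cut Γ₁ Γ₅ π₄ π₂)))) := by
  simp only [sm_tr, sm_impL, sm_cut]
  rw [cutM_of_cutM (hD := by simp) (hG := by simp)]
  simp
  simp [cutM, boxM]

theorem sm_lswap_left {Δ : GCtx R} (Γ₁ Q Γ₃ : List (LTy R)) {A B : LTy R}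
    (π : MS Δ (Γ₁ ++ ([A] ++ (Q ++ Γ₃))) B) : 𝓜.sm (MS.lswap Γ₁ [A] Q Γ₃ π) =
      boxM (gl Δ ++ ll Γ₁) (ll Γ₃) (by simp) (br 𝓜.hyp (ll Q) [.inr A]) (by simp) (𝓜.sm π) :=
  𝓜.sm_lswap _ _ _ _ _

theorem sm_lswap_right {Δ : GCtx R} (Γ₁ P Γ₃ : List (LTy R)) {A B : LTy R}
    (π : MS Δ (Γ₁ ++ (P ++ ([A] ++ Γ₃))) B) : 𝓜.sm (MS.lswap Γ₁ P [A] Γ₃ π) =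
      boxM (gl Δ ++ ll Γ₁) (ll Γ₃) (by simp) (br 𝓜.hyp [.inr A] (ll P)) (by simp) (𝓜.sm π) :=
  𝓜.sm_lswap _ _ _ _ _

theorem sm_gswap_left (A Q D : GCtx R) {p : R × GTy R} {Γ : List (LTy R)} {B : LTy R}
    (π : MS (A ++ ([p] ++ (Q ++ D))) Γ B) : 𝓜.sm (MS.gswap A [p] Q D π) =
      boxM (gl A) (gl D ++ ll Γ) (by simp) (br 𝓜.hyp (gl Q) [.inl p]) (by simp) (𝓜.sm π) :=
  𝓜.sm_gswap _ _ _ _ _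

theorem sm_gswap_right (A P D : GCtx R) {p : R × GTy R} {Γ : List (LTy R)} {B : LTy R}
    (π : MS (A ++ (P ++ ([p] ++ D))) Γ B) : 𝓜.sm (MS.gswap A P [p] D π) =
      boxM (gl A) (gl D ++ ll Γ) (by simp) (br 𝓜.hyp [.inl p] (gl P)) (by simp) (𝓜.sm π) :=
  𝓜.sm_gswap _ _ _ _ _

/-- Here, and in several statements below, some casts `MS.tr` are added to those of the
corresponding equation. They reduce away, and serve to present the contexts in the associated form
that the sliding laws expect. -/
theorem cut_linL {Δ₁ Δ₂ : GCtx R} (Γ₁ Γ₃ : List (LTy R)) {Γ₂ : List (LTy R)} {A B C : LTy R}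
    (π₁ : MS Δ₂ (A :: Γ₂) B) (π₂ : MS Δ₁ (Γ₁ ++ B :: Γ₃) C) :
    𝓜.sm (.cut Γ₁ Γ₃ (.linL π₁) π₂) = 𝓜.sm (MS.tr (.linL (A := A) (Γ := Γ₁ ++ (Γ₂ ++ Γ₃))
      (MS.tr (MS.lswap [] Γ₁ [A] (Γ₂ ++ Γ₃) (MS.tr (.cut Γ₁ Γ₃ π₁ π₂)))))) := by
  simp only [sm_tr, sm_linL, sm_cut, sm_lswap_right]
  rw [cutM_of_boxD₂ (gl Δ₁) (gl Δ₂) [] (ll Γ₁) (ll Γ₂) (ll Γ₃) 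
    (D₂ := gl (Δ₂ ++ [(1, GTy.Lin A)])) (E := ll Γ₂) (g := 𝓜.linM A) (hD := by simp) (hE := by simp), 
    cutM_move (D₂ := gl Δ₂) (A := [.inr A]) (hE := by simp)]
  simp
  simp [cutM, boxM]

theorem cut_grdL {Δ₁ Δ₂ : GCtx R} (Γ₁ Γ₃ : List (LTy R)) {Γ₂ : List (LTy R)} {X : GTy R} {r : R}
    {B C : LTy R} (π₁ : MS (Δ₂ ++ [(r, X)]) Γ₂ B) (π₂ : MS Δ₁ (Γ₁ ++ B :: Γ₃) C) :
    𝓜.sm (.cut Γ₁ Γ₃ (.grdL π₁) π₂) =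
      𝓜.sm (MS.tr (MS.lswap [] [.Grd r X] Γ₁ (Γ₂ ++ Γ₃)
        (MS.tr (.grdL (Δ := Δ₁ ++ Δ₂) (r := r) (X := X) (MS.tr (.cut Γ₁ Γ₃ π₁ π₂)))))) := by
  simp only [sm_tr, sm_grdL, sm_cut, sm_lswap_left]
  rw [cutM_of_boxL (hN := by simp)]
  simp
  simp [cutM, boxM]

theorem cut_tenR₁ {Δ₁ Δ₂ Δ₃ : GCtx R} (Γ₁ Γ₃ : List (LTy R)) {Γ₂ Γ₄ : List (LTy R)} {A B C : LTy R}
    (π₁ : MS Δ₃ Γ₂ A) (π₃ : MS Δ₁ (Γ₁ ++ A :: Γ₃) B) (π₄ : MS Δ₂ Γ₄ C) :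
    𝓜.sm (.cut Γ₁ (Γ₃ ++ Γ₄) π₁ (MS.tr (.tenR π₃ π₄))) =
      𝓜.sm (MS.tr (MS.gswap Δ₁ Δ₃ Δ₂ [] (MS.tr (.tenR (.cut Γ₁ Γ₃ π₁ π₃) π₄)))) := by
  simp only [sm_tr, sm_gswap, sm_cut, sm_tenR]
  simp only [lc_cutM]
  -- The pair is a cut with `π₄` followed by one with `π₃`: the new cut commutes with the former and
  -- associates with the latter.
  rw [cutM_comm_of _ _ (ll Γ₃) (hE := by simp) (hN := by simp) (hG := by simp),
    cutM_of_cutM _ _ _ _ (ll Γ₃) (hD := by simp) (hG := by simp)]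
  simp
  simp [cutM, boxM]

theorem cut_tenR₂ {Δ₁ Δ₂ Δ₃ : GCtx R} (Γ₂ Γ₄ : List (LTy R)) {Γ₁ Γ₃ : List (LTy R)} {A B C : LTy R}
    (π₁ : MS Δ₃ Γ₃ A) (π₃ : MS Δ₁ Γ₁ B) (π₄ : MS Δ₂ (Γ₂ ++ A :: Γ₄) C) :
    𝓜.sm (.cut (Γ₁ ++ Γ₂) Γ₄ π₁ (MS.tr (.tenR π₃ π₄))) =
      𝓜.sm (MS.tr (.tenR π₃ (.cut Γ₂ Γ₄ π₁ π₄))) := by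
  simp only [sm_tr, sm_cut, sm_tenR]
  rw [cutM_of_cutM (gl Δ₂) _ _ _ _ (hD := by simp) (hG := by simp)]
  simp
  simp [cutM, boxM]

theorem cut_lleftL {Δ₁ Δ₂ : GCtx R} (Γ₁ Γ₃ Γ₄ : List (LTy R)) {Γ₂ P Q : List (LTy R)} {A B : LTy R}
    (κ : LStep P Q) (π₁ : MS Δ₂ Γ₂ A) (π₂ : MS Δ₁ (Γ₁ ++ A :: (Γ₃ ++ (P ++ Γ₄))) B) :
    𝓜.sm (.cut Γ₁ (Γ₃ ++ (Q ++ Γ₄)) π₁ (MS.tr (.lleft (Γ₁ ++ A :: Γ₃) Γ₄ κ (MS.tr π₂)))) =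
      𝓜.sm (MS.tr (.lleft (Γ₁ ++ (Γ₂ ++ Γ₃)) Γ₄ κ
        (MS.tr (.cut Γ₁ (Γ₃ ++ (P ++ Γ₄)) π₁ π₂)))) := by
  simp only [sm_tr, sm_cut, sm_lleft]
  simp only [lc_boxM]
  rw [cutM_of_boxG₃ _ _ _ _ (ll Γ₃) _ (hG := by simp) (hA := by simp)]
  simp
  simp [cutM, boxM]

theorem cut_lleftR {Δ₁ Δ₂ : GCtx R} (Γ₁ Γ₃ Γ₄ : List (LTy R)) {Γ₂ P Q : List (LTy R)} {A B : LTy R}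
    (κ : LStep P Q) (π₁ : MS Δ₂ Γ₂ A) (π₂ : MS Δ₁ (Γ₁ ++ (P ++ (Γ₃ ++ A :: Γ₄))) B) :
    𝓜.sm (.cut (Γ₁ ++ (Q ++ Γ₃)) Γ₄ π₁ (MS.tr (.lleft Γ₁ (Γ₃ ++ A :: Γ₄) κ π₂))) =
      𝓜.sm (MS.tr (.lleft Γ₁ (Γ₃ ++ (Γ₂ ++ Γ₄)) κ
        (MS.tr (.cut (Γ₁ ++ (P ++ Γ₃)) Γ₄ π₁ (MS.tr π₂))))) := by
  simp only [sm_tr, sm_cut, sm_lleft]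
  simp only [lc_boxM]
  rw [cutM_of_boxG₁ _ _ (ll Γ₁) (ll Γ₃) (hG := by simp) (hA := by simp) (hE := by simp)]
  simp
  simp [cutM, boxM]

theorem cut_exL {Δ₁ Δ₂ : GCtx R} (Γ₁ Γ₃ : List (LTy R)) {Γ₂ : List (LTy R)} {A B C : LTy R}
    (π₁ : MS Δ₂ Γ₂ A) (π₂ : MS Δ₁ (Γ₁ ++ ([A, B] ++ Γ₃)) C) :
    𝓜.sm (.cut (Γ₁ ++ [B]) Γ₃ π₁ (MS.tr (.lleft Γ₁ Γ₃ (.ex A B) π₂))) =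
      𝓜.sm (MS.tr (MS.lswap Γ₁ Γ₂ [B] Γ₃ (MS.tr (.cut Γ₁ (B :: Γ₃) π₁ (MS.tr π₂))))) := by
  simp only [sm_tr, sm_cut, sm_lleft, sm_lswap_right, lm_ex, boxM_lc_comp, boxM_comp_lc]
  simp only [lc_boxM]
  rw [cutM_exL_of (hG := by simp) (hA := rfl) (h₃ := rfl)]
  simp
  simp [cutM, boxM]

theorem cut_exR {Δ₁ Δ₂ : GCtx R} (Γ₁ Γ₃ : List (LTy R)) {Γ₂ : List (LTy R)} {A B C : LTy R}
    (π₁ : MS Δ₂ Γ₂ A) (π₂ : MS Δ₁ (Γ₁ ++ ([B, A] ++ Γ₃)) C) :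
    𝓜.sm (.cut Γ₁ (B :: Γ₃) π₁ (MS.tr (.lleft Γ₁ Γ₃ (.ex B A) π₂))) =
      𝓜.sm (MS.tr (MS.lswap Γ₁ [B] Γ₂ Γ₃ (MS.tr (.cut (Γ₁ ++ [B]) Γ₃ π₁ (MS.tr π₂))))) := by
  simp only [sm_tr, sm_cut, sm_lleft, sm_lswap_left, lm_ex, boxM_lc_comp, boxM_comp_lc]
  simp only [lc_boxM]
  rw [cutM_exR_of (hG := by simp) (hA := rfl)]
  simp
  simp [cutM, boxM]

theorem cut_gleft₂ {Δ₂ : GCtx R} (A D : GCtx R) {P Q : GCtx R} (Γ₁ Γ₃ : List (LTy R))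
    {Γ₂ : List (LTy R)} {B C : LTy R} (ρ : GStep P Q) (π₁ : MS Δ₂ Γ₂ B)
    (π₂ : MS (A ++ (P ++ D)) (Γ₁ ++ B :: Γ₃) C) : 𝓜.sm (.cut Γ₁ Γ₃ π₁ (.gleft A D ρ π₂)) =
      𝓜.sm (MS.tr (.gleft A (D ++ Δ₂) ρ (MS.tr (.cut Γ₁ Γ₃ π₁ π₂)))) := by
  simp only [sm_tr, sm_gleft, sm_cut]
  rw [cutM_of_boxD₁ (gl A) (gl D) (hD := by simp) (hE := by simp)]
  simp
  simp [cutM, boxM]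

theorem cut_impR {Δ₁ Δ₂ : GCtx R} (Γ₁ Γ₃ : List (LTy R)) {Γ₂ : List (LTy R)} {A B C : LTy R}
    (π₁ : MS Δ₂ Γ₂ A) (π₂ : MS Δ₁ ((Γ₁ ++ A :: Γ₃) ++ [B]) C) : 𝓜.ms (.cut Γ₁ Γ₃ π₁ (.impR π₂)) =
      𝓜.ms (.impR (MS.tr (.cut Γ₁ (Γ₃ ++ [B]) π₁ (MS.tr π₂)))) := by
  apply ms_imp_ext
  rw [boxM_sm_impR]
  simp only [sm_cut, sm_tr]
  rw [boxM_cutM, boxM_sm_impR]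
  simp

theorem cut_impL₁ {Δ₁ Δ₂ Δ₃ : GCtx R} (Γ₁ Γ₂ Γ₄ Γ₅ : List (LTy R)) {Γ₃ : List (LTy R)}
    {A B C D : LTy R} (π₁ : MS Δ₃ Γ₃ A) (π₃ : MS Δ₂ (Γ₂ ++ A :: Γ₄) B)
    (π₄ : MS Δ₁ (Γ₁ ++ C :: Γ₅) D) :
    𝓜.sm (.cut (Γ₁ ++ .imp B C :: Γ₂) (Γ₄ ++ Γ₅) π₁ (MS.tr (.impL Γ₁ Γ₅ π₃ π₄))) =
      𝓜.sm (MS.tr (.impL Γ₁ Γ₅ (.cut Γ₂ Γ₄ π₁ π₃) π₄)) := by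
  simp only [sm_tr, sm_impL, sm_cut]
  rw [cutM_of_cutM (gl Δ₂) _ (ll Γ₂) _ _ (hD := by simp) (hG := by simp),
    cutM_of_cutM ([] ++ gl Δ₂) (gl Δ₃) ([Sum.inr (LTy.imp B C)] ++ ll Γ₂) (ll Γ₃)
      (ll Γ₄ ++ []) (hD := by simp)
      (hG := by simp)]
  simp
  simp [cutM, boxM]

theorem cut_impL₂ {Δ₁ Δ₂ Δ₃ : GCtx R} (Γ₁ Γ₃ Γ₅ : List (LTy R)) {Γ₂ Γ₄ : List (LTy R)}
    {A B C D : LTy R} (π₁ : MS Δ₃ Γ₄ A) (π₃ : MS Δ₂ Γ₂ B)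
    (π₄ : MS Δ₁ (Γ₁ ++ C :: (Γ₃ ++ A :: Γ₅)) D) :
    𝓜.sm (.cut (Γ₁ ++ .imp B C :: (Γ₂ ++ Γ₃)) Γ₅ π₁ (MS.tr (.impL Γ₁ (Γ₃ ++ A :: Γ₅) π₃ π₄))) =
      𝓜.sm (MS.tr (MS.gswap Δ₁ Δ₃ Δ₂ [] (MS.tr (.impL (B := C) Γ₁ (Γ₃ ++ (Γ₄ ++ Γ₅)) π₃
          (MS.tr (.cut (Γ₁ ++ C :: Γ₃) Γ₅ π₁ (MS.tr π₄))))))) := by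
  simp only [sm_tr, sm_gswap, sm_cut, sm_impL]
  simp only [lc_cutM]
  -- The commutation is applied to the right-hand side; the symmetry it creates is the inverse of
  -- the one interpreting the exchange of `Δ₃` and `Δ₂`.
  rw [cutM_comm_of (gl Δ₁) (gl Δ₃) (ll Γ₃) (ll Γ₄) (ll Γ₅) (N := ll (Γ₁ ++ C :: Γ₃)) (hE := by simp) (hN := by simp) (hG := by simp)]
  simp only [lc_boxM, boxM_lc]
  rw [boxM_br_br (hA := by simp) (hD := by simp)]
  simp
  simp [cutM, boxM]

theorem cut_impL₃ {Δ₁ Δ₂ Δ₃ : GCtx R} (Γ₁ Γ₃ Γ₅ : List (LTy R)) {Γ₂ Γ₄ : List (LTy R)}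
    {A B C D : LTy R} (π₁ : MS Δ₃ Γ₂ A) (π₃ : MS Δ₂ Γ₄ B)
    (π₄ : MS Δ₁ (Γ₁ ++ A :: (Γ₃ ++ C :: Γ₅)) D) :
    𝓜.sm (.cut Γ₁ (Γ₃ ++ .imp B C :: (Γ₄ ++ Γ₅)) π₁
        (MS.tr (.impL (B := C) (Γ₁ ++ A :: Γ₃) Γ₅ π₃ (MS.tr π₄)))) =
      𝓜.sm (MS.tr (MS.gswap Δ₁ Δ₃ Δ₂ [] (MS.tr (.impL (B := C) (Γ₁ ++ (Γ₂ ++ Γ₃)) Γ₅ π₃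
          (MS.tr (.cut Γ₁ (Γ₃ ++ C :: Γ₅) π₁ π₄)))))) := by
  simp only [sm_tr, sm_gswap, sm_cut, sm_impL]
  simp only [lc_cutM]
  rw [cutM_comm_of _ _ (ll Γ₃) (hE := by simp) (hN := by simp) (hG := by simp)]
  simp
  simp [cutM, boxM]

theorem cut_linL₂ {Δ₁ Δ₂ : GCtx R} (Γ₁ Γ₃ : List (LTy R)) {Γ₂ : List (LTy R)} {A B C : LTy R}
    (π₁ : MS Δ₂ Γ₂ B) (π₂ : MS Δ₁ (A :: (Γ₁ ++ B :: Γ₃)) C) :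
    𝓜.sm (.cut Γ₁ Γ₃ π₁ (.linL π₂)) =
      𝓜.sm (MS.tr (MS.gswap Δ₁ Δ₂ [(1, .Lin A)] []
        (MS.tr (.linL (A := A) (Γ := Γ₁ ++ (Γ₂ ++ Γ₃)) (.cut (A :: Γ₁) Γ₃ π₁ π₂))))) := by
  simp only [sm_tr, sm_cut, sm_linL, sm_gswap_right]
  rw [cutM_boxM_right (hN := by simp) (hE := by simp)]
  simp
  simp [cutM, boxM]

theorem cut_grdL₂ {Δ₁ Δ₂ : GCtx R} (Γ₁ Γ₃ : List (LTy R)) {Γ₂ : List (LTy R)} {X : GTy R} {r : R}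
    {B C : LTy R} (π₁ : MS Δ₂ Γ₂ B) (π₂ : MS (Δ₁ ++ [(r, X)]) (Γ₁ ++ B :: Γ₃) C) :
    𝓜.sm (.cut (.Grd r X :: Γ₁) Γ₃ π₁ (.grdL π₂)) =
      𝓜.sm (.grdL (MS.tr (MS.gswap Δ₁ [(r, X)] Δ₂ [] (MS.tr (.cut Γ₁ Γ₃ π₁ π₂))))) := by
  simp only [sm_tr, sm_cut, sm_grdL, sm_gswap_left]
  rw [cutM_of_boxM_left (ll Γ₁) (hN := by simp) (hE := by simp)]
  simp
  simp [cutM, boxM]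

theorem boxM_nil_lc {α : Type*} {f : α → C} {A D P Q L L' : List α} {Z : C} (h : L = A ++ (P ++ D))
    (g : tens f P ⟶ tens f Q) (k : A ++ (Q ++ D) = L') (y : tens f L' ⟶ Z) (hA : A = [] := by simp)
    (hD : D = [] := by simp) :
    boxM A D h g k y = lc f (by simp [h, hA, hD]) ≫ g ≫ lc f (by simp [← k, hA, hD]) ≫ y := by
  subst hA hD k
  simp [boxM]

theorem sm_id_lc (A : LTy R) :
    𝓜.sm (.id A) = lc 𝓜.hyp (by simp : gl [] ++ ll [A] = [.inr A]) := 𝓜.sm_id A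

theorem sm_unit_unit :
    𝓜.sm .unitR ≫ lc 𝓜.hyp (by simp) ≫ 𝓜.lm (𝓜.lstep .unitL) = lc 𝓜.hyp (by simp) :=
  (congrArg (_ ≫ ·) (Category.id_comp _)).trans 𝓜.sm_unitR_unitL

theorem unit_sm_unit :
    𝓜.lm (𝓜.lstep .unitL) ≫ lc 𝓜.hyp (by simp) ≫ 𝓜.sm .unitR = lc 𝓜.hyp (by simp) :=
  (congrArg (_ ≫ ·) (Category.id_comp _)).trans 𝓜.unitL_sm_unitR

theorem pair_tenL (A B : LTy R) : 𝓜.pairT A B ≫ lc 𝓜.hyp (by simp) ≫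
    𝓜.lm (𝓜.lstep (.tenL A B)) = lc 𝓜.hyp (by simp) :=
  (congrArg (_ ≫ ·) (Category.id_comp _)).trans (𝓜.pairT_tenL A B)

theorem tenL_pair (A B : LTy R) : 𝓜.lm (𝓜.lstep (.tenL A B)) ≫ lc 𝓜.hyp (by simp) ≫
    𝓜.pairT A B = lc 𝓜.hyp (by simp) :=
  (congrArg (_ ≫ ·) (Category.id_comp _)).trans (𝓜.tenL_pairT A B)

theorem sm_grdR_lc (r : R) {Δ : GCtx R} {X : GTy R} (Θ : GS Δ X) :
    𝓜.sm (.grdR r Θ) = lc 𝓜.hyp (by simp) ≫ 𝓜.gm (𝓜.mstep (.cut r Θ)) ≫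
      lc 𝓜.hyp (by simp) ≫ 𝓜.grdMinv r X :=
  (𝓜.sm_grdR r Θ).trans (congrArg (fun t => _ ≫ _ ≫ t) (Category.id_comp _).symm)

theorem cut_linR_linM {Δ : GCtx R} {A : LTy R} (π : MS Δ [] A) :
    𝓜.gm (𝓜.mstep (.cut 1 (.linR π))) ≫ lc 𝓜.hyp (by simp) ≫ 𝓜.linM A =
      lc 𝓜.hyp (by simp [scale]) ≫ 𝓜.sm π :=
  (congrArg (_ ≫ ·) (Category.id_comp _)).trans (𝓜.mstep_cut_linR π)

theorem eta_ten (A B : LTy R) : 𝓜.sm (.id (.ten A B)) =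
    𝓜.sm (MS.tr (.lleft [] [] (.tenL A B) (MS.tr (.tenR (.id A) (.id B))))) := by
  have h := 𝓜.tenL_pair A B
  simp only [sm_tr, sm_lleft, sm_tenR, sm_id_lc]
  simp only [gl_nil, cutM_nil, boxM_eq_lc]
  rw [boxM_nil_lc]
  simp only [lc_lc_assoc]
  rw [h]
  simp

theorem eta_unit : 𝓜.sm (.id .I) = 𝓜.sm (MS.tr (.lleft [] [] .unitL (MS.tr .unitR))) := by
  have h := 𝓜.unit_sm_unit
  simp only [sm_tr, sm_lleft, sm_id_lc]
  simp only [gl_nil]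
  rw [boxM_nil_lc]
  simp only [lc_lc_assoc]
  rw [h]
  simp

theorem gcut_lin {Δ₁ Δ₂ : GCtx R} {Γ : List (LTy R)} {A B : LTy R} (π₁ : MS Δ₂ [] A)
    (π₂ : MS Δ₁ (A :: Γ) B) :
    𝓜.sm (.gleft Δ₁ [] (.cut 1 (.linR π₁)) (MS.tr (.linL π₂))) =
      𝓜.sm (MS.tr (.cut [] Γ π₁ (MS.tr π₂)) (by simp [scale])) := by
  simp only [sm_tr, sm_gleft, sm_linL, sm_cut]
  simp only [lc_boxM, ll_nil]
  rw [boxM_boxM_of (e := by simp) (hA := rfl) (hD := by simp), cut_linR_linM, boxM_lc_comp,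
    cutM_nil_mid]
  simp

theorem cut_id_left {Δ : GCtx R} (Γ₁ Γ₃ : List (LTy R)) {A B : LTy R}
    (π : MS Δ (Γ₁ ++ A :: Γ₃) B) : 𝓜.sm (.cut Γ₁ Γ₃ (.id A) π) = 𝓜.sm π.tr := by
  simp only [sm_tr, sm_cut, sm_id_lc, gl_nil]
  rw [cutM_nil, boxM_eq_lc]

theorem cut_id_right {Δ : GCtx R} {Γ : List (LTy R)} {A : LTy R} (π : MS Δ Γ A) :
    𝓜.sm (.cut [] [] π (.id A)) = 𝓜.sm π.tr := by
  simp only [sm_tr, sm_cut, sm_id_lc, gl_nil, ll_nil]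
  rw [cutM_id]

theorem cut_ten_ten {Δ₁ Δ₂ Δ₃ : GCtx R} (Γ₁ Γ₄ : List (LTy R)) {Γ₂ Γ₃ : List (LTy R)} {A B C : LTy R}
    (π₁ : MS Δ₂ Γ₂ A) (π₂ : MS Δ₃ Γ₃ B) (π₃ : MS Δ₁ (Γ₁ ++ ([A, B] ++ Γ₄)) C) :
    𝓜.sm (.cut Γ₁ Γ₄ (.tenR π₁ π₂) (MS.tr (.lleft Γ₁ Γ₄ (.tenL A B) π₃))) =
      𝓜.sm (MS.tr (.cut (Γ₁ ++ Γ₂) Γ₄ π₂ (MS.tr (.cut Γ₁ (B :: Γ₄) π₁ (MS.tr π₃))))) := by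
  simp only [sm_tr, sm_cut, sm_tenR, sm_lleft]
  simp only [lc_boxM]
  -- Both cuts hidden in the right rule of the tensor are taken out by associativity, which leaves
  -- the pairing next to the left rule, its inverse.
  rw [cutM_of_cutM (gl Δ₂) (gl Δ₃) (ll Γ₂) (ll Γ₃) [] (hD := by simp) (hG := by simp),
    cutM_of_cutM [] (gl Δ₂) [] (ll Γ₂) [.inr B] (hD := by simp) (hG := by simp), cutM_nil,
    boxM_boxM_of (e := by simp) (hA := by simp) (hD := by simp), pair_tenL, boxM_eq_lc]
  simp
  simp [cutM, boxM]

theorem cut_unit_unit {Δ : GCtx R} (Γ₁ Γ₃ : List (LTy R)) {B : LTy R}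
    (π : MS Δ (Γ₁ ++ ([] ++ Γ₃)) B) :
    𝓜.sm (.cut Γ₁ Γ₃ .unitR (MS.tr (.lleft Γ₁ Γ₃ .unitL π))) = 𝓜.sm π.tr := by
  simp only [sm_tr, sm_cut, sm_lleft, gl_nil]
  simp only [lc_boxM]
  rw [cutM_nil, boxM_boxM_of (e := by simp) (hA := by simp) (hD := by simp), sm_unit_unit,
    boxM_eq_lc]

theorem cut_grd_grd {Δ₁ Δ₂ : GCtx R} {Γ : List (LTy R)} {X : GTy R} {B : LTy R} (r : R) (Θ : GS Δ₂ X)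
    (π : MS (Δ₁ ++ [(r, X)]) Γ B) : 𝓜.sm (.cut [] Γ (.grdR r Θ) (MS.tr (.grdL π))) =
      𝓜.sm (MS.tr (.gleft Δ₁ [] (.cut r Θ) (MS.tr π)) (by simp only [List.append_nil])) := by
  simp only [sm_tr, sm_cut, sm_gleft, sm_grdL, sm_grdR_lc, ll_nil]
  simp only [lc_boxM]
  rw [cutM_nil_mid, boxM_boxM_of (e := rfl) (hA := rfl) (hD := rfl)]
  simp only [lc_self, Category.id_comp, Category.assoc, grdMinv_grdM, Category.comp_id]
  rw [boxM_lc_comp, boxM_comp_lc]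
  simp

theorem cut_imp_imp {Δ₁ Δ₂ Δ₃ : GCtx R} (Γ₁ Γ₄ : List (LTy R)) {Γ₂ Γ₃ : List (LTy R)} {A B C : LTy R}
    (π₃ : MS Δ₃ (Γ₂ ++ [A]) B) (π₂ : MS Δ₂ Γ₃ A) (π₁ : MS Δ₁ (Γ₁ ++ B :: Γ₄) C) :
    𝓜.sm (.cut Γ₁ (Γ₃ ++ Γ₄) (.impR π₃) (.impL Γ₁ Γ₄ π₂ π₁)) =
      𝓜.sm (MS.tr (MS.gswap Δ₁ Δ₃ Δ₂ [] (MS.tr (.cut Γ₁ Γ₄ (.cut Γ₂ [] π₂ π₃) π₁)))) := by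
  -- The body of the abstraction is recovered from the abstraction by evaluation. After this
  -- substitution both sides are iterated cuts around `evM`, and only associativity and commutation
  -- are needed.
  have e : 𝓜.sm π₃ = lc 𝓜.hyp (by simp) ≫ cutM [] (gl Δ₃) [] (ll Γ₂) [.inr A] (L := gl Δ₃ ++ (ll Γ₂ ++ [.inr A])) (by simp) rfl
      (𝓜.sm (.impR π₃)) rfl (𝓜.evM A B) := by
    rw [cutM_nil_nil, boxM_sm_impR, lc_lc_assoc, lc_self, Category.id_comp]
  simp only [sm_tr, sm_cut, sm_impL, sm_gswap, e]
  simp only [cutM_lc, ll_nil]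
  rw [cutM_of_cutM [] (gl Δ₂) [.inr (.imp A B)] (ll Γ₃) [] (hD := by simp) (hG := by simp),
    cutM_of_cutM (gl Δ₃) (gl Δ₂) (ll Γ₂) (ll Γ₃) [] (hD := by simp) (hG := by simp),
    cutM_of_cutM [] (gl Δ₃) [] (ll Γ₂) [.inr A] (hD := by simp) (hG := by simp)]
  rw [cutM_comm_of (gl Δ₁ ++ []) (gl Δ₂) [] (ll Γ₃) ([] ++ ll Γ₄) (hE := by simp) (hN := by simp) (hG := by simp)]
  simp
  simp [cutM, boxM]

theorem mstep_cut_id (r : R) (X : GTy R) : 𝓜.mstep (.cut r (.id X)) =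
    lc 𝓜.mhyp (by simp [scale] : scale r [(1, X)] = [(r, X)]) := by
  refine 𝓜.lift_unique (lift_gstep _) ?_
  rw [cut_id]
  exact lift_lc _

theorem eta_grd (r : R) (X : GTy R) : 𝓜.sm (.id (.Grd r X)) =
    𝓜.sm (.grdL (MS.tr (Δ' := [] ++ [(r, X)]) (.grdR r (.id X)) (by simp [scale]))) := by
  simp only [sm_tr, sm_grdL, sm_grdR_lc, sm_id_lc, mstep_cut_id, gm_lc, lc_lc_assoc, boxM_lc]
  rw [boxM_nil_lc]
  simp only [lc_lc_assoc, lc_self, Category.id_comp]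
  rw [grdM_inv, Category.comp_id]

theorem mstep_cut_sub (r : R) {Δ Δ' : GCtx R} {X : GTy R} (h : GLe Δ Δ') (Θ : GS Δ X) :
    𝓜.mstep (.cut r (.sub h Θ)) = 𝓜.mle (GLe.scale le_rfl h) ≫ 𝓜.mstep (.cut r Θ) := by
  refine 𝓜.lift_unique (lift_gstep _) ?_
  have e := 𝓜.scale_cut (le_refl r) h Θ
  rw [gle_self, Category.comp_id] at e
  rw [← e]
  exact lift_comp (lift_gle _) (lift_gstep _)

theorem sub_grdR (r : R) {Δ Δ' : GCtx R} {X : GTy R} (h : GLe Δ Δ') (Θ : GS Δ X) :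
    𝓜.sm (.grdR r (.sub h Θ)) = 𝓜.sm (.sub (.scale le_rfl h) (.grdR r Θ)) := by
  simp only [sm_sub, sm_grdR_lc, mstep_cut_sub, gm_comp]
  rw [boxM_nil_lc]
  simp

/-- The scaled multicut is found in C by `prom_mcut` and carried to M by uniqueness of lifts. This
is what makes multicuts commute with the right rule of Grd. -/
theorem mstep_cut_mcut (r : R) (A D : GCtx R) (ds : List R) {Δ : GCtx R} {X Y : GTy R} (Θ : GS Δ X)
    (Θ' : GS (A ++ (rep ds X ++ D)) Y) : 𝓜.mstep (.cut r (GS.mcut A D ds Θ Θ')) =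
      (lc 𝓜.mhyp (by simp [scale_append]) ≫
        inside 𝓜.mhyp (lc 𝓜.mhyp (by simp [scale, sum_map_mul, mul_assoc, Function.comp_def] :
          scale r (scale ds.sum Δ) = scale (ds.map (r * ·)).sum Δ) ≫
          mcutMor 𝓜.mstep (ds.map (r * ·)) Θ ≫ lc 𝓜.mhyp (scale_rep r ds X).symm)
          (scale r A) (scale r D) ≫ lc 𝓜.mhyp (by simp [scale_append])) ≫ 𝓜.mstep (.cut r Θ') := by
  refine 𝓜.lift_unique (lift_gstep _) ?_
  rw [𝓜.cut_of_prom Θ' _ (𝓜.prom_inside (𝓜.prom_mcut r ds Θ) A D) (𝓜.gs_mcut A D ds Θ Θ')]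
  exact lift_comp (lift_comp (lift_lc _) (lift_comp (lift_inside (lift_comp (lift_lc _)
    (lift_comp (𝓜.lift_mcut _ Θ) (lift_lc _))) _ _) (lift_lc _))) (lift_gstep _)

theorem gm_inside {P Q : GCtx R} (g : 𝓜.mctx P ⟶ 𝓜.mctx Q) (A D : GCtx R) :
    𝓜.gm (inside 𝓜.mhyp g A D) = boxM (gl A) (gl D) (by simp) (𝓜.gm g) rfl
      (lc 𝓜.hyp (by simp)) := by
  rw [inside_eq, gm_ten, gm_ten, gm_id, gm_id]
  simp [boxM]

theorem mcut_grdR (A D : GCtx R) (ds : List R) {Δ : GCtx R} {X Y : GTy R} (Θ : GS Δ X) (r : R)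
    (Θ' : GS (A ++ (rep ds X ++ D)) Y)
    (e : scale r (A ++ (rep ds X ++ D)) = scale r A ++ (rep (ds.map (r * ·)) X ++ scale r D))
    (e' : scale r (A ++ (scale ds.sum Δ ++ D)) =
      scale r A ++ (scale (ds.map (r * ·)).sum Δ ++ scale r D)) :
    𝓜.sm (MS.mcut (scale r A) (scale r D) (ds.map (r * ·)) Θ (MS.tr (.grdR r Θ') e)) =
      𝓜.sm (MS.tr (.grdR r (GS.mcut A D ds Θ Θ')) e') := by
  simp only [sm_tr, sm_mcut, sm_grdR_lc, mstep_cut_mcut, gm_comp, gm_inside, gm_lc]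
  rw [boxM_lc_comp, boxM_comp_lc]
  simp

-- The shared equations in both calculi, the graded calculus, and the induction

theorem gs_ax {Δ : GCtx R} {X : GTy R} {π π' : GS Δ X}
    (e : Ax (F := fun Δ => GS Δ X) (GS.step X) GS.sub π π') : 𝓜.gs π = 𝓜.gs π' :=
  𝓜.ax_sound (Psh.hom (𝓜.gty X)) (F := fun Δ => GS Δ X) 𝓜.gs
    (fun A D _ _ ρ π => 𝓜.gs_gleft A D ρ π) (fun h π => 𝓜.gs_sub h π) e

/-- Morphisms out of `Mny X ⊗ Γ`. -/
def mnyPsh (Γ : List (LTy R)) (B : LTy R) : Psh.{v, w, w} C where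
  obj X := 𝓜.Mny.obj X ⊗ 𝓜.lctx Γ ⟶ 𝓜.lty B
  res f g := 𝓜.Mny.map f ▷ _ ≫ g
  res_id := by simp
  res_comp := by simp

theorem lift_inv {P Q : GCtx R} {g : 𝓜.gctx Q ⟶ 𝓜.gctx P} {g' : 𝓜.mctx Q ⟶ 𝓜.mctx P}
    (h : 𝓜.Lift g g') : inv (𝓜.mMny Q) ≫ g' = 𝓜.Mny.map g ≫ inv (𝓜.mMny P) := by
  unfold Lift at h
  rw [IsIso.inv_comp_eq, ← Category.assoc, h, Category.assoc, IsIso.hom_inv_id, Category.comp_id]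

/-- Precomposing with the inverse of `mMny` makes the graded context of a mixed derivation the image
of an object of C. Steps and approximations then act through C by `lift_inv`, so `ax_sound` applies,
and the invertible factor is cancelled at the end. -/
theorem ms_ax {Δ : GCtx R} {Γ : List (LTy R)} {B : LTy R} {π π' : MS Δ Γ B}
    (e : Ax (F := fun Δ => MS Δ Γ B) (MS.step Γ B) MS.sub π π') : 𝓜.ms π = 𝓜.ms π' := by
  have h := 𝓜.ax_sound (𝓜.mnyPsh Γ B) (F := fun Δ => MS Δ Γ B)
    (fun {L} π => inv (𝓜.mMny L) ▷ _ ≫ 𝓜.ms π)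
    (fun A D P Q ρ π => ?_) (fun h π => ?_) e
  · exact (cancel_epi (inv (𝓜.mMny Δ) ▷ 𝓜.lctx Γ)).mp h
  · refine (congrArg (_ ≫ ·) (𝓜.ms_gleft A D ρ π)).trans ?_
    refine (comp_whiskerRight_assoc _ _ _ _).symm.trans ?_
    rw [𝓜.lift_inv (lift_inside (lift_gstep ρ) A D)]
    exact comp_whiskerRight_assoc _ _ _ _
  · have k : 𝓜.ms (.sub h π) = 𝓜.mle h ▷ 𝓜.lctx Γ ≫ 𝓜.ms π := by rw [MGLModel.ms]
    refine (congrArg (_ ≫ ·) k).trans ?_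
    refine (comp_whiskerRight_assoc _ _ _ _).symm.trans ?_
    rw [𝓜.lift_inv (lift_gle h)]
    exact comp_whiskerRight_assoc _ _ _ _

theorem inside_nil_nil {α : Type*} {f : α → C} {P Q : List α} (g : tens f P ⟶ tens f Q) :
    inside f g [] [] = lc f (by simp) ≫ g ≫ lc f (by simp) := by
  rw [inside_eq]
  simp

/-- The interpretation of the right rule of `⊠`. -/
def pairG {Δ₁ Δ₂ : GCtx R} {X Y : GTy R} (x : 𝓜.gctx Δ₁ ⟶ 𝓜.gty X) (y : 𝓜.gctx Δ₂ ⟶ 𝓜.gty Y) :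
    𝓜.gctx (Δ₁ ++ Δ₂) ⟶ 𝓜.gty (.ten X Y) := (split 𝓜.ghyp Δ₁ Δ₂).hom ≫ (x ⊗ₘ y)

theorem gs_tenR {Δ₁ Δ₂ : GCtx R} {X Y : GTy R} (π₁ : GS Δ₁ X) (π₂ : GS Δ₂ Y) :
    𝓜.gs (.tenR π₁ π₂) = 𝓜.pairG (𝓜.gs π₁) (𝓜.gs π₂) := by
  rw [MGLModel.gs]; rfl

theorem ten_pairG {Δ₁ Δ₂ Δ₁' Δ₂' : GCtx R} {X Y : GTy R} (g : 𝓜.gctx Δ₁' ⟶ 𝓜.gctx Δ₁)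
    (h : 𝓜.gctx Δ₂' ⟶ 𝓜.gctx Δ₂) (x : 𝓜.gctx Δ₁ ⟶ 𝓜.gty X) (y : 𝓜.gctx Δ₂ ⟶ 𝓜.gty Y) :
    ten 𝓜.ghyp g h ≫ 𝓜.pairG x y = 𝓜.pairG (g ≫ x) (h ≫ y) := by
  have k : ten 𝓜.ghyp g h ≫ (split 𝓜.ghyp Δ₁ Δ₂).hom ≫ (x ⊗ₘ y) =
      (split 𝓜.ghyp Δ₁' Δ₂').hom ≫ ((g ≫ x) ⊗ₘ (h ≫ y)) := by
    simp [ten]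
  exact k

theorem gs_linR {Δ : GCtx R} {A : LTy R} (π : MS Δ [] A) :
    𝓜.gs (.linR π) = 𝓜.mLin Δ ≫ 𝓜.Lin.map ((ρ_ _).inv ≫ 𝓜.ms π) := by
  rw [MGLModel.gs]; rfl

theorem gs_id (X : GTy R) : 𝓜.gs (.id X) = (ρ_ _).hom ≫ 𝓜.one (𝓜.gty X) := by
  rw [MGLModel.gs]; rfl

/-- After composition with the invertible `Lin.map (mMny P)` both sides become units of the
adjunction by `mLin_mMny`, and the claim is naturality of the unit. -/
theorem lift_mLin {P Q : GCtx R} {g : 𝓜.gctx Q ⟶ 𝓜.gctx P} {g' : 𝓜.mctx Q ⟶ 𝓜.mctx P}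
    (h : 𝓜.Lift g g') : g ≫ 𝓜.mLin P = 𝓜.mLin Q ≫ 𝓜.Lin.map g' := by
  rw [← cancel_mono (𝓜.Lin.map (𝓜.mMny P)), Category.assoc, mLin_mMny, Category.assoc,
    ← Functor.map_comp, ← (show _ = _ from h), Functor.map_comp, ← Category.assoc, mLin_mMny]
  exact 𝓜.adj.unit.naturality g

theorem gs_sub_tenR {Δ₁ Δ₁' Δ₂ Δ₂' : GCtx R} {X Y : GTy R} (h₁ : GLe Δ₁ Δ₁') (h₂ : GLe Δ₂ Δ₂')
    (π₁ : GS Δ₁ X) (π₂ : GS Δ₂ Y) :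
    𝓜.gs (.tenR (.sub h₁ π₁) (.sub h₂ π₂)) = 𝓜.gs (.sub (h₁.append h₂) (.tenR π₁ π₂)) := by
  rw [gs_sub, gle_append, gs_tenR, gs_tenR, gs_sub, gs_sub, ten_pairG]

/-- Any operation on mixed contexts that lifts a graded one commutes with the right rule of Lin, by
`lift_mLin`. Approximation and multicut are both instances. -/
theorem gs_linR_of_lift {P Q : GCtx R} {A : LTy R} {g : 𝓜.gctx Q ⟶ 𝓜.gctx P}
    {g' : 𝓜.mctx Q ⟶ 𝓜.mctx P} (h : 𝓜.Lift g g') (π : MS P [] A) (π' : MS Q [] A)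
    (e : 𝓜.ms π' = g' ▷ 𝓜.lctx [] ≫ 𝓜.ms π) : 𝓜.gs (.linR π') = g ≫ 𝓜.gs (.linR π) := by
  have k : (ρ_ (𝓜.mctx Q)).inv ≫ g' ▷ 𝟙_ M ≫ 𝓜.ms π = g' ≫ (ρ_ _).inv ≫ 𝓜.ms π :=
    (rightUnitor_inv_naturality_assoc g' _).symm
  rw [gs_linR, gs_linR, e]
  refine (congrArg (fun t => _ ≫ 𝓜.Lin.map t) k).trans ?_
  rw [Functor.map_comp, ← reassoc_of% 𝓜.lift_mLin h]
  rfl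

theorem gs_sub_linR {Δ Δ' : GCtx R} {A : LTy R} (h : GLe Δ Δ') (π : MS Δ [] A) :
    𝓜.gs (.linR (.sub h π)) = 𝓜.gs (.sub h (.linR π)) := by
  rw [gs_sub]
  exact 𝓜.gs_linR_of_lift (lift_gle h) _ _ (by rw [MGLModel.ms])

theorem gs_mcut_linR (A D : GCtx R) (ds : List R) {Δ : GCtx R} {X : GTy R} {B : LTy R} (Θ : GS Δ X)
    (π : MS (A ++ (rep ds X ++ D)) [] B) :
    𝓜.gs (GS.mcut A D ds Θ (.linR π)) = 𝓜.gs (.linR (MS.mcut A D ds Θ π)) := by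
  rw [gs_mcut]
  exact (𝓜.gs_linR_of_lift (lift_inside (𝓜.lift_mcut ds Θ) A D) _ _
    (sem_mcut 𝓜.mstep (𝓜.mPsh [] B) (F := fun Δ => MS Δ [] B) 𝓜.ms (step := MS.step [] B)
      (fun A D _ _ ρ π => 𝓜.ms_gleft A D ρ π) A D ds Θ π)).symm

theorem gs_mcut_tenR₁ (A D : GCtx R) (ds : List R) {Δ Δ₂ : GCtx R} {X Y Z : GTy R} (Θ : GS Δ X)
    (π₁ : GS (A ++ (rep ds X ++ D)) Y) (π₂ : GS Δ₂ Z) :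
    𝓜.gs (GS.mcut A (D ++ Δ₂) ds Θ (GS.tr (.tenR π₁ π₂) (by simp only [List.append_assoc]))) =
      𝓜.gs (GS.tr (.tenR (GS.mcut A D ds Θ π₁) π₂) (by simp only [List.append_assoc])) := by
  rw [gs_mcut, gs_tr, gs_tr, gs_tenR, gs_tenR, gs_mcut, inside_eq, inside_eq]
  have h := 𝓜.ten_pairG (inside 𝓜.ghyp (mcutMor 𝓜.gstep ds Θ) A D) (𝟙 (𝓜.gctx Δ₂)) (𝓜.gs π₁) (𝓜.gs π₂)
  rw [Category.id_comp, inside_eq] at h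
  rw [← h]
  simp

theorem gs_mcut_tenR₂ (A D : GCtx R) (ds : List R) {Δ Δ₁ : GCtx R} {X Y Z : GTy R} (Θ : GS Δ X)
    (π₁ : GS Δ₁ Y) (π₂ : GS (A ++ (rep ds X ++ D)) Z) :
    𝓜.gs (GS.mcut (Δ₁ ++ A) D ds Θ (GS.tr (.tenR π₁ π₂) (by simp only [List.append_assoc]))) =
      𝓜.gs (GS.tr (.tenR π₁ (GS.mcut A D ds Θ π₂)) (by simp only [List.append_assoc])) := by
  rw [gs_mcut, gs_tr, gs_tr, gs_tenR, gs_tenR, gs_mcut, inside_eq, inside_eq]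
  have h := 𝓜.ten_pairG (𝟙 (𝓜.gctx Δ₁)) (inside 𝓜.ghyp (mcutMor 𝓜.gstep ds Θ) A D) (𝓜.gs π₁) (𝓜.gs π₂)
  rw [Category.id_comp, inside_eq] at h
  rw [← h]
  simp

theorem one_ten (X Y : C) : 𝓜.one (X ⊗ Y) = 𝓜.nTen 1 X Y ≫ (𝓜.one X ⊗ₘ 𝓜.one Y) := by
  rw [one_eq, one_eq, one_eq, nTen, eqToHom_tensorHom, eqToHom_trans]

theorem one_unit : 𝓜.one (𝟙_ C) = 𝓜.nUnit 1 := by rw [one_eq, nUnit]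

theorem gs_eta_ten (X Y : GTy R) : 𝓜.gs (.id (.ten X Y)) =
    𝓜.gs (.gleft [] [] (.tenL 1 X Y) (.tenR (Δ₁ := [(1, X)]) (.id X) (.id Y))) := by
  have k {A X Y X' Y' : C} (n : A ⟶ X ⊗ Y) (a : X ⟶ X') (b : Y ⟶ Y') :
      (ρ_ A).hom ≫ n ≫ (a ⊗ₘ b) =
      ((A ◁ (λ_ (𝟙_ C)).inv ≫ (α_ A (𝟙_ C) (𝟙_ C)).inv) ≫ (n ▷ 𝟙_ C ≫ (α_ X Y (𝟙_ C)).hom) ▷ 𝟙_ C ≫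
        ((α_ X (Y ⊗ 𝟙_ C) (𝟙_ C)).hom ≫ X ◁ ((α_ Y (𝟙_ C) (𝟙_ C)).hom ≫ Y ◁ (λ_ (𝟙_ C)).hom))) ≫
        (X ◁ (λ_ (Y ⊗ 𝟙_ C)).inv ≫ (α_ X (𝟙_ C) (Y ⊗ 𝟙_ C)).inv) ≫
        (((ρ_ X).hom ≫ a) ⊗ₘ ((ρ_ Y).hom ≫ b)) := by
    have : (n ▷ 𝟙_ C ≫ (α_ X Y (𝟙_ C)).hom) ▷ 𝟙_ C = (ρ_ _).hom ≫ (ρ_ _).hom ≫ n ≫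
      X ◁ (ρ_ Y).inv ≫ (ρ_ _).inv := by monoidal
    rw [this]
    simp only [MonoidalCategory.tensorHom_def]
    monoidal
  rw [gs_gleft, gs_tenR, gs_id, gs_id, gs_id]
  refine (congrArg (_ ≫ ·) (𝓜.one_ten _ _)).trans ((k (𝓜.nTen 1 (𝓜.gty X) (𝓜.gty Y)) _ _).trans ?_)
  rw [MGLModel.gstep]
  rfl

theorem gs_eta_unit : 𝓜.gs (.id .J) = 𝓜.gs (.gleft [] [] (.unitL 1) .unitR) := by
  have k {A : C} (n : A ⟶ 𝟙_ C) : (ρ_ A).hom ≫ n =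
      ((A ◁ (λ_ (𝟙_ C)).inv ≫ (α_ A (𝟙_ C) (𝟙_ C)).inv) ≫ ((ρ_ A).hom ≫ n) ▷ 𝟙_ C ≫
        (λ_ (𝟙_ C)).hom) ≫ 𝟙 (𝟙_ C) := by
    monoidal
  rw [gs_gleft, gs_id]
  refine (congrArg (_ ≫ ·) 𝓜.one_unit).trans ((k (𝓜.nUnit 1)).trans ?_)
  rw [MGLModel.gs, MGLModel.gstep]
  rfl

theorem mLin_singleton (p : R × GTy R) : 𝓜.mLin [p] =
    (ρ_ (𝓜.ghyp p)).hom ≫ 𝓜.adj.unit.app (𝓜.ghyp p) ≫ 𝓜.Lin.map (ρ_ (𝓜.mhyp p)).inv := by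
  have k : (𝓜.adj.unit.app (𝓜.ghyp p) ⊗ₘ ε 𝓜.Lin) ≫ μ 𝓜.Lin (𝓜.Mny.obj (𝓜.ghyp p)) _ =
      (ρ_ (𝓜.ghyp p)).hom ≫ 𝓜.adj.unit.app (𝓜.ghyp p) ≫
        𝓜.Lin.map (ρ_ (𝓜.Mny.obj (𝓜.ghyp p))).inv := by
    rw [MonoidalCategory.tensorHom_def, Category.assoc, ← Functor.LaxMonoidal.right_unitality_inv]
    have l {X Y Z : C} (u : X ⟶ Y) (t : Y ⊗ 𝟙_ C ⟶ Z) :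
        u ▷ 𝟙_ C ≫ t = (ρ_ X).hom ≫ u ≫ (ρ_ Y).inv ≫ t := by simp
    exact l (𝓜.adj.unit.app (𝓜.ghyp p)) _
  exact k

theorem gs_eta_lin (A : LTy R) :
    𝓜.gs (.id (.Lin A)) = 𝓜.gs (.linR (Δ := [(1, .Lin A)]) (.linL (Δ := []) (.id A))) := by
  have k {P Z : M} (x : P ⟶ Z) : (ρ_ (P ⊗ 𝟙_ M)).inv ≫ ((λ_ (P ⊗ 𝟙_ M)).inv ≫
      𝟙_ M ◁ ((ρ_ P).hom ≫ x)) ▷ 𝟙_ M ≫ (α_ (𝟙_ M) Z (𝟙_ M)).hom ≫ (λ_ (Z ⊗ 𝟙_ M)).hom ≫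
      (ρ_ Z).hom = (ρ_ P).hom ≫ x := by
    monoidal
  have e : (ρ_ _).inv ≫ 𝓜.ms (.linL (Δ := []) (.id A)) = (ρ_ _).hom ≫
      𝓜.Mny.map (𝓜.one (𝓜.Lin.obj (𝓜.lty A))) ≫ 𝓜.adj.counit.app (𝓜.lty A) := by
    rw [MGLModel.ms, MGLModel.ms]
    exact k _
  -- A morphism into an object of the form `Lin A` is recovered from its transpose: naturality of
  -- the unit and a triangle identity, with the unitors of the one-element context inserted.
  have l {X : C} (f : X ⟶ 𝓜.Lin.obj (𝓜.lty A)) : (ρ_ X).hom ≫ f =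
      ((ρ_ X).hom ≫ 𝓜.adj.unit.app X ≫ 𝓜.Lin.map (ρ_ (𝓜.Mny.obj X)).inv) ≫
        𝓜.Lin.map ((ρ_ (𝓜.Mny.obj X)).hom ≫ 𝓜.Mny.map f ≫ 𝓜.adj.counit.app (𝓜.lty A)) := by
    simp only [Functor.map_comp, Category.assoc]
    rw [← Functor.map_comp_assoc, Iso.inv_hom_id, CategoryTheory.Functor.map_id, Category.id_comp,
      𝓜.adj.unit_naturality_assoc, Adjunction.right_triangle_components, Category.comp_id]
  rw [gs_linR, gs_id]
  refine (l _).trans (congrArg₂ (· ≫ ·) (𝓜.mLin_singleton (1, .Lin A)).symm (congrArg 𝓜.Lin.map ?_))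
  exact e.symm

theorem gs_cut_id_right {Δ : GCtx R} {X : GTy R} (Θ : GS Δ X) :
    𝓜.gs (.gleft [] [] (.cut 1 Θ) (.id X)) = 𝓜.gs (Θ.tr (by simp [scale])) := by
  rw [gs_gleft, gs_tr, gs_id, inside_nil_nil, gstep_cut]
  have k : (𝓜.prom 1 Δ ≫ (𝓜.gr 1).map (𝓜.gs Θ) ≫ (ρ_ _).inv) ≫ 𝟙 _ ≫ (ρ_ _).hom ≫
      𝓜.one (𝓜.gty X) = lc 𝓜.ghyp (scale_one Δ) ≫ 𝓜.gs Θ := by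
    simp only [Category.assoc, Category.id_comp, Iso.inv_hom_id_assoc]
    rw [one_nat, ← 𝓜.prom_one, Category.assoc]
  refine (Category.assoc _ _ _).trans ((congrArg (_ ≫ ·) ((Category.assoc _ _ _).trans k)).trans ?_)
  simp

set_option maxHeartbeats 1000000 in
mutual
/-- Equal graded derivations have the same interpretation. -/
theorem gs_sound : ∀ {Δ : GCtx R} {X : GTy R} {π π' : GS Δ X}, GEq π π' → 𝓜.gs π = 𝓜.gs π'
  | _, _, _, _, .refl _ => rfl
  | _, _, _, _, .symm e => (gs_sound e).symm
  | _, _, _, _, .trans e e' => (gs_sound e).trans (gs_sound e')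
  | _, _, _, _, .sub _ e => by rw [gs_sub, gs_sub, gs_sound e]
  | _, _, _, _, .tenR e₁ e₂ => by rw [gs_tenR, gs_tenR, gs_sound e₁, gs_sound e₂]
  | _, _, _, _, .linR e => by rw [gs_linR, gs_linR, ms_sound e]
  | _, _, _, _, .gleft _ _ _ e => by rw [gs_gleft, gs_gleft, gs_sound e]
  | _, _, _, _, .cut _ _ _ e _ => by rw [gs_gleft, gs_gleft, gstep_cut, gstep_cut, gs_sound e]
  | _, _, _, _, .ax e => 𝓜.gs_ax e
  | _, _, _, _, .etaTen X Y => 𝓜.gs_eta_ten X Y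
  | _, _, _, _, .etaUnit => 𝓜.gs_eta_unit
  | _, _, _, _, .etaLin A => 𝓜.gs_eta_lin A
  | _, _, _, _, .cutIdR Θ => 𝓜.gs_cut_id_right Θ
  | _, _, _, _, .subTenR h₁ h₂ π₁ π₂ => 𝓜.gs_sub_tenR h₁ h₂ π₁ π₂
  | _, _, _, _, .subLinR h π => 𝓜.gs_sub_linR h π
  | _, _, _, _, .mcutTenR₁ A D ds Θ π₁ π₂ => 𝓜.gs_mcut_tenR₁ A D ds Θ π₁ π₂
  | _, _, _, _, .mcutTenR₂ A D ds Θ π₁ π₂ => 𝓜.gs_mcut_tenR₂ A D ds Θ π₁ π₂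
  | _, _, _, _, .mcutLinR A D ds Θ π => 𝓜.gs_mcut_linR A D ds Θ π
/-- Equal mixed derivations have the same interpretation. -/
theorem ms_sound : ∀ {Δ : GCtx R} {Γ : List (LTy R)} {A : LTy R} {π π' : MS Δ Γ A},
    MEq π π' → 𝓜.ms π = 𝓜.ms π'
  | _, _, _, _, _, .refl _ => rfl
  | _, _, _, _, _, .symm e => (ms_sound e).symm
  | _, _, _, _, _, .trans e e' => (ms_sound e).trans (ms_sound e')
  | _, _, _, _, _, .sub _ e => by rw [MGLModel.ms, MGLModel.ms, ms_sound e]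
  | _, _, _, _, _, .gleft _ _ _ e => by rw [MGLModel.ms, MGLModel.ms, ms_sound e]
  | _, _, _, _, _, .gcut _ _ _ e _ => by rw [ms_gleft, ms_gleft, mstep_cut, mstep_cut, gs_sound e]
  | _, _, _, _, _, .lleft _ _ _ e => by rw [MGLModel.ms, MGLModel.ms, ms_sound e]
  | _, _, _, _, _, .tenR e₁ e₂ => by rw [MGLModel.ms, MGLModel.ms, ms_sound e₁, ms_sound e₂]
  | _, _, _, _, _, .impR e => by rw [MGLModel.ms, MGLModel.ms, ms_sound e]
  | _, _, _, _, _, .impL _ _ e₂ e₁ => by rw [MGLModel.ms, MGLModel.ms, ms_sound e₂, ms_sound e₁]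
  | _, _, _, _, _, .grdR _ e => by rw [MGLModel.ms, MGLModel.ms, gs_sound e]
  | _, _, _, _, _, .grdL e => by rw [MGLModel.ms, MGLModel.ms, ms_sound e]
  | _, _, _, _, _, .linL e => by rw [MGLModel.ms, MGLModel.ms, ms_sound e]
  | _, _, _, _, _, .cut _ _ e₁ e₂ => by rw [MGLModel.ms, MGLModel.ms, ms_sound e₁, ms_sound e₂]
  | _, _, _, _, _, .ax e => 𝓜.ms_ax e
  | _, _, _, _, _, .exEx Γ₁ Γ₃ A B π => 𝓜.ms_eq_of_sm (𝓜.lcut_exEx Γ₁ Γ₃ A B π)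
  | _, _, _, _, _, .etaTen A B => 𝓜.ms_eq_of_sm (𝓜.eta_ten A B)
  | _, _, _, _, _, .etaUnit => 𝓜.ms_eq_of_sm (𝓜.eta_unit)
  | _, _, _, _, _, .etaGrd r X => 𝓜.ms_eq_of_sm (𝓜.eta_grd r X)
  | _, _, _, _, _, .subLleft h Γ₁ Γ₃ κ π => 𝓜.ms_eq_of_sm (𝓜.sub_lleft h Γ₁ Γ₃ κ π)
  | _, _, _, _, _, .subTenR h₁ h₂ π₁ π₂ => 𝓜.ms_eq_of_sm (𝓜.sub_tenR h₁ h₂ π₁ π₂)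
  | _, _, _, _, _, .subImpR h π => 𝓜.sub_impR h π
  | _, _, _, _, _, .subImpL Γ₁ Γ₃ h₁ h₂ π₂ π₁ => 𝓜.ms_eq_of_sm (𝓜.sub_impL Γ₁ Γ₃ h₁ h₂ π₂ π₁)
  | _, _, _, _, _, .subGrdR r h Θ => 𝓜.ms_eq_of_sm (𝓜.sub_grdR r h Θ)
  | _, _, _, _, _, .subGrdL h π => 𝓜.ms_eq_of_sm (𝓜.sub_grdL h π)
  | _, _, _, _, _, .subLinL h π => 𝓜.ms_eq_of_sm (𝓜.sub_linL h π)
  | _, _, _, _, _, .subCut Γ₁ Γ₃ h₁ h₂ π₁ π₂ => 𝓜.ms_eq_of_sm (𝓜.sub_cut Γ₁ Γ₃ h₁ h₂ π₁ π₂)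
  | _, _, _, _, _, .mcutLleft A D ds Θ Γ₁ Γ₃ κ π => 𝓜.ms_eq_of_sm (𝓜.mcut_lleft A D ds Θ Γ₁ Γ₃ κ π)
  | _, _, _, _, _, .mcutTenR₁ A D ds Θ π₁ π₂ => 𝓜.ms_eq_of_sm (𝓜.mcut_tenR₁ A D ds Θ π₁ π₂)
  | _, _, _, _, _, .mcutTenR₂ A D ds Θ π₁ π₂ => 𝓜.ms_eq_of_sm (𝓜.mcut_tenR₂ A D ds Θ π₁ π₂)
  | _, _, _, _, _, .mcutImpR A D ds Θ π => 𝓜.mcut_impR A D ds Θ π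
  | _, _, _, _, _, .mcutImpL₁ A D ds Θ Γ₁ Γ₃ π₂ π₁ => 𝓜.ms_eq_of_sm (𝓜.mcut_impL₁ A D ds Θ Γ₁ Γ₃ π₂ π₁)
  | _, _, _, _, _, .mcutImpL₂ A D ds Θ Γ₁ Γ₃ π₂ π₁ => 𝓜.ms_eq_of_sm (𝓜.mcut_impL₂ A D ds Θ Γ₁ Γ₃ π₂ π₁)
  | _, _, _, _, _, .mcutGrdR A D ds Θ r Θ' => 𝓜.ms_eq_of_sm (𝓜.mcut_grdR A D ds Θ r Θ' _ _)
  | _, _, _, _, _, .mcutGrdL A D ds Θ π => 𝓜.ms_eq_of_sm (𝓜.mcut_grdL A D ds Θ π)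
  | _, _, _, _, _, .mcutLinL A D ds Θ π => 𝓜.ms_eq_of_sm (𝓜.mcut_linL A D ds Θ π)
  | _, _, _, _, _, .mcutCut₁ A D ds Θ Γ₁ Γ₃ π₁ π₂ => 𝓜.ms_eq_of_sm (𝓜.mcut_cut₁ A D ds Θ Γ₁ Γ₃ π₁ π₂)
  | _, _, _, _, _, .mcutCut₂ A D ds Θ Γ₁ Γ₃ π₁ π₂ => 𝓜.ms_eq_of_sm (𝓜.mcut_cut₂ A D ds Θ Γ₁ Γ₃ π₁ π₂)
  | _, _, _, _, _, .gcutLin π₁ π₂ => 𝓜.ms_eq_of_sm (𝓜.gcut_lin π₁ π₂)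
  | _, _, _, _, _, .cutIdL Γ₁ Γ₃ π => 𝓜.ms_eq_of_sm (𝓜.cut_id_left Γ₁ Γ₃ π)
  | _, _, _, _, _, .cutIdR π => 𝓜.ms_eq_of_sm (𝓜.cut_id_right π)
  | _, _, _, _, _, .cutTen Γ₁ Γ₄ π₁ π₂ π₃ => 𝓜.ms_eq_of_sm (𝓜.cut_ten_ten Γ₁ Γ₄ π₁ π₂ π₃)
  | _, _, _, _, _, .cutUnit Γ₁ Γ₃ π => 𝓜.ms_eq_of_sm (𝓜.cut_unit_unit Γ₁ Γ₃ π)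
  | _, _, _, _, _, .cutGrd r Θ π => 𝓜.ms_eq_of_sm (𝓜.cut_grd_grd r Θ π)
  | _, _, _, _, _, .cutImp Γ₁ Γ₄ π₃ π₂ π₁ => 𝓜.ms_eq_of_sm (𝓜.cut_imp_imp Γ₁ Γ₄ π₃ π₂ π₁)
  | _, _, _, _, _, .cutCut Γ₁ Γ₂ Γ₄ Γ₅ π₁ π₃ π₄ => 𝓜.ms_eq_of_sm (𝓜.cut_cut Γ₁ Γ₂ Γ₄ Γ₅ π₁ π₃ π₄)
  | _, _, _, _, _, .cutCutComm Γ₁ Γ₃ Γ₅ π₁ π₃ π₄ => 𝓜.ms_eq_of_sm (𝓜.cut_cut_comm Γ₁ Γ₃ Γ₅ π₁ π₃ π₄)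
  | _, _, _, _, _, .cutLleft₁ Γ₁ Γ₂ Γ₃ Γ₄ κ π₁ π₂ => 𝓜.ms_eq_of_sm (𝓜.cut_lleft₁ Γ₁ Γ₂ Γ₃ Γ₄ κ π₁ π₂)
  | _, _, _, _, _, .cutGleft₁ A D Γ₁ Γ₃ ρ π₁ π₂ => 𝓜.ms_eq_of_sm (𝓜.cut_gleft₁ A D Γ₁ Γ₃ ρ π₁ π₂)
  | _, _, _, _, _, .cutImpL Γ₁ Γ₂ Γ₄ Γ₅ π₃ π₄ π₂ => 𝓜.ms_eq_of_sm (𝓜.cut_impL Γ₁ Γ₂ Γ₄ Γ₅ π₃ π₄ π₂)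
  | _, _, _, _, _, .cutLinL Γ₁ Γ₃ π₁ π₂ => 𝓜.ms_eq_of_sm (𝓜.cut_linL Γ₁ Γ₃ π₁ π₂)
  | _, _, _, _, _, .cutGrdL (Γ₂ := Γ₂) Γ₁ Γ₃ π₁ π₂ => 𝓜.ms_eq_of_sm (𝓜.cut_grdL (Γ₂ := Γ₂) Γ₁ Γ₃ π₁ π₂)
  | _, _, _, _, _, .cutTenR₁ Γ₁ Γ₃ π₁ π₃ π₄ => 𝓜.ms_eq_of_sm (𝓜.cut_tenR₁ Γ₁ Γ₃ π₁ π₃ π₄)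
  | _, _, _, _, _, .cutTenR₂ Γ₂ Γ₄ π₁ π₃ π₄ => 𝓜.ms_eq_of_sm (𝓜.cut_tenR₂ Γ₂ Γ₄ π₁ π₃ π₄)
  | _, _, _, _, _, .cutLleftL Γ₁ Γ₃ Γ₄ κ π₁ π₂ => 𝓜.ms_eq_of_sm (𝓜.cut_lleftL Γ₁ Γ₃ Γ₄ κ π₁ π₂)
  | _, _, _, _, _, .cutLleftR Γ₁ Γ₃ Γ₄ κ π₁ π₂ => 𝓜.ms_eq_of_sm (𝓜.cut_lleftR Γ₁ Γ₃ Γ₄ κ π₁ π₂)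
  | _, _, _, _, _, .cutExL Γ₁ Γ₃ π₁ π₂ => 𝓜.ms_eq_of_sm (𝓜.cut_exL Γ₁ Γ₃ π₁ π₂)
  | _, _, _, _, _, .cutExR Γ₁ Γ₃ π₁ π₂ => 𝓜.ms_eq_of_sm (𝓜.cut_exR Γ₁ Γ₃ π₁ π₂)
  | _, _, _, _, _, .cutGleft₂ A D Γ₁ Γ₃ ρ π₁ π₂ => 𝓜.ms_eq_of_sm (𝓜.cut_gleft₂ A D Γ₁ Γ₃ ρ π₁ π₂)
  | _, _, _, _, _, .cutImpR Γ₁ Γ₃ π₁ π₂ => 𝓜.cut_impR Γ₁ Γ₃ π₁ π₂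
  | _, _, _, _, _, .cutImpL₁ Γ₁ Γ₂ Γ₄ Γ₅ π₁ π₃ π₄ => 𝓜.ms_eq_of_sm (𝓜.cut_impL₁ Γ₁ Γ₂ Γ₄ Γ₅ π₁ π₃ π₄)
  | _, _, _, _, _, .cutImpL₂ Γ₁ Γ₃ Γ₅ π₁ π₃ π₄ => 𝓜.ms_eq_of_sm (𝓜.cut_impL₂ Γ₁ Γ₃ Γ₅ π₁ π₃ π₄)
  | _, _, _, _, _, .cutImpL₃ Γ₁ Γ₃ Γ₅ π₁ π₃ π₄ => 𝓜.ms_eq_of_sm (𝓜.cut_impL₃ Γ₁ Γ₃ Γ₅ π₁ π₃ π₄)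
  | _, _, _, _, _, .cutLinL₂ Γ₁ Γ₃ π₁ π₂ => 𝓜.ms_eq_of_sm (𝓜.cut_linL₂ Γ₁ Γ₃ π₁ π₂)
  | _, _, _, _, _, .cutGrdL₂ Γ₁ Γ₃ π₁ π₂ => 𝓜.ms_eq_of_sm (𝓜.cut_grdL₂ Γ₁ Γ₃ π₁ π₂)
end

end MGLModel
end MGL

theorem mainTheorem2 {R : Type u} [Semiring R] [Preorder R]
    [AddLeftMono R] [MulLeftMono R] [MulRightMono R]
    {C : Type v} [Category.{w} C] [MonoidalCategory C] [SymmetricCategory C]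
    {M : Type v} [Category.{w} M] [MonoidalCategory M] [SymmetricCategory M] [MonoidalClosed M]
    (𝓜 : MGL.MGLModel R C M) :
    (∀ (Δ : MGL.GCtx R) (X : MGL.GTy R) (π₁ π₂ : MGL.GS Δ X),
      MGL.GEq π₁ π₂ → 𝓜.gs π₁ = 𝓜.gs π₂) ∧
    (∀ (Δ : MGL.GCtx R) (Γ : List (MGL.LTy R)) (A : MGL.LTy R) (π₁ π₂ : MGL.MS Δ Γ A),
      MGL.MEq π₁ π₂ → 𝓜.ms π₁ = 𝓜.ms π₂) :=
  ⟨fun _ _ _ _ e => 𝓜.gs_sound e, fun _ _ _ _ _ e => 𝓜.ms_sound e⟩
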